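/- Let $N\ge 1$, let $\Omega\subset\mathbb R^N$ be a bounded Lipschitz domain with boundary $\Gamma$, and let $T>0$. Write $(\cdot,\cdot)$, $\|\cdot\|$ for the inner product and norm of $L^2(\Omega)$ (or $L^2(\Omega;\mathbb R^N)$), $(\cdot,\cdot)_\Gamma$ for the inner product of $L^2(\Gamma)$, and $(K*u)(t)=\int_0^t K(t-s)u(s)\,ds$. Consider the problem of finding $\langle u,K\rangle$, $K=K(t)$, with $$\partial_t u-\Delta u+K(t)h+K*u=f(x,t,u,\nabla u)\ \text{ in }\Omega\times[0,T],\qquad -\nabla u\cdot\nu=g\ \text{ on }\Gamma\times[0,T],\qquad u(\cdot,0)=u_0,$$ $$\int_\Omega u(x,t)\,dx=m(t),\qquad t\in[0,T].$$ A (weak) solution is a pair $u\in L^2(0,T;H^1(\Omega))$, $K\in L^2(0,T)$ such that $\int_\Omega u(t)\,dx=m(t)$ for a.e. $t\in(0,T)$ and, for every $\phi\in H^1(\Omega)$, in the sense of weak derivatives on $(0,T)$ and with initial value $u(0)=u_0$, $$\frac{d}{dt}(u,\phi)+(\nabla u,\nabla\phi)+(g,\phi)_\Gamma+K(h,\phi)+(K*u,\phi)=(f(\cdot,t,u,\nabla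 u),\phi).$$ Basic assumptions: $f$ is Borel measurable and bounded, $u_0\in L^2(\Omega)$, $g\in C([0,T];L^2(\Gamma))$, $h\in C([0,T];L^2(\Omega))$, $\min_{t\in[0,T]}|(h(t),1)|\ge\omega>0$, and $m\in C^1([0,T])$. Below, $C>0$ denotes a constant that depends only on $\Omega$, $T$, $\omega$ and on an upper bound $M$ for the norms of the data in the spaces named in the assumptions of the respective item (including $\sup|f|$ and, in 3 and 4, the Lipschitz constant of $f$), and not on the solution. Maxima of $K$ and of $\partial_t u$ over $[0,T]$ are understood as essential suprema. Let $\langle u,K\rangle$ be a solution. 1. Under the basic assumptions, $$\max_{t\in[0,T]}|K(t)|\le C,$$ $u\in C([0,T];L^2(\Omega))$ (after modification on a null set of times) with $u(0)=u_0$, $\partial_t u\in L^2(0,T;H^1(\Omega)^*)$, and $$\max_{t\in[0,T]}\|u(t)\|^2+\int_0^T\|\nabla u\|^2\,dt\le C,\qquad \int_0^T\|\partial_t u\|^2_{H^1(\Omega)^*}\,dt\le C.$$ 2. If moreover $g\in C^1([0,T];L^2(\Gamma))$ and $u_0\in H^1(\Omega)$, then $u\in C([0,T];H^1(\Omega))$,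 $\partial_tu\in L^2(0,T;L^2(\Omega))$, and $$\max_{t\in[0,T]}\|\nabla u(t)\|^2+\int_0^T\|\partial_t u\|^2\,dt\le C.$$ 3. If, in addition to the basic assumptions, $g\in C^1([0,T];L^2(\Gamma))$, $h\in C([0,T];H^1(\Omega))$, $f$ is Lipschitz continuous in all its variables, $u_0\in H^2(\Omega)$, and the boundary condition holds at $t=0$, i.e. $-\nabla u_0\cdot\nu=g(0)$ on $\Gamma$, then $u\in C([0,T];H^1(\Omega))$, $\Delta u\in L^\infty(0,T;L^2(\Omega))$, $\partial_tu\in L^2(0,T;H^1(\Omega))$, and $$\max_{t\in[0,T]}\|\Delta u(t)\|^2+\int_0^T\|\nabla\partial_t u\|^2\,dt\le C,\qquad \max_{t\in[0,T]}\|\partial_t u(t)\|\le C.$$ 4. If, in addition to the assumptions of 3, $h\in C^1([0,T];L^2(\Omega))$ and $m\in C^2([0,T])$, then $K$ has a weak derivative $K'\in L^2(0,T)$, and $$\int_0^T|K'(s)|^2\,ds\le C.$$ -/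

import Mathlib

open MeasureTheory Set Filter Topology
open scoped ContDiff InnerProductSpace

namespace KernelRecovery

noncomputable section

/-! ### Bounded Lipschitz domains and the Lebesgue and Sobolev spaces on them -/

/-- The Euclidean space `ℝᴺ`. -/
abbrev Eu (N : ℕ) : Type := EuclideanSpace ℝ (Fin N)

/-- A bounded Lipschitz domain: a bounded, connected, nonempty open set which, near each of its
boundary points, is the strict epigraph of a Lipschitz function in a direction `e`. Here
`y - ⟪e, y⟫ e` is the component of `y` orthogonal to the unit vector `e`, so that only the values
of `a` on the hyperplane `e⊥` matter. -/
structure IsBoundedLipschitzDomain {N : ℕ} (Ω : Set (Eu N)) : Prop where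
  isOpen : IsOpen Ω
  isConnected : IsConnected Ω
  isBounded : Bornology.IsBounded Ω
  graph : ∀ x ∈ frontier Ω, ∃ (r : ℝ) (e : Eu N) (L : NNReal) (a : Eu N → ℝ),
    0 < r ∧ ‖e‖ = 1 ∧ LipschitzWith L a ∧
      ∀ y ∈ Metric.ball x r, (y ∈ Ω ↔ a (y - ⟪e, y⟫_ℝ • e) < ⟪e, y⟫_ℝ)

/-- `L²(Ω)`. -/
abbrev L2 {N : ℕ} (Ω : Set (Eu N)) : Type := Lp ℝ 2 (volume.restrict Ω)

/-- `L²(Ω; ℝᴺ)`. -/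
abbrev L2vec {N : ℕ} (Ω : Set (Eu N)) : Type := Lp (Eu N) 2 (volume.restrict Ω)

/-- The surface measure on `Γ = ∂Ω`: the `(N-1)`-dimensional Hausdorff measure in the Euclidean
normalization (for `N = 1`, the counting measure on `∂Ω`). -/
def surf {N : ℕ} (Ω : Set (Eu N)) : Measure (Eu N) :=
  (Measure.euclideanHausdorffMeasure (N - 1)).restrict (frontier Ω)

/-- `L²(Γ)`. -/
abbrev L2bdry {N : ℕ} (Ω : Set (Eu N)) : Type := Lp ℝ 2 (surf Ω)

/-- `φ ∈ C_c^∞(Ω)`. -/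
structure IsTestFunction {N : ℕ} (Ω : Set (Eu N)) (φ : Eu N → ℝ) : Prop where
  contDiff : ContDiff ℝ ∞ φ
  hasCompactSupport : HasCompactSupport φ
  tsupport_subset : tsupport φ ⊆ Ω

/-- `w` is the weak gradient of `v` in `Ω`. -/
def HasWeakGradient {N : ℕ} (Ω : Set (Eu N)) (v : L2 Ω) (w : L2vec Ω) : Prop :=
  ∀ φ : Eu N → ℝ, IsTestFunction Ω φ → ∀ e : Eu N,
    ∫ x in Ω, v x * fderiv ℝ φ x e = -∫ x in Ω, ⟪w x, e⟫_ℝ * φ x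

theorem integrable_mul_fderiv {N : ℕ} {Ω : Set (Eu N)} (v : L2 Ω) {φ : Eu N → ℝ}
    (hφ : IsTestFunction Ω φ) (e : Eu N) :
    Integrable (fun x => v x * fderiv ℝ φ x e) (volume.restrict Ω) := by
  have hc : Continuous fun x => fderiv ℝ φ x e :=
    (hφ.contDiff.continuous_fderiv (by simp)).clm_apply continuous_const
  have hs : HasCompactSupport fun x => fderiv ℝ φ x e := hφ.hasCompactSupport.fderiv_apply ℝ e
  exact (Lp.memLp v).integrable_mul
    ((hc.memLp_of_hasCompactSupport (p := 2) (μ := volume) hs).restrict Ω)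

theorem integrable_inner_mul {N : ℕ} {Ω : Set (Eu N)} (w : L2vec Ω) {φ : Eu N → ℝ}
    (hφ : IsTestFunction Ω φ) (e : Eu N) :
    Integrable (fun x => ⟪w x, e⟫_ℝ * φ x) (volume.restrict Ω) :=
  ((Lp.memLp w).inner_const e).integrable_mul
    ((hφ.contDiff.continuous.memLp_of_hasCompactSupport (p := 2) (μ := volume)
      hφ.hasCompactSupport).restrict Ω)

/-- `H¹(Ω)`, as the space of pairs `(v, ∇v)` with `v ∈ L²(Ω)` and weak gradient
`∇v ∈ L²(Ω; ℝᴺ)`. It inherits the inner product `(v₁, v₂) + (∇v₁, ∇v₂)`, so that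
`‖v‖²_{H¹} = ‖v‖² + ‖∇v‖²`. -/
def H1 {N : ℕ} (Ω : Set (Eu N)) : Submodule ℝ (WithLp 2 (L2 Ω × L2vec Ω)) where
  carrier := {p | HasWeakGradient Ω p.fst p.snd}
  zero_mem' := by
    intro φ _ e
    have h1 : ∀ᵐ x ∂(volume.restrict Ω), ((0 : L2 Ω) : Eu N → ℝ) x = 0 := Lp.coeFn_zero _ _ _
    have h2 : ∀ᵐ x ∂(volume.restrict Ω), ((0 : L2vec Ω) : Eu N → Eu N) x = 0 :=
      Lp.coeFn_zero _ _ _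
    have e1 : ∫ x in Ω, ((0 : L2 Ω) : Eu N → ℝ) x * fderiv ℝ φ x e = 0 :=
      integral_eq_zero_of_ae (h1.mono fun x hx => by
        change ((0 : L2 Ω) : Eu N → ℝ) x * _ = 0
        rw [hx, zero_mul])
    have e2 : ∫ x in Ω, ⟪((0 : L2vec Ω) : Eu N → Eu N) x, e⟫_ℝ * φ x = 0 :=
      integral_eq_zero_of_ae (h2.mono fun x hx => by
        change ⟪((0 : L2vec Ω) : Eu N → Eu N) x, e⟫_ℝ * _ = 0
        rw [hx, inner_zero_left, zero_mul])
    exact e1.trans (neg_eq_zero.mpr e2).symm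
  add_mem' := by
    intro p q hp hq φ hφ e
    have e1 : ∫ x in Ω, (p.fst + q.fst) x * fderiv ℝ φ x e
        = ∫ x in Ω, (p.fst x * fderiv ℝ φ x e + q.fst x * fderiv ℝ φ x e) :=
      integral_congr_ae ((Lp.coeFn_add p.fst q.fst).mono fun x hx => by
        simp only [hx, Pi.add_apply, add_mul])
    have e2 : ∫ x in Ω, ⟪(p.snd + q.snd) x, e⟫_ℝ * φ x
        = ∫ x in Ω, (⟪p.snd x, e⟫_ℝ * φ x + ⟪q.snd x, e⟫_ℝ * φ x) :=
      integral_congr_ae ((Lp.coeFn_add p.snd q.snd).mono fun x hx => by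
        simp only [hx, Pi.add_apply, inner_add_left, add_mul])
    change ∫ x in Ω, (p.fst + q.fst) x * fderiv ℝ φ x e
      = -∫ x in Ω, ⟪(p.snd + q.snd) x, e⟫_ℝ * φ x
    rw [e1, e2, integral_add (integrable_mul_fderiv _ hφ e) (integrable_mul_fderiv _ hφ e),
      integral_add (integrable_inner_mul _ hφ e) (integrable_inner_mul _ hφ e),
      hp φ hφ e, hq φ hφ e]
    ring
  smul_mem' := by
    intro c p hp φ hφ e
    have e1 : ∫ x in Ω, (c • p.fst) x * fderiv ℝ φ x e
        = ∫ x in Ω, c * (p.fst x * fderiv ℝ φ x e) :=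
      integral_congr_ae ((Lp.coeFn_smul c p.fst).mono fun x hx => by
        simp only [hx, Pi.smul_apply, smul_eq_mul, mul_assoc])
    have e2 : ∫ x in Ω, ⟪(c • p.snd) x, e⟫_ℝ * φ x
        = ∫ x in Ω, c * (⟪p.snd x, e⟫_ℝ * φ x) :=
      integral_congr_ae ((Lp.coeFn_smul c p.snd).mono fun x hx => by
        simp only [hx, Pi.smul_apply, real_inner_smul_left, mul_assoc])
    change ∫ x in Ω, (c • p.fst) x * fderiv ℝ φ x e = -∫ x in Ω, ⟪(c • p.snd) x, e⟫_ℝ * φ x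
    rw [e1, e2, integral_const_mul, integral_const_mul, hp φ hφ e]
    ring

/-- The function underlying an element of `H¹(Ω)`, in `L²(Ω)`. -/
def fn {N : ℕ} {Ω : Set (Eu N)} (v : H1 Ω) : L2 Ω := (v : WithLp 2 (L2 Ω × L2vec Ω)).fst

/-- The weak gradient of an element of `H¹(Ω)`, in `L²(Ω; ℝᴺ)`. -/
def grad {N : ℕ} {Ω : Set (Eu N)} (v : H1 Ω) : L2vec Ω := (v : WithLp 2 (L2 Ω × L2vec Ω)).snd

/-- `ψ ∈ L²(Γ)` is the trace of `v ∈ H¹(Ω)`: there are `φₙ ∈ C_c^∞(ℝᴺ)` with `φₙ → v` in `H¹(Ω)`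
and `φₙ|_Γ → ψ` in `L²(Γ)`. -/
def IsTrace {N : ℕ} {Ω : Set (Eu N)} (v : H1 Ω) (ψ : L2bdry Ω) : Prop :=
  ∃ φ : ℕ → Eu N → ℝ, (∀ n, ContDiff ℝ ∞ (φ n) ∧ HasCompactSupport (φ n)) ∧
    Tendsto (fun n => eLpNorm (fun x => φ n x - fn v x) 2 (volume.restrict Ω)) atTop (𝓝 0) ∧
    Tendsto (fun n => eLpNorm (fun x => gradient (φ n) x - grad v x) 2 (volume.restrict Ω))
      atTop (𝓝 0) ∧
    Tendsto (fun n => eLpNorm (fun x => φ n x - ψ x) 2 (surf Ω)) atTop (𝓝 0)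

/-- `l ∈ L²(Ω)` is the (distributional) Laplacian of `v ∈ H¹(Ω)`. -/
def HasWeakLaplacian {N : ℕ} {Ω : Set (Eu N)} (v : H1 Ω) (l : L2 Ω) : Prop :=
  ∀ φ : Eu N → ℝ, IsTestFunction Ω φ →
    ∫ x in Ω, fderiv ℝ φ x (grad v x) = -∫ x in Ω, l x * φ x

/-- `-∇v · ν = γ` on `Γ`, with `ν` the outward unit normal: the normal derivative is given by
Green's first identity `(∇v, ∇φ) + (Δv, φ) = (∇v · ν, φ)_Γ`. -/
def NeumannCondition {N : ℕ} {Ω : Set (Eu N)} (v : H1 Ω) (γ : L2bdry Ω) : Prop :=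
  ∃ l : L2 Ω, HasWeakLaplacian v l ∧
    ∀ (φ : H1 Ω) (ψ : L2bdry Ω), IsTrace φ ψ →
      ⟪grad v, grad φ⟫_ℝ + ⟪l, fn φ⟫_ℝ = -⟪γ, ψ⟫_ℝ

/-- `v ∈ H²(Ω)`, with bound `M`: the components of `∇v` belong to `H¹(Ω)`, and `v` and these
components have `H¹`-norm at most `M`. -/
def BoundedH2 {N : ℕ} {Ω : Set (Eu N)} (M : ℝ) (v : H1 Ω) : Prop :=
  ‖v‖ ≤ M ∧ ∃ W : Fin N → H1 Ω, ∀ i,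
    (∀ᵐ x ∂(volume.restrict Ω), fn (W i) x = grad v x i) ∧ ‖W i‖ ≤ M

/-! ### Functions of time -/

/-- Lebesgue measure on the time interval `[0, T]`. -/
abbrev timeMeasure (T : ℝ) : Measure ℝ := volume.restrict (Icc 0 T)

/-- `y ∈ C^k([0, T]; X)`, with all derivatives up to order `k` bounded by `M`. -/
def BoundedCk {X : Type*} [NormedAddCommGroup X] [NormedSpace ℝ X] (k : ℕ) (T M : ℝ)
    (y : ℝ → X) : Prop :=
  ContDiffOn ℝ k y (Icc 0 T) ∧
    ∀ j ≤ k, ∀ t ∈ Icc 0 T, ‖iteratedDerivWithin j y (Icc 0 T) t‖ ≤ M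

/-- `y ∈ W^{1,1}(0, T; X)` has weak time derivative `y'` and initial value `y₀`. -/
def HasTimeDeriv {X : Type*} [NormedAddCommGroup X] [NormedSpace ℝ X] (T : ℝ)
    (y y' : ℝ → X) (y₀ : X) : Prop :=
  Integrable y' (timeMeasure T) ∧
    ∀ᵐ t ∂timeMeasure T, y t = y₀ + ∫ s in (0 : ℝ)..t, y' s

/-- The convolution in time `(K ∗ y)(t) = ∫₀ᵗ K(t - s) y(s) ds`. -/
def timeConv {X : Type*} [NormedAddCommGroup X] [NormedSpace ℝ X] (K : ℝ → ℝ) (y : ℝ → X)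
    (t : ℝ) : X :=
  ∫ s in (0 : ℝ)..t, K (t - s) • y s

/-! ### The inverse problem -/

/-- The data of the inverse problem: the nonlinearity `f(x, t, u, ∇u)`, the initial datum, the
Neumann datum, the coefficient of the unknown kernel, and the measurement. -/
structure Data {N : ℕ} (Ω : Set (Eu N)) where
  f : Eu N → ℝ → ℝ → Eu N → ℝ
  u₀ : L2 Ω
  g : ℝ → L2bdry Ω
  h : ℝ → L2 Ω
  m : ℝ → ℝ

/-- The basic assumptions: `f` is bounded (and Borel), `u₀ ∈ L²(Ω)`, `g ∈ C([0, T]; L²(Γ))`,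
`h ∈ C([0, T]; L²(Ω))`, `|(h(t), 1)| ≥ w₀`, `m ∈ C¹([0, T])`; the size of the data is at most
`M`. -/
structure Data.Basic {N : ℕ} {Ω : Set (Eu N)} (D : Data Ω) (T w₀ M : ℝ) : Prop where
  f_measurable : Measurable fun q : Eu N × ℝ × ℝ × Eu N => D.f q.1 q.2.1 q.2.2.1 q.2.2.2
  f_bounded : ∀ x ∈ Ω, ∀ t ∈ Icc 0 T, ∀ (s : ℝ) (p : Eu N), |D.f x t s p| ≤ M
  u₀_bounded : ‖D.u₀‖ ≤ M
  g_continuous : BoundedCk 0 T M D.g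
  h_continuous : BoundedCk 0 T M D.h
  h_mean : ∀ t ∈ Icc 0 T, w₀ ≤ |∫ x in Ω, D.h t x|
  m_C1 : BoundedCk 1 T M D.m

/-- `g ∈ C¹([0, T]; L²(Γ))` and `u₀ ∈ H¹(Ω)`, with bound `M`. -/
structure Data.FirstOrder {N : ℕ} {Ω : Set (Eu N)} (D : Data Ω) (T M : ℝ) : Prop where
  g_C1 : BoundedCk 1 T M D.g
  u₀_H1 : ∃ U : H1 Ω, fn U = D.u₀ ∧ ‖U‖ ≤ M

/-- `g ∈ C¹([0, T]; L²(Γ))`, `h ∈ C([0, T]; H¹(Ω))`, `f` is Lipschitz continuous in all variables,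
and `u₀ ∈ H²(Ω)`, with bound `M`; the boundary condition holds at `t = 0`. -/
structure Data.SecondOrder {N : ℕ} {Ω : Set (Eu N)} (D : Data Ω) (T M : ℝ) : Prop where
  g_C1 : BoundedCk 1 T M D.g
  h_H1 : ∃ H : ℝ → H1 Ω, (∀ t ∈ Icc 0 T, fn (H t) = D.h t) ∧ BoundedCk 0 T M H
  f_lipschitz : ∀ x ∈ Ω, ∀ x' ∈ Ω, ∀ t ∈ Icc 0 T, ∀ t' ∈ Icc 0 T, ∀ (s s' : ℝ) (p p' : Eu N),
    |D.f x t s p - D.f x' t' s' p'| ≤ M * (‖x - x'‖ + |t - t'| + |s - s'| + ‖p - p'‖)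
  u₀_H2 : ∃ U : H1 Ω, fn U = D.u₀ ∧ BoundedH2 M U ∧ NeumannCondition U (D.g 0)

/-- The pairing `(f(·, t, v, ∇v), φ)` in `L²(Ω)`. -/
def Data.nonlinearity {N : ℕ} {Ω : Set (Eu N)} (D : Data Ω) (t : ℝ) (v φ : H1 Ω) : ℝ :=
  ∫ x in Ω, D.f x t (fn v x) (grad v x) * fn φ x

/-- `⟨u, K⟩ ∈ L²(0, T; H¹(Ω)) × L²(0, T)` is a weak solution of the inverse problem: for all
`φ ∈ H¹(Ω)`, in the sense of weak derivatives in time,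
`(∂ₜu, φ) + (∇u, ∇φ) + (g, φ)_Γ + K (h, φ) + (K ∗ u, φ) = (f(u, ∇u), φ)`
with initial value `u(0) = u₀`, and `∫_Ω u(t) = m(t)`. -/
structure IsWeakSolution {N : ℕ} {Ω : Set (Eu N)} (D : Data Ω) (T : ℝ)
    (u : ℝ → H1 Ω) (K : ℝ → ℝ) : Prop where
  u_memLp : MemLp u 2 (timeMeasure T)
  K_memLp : MemLp K 2 (timeMeasure T)
  equation : ∀ (φ : H1 Ω) (ψ : L2bdry Ω), IsTrace φ ψ →
    HasTimeDeriv T (fun t => ⟪fn (u t), fn φ⟫_ℝ)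
      (fun t => D.nonlinearity t (u t) φ - ⟪grad (u t), grad φ⟫_ℝ - ⟪D.g t, ψ⟫_ℝ
        - K t * ⟪D.h t, fn φ⟫_ℝ - ⟪timeConv K (fun s => fn (u s)) t, fn φ⟫_ℝ)
      ⟪D.u₀, fn φ⟫_ℝ
  measurement : ∀ᵐ t ∂timeMeasure T, ∫ x in Ω, fn (u t) x = D.m t

/-! ### The regularity classes and estimates -/

/-- `K` is bounded; `u` has a representative `v ∈ C([0, T]; L²(Ω))`, and
`‖u(t)‖² + ∫₀ᵀ ‖∇u‖² ≤ C`; and `∂ₜu ∈ L²(0, T; H¹(Ω)*)` with `∫₀ᵀ ‖∂ₜu‖²_{H¹(Ω)*} ≤ C`. -/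
def BasicEstimate {N : ℕ} {Ω : Set (Eu N)} (D : Data Ω) (T : ℝ) (u : ℝ → H1 Ω) (K : ℝ → ℝ)
    (C : ℝ) : Prop :=
  (∀ᵐ t ∂timeMeasure T, |K t| ≤ C) ∧
  (∃ v : ℝ → L2 Ω, ContinuousOn v (Icc 0 T) ∧ v 0 = D.u₀ ∧
    (∀ᵐ t ∂timeMeasure T, fn (u t) = v t) ∧
    ∀ t ∈ Icc 0 T, ‖v t‖ ^ 2 + ∫ s in Icc 0 T, ‖grad (u s)‖ ^ 2 ≤ C) ∧
  (∃ u' : ℝ → (H1 Ω →L[ℝ] ℝ), MemLp u' 2 (timeMeasure T) ∧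
    (∀ φ : H1 Ω, HasTimeDeriv T (fun t => ⟪fn (u t), fn φ⟫_ℝ) (fun t => u' t φ)
      ⟪D.u₀, fn φ⟫_ℝ) ∧
    ∫ s in Icc 0 T, ‖u' s‖ ^ 2 ≤ C)

/-- `u` has a representative `v ∈ C([0, T]; H¹(Ω))`, `∂ₜu ∈ L²(0, T; L²(Ω))`, and
`‖∇u(t)‖² + ∫₀ᵀ ‖∂ₜu‖² ≤ C`. -/
def FirstOrderEstimate {N : ℕ} {Ω : Set (Eu N)} (D : Data Ω) (T : ℝ) (u : ℝ → H1 Ω)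
    (C : ℝ) : Prop :=
  ∃ (v : ℝ → H1 Ω) (u' : ℝ → L2 Ω),
    ContinuousOn v (Icc 0 T) ∧ (∀ᵐ t ∂timeMeasure T, u t = v t) ∧
    MemLp u' 2 (timeMeasure T) ∧ HasTimeDeriv T (fun t => fn (u t)) u' D.u₀ ∧
    ∀ t ∈ Icc 0 T, ‖grad (v t)‖ ^ 2 + ∫ s in Icc 0 T, ‖u' s‖ ^ 2 ≤ C

/-- With `v ∈ C([0, T]; H¹(Ω))` the representative of `u`: `Δu ∈ L^∞(0, T; L²(Ω))`,
`∂ₜu ∈ L²(0, T; H¹(Ω))`, `‖Δu(t)‖² + ∫₀ᵀ ‖∇∂ₜu‖² ≤ C` and `‖∂ₜu(t)‖ ≤ C`. -/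
def SecondOrderEstimate {N : ℕ} {Ω : Set (Eu N)} (D : Data Ω) (T : ℝ) (u : ℝ → H1 Ω)
    (C : ℝ) : Prop :=
  ∃ (v : ℝ → H1 Ω) (l : ℝ → L2 Ω) (u' : ℝ → H1 Ω),
    ContinuousOn v (Icc 0 T) ∧ (∀ᵐ t ∂timeMeasure T, u t = v t) ∧
    MemLp l ⊤ (timeMeasure T) ∧ MemLp u' 2 (timeMeasure T) ∧
    HasTimeDeriv T (fun t => fn (u t)) (fun t => fn (u' t)) D.u₀ ∧
    (∀ t ∈ Icc 0 T, HasWeakLaplacian (v t) (l t) ∧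
      ‖l t‖ ^ 2 + ∫ s in Icc 0 T, ‖grad (u' s)‖ ^ 2 ≤ C) ∧
    ∀ᵐ t ∂timeMeasure T, ‖fn (u' t)‖ ≤ C

/-- `K' ∈ L²(0, T)` and `∫₀ᵀ |K'|² ≤ C`. -/
def KernelEstimate (T : ℝ) (K : ℝ → ℝ) (C : ℝ) : Prop :=
  ∃ (K' : ℝ → ℝ) (k₀ : ℝ), MemLp K' 2 (timeMeasure T) ∧ HasTimeDeriv T K K' k₀ ∧
    ∫ s in Icc 0 T, |K' s| ^ 2 ≤ C

end

end KernelRecovery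

namespace KernelRecovery

noncomputable section

section


/-! ### Calculus of primitives -/

section Time

variable {X Y : Type*} [NormedAddCommGroup X] [NormedSpace ℝ X] [NormedAddCommGroup Y]
  [NormedSpace ℝ Y] {T : ℝ}

/-! Write V = H¹(Ω), H = L²(Ω), ι : V → H for the embedding and ι* : H → V for its Hilbert adjoint.
The inner product of V is (v, w) + (∇v, ∇w), so the Dirichlet form (∇v, ∇φ) equals ⟨v - ι*ι v, φ⟩ in
V. With the trace operator tr, the weak equation becomes a single identity in V, integrated in time:
ι*ι u(t) = ι* u₀ + ∫₀ᵗ (ι* F - (u - ι*ι u) - ℓ), where F = f - K h - K ∗ u and ℓ = tr* g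
(`weak_formulation`).

The kernel comes first. Testing with the constant 1 removes the gradient term and turns K ∗ u into K
∗ m, so K (h, 1) = (f, 1) - (g, 1)_Γ - m' - K ∗ m (`kernel_formula`). Since |(h, 1)| is bounded
below and f is bounded, Grönwall's inequality bounds K without any information on u
(`exists_kernel_bound`). What remains is a heat equation whose forcing is controlled up to the
memory term K ∗ u.

Item 1 is the energy estimate, with Grönwall absorbing the memory term (`exists_energy_bound`). As
∂ₜu lies only in the dual of V, the product rule is applied after regularization with (ι*ι +
1/(n+1))⁻¹. This operator commutes with ι*ι, and the energy identity for the difference of two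
regularizations shows that they are uniformly Cauchy in H, which gives the continuous
representative. Item 2 tests with ∂ₜu, regularized in the same way, and integrates the boundary term
by parts in time (`exists_strong_solution`, `first_order_bound`).

Item 3 is the delicate one: the equation cannot be differentiated in time, because K has no time
regularity yet. One works with z = -Δu = Φ - K h - ∂ₜu, where Φ = f - K ∗ u. The difference quotient
of z is paired with the moving average of z minus that of Φ, which is minus the moving average of K
h minus the difference quotient of u. Since h takes values in H¹, K h is an admissible test function
and is never differentiated. The Dirichlet form yields the square of the difference quotient of ∇u.
The part with Φ is integrated by parts in time, Φ being Lipschitz in time up to the increments of u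
in V. The compatibility condition bounds the initial average of z (`norm_sub_initial_le`). Grönwall
then bounds moving averages of Δu and difference quotients of u (`exists_diffQuot_bound`), and weak
limits give the statement (`exists_second_order`).

Item 4 returns to the formula for K: divided by (h, 1), every term is now Lipschitz in time up to
the increments of u in V, whose difference quotients are bounded in L² by item 3
(`exists_weak_derivative_of_norm_sub_le`).

The geometry of Ω enters through the density of smooth functions in H¹(Ω), proved with mollifiers
shifted across the boundary graph (`denseRange_resH1`), and the trace inequality
(`exists_trace_bound`). Together they give every element of H¹(Ω) a trace (`exists_trace`), as
needed because the equation is assumed only for pairs consisting of a function and its trace. -/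

theorem intervalIntegrable_of_integrable_timeMeasure {f : ℝ → X}
    (hf : Integrable f (timeMeasure T)) {a b : ℝ} (ha : a ∈ Icc 0 T) (hb : b ∈ Icc 0 T) :
    IntervalIntegrable f volume a b := by
  rw [intervalIntegrable_iff]
  refine IntegrableOn.mono_set (t := Icc 0 T) hf ?_
  exact uIoc_subset_uIcc.trans (uIcc_subset_Icc ha hb)

theorem ae_timeMeasure_iff {p : ℝ → Prop} :
    (∀ᵐ t ∂timeMeasure T, p t) ↔ ∀ᵐ t, t ∈ Icc 0 T → p t :=
  ae_restrict_iff' measurableSet_Icc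

theorem ae_mem_Icc : ∀ᵐ t ∂timeMeasure T, t ∈ Icc 0 T :=
  ae_timeMeasure_iff.2 (Eventually.of_forall fun _ h => h)

theorem intervalIntegral_eq_timeMeasure (hT : 0 ≤ T) (f : ℝ → X) :
    ∫ s in (0 : ℝ)..T, f s = ∫ s, f s ∂timeMeasure T := by
  rw [intervalIntegral.integral_of_le hT, integral_Icc_eq_integral_Ioc]

theorem intervalIntegral_congr_timeMeasure {f g : ℝ → X} (h : f =ᵐ[timeMeasure T] g)
    {a b : ℝ} (ha : a ∈ Icc 0 T) (hb : b ∈ Icc 0 T) :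
    ∫ s in a..b, f s = ∫ s in a..b, g s := by
  refine intervalIntegral.integral_congr_ae ?_
  filter_upwards [ae_timeMeasure_iff.1 h] with s hs hab
  exact hs (uIcc_subset_Icc ha hb (uIoc_subset_uIcc hab))

theorem intervalIntegral_mono_timeMeasure {f g : ℝ → ℝ} (hf : Integrable f (timeMeasure T))
    (hg : Integrable g (timeMeasure T)) (h : ∀ᵐ s ∂timeMeasure T, f s ≤ g s)
    {a b : ℝ} (ha : a ∈ Icc 0 T) (hb : b ∈ Icc 0 T) (hab : a ≤ b) :
    ∫ s in a..b, f s ≤ ∫ s in a..b, g s := by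
  refine intervalIntegral.integral_mono_ae_restrict hab
    (intervalIntegrable_of_integrable_timeMeasure hf ha hb)
    (intervalIntegrable_of_integrable_timeMeasure hg ha hb) ?_
  exact ae_restrict_of_ae_restrict_of_subset (Icc_subset_Icc ha.1 hb.2) h

theorem intervalIntegral_nonneg_timeMeasure {f : ℝ → ℝ}
    (h : ∀ᵐ s ∂timeMeasure T, 0 ≤ f s)
    {a b : ℝ} (ha : a ∈ Icc 0 T) (hb : b ∈ Icc 0 T) (hab : a ≤ b) :
    0 ≤ ∫ s in a..b, f s := by
  refine intervalIntegral.integral_nonneg_of_ae_restrict hab ?_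
  exact ae_restrict_of_ae_restrict_of_subset (Icc_subset_Icc ha.1 hb.2) h

theorem norm_intervalIntegral_le_timeMeasure {f : ℝ → X} {g : ℝ → ℝ}
    (hg : Integrable g (timeMeasure T)) (h : ∀ᵐ s ∂timeMeasure T, ‖f s‖ ≤ g s)
    {a b : ℝ} (ha : a ∈ Icc 0 T) (hb : b ∈ Icc 0 T) (hab : a ≤ b) :
    ‖∫ s in a..b, f s‖ ≤ ∫ s in a..b, g s := by
  refine intervalIntegral.norm_integral_le_of_norm_le hab ?_
    (intervalIntegrable_of_integrable_timeMeasure hg ha hb)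
  filter_upwards [ae_timeMeasure_iff.1 h] with s hs hab'
  exact hs ⟨ha.1.trans hab'.1.le, hab'.2.trans hb.2⟩

theorem intervalIntegral_le_of_nonneg {f : ℝ → ℝ} (hf : Integrable f (timeMeasure T))
    (h : ∀ᵐ s ∂timeMeasure T, 0 ≤ f s) {a b : ℝ} (ha : a ∈ Icc 0 T) (hb : b ∈ Icc 0 T)
    (hab : a ≤ b) : ∫ s in a..b, f s ≤ ∫ s, f s ∂timeMeasure T := by
  rw [intervalIntegral.integral_of_le hab]
  exact setIntegral_mono_set hf h
    (LE.le.eventuallyLE (Ioc_subset_Icc_self.trans (Icc_subset_Icc ha.1 hb.2)))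

theorem continuousOn_primitive {f : ℝ → X} (hf : Integrable f (timeMeasure T)) (hT : 0 ≤ T) :
    ContinuousOn (fun t => ∫ s in (0 : ℝ)..t, f s) (Icc 0 T) := by
  have := intervalIntegral.continuousOn_primitive_interval (μ := volume) (a := 0) (b := T) (f := f)
    (by rw [uIcc_of_le hT]; exact hf)
  rwa [uIcc_of_le hT] at this

theorem integrable_of_continuousOn {f : ℝ → X} (hf : ContinuousOn f (Icc 0 T)) :
    Integrable f (timeMeasure T) :=
  hf.integrableOn_compact isCompact_Icc

theorem primitive_sub {f : ℝ → X} (hf : Integrable f (timeMeasure T)) {s t : ℝ}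
    (hs : s ∈ Icc 0 T) (ht : t ∈ Icc 0 T) :
    (∫ r in (0 : ℝ)..t, f r) - ∫ r in (0 : ℝ)..s, f r = ∫ r in s..t, f r := by
  have h0 : (0 : ℝ) ∈ Icc 0 T := ⟨le_rfl, hs.1.trans hs.2⟩
  exact intervalIntegral.integral_interval_sub_left
    (intervalIntegrable_of_integrable_timeMeasure hf h0 ht)
    (intervalIntegrable_of_integrable_timeMeasure hf h0 hs)

/-- Absolute continuity passes to any function whose increments are dominated by those of an
absolutely continuous one. This covers vector-valued primitives (compared with ∫ ‖f‖) and bilinear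
expressions in them. -/
theorem AbsolutelyContinuousOnInterval.of_dist_le {f : ℝ → X} {κ : ℝ → Y} {a b C : ℝ}
    (hκ : AbsolutelyContinuousOnInterval κ a b)
    (h : ∀ s ∈ uIcc a b, ∀ t ∈ uIcc a b, dist (f s) (f t) ≤ C * dist (κ s) (κ t)) :
    AbsolutelyContinuousOnInterval f a b := by
  unfold AbsolutelyContinuousOnInterval at hκ ⊢
  apply squeeze_zero' ?_ ?_ (by simpa using hκ.const_mul C)
  · exact Eventually.of_forall fun E => Finset.sum_nonneg fun i _ => dist_nonneg
  · have : ∀ᶠ E in AbsolutelyContinuousOnInterval.totalLengthFilter ⊓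
        𝓟 (AbsolutelyContinuousOnInterval.disjWithin a b),
        E ∈ AbsolutelyContinuousOnInterval.disjWithin a b :=
      Filter.mem_inf_of_right (mem_principal_self _)
    filter_upwards [this] with E hE
    rw [Finset.mul_sum]
    refine Finset.sum_le_sum fun i hi => ?_
    have := hE.1 i hi
    exact h _ this.1 _ this.2

theorem absolutelyContinuousOnInterval_primitive {f : ℝ → X}
    (hf : Integrable f (timeMeasure T)) {t : ℝ} (ht : t ∈ Icc 0 T) :
    AbsolutelyContinuousOnInterval (fun r => ∫ s in (0 : ℝ)..r, f s) 0 t := by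
  have h0 : (0 : ℝ) ∈ Icc 0 T := ⟨le_rfl, ht.1.trans ht.2⟩
  have hn := hf.norm
  refine AbsolutelyContinuousOnInterval.of_dist_le (C := 1)
    ((intervalIntegrable_of_integrable_timeMeasure hn h0 ht).absolutelyContinuousOnInterval_intervalIntegral
      left_mem_uIcc) ?_
  have key : ∀ r ∈ uIcc 0 t, r ∈ Icc 0 T := fun r hr => uIcc_subset_Icc h0 ht hr
  intro r hr s hs
  rw [dist_comm, dist_eq_norm, dist_comm, Real.dist_eq, one_mul,
    primitive_sub hf (key r hr) (key s hs), primitive_sub hn (key r hr) (key s hs)]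
  exact intervalIntegral.norm_integral_le_abs_integral_norm

variable [CompleteSpace X] [CompleteSpace Y]

/-- The product rule for primitives of integrable functions. -/
theorem bilin_primitive_eq (B : X →L[ℝ] Y →L[ℝ] ℝ) {f : ℝ → X} {g : ℝ → Y}
    (hf : Integrable f (timeMeasure T)) (hg : Integrable g (timeMeasure T)) (x₀ : X) (y₀ : Y)
    {x : ℝ → X} {y : ℝ → Y} (hx : ∀ t ∈ Icc 0 T, x t = x₀ + ∫ s in (0 : ℝ)..t, f s)
    (hy : ∀ t ∈ Icc 0 T, y t = y₀ + ∫ s in (0 : ℝ)..t, g s) {t : ℝ} (ht : t ∈ Icc 0 T) :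
    B (x t) (y t) = B x₀ y₀ + ∫ s in (0 : ℝ)..t, (B (f s) (y s) + B (x s) (g s)) := by
  have hT : 0 ≤ T := ht.1.trans ht.2
  have h0 : (0 : ℝ) ∈ Icc 0 T := ⟨le_rfl, hT⟩
  have hsub : ∀ r ∈ uIcc 0 t, r ∈ Icc 0 T := fun r hr => uIcc_subset_Icc h0 ht hr
  set X' : ℝ → X := fun t => x₀ + ∫ s in (0 : ℝ)..t, f s with hX'
  set Y' : ℝ → Y := fun t => y₀ + ∫ s in (0 : ℝ)..t, g s with hY'
  have cX : ContinuousOn X' (Icc 0 T) := continuousOn_const.add (continuousOn_primitive hf hT)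
  have cY : ContinuousOn Y' (Icc 0 T) := continuousOn_const.add (continuousOn_primitive hg hT)
  obtain ⟨CX, hCX⟩ := isCompact_Icc.exists_bound_of_continuousOn cX
  obtain ⟨CY, hCY⟩ := isCompact_Icc.exists_bound_of_continuousOn cY
  have mB1 : AEStronglyMeasurable (fun s => B (f s) (Y' s)) (timeMeasure T) :=
    B.aestronglyMeasurable_comp₂ hf.1 (cY.aestronglyMeasurable measurableSet_Icc)
  have mB2 : AEStronglyMeasurable (fun s => B (X' s) (g s)) (timeMeasure T) :=
    B.aestronglyMeasurable_comp₂ (cX.aestronglyMeasurable measurableSet_Icc) hg.1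
  have i1 : Integrable (fun s => B (f s) (Y' s)) (timeMeasure T) := by
    refine Integrable.mono' (hf.norm.const_mul (‖B‖ * CY)) mB1 ?_
    filter_upwards [ae_mem_Icc] with s hs
    calc ‖B (f s) (Y' s)‖ ≤ ‖B‖ * ‖f s‖ * ‖Y' s‖ := B.le_opNorm₂ _ _
      _ ≤ ‖B‖ * ‖f s‖ * CY := by gcongr; exact hCY s hs
      _ = _ := by ring
  have i2 : Integrable (fun s => B (X' s) (g s)) (timeMeasure T) := by
    refine Integrable.mono' (hg.norm.const_mul (‖B‖ * CX)) mB2 ?_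
    filter_upwards [ae_mem_Icc] with s hs
    calc ‖B (X' s) (g s)‖ ≤ ‖B‖ * ‖X' s‖ * ‖g s‖ := B.le_opNorm₂ _ _
      _ ≤ ‖B‖ * CX * ‖g s‖ := by gcongr; exact hCX s hs
      _ = _ := by ring
  have i12 := i1.add i2
  have acX := absolutelyContinuousOnInterval_primitive hf ht
  have acY := absolutelyContinuousOnInterval_primitive hg ht
  have acN := (absolutelyContinuousOnInterval_primitive hf.norm ht).add
    (absolutelyContinuousOnInterval_primitive hg.norm ht)
  -- The increments of B(x, y) are dominated by those of the monotone function ∫ ‖f‖ + ∫ ‖g‖.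
  have acp : AbsolutelyContinuousOnInterval (fun r => B (X' r) (Y' r)) 0 t := by
    refine AbsolutelyContinuousOnInterval.of_dist_le (C := ‖B‖ * (|CX| + |CY|)) acN ?_
    have main : ∀ r ∈ Icc 0 T, ∀ s ∈ Icc 0 T, r ≤ s →
        dist (B (X' s) (Y' s)) (B (X' r) (Y' r)) ≤ ‖B‖ * (|CX| + |CY|) *
          dist ((∫ q in (0 : ℝ)..s, ‖f q‖) + ∫ q in (0 : ℝ)..s, ‖g q‖)
            ((∫ q in (0 : ℝ)..r, ‖f q‖) + ∫ q in (0 : ℝ)..r, ‖g q‖) := by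
      intro r hr s hs hrs
      have e1 : X' s - X' r = ∫ q in r..s, f q := by
        simp only [hX', add_sub_add_left_eq_sub]; exact primitive_sub hf hr hs
      have e2 : Y' s - Y' r = ∫ q in r..s, g q := by
        simp only [hY', add_sub_add_left_eq_sub]; exact primitive_sub hg hr hs
      have e3 := primitive_sub hf.norm hr hs
      have e4 := primitive_sub hg.norm hr hs
      have n1 : ‖X' s - X' r‖ ≤ ∫ q in r..s, ‖f q‖ := by
        rw [e1]; exact intervalIntegral.norm_integral_le_integral_norm hrs
      have n2 : ‖Y' s - Y' r‖ ≤ ∫ q in r..s, ‖g q‖ := by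
        rw [e2]; exact intervalIntegral.norm_integral_le_integral_norm hrs
      have n3 : 0 ≤ ∫ q in r..s, ‖f q‖ := (norm_nonneg _).trans n1
      have n4 : 0 ≤ ∫ q in r..s, ‖g q‖ := (norm_nonneg _).trans n2
      have : B (X' s) (Y' s) - B (X' r) (Y' r) = B (X' s - X' r) (Y' s) + B (X' r) (Y' s - Y' r) := by
        simp only [map_sub, sub_apply]; ring
      have e5 : ((∫ q in (0 : ℝ)..s, ‖f q‖) + ∫ q in (0 : ℝ)..s, ‖g q‖) -
          ((∫ q in (0 : ℝ)..r, ‖f q‖) + ∫ q in (0 : ℝ)..r, ‖g q‖)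
          = (∫ q in r..s, ‖f q‖) + ∫ q in r..s, ‖g q‖ := by rw [← e3, ← e4]; ring
      rw [dist_eq_norm, this, Real.dist_eq, e5, abs_of_nonneg (add_nonneg n3 n4)]
      calc _ ≤ ‖B (X' s - X' r) (Y' s)‖ + ‖B (X' r) (Y' s - Y' r)‖ := norm_add_le _ _
        _ ≤ ‖B‖ * ‖X' s - X' r‖ * ‖Y' s‖ + ‖B‖ * ‖X' r‖ * ‖Y' s - Y' r‖ :=
          add_le_add (B.le_opNorm₂ _ _) (B.le_opNorm₂ _ _)
        _ ≤ ‖B‖ * (∫ q in r..s, ‖f q‖) * |CY| + ‖B‖ * |CX| * (∫ q in r..s, ‖g q‖) := by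
          gcongr
          · exact (hCY s hs).trans (le_abs_self _)
          · exact (hCX r hr).trans (le_abs_self _)
        _ ≤ _ := by
          have := mul_nonneg (mul_nonneg (norm_nonneg B) (abs_nonneg CX)) n3
          have := mul_nonneg (mul_nonneg (norm_nonneg B) (abs_nonneg CY)) n4
          nlinarith
    intro r hr s hs
    rcases le_total r s with h | h
    · rw [dist_comm, dist_comm (α := ℝ) ((_ : ℝ → ℝ) r)]; exact main r (hsub r hr) s (hsub s hs) h
    · exact main s (hsub s hs) r (hsub r hr) h
  have acI := absolutelyContinuousOnInterval_primitive i12 ht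
  -- Both sides are absolutely continuous with the same derivative at almost every point by Lebesgue
  -- differentiation, so their difference is constant.
  obtain ⟨C, hC⟩ := (acp.sub acI).const_of_ae_hasDerivAt_zero (by
    filter_upwards [(intervalIntegrable_of_integrable_timeMeasure hf h0 ht).ae_hasDerivAt_integral,
      (intervalIntegrable_of_integrable_timeMeasure hg h0 ht).ae_hasDerivAt_integral,
      (intervalIntegrable_of_integrable_timeMeasure i12 h0 ht).ae_hasDerivAt_integral]
      with r h1 h2 h3 hr
    have d1 : HasDerivAt X' (f r) r := (h1 hr 0 left_mem_uIcc).const_add x₀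
    have d2 : HasDerivAt Y' (g r) r := (h2 hr 0 left_mem_uIcc).const_add y₀
    have d3 := h3 hr 0 left_mem_uIcc
    have := (B.hasDerivAt_of_bilinear (fun _ => d1) (fun _ => d2)).sub d3
    refine this.congr_deriv ?_
    simp only [Pi.add_apply]
    ring)
  have E0 := hC 0 left_mem_uIcc
  have Et := hC t right_mem_uIcc
  rw [← E0] at Et
  simp only [Pi.sub_apply, intervalIntegral.integral_same, sub_zero, hX', hY', add_zero] at Et
  rw [hx t ht, hy t ht, sub_eq_iff_eq_add.1 Et]
  congr 1
  refine intervalIntegral.integral_congr fun s hs => ?_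
  simp only [Pi.add_apply, hx s (hsub s hs), hy s (hsub s hs)]

/-- An integrable function on `[0, T]` whose primitive vanishes is zero. -/
theorem ae_eq_zero_of_primitive_eq_zero {f : ℝ → X} (hf : Integrable f (timeMeasure T))
    (h : ∀ t ∈ Icc 0 T, ∫ s in (0 : ℝ)..t, f s = 0) : f =ᵐ[timeMeasure T] 0 := by
  rcases lt_or_ge T 0 with hT | hT
  · have : timeMeasure T = 0 := by simp [timeMeasure, Icc_eq_empty (not_le.2 hT)]
    rw [this]; exact ae_zero ▸ Filter.eventually_bot
  have h0 : (0 : ℝ) ∈ Icc 0 T := ⟨le_rfl, hT⟩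
  have hTm : T ∈ Icc 0 T := ⟨hT, le_rfl⟩
  refine ae_timeMeasure_iff.2 ?_
  have hn0 : ∀ᵐ t : ℝ, t ≠ 0 := by simp [ae_iff, measure_singleton]
  have hnT : ∀ᵐ t : ℝ, t ≠ T := by simp [ae_iff, measure_singleton]
  filter_upwards [(intervalIntegrable_of_integrable_timeMeasure hf h0 hTm).ae_hasDerivAt_integral,
    hn0, hnT] with t ht n0 nT htT
  rw [uIcc_of_le hT] at ht
  have d := ht htT 0 h0
  have hmem : Icc 0 T ∈ 𝓝 t :=
    Icc_mem_nhds (lt_of_le_of_ne htT.1 (Ne.symm n0)) (lt_of_le_of_ne htT.2 nT)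
  have d0 : HasDerivAt (fun x => ∫ s in (0 : ℝ)..x, f s) 0 t :=
    (hasDerivAt_const t (0 : X)).congr_of_eventuallyEq
      (Filter.mem_of_superset hmem fun x hx => h x hx)
  exact d.unique d0

theorem ae_eq_of_primitive_eq {f g : ℝ → X} (hf : Integrable f (timeMeasure T))
    (hg : Integrable g (timeMeasure T))
    (h : ∀ t ∈ Icc 0 T, ∫ s in (0 : ℝ)..t, f s = ∫ s in (0 : ℝ)..t, g s) :
    f =ᵐ[timeMeasure T] g := by
  have := ae_eq_zero_of_primitive_eq_zero (hf.sub hg) fun t ht => by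
    have h0 : (0 : ℝ) ∈ Icc 0 T := ⟨le_rfl, ht.1.trans ht.2⟩
    simp only [Pi.sub_apply]
    rw [intervalIntegral.integral_sub (intervalIntegrable_of_integrable_timeMeasure hf h0 ht)
      (intervalIntegrable_of_integrable_timeMeasure hg h0 ht), h t ht, sub_self]
  filter_upwards [this] with t ht
  exact sub_eq_zero.1 ht

end Time

theorem eqOn_of_ae_eq {X : Type*} [TopologicalSpace X] [T2Space X] {T : ℝ} (hT : 0 < T)
    {f g : ℝ → X} (h : ∀ᵐ t ∂timeMeasure T, f t = g t) (hf : ContinuousOn f (Icc 0 T))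
    (hg : ContinuousOn g (Icc 0 T)) : ∀ t ∈ Icc 0 T, f t = g t :=
  Measure.eqOn_Icc_of_ae_eq volume hT.ne h hf hg

theorem le_of_ae_le {T : ℝ} (hT : 0 < T) {f g : ℝ → ℝ} (h : ∀ᵐ t ∂timeMeasure T, f t ≤ g t)
    (hf : ContinuousOn f (Icc 0 T)) (hg : ContinuousOn g (Icc 0 T)) :
    ∀ t ∈ Icc 0 T, f t ≤ g t := by
  have := eqOn_of_ae_eq hT (f := fun t => max (f t) (g t)) (g := g)
    (h.mono fun t ht => max_eq_right ht) (hf.sup hg) hg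
  exact fun t ht => max_eq_right_iff.1 (this t ht)

/-- Grönwall's inequality in integral form. -/
theorem gronwall_integral {T A B : ℝ} (hB : 0 ≤ B) {φ : ℝ → ℝ}
    (hφ : ContinuousOn φ (Icc 0 T))
    (h : ∀ t ∈ Icc 0 T, φ t ≤ A + B * ∫ s in (0 : ℝ)..t, φ s) :
    ∀ t ∈ Icc 0 T, φ t ≤ A * Real.exp (B * t) := by
  intro t ht
  have hT : 0 ≤ T := ht.1.trans ht.2
  have hi := integrable_of_continuousOn hφ
  -- The function φ is only continuous; the differential inequality is that of ψ, for which ψ' = B φ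
  -- ≤ B ψ.
  set ψ : ℝ → ℝ := fun t => A + B * ∫ s in (0 : ℝ)..t, φ s with hψ
  have cψ : ContinuousOn ψ (Icc 0 T) :=
    continuousOn_const.add (continuousOn_const.mul (continuousOn_primitive hi hT))
  have hd : ∀ x ∈ Ico 0 T, HasDerivWithinAt ψ (B * φ x) (Ici x) x := by
    intro x hx
    have hx' : x ∈ Icc 0 T := ⟨hx.1, hx.2.le⟩
    have hc : ContinuousWithinAt φ (Ici x) x :=
      ((hφ x hx').mono_of_mem_nhdsWithin
        (Filter.mem_of_superset (Icc_mem_nhdsGE hx.2) (Icc_subset_Icc hx.1 le_rfl)))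
    have hm : StronglyMeasurableAtFilter φ (𝓝[>] x) volume :=
      ⟨Ioo x T, Ioo_mem_nhdsGT hx.2,
        hi.1.mono_measure (Measure.restrict_mono
          ((Ioo_subset_Icc_self.trans (Icc_subset_Icc hx.1 le_rfl) : Ioo x T ⊆ Icc 0 T)) le_rfl)⟩
    have := intervalIntegral.integral_hasDerivWithinAt_right
      (intervalIntegrable_of_integrable_timeMeasure hi (left_mem_Icc.2 hT) hx') (s := Ici x) (t := Ioi x)
      hm (hc.mono Ioi_subset_Ici_self)
    exact (this.const_mul B).const_add A
  have key := le_gronwallBound_of_liminf_deriv_right_le (f := ψ) (f' := fun x => B * φ x)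
    (δ := A) (K := B) (ε := 0) cψ
    (fun x hx r hr => (hd x hx).liminf_right_slope_le hr) (by simp [hψ])
    (fun x hx => by
      have := mul_le_mul_of_nonneg_left (h x ⟨hx.1, hx.2.le⟩) hB
      simpa using this) t ht
  rw [gronwallBound_ε0, sub_zero] at key
  exact (h t ht).trans key

theorem sq_norm_intervalIntegral_le {X : Type*} [NormedAddCommGroup X] [NormedSpace ℝ X] {T : ℝ}
    {f : ℝ → X} (hf : MemLp f 2 (timeMeasure T)) {a b : ℝ} (ha : a ∈ Icc 0 T) (hb : b ∈ Icc 0 T)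
    (hab : a ≤ b) : ‖∫ s in a..b, f s‖ ^ 2 ≤ (b - a) * ∫ s in a..b, ‖f s‖ ^ 2 := by
  have hsq : Integrable (fun s => ‖f s‖ ^ 2) (timeMeasure T) :=
    (memLp_two_iff_integrable_sq_norm hf.1).1 hf
  have hfi : Integrable f (timeMeasure T) := hf.integrable (by norm_num)
  have h1 : ‖∫ s in a..b, f s‖ ≤ ∫ s in a..b, ‖f s‖ :=
    intervalIntegral.norm_integral_le_integral_norm hab
  set I := ∫ s in a..b, ‖f s‖
  set Q := ∫ s in a..b, ‖f s‖ ^ 2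
  have iI := intervalIntegrable_of_integrable_timeMeasure hfi.norm ha hb
  have iQ := intervalIntegrable_of_integrable_timeMeasure hsq ha hb
  rcases hab.eq_or_lt with rfl | hlt
  · simp
  -- Cauchy–Schwarz as nonnegativity of the variance of ‖f‖ about its mean.
  have h2 : 0 ≤ ∫ s in a..b, (‖f s‖ - I / (b - a)) ^ 2 :=
    intervalIntegral.integral_nonneg hab fun s _ => sq_nonneg _
  have h3 : ∫ s in a..b, (‖f s‖ - I / (b - a)) ^ 2
      = Q - 2 * (I / (b - a)) * I + (b - a) * (I / (b - a)) ^ 2 := by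
    have : (fun s => (‖f s‖ - I / (b - a)) ^ 2)
        = fun s => ‖f s‖ ^ 2 - 2 * (I / (b - a)) * ‖f s‖ + (I / (b - a)) ^ 2 := by
      ext s; ring
    rw [this, intervalIntegral.integral_add (iQ.sub (iI.const_mul _)) (by simp),
      intervalIntegral.integral_sub iQ (iI.const_mul _), intervalIntegral.integral_const_mul]
    simp [I, Q]
  rw [h3] at h2
  have hpos : 0 < b - a := sub_pos.2 hlt
  have h4 : Q - 2 * (I / (b - a)) * I + (b - a) * (I / (b - a)) ^ 2 = Q - I ^ 2 / (b - a) := by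
    field_simp; ring
  rw [h4, sub_nonneg, div_le_iff₀ hpos] at h2
  calc _ ≤ I ^ 2 := by gcongr
    _ ≤ _ := by linarith

/-- Integrated moving averages are bounded by the full integral. -/
theorem integral_movingIntegral_le {T τ : ℝ} {k : ℝ → ℝ} (hk : Integrable k (timeMeasure T))
    (hk0 : ∀ᵐ s ∂timeMeasure T, 0 ≤ k s) (hτ : 0 ≤ τ) {t : ℝ} (ht : 0 ≤ t) (htT : t + τ ≤ T) :
    ∫ r in (0 : ℝ)..t, (∫ s in r..(r + τ), k s) ≤ τ * ∫ s, k s ∂timeMeasure T := by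
  have hT : 0 ≤ T := by linarith
  have h0 : (0 : ℝ) ∈ Icc 0 T := ⟨le_rfl, hT⟩
  have htm : t ∈ Icc 0 T := ⟨ht, by linarith⟩
  have hτm : τ ∈ Icc 0 T := ⟨hτ, by linarith⟩
  have htτ : t + τ ∈ Icc 0 T := ⟨by linarith, htT⟩
  set κ : ℝ → ℝ := fun r => ∫ s in (0 : ℝ)..r, k s with hκ
  have cκ : ContinuousOn κ (Icc 0 T) := continuousOn_primitive hk hT
  have iκ := integrable_of_continuousOn cκ
  have e1 : ∫ r in (0 : ℝ)..t, (∫ s in r..(r + τ), k s)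
      = ∫ r in (0 : ℝ)..t, (κ (r + τ) - κ r) := by
    refine intervalIntegral.integral_congr fun r hr => ?_
    rw [uIcc_of_le ht] at hr
    exact (primitive_sub hk ⟨hr.1, by linarith [hr.2]⟩
      ⟨by linarith [hr.1], by linarith [hr.2]⟩).symm
  have i1 : IntervalIntegrable (fun r => κ (r + τ)) volume 0 t := by
    have := (intervalIntegrable_of_integrable_timeMeasure iκ hτm htτ).comp_add_right τ
    simpa using this
  rw [e1, intervalIntegral.integral_sub i1 (intervalIntegrable_of_integrable_timeMeasure iκ h0 htm),
    intervalIntegral.integral_comp_add_right (fun r => κ r) τ, zero_add]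
  -- The two windows overlap; after cancellation only the end piece and the initial piece, each of
  -- length τ, survive.
  have e2 : (∫ r in τ..(t + τ), κ r) - ∫ r in (0 : ℝ)..t, κ r
      = (∫ r in t..(t + τ), κ r) - ∫ r in (0 : ℝ)..τ, κ r := by
    have A := intervalIntegral.integral_add_adjacent_intervals
      (intervalIntegrable_of_integrable_timeMeasure iκ h0 hτm)
      (intervalIntegrable_of_integrable_timeMeasure iκ hτm htτ)
    have B := intervalIntegral.integral_add_adjacent_intervals
      (intervalIntegrable_of_integrable_timeMeasure iκ h0 htm)
      (intervalIntegrable_of_integrable_timeMeasure iκ htm htτ)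
    linarith
  rw [e2]
  have b1 : ∫ r in t..(t + τ), κ r ≤ τ * ∫ s, k s ∂timeMeasure T := by
    have : ∫ r in t..(t + τ), κ r ≤ ∫ r in t..(t + τ), (∫ s, k s ∂timeMeasure T) := by
      refine intervalIntegral.integral_mono_on (by linarith)
        (intervalIntegrable_of_integrable_timeMeasure iκ htm htτ) (by simp) fun r hr => ?_
      exact intervalIntegral_le_of_nonneg hk hk0 h0 ⟨ht.trans hr.1, hr.2.trans htT⟩ (ht.trans hr.1)
    simpa using this
  have b2 : 0 ≤ ∫ r in (0 : ℝ)..τ, κ r :=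
    intervalIntegral.integral_nonneg hτ fun r hr =>
      intervalIntegral_nonneg_timeMeasure hk0 h0 ⟨hr.1, hr.2.trans hτm.2⟩ hr.1
  linarith

end

section


/-! ### Resolvents of the form operator, and the energy identity -/

section Abstract

variable {V H : Type*} [NormedAddCommGroup V] [InnerProductSpace ℝ V] [CompleteSpace V]
  [NormedAddCommGroup H] [InnerProductSpace ℝ H] [CompleteSpace H] (ι : V →L[ℝ] H)

/-- The adjoint of the embedding `ι`, i.e. the solution operator of the variational problem
`⟪x, φ⟫ = ⟪y, ι φ⟫`. -/
def rieszAdj : H →L[ℝ] V := ContinuousLinearMap.adjoint ι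

/-- The operator `ι* ι`. -/
def gramOp : V →L[ℝ] V := (rieszAdj ι).comp ι

theorem inner_rieszAdj (y : H) (x : V) : ⟪rieszAdj ι y, x⟫_ℝ = ⟪y, ι x⟫_ℝ :=
  ContinuousLinearMap.adjoint_inner_left ι x y

theorem inner_gramOp (x y : V) : ⟪gramOp ι x, y⟫_ℝ = ⟪ι x, ι y⟫_ℝ := inner_rieszAdj ι (ι x) y

theorem gramOp_apply (x : V) : gramOp ι x = rieszAdj ι (ι x) := rfl

/-- Lax–Milgram: the form of ι*ι + ε at x is ‖ι x‖² + ε ‖x‖², hence coercive. -/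
theorem exists_resolvent {ε : ℝ} (hε : 0 < ε) : ∃ B : V →L[ℝ] V,
    (∀ x, gramOp ι (B x) + ε • B x = x) ∧ ∀ x, B (gramOp ι x) + ε • B x = x := by
  let A : V →L[ℝ] V := gramOp ι + ε • ContinuousLinearMap.id ℝ V
  let b : V →L[ℝ] V →L[ℝ] ℝ := (innerSL ℝ).comp A
  have hb : IsCoercive b := by
    refine ⟨ε, hε, fun x => ?_⟩
    have : b x x = ‖ι x‖ ^ 2 + ε * (‖x‖ * ‖x‖) := by
      simp only [b, A, ContinuousLinearMap.comp_apply, innerSL_apply_apply,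
        add_apply, smul_apply, ContinuousLinearMap.id_apply,
        inner_add_left, inner_gramOp, real_inner_smul_left, real_inner_self_eq_norm_sq]
      ring
    rw [this]
    nlinarith [sq_nonneg ‖ι x‖]
  let e := hb.continuousLinearEquivOfBilin
  have he : ∀ x, e x = A x := fun x => by
    refine ext_inner_right ℝ fun w => ?_
    exact hb.continuousLinearEquivOfBilin_apply x w
  refine ⟨e.symm, fun x => ?_, fun x => ?_⟩
  · have := e.apply_symm_apply x
    rw [he] at this
    simpa [A] using this
  · have := e.symm_apply_apply x
    rw [he] at this
    simpa [A] using this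

/-- The resolvent `(ι* ι + 1 / (n + 1))⁻¹`. -/
def resolv (n : ℕ) : V →L[ℝ] V :=
  Classical.choose (exists_resolvent ι (Nat.one_div_pos_of_nat (α := ℝ) (n := n)))

theorem gramOp_resolv_add (n : ℕ) (x : V) :
    gramOp ι (resolv ι n x) + (1 / ((n : ℝ) + 1)) • resolv ι n x = x :=
  (Classical.choose_spec (exists_resolvent ι (Nat.one_div_pos_of_nat (α := ℝ) (n := n)))).1 x

theorem resolv_gramOp_add (n : ℕ) (x : V) :
    resolv ι n (gramOp ι x) + (1 / ((n : ℝ) + 1)) • resolv ι n x = x :=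
  (Classical.choose_spec (exists_resolvent ι (Nat.one_div_pos_of_nat (α := ℝ) (n := n)))).2 x

theorem gramOp_resolv_comm (n : ℕ) (x : V) :
    gramOp ι (resolv ι n x) = resolv ι n (gramOp ι x) :=
  add_right_cancel ((gramOp_resolv_add ι n x).trans (resolv_gramOp_add ι n x).symm)

/-- The regularizing operators `J n = (ι* ι + 1 / (n + 1))⁻¹ ι* ι`, which tend to the identity. -/
def regOp (n : ℕ) : V →L[ℝ] V := (resolv ι n).comp (gramOp ι)

theorem regOp_apply (n : ℕ) (x : V) : regOp ι n x = resolv ι n (gramOp ι x) := rfl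

/-- With y the resolvent of x, x = ι*ι y + ε y and the cross term 2ε ‖ι y‖² is nonnegative, so ‖ι*ι
y‖ ≤ ‖x‖. -/
theorem norm_regOp_le (n : ℕ) (x : V) : ‖regOp ι n x‖ ≤ ‖x‖ := by
  have h := gramOp_resolv_add ι n x
  set ε : ℝ := 1 / ((n : ℝ) + 1) with hε
  have hpos : 0 < ε := Nat.one_div_pos_of_nat
  rw [regOp_apply, ← gramOp_resolv_comm]
  set y := resolv ι n x
  have : ‖x‖ ^ 2 = ‖gramOp ι y‖ ^ 2 + 2 * (ε * ‖ι y‖ ^ 2) + ε ^ 2 * ‖y‖ ^ 2 := by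
    rw [← h, norm_add_sq_real, real_inner_smul_right, inner_gramOp, real_inner_self_eq_norm_sq,
      norm_smul, Real.norm_of_nonneg hpos.le]
    ring
  refine le_of_sq_le_sq ?_ (norm_nonneg x)
  rw [this]
  have := mul_nonneg hpos.le (sq_nonneg ‖ι y‖)
  have := mul_nonneg (sq_nonneg ε) (sq_nonneg ‖y‖)
  linarith

/-- On the range of ι*ι the error is explicit: J ι*ι x - ι*ι x = -ε J x. Together with density of
this range it gives strong convergence to the identity. -/
theorem norm_sub_regOp_gramOp_le (n : ℕ) (x : V) :
    ‖regOp ι n (gramOp ι x) - gramOp ι x‖ ≤ (1 / ((n : ℝ) + 1)) * ‖x‖ := by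
  have h := resolv_gramOp_add ι n (gramOp ι x)
  have : regOp ι n (gramOp ι x) - gramOp ι x = -((1 / ((n : ℝ) + 1)) • regOp ι n x) := by
    rw [regOp_apply, regOp_apply, eq_neg_iff_add_eq_zero]
    nth_rewrite 2 [← h]
    abel
  rw [this, norm_neg, norm_smul, Real.norm_of_nonneg Nat.one_div_pos_of_nat.le]
  gcongr
  exact norm_regOp_le ι n x

variable {ι}

/-- Strong convergence to the identity extends from a dense range. -/
theorem tendsto_of_tendsto_dense_range {E Z : Type*} [NormedAddCommGroup E] [NormedSpace ℝ E]
    {P : ℕ → E →L[ℝ] E} (hP : ∀ n x, ‖P n x‖ ≤ ‖x‖) {j : Z → E} (hj : DenseRange j)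
    (h : ∀ z, Tendsto (fun n => P n (j z)) atTop (𝓝 (j z))) (x : E) :
    Tendsto (fun n => P n x) atTop (𝓝 x) := by
  rw [Metric.tendsto_atTop]
  intro δ hδ
  obtain ⟨z, hz⟩ := hj.exists_dist_lt x (show (0 : ℝ) < δ / 3 by positivity)
  obtain ⟨n₀, hn₀⟩ := Metric.tendsto_atTop.1 (h z) (δ / 3) (by positivity)
  refine ⟨n₀, fun n hn => ?_⟩
  have h1 : dist (P n x) (P n (j z)) ≤ dist x (j z) := by
    rw [dist_eq_norm, dist_eq_norm, ← map_sub]; exact hP n _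
  have h2 := hn₀ n hn
  have h3 := dist_triangle4 (P n x) (P n (j z)) (j z) x
  rw [dist_comm (j z) x] at h3
  linarith

/-- A vector x orthogonal to the range satisfies ‖ι x‖² = ⟨ι*ι x, x⟩ = 0. -/
theorem denseRange_gramOp (hι : Function.Injective ι) : DenseRange (gramOp ι) := by
  have : (LinearMap.range (gramOp ι).toLinearMap).topologicalClosure = ⊤ := by
    rw [Submodule.topologicalClosure_eq_top_iff, Submodule.eq_bot_iff]
    intro x hx
    have := (Submodule.mem_orthogonal _ x).1 hx (gramOp ι x) ⟨x, rfl⟩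
    rw [inner_gramOp, inner_self_eq_zero] at this
    exact hι (this.trans (map_zero ι).symm)
  have := Submodule.dense_iff_topologicalClosure_eq_top.2 this
  exact this

theorem tendsto_regOp (hι : Function.Injective ι) (x : V) :
    Tendsto (fun n => regOp ι n x) atTop (𝓝 x) := by
  refine tendsto_of_tendsto_dense_range (norm_regOp_le ι) (denseRange_gramOp hι) (fun z => ?_) x
  rw [tendsto_iff_norm_sub_tendsto_zero]
  refine squeeze_zero (fun n => norm_nonneg _) (fun n => norm_sub_regOp_gramOp_le ι n z) ?_
  simpa using (tendsto_one_div_add_atTop_nhds_zero_nat (𝕜 := ℝ)).mul_const ‖z‖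

/-- The resolvent equation tested with its own solution x gives ‖ι x‖² ≤ ⟨y, ι x⟩. These
contractions on H are the counterparts of the operators J n on V, and they regularize initial values
and forcings that lie only in H. -/
theorem norm_resolv_rieszAdj_le (n : ℕ) (y : H) : ‖ι (resolv ι n (rieszAdj ι y))‖ ≤ ‖y‖ := by
  set x := resolv ι n (rieszAdj ι y) with hx
  have h := gramOp_resolv_add ι n (rieszAdj ι y)
  rw [← hx] at h
  have h1 : ‖ι x‖ ^ 2 ≤ ⟪y, ι x⟫_ℝ := by
    rw [← inner_rieszAdj, ← h, inner_add_left, inner_gramOp, real_inner_self_eq_norm_sq,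
      real_inner_smul_left, real_inner_self_eq_norm_sq]
    have := mul_nonneg (Nat.one_div_pos_of_nat (α := ℝ) (n := n)).le (sq_nonneg ‖x‖)
    linarith
  have h2 := h1.trans (real_inner_le_norm y (ι x))
  by_contra hlt
  push Not at hlt
  nlinarith [norm_nonneg y]

theorem tendsto_resolv_rieszAdj (hι : Function.Injective ι) (hd : DenseRange ι) (y : H) :
    Tendsto (fun n => ι (resolv ι n (rieszAdj ι y))) atTop (𝓝 y) :=
  tendsto_of_tendsto_dense_range
    (P := fun n => ι.comp ((resolv ι n).comp (rieszAdj ι))) norm_resolv_rieszAdj_le hd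
    (fun z => (ι.continuous.tendsto z).comp (tendsto_regOp hι z)) y

/-! #### Convergence in time -/

variable {T : ℝ}

theorem integrable_norm_sq {E : Type*} [NormedAddCommGroup E] {f : ℝ → E}
    (hf : MemLp f 2 (timeMeasure T)) : Integrable (fun s => ‖f s‖ ^ 2) (timeMeasure T) :=
  (memLp_two_iff_integrable_sq_norm hf.1).1 hf

theorem integrable_of_memLp_two {E : Type*} [NormedAddCommGroup E] {f : ℝ → E}
    (hf : MemLp f 2 (timeMeasure T)) : Integrable f (timeMeasure T) :=
  hf.integrable (by norm_num)

theorem integrable_inner {E : Type*} [NormedAddCommGroup E] [InnerProductSpace ℝ E]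
    {f g : ℝ → E} (hf : MemLp f 2 (timeMeasure T)) (hg : MemLp g 2 (timeMeasure T)) :
    Integrable (fun s => ⟪f s, g s⟫_ℝ) (timeMeasure T) := by
  refine Integrable.mono' ((integrable_norm_sq hf).add (integrable_norm_sq hg)) (hf.1.inner hg.1) ?_
  refine Eventually.of_forall fun s => ?_
  have := norm_inner_le_norm (𝕜 := ℝ) (f s) (g s)
  simp only [Pi.add_apply]
  nlinarith [sq_nonneg (‖f s‖ - ‖g s‖), sq_nonneg ‖f s‖, sq_nonneg ‖g s‖]

theorem memLp_clm {E F : Type*} [NormedAddCommGroup E] [NormedSpace ℝ E] [NormedAddCommGroup F]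
    [NormedSpace ℝ F] (L : E →L[ℝ] F) {f : ℝ → E} (hf : MemLp f 2 (timeMeasure T)) :
    MemLp (fun s => L (f s)) 2 (timeMeasure T) := L.comp_memLp' hf

/-- Dominated convergence: contractions give the majorant 4 ‖f‖². -/
theorem tendsto_integral_sq_norm_sub {E : Type*} [NormedAddCommGroup E] [NormedSpace ℝ E]
    {P : ℕ → E →L[ℝ] E} (hP : ∀ n x, ‖P n x‖ ≤ ‖x‖)
    (h : ∀ x, Tendsto (fun n => P n x) atTop (𝓝 x)) {f : ℝ → E}
    (hf : MemLp f 2 (timeMeasure T)) :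
    Tendsto (fun n => ∫ s, ‖P n (f s) - f s‖ ^ 2 ∂timeMeasure T) atTop (𝓝 0) := by
  have := tendsto_integral_of_dominated_convergence (μ := timeMeasure T)
    (F := fun n s => ‖P n (f s) - f s‖ ^ 2) (f := fun _ => (0 : ℝ)) (fun s => 4 * ‖f s‖ ^ 2)
    (fun n => (((memLp_clm (P n) hf).sub hf).1.norm.pow 2))
    ((integrable_norm_sq hf).const_mul 4)
    (fun n => Eventually.of_forall fun s => by
      have h1 := norm_sub_le (P n (f s)) (f s)
      have h2 := hP n (f s)
      have h3 := norm_nonneg (P n (f s) - f s)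
      rw [Real.norm_of_nonneg (by positivity)]
      nlinarith [norm_nonneg (f s)])
    (Eventually.of_forall fun s => by
      have := ((h (f s)).sub_const (f s)).norm.pow 2
      simpa using this)
  simpa using this

theorem exists_uniform_limit {E : Type*} [NormedAddCommGroup E] [CompleteSpace E] {s : Set ℝ}
    {f : ℕ → ℝ → E} (hf : ∀ n, ContinuousOn (f n) s) {e : ℕ → ℝ} (he : Tendsto e atTop (𝓝 0))
    (h : ∀ n m, ∀ t ∈ s, ‖f n t - f m t‖ ^ 2 ≤ e n + e m) :
    ∃ v : ℝ → E, ContinuousOn v s ∧ ∀ t ∈ s, Tendsto (fun n => f n t) atTop (𝓝 (v t)) := by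
  have hU : UniformCauchySeqOn f atTop s := by
    rw [Metric.uniformCauchySeqOn_iff]
    intro δ hδ
    obtain ⟨N, hN⟩ := Metric.tendsto_atTop.1 he (δ ^ 2 / 2) (by positivity)
    refine ⟨N, fun m hm n hn t ht => ?_⟩
    have h1 := hN m hm
    have h2 := hN n hn
    rw [Real.dist_eq, sub_zero] at h1 h2
    have h3 := h m n t ht
    rw [dist_eq_norm]
    refine lt_of_pow_lt_pow_left₀ 2 hδ.le ?_
    linarith [le_abs_self (e m), le_abs_self (e n)]
  have hex : ∀ t, ∃ y, t ∈ s → Tendsto (fun n => f n t) atTop (𝓝 y) := fun t => by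
    by_cases ht : t ∈ s
    · obtain ⟨y, hy⟩ := cauchySeq_tendsto_of_complete (hU.cauchySeq ht)
      exact ⟨y, fun _ => hy⟩
    · exact ⟨0, fun h => absurd h ht⟩
  choose v hv using hex
  refine ⟨v, ?_, hv⟩
  have := hU.tendstoUniformlyOn_of_tendsto hv
  exact this.continuousOn (Frequently.of_forall hf)

theorem norm_sub_sq_le {E : Type*} [NormedAddCommGroup E] (a b c : E) :
    ‖a - b‖ ^ 2 ≤ 2 * ‖a - c‖ ^ 2 + 2 * ‖b - c‖ ^ 2 := by
  have : ‖a - b‖ ≤ ‖a - c‖ + ‖b - c‖ := by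
    rw [norm_sub_rev b c]; exact norm_sub_le_norm_sub_add_norm_sub a c b
  nlinarith [norm_nonneg (a - b), sq_nonneg (‖a - c‖ - ‖b - c‖)]

/-- The energy identity: if `u ∈ L²(0, T; V)` satisfies `ι* ι u(t) = ι* u₀ + ∫₀ᵗ U` with
`U ∈ L²(0, T; V)`, then `ι u` has a continuous representative. -/
theorem exists_continuous_representative (hι : Function.Injective ι) (hd : DenseRange ι)
    {u U : ℝ → V} (hu : MemLp u 2 (timeMeasure T)) (hU : MemLp U 2 (timeMeasure T)) (u₀ : H)
    (hT : 0 ≤ T)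
    (h : ∀ᵐ t ∂timeMeasure T, gramOp ι (u t) = rieszAdj ι u₀ + ∫ s in (0 : ℝ)..t, U s) :
    ∃ v : ℝ → H, ContinuousOn v (Icc 0 T) ∧ v 0 = u₀ ∧ (∀ᵐ t ∂timeMeasure T, ι (u t) = v t) ∧
      ∀ t ∈ Icc 0 T, ‖v t‖ ^ 2 = ‖u₀‖ ^ 2 + 2 * ∫ s in (0 : ℝ)..t, ⟪U s, u s⟫_ℝ := by
  have h0 : (0 : ℝ) ∈ Icc 0 T := ⟨le_rfl, hT⟩
  have hUi := integrable_of_memLp_two hU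
  set w : ℝ → V := fun t => rieszAdj ι u₀ + ∫ s in (0 : ℝ)..t, U s with hw
  have cw : ContinuousOn w (Icc 0 T) := continuousOn_const.add (continuousOn_primitive hUi hT)
  -- The energy identity after applying an operator D that commutes with ι*ι. When D is a resolvent,
  -- D ι*ι is a contraction J n, so the integrand on the right stays bounded as n grows although D
  -- itself does not.
  have expand : ∀ D : V →L[ℝ] V, (∀ x, gramOp ι (D x) = D (gramOp ι x)) → ∀ t ∈ Icc 0 T,
      ‖ι (D (w t))‖ ^ 2 = ‖ι (D (rieszAdj ι u₀))‖ ^ 2 +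
        2 * ∫ s in (0 : ℝ)..t, ⟪D (gramOp ι (U s)), D (gramOp ι (u s))⟫_ℝ := by
    intro D hDc t ht
    have hDU : Integrable (fun s => D (U s)) (timeMeasure T) := D.integrable_comp hUi
    have hprim : ∀ r ∈ Icc 0 T, D (w r) = D (rieszAdj ι u₀) + ∫ s in (0 : ℝ)..r, D (U s) := by
      intro r hr
      rw [hw, D.intervalIntegral_comp_comm (intervalIntegrable_of_integrable_timeMeasure hUi h0 hr),
        ← map_add]
    have := bilin_primitive_eq (T := T) ((innerSL ℝ).comp (gramOp ι)) hDU hDU _ _ hprim hprim ht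
    simp only [ContinuousLinearMap.comp_apply, innerSL_apply_apply, inner_gramOp,
      real_inner_self_eq_norm_sq] at this
    rw [this, ← intervalIntegral.integral_const_mul]
    congr 1
    refine intervalIntegral_congr_timeMeasure (T := T) ?_ h0 ht
    filter_upwards [h] with s hs
    have e : D (w s) = D (gramOp ι (u s)) := by rw [hs]
    rw [real_inner_comm (ι (D (U s))) (ι (D (w s))), ← two_mul, ← inner_gramOp, hDc, e]
  let un : ℕ → ℝ → H := fun n t => ι (resolv ι n (w t))
  let e : ℕ → ℝ := fun n => 2 * (‖ι (resolv ι n (rieszAdj ι u₀)) - u₀‖ ^ 2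
    + (∫ s, ‖regOp ι n (U s) - U s‖ ^ 2 ∂timeMeasure T)
    + ∫ s, ‖regOp ι n (u s) - u s‖ ^ 2 ∂timeMeasure T)
  have he : Tendsto e atTop (𝓝 0) := by
    have h1 : Tendsto (fun n => ‖ι (resolv ι n (rieszAdj ι u₀)) - u₀‖ ^ 2) atTop (𝓝 0) := by
      have := ((tendsto_resolv_rieszAdj hι hd u₀).sub_const u₀).norm.pow 2
      simpa using this
    have h2 := tendsto_integral_sq_norm_sub (norm_regOp_le ι) (tendsto_regOp hι) hU
    have h3 := tendsto_integral_sq_norm_sub (norm_regOp_le ι) (tendsto_regOp hι) hu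
    simpa using ((h1.add h2).add h3).const_mul 2
  -- A difference of two resolvents also commutes with ι*ι, so the same identity measures the
  -- distance of two regularizations.
  have hcauchy : ∀ n m, ∀ t ∈ Icc 0 T, ‖un n t - un m t‖ ^ 2 ≤ e n + e m := by
    intro n m t ht
    have := expand (resolv ι n - resolv ι m)
      (fun x => by simp only [sub_apply, map_sub, gramOp_resolv_comm]) t ht
    simp only [sub_apply, map_sub] at this
    change ‖un n t - un m t‖ ^ 2 = _ at this
    rw [this]
    have i1 : ∀ k, Integrable (fun s => ‖regOp ι k (U s) - U s‖ ^ 2) (timeMeasure T) := fun k =>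
      integrable_norm_sq ((memLp_clm (regOp ι k) hU).sub hU)
    have i2 : ∀ k, Integrable (fun s => ‖regOp ι k (u s) - u s‖ ^ 2) (timeMeasure T) := fun k =>
      integrable_norm_sq ((memLp_clm (regOp ι k) hu).sub hu)
    have i3 := ((i1 n).add (i1 m)).add ((i2 n).add (i2 m))
    have b1 : ∫ s in (0 : ℝ)..t, ⟪regOp ι n (U s) - regOp ι m (U s),
        regOp ι n (u s) - regOp ι m (u s)⟫_ℝ ≤
        (∫ s, ‖regOp ι n (U s) - U s‖ ^ 2 ∂timeMeasure T) +
        (∫ s, ‖regOp ι m (U s) - U s‖ ^ 2 ∂timeMeasure T) +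
        ((∫ s, ‖regOp ι n (u s) - u s‖ ^ 2 ∂timeMeasure T) +
        ∫ s, ‖regOp ι m (u s) - u s‖ ^ 2 ∂timeMeasure T) := by
      rw [← integral_add' (i1 n) (i1 m), ← integral_add' (i2 n) (i2 m),
        ← integral_add' ((i1 n).add (i1 m)) ((i2 n).add (i2 m))]
      refine le_trans ?_ (intervalIntegral_le_of_nonneg i3
        (Eventually.of_forall fun s => by simp only [Pi.add_apply]; positivity) h0 ht ht.1)
      refine intervalIntegral_mono_timeMeasure
        (integrable_inner ((memLp_clm (regOp ι n) hU).sub (memLp_clm (regOp ι m) hU))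
          ((memLp_clm (regOp ι n) hu).sub (memLp_clm (regOp ι m) hu))) i3
        (Eventually.of_forall fun s => ?_) h0 ht ht.1
      simp only [Pi.add_apply, Pi.sub_apply]
      have a1 := real_inner_le_norm (regOp ι n (U s) - regOp ι m (U s))
        (regOp ι n (u s) - regOp ι m (u s))
      have a2 := norm_sub_sq_le (regOp ι n (U s)) (regOp ι m (U s)) (U s)
      have a3 := norm_sub_sq_le (regOp ι n (u s)) (regOp ι m (u s)) (u s)
      nlinarith [sq_nonneg (‖regOp ι n (U s) - regOp ι m (U s)‖ -
        ‖regOp ι n (u s) - regOp ι m (u s)‖)]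
    have b2 := norm_sub_sq_le (ι (resolv ι n (rieszAdj ι u₀))) (ι (resolv ι m (rieszAdj ι u₀))) u₀
    simp only [e]
    simp only [regOp_apply] at b1 ⊢
    linarith
  have hcont : ∀ n, ContinuousOn (un n) (Icc 0 T) := fun n =>
    (ι.continuous.comp (resolv ι n).continuous).comp_continuousOn cw
  obtain ⟨v, cv, hv⟩ := exists_uniform_limit hcont he hcauchy
  refine ⟨v, cv, ?_, ?_, fun t ht => ?_⟩
  · refine tendsto_nhds_unique (hv 0 h0) ?_
    have := tendsto_resolv_rieszAdj hι hd u₀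
    simpa [un, hw] using this
  · filter_upwards [h, ae_mem_Icc] with t ht htm
    refine tendsto_nhds_unique ?_ (hv t htm)
    have := (ι.continuous.tendsto _).comp (tendsto_regOp hι (u t))
    refine this.congr fun n => ?_
    simp only [un, Function.comp, regOp_apply, ht, hw]
  · have l1 := ((hv t ht).norm.pow 2)
    have l2 := (tendsto_resolv_rieszAdj hι hd u₀).norm.pow 2
    have l3 : Tendsto (fun n => ∫ s in (0 : ℝ)..t, ⟪regOp ι n (U s), regOp ι n (u s)⟫_ℝ) atTop
        (𝓝 (∫ s in (0 : ℝ)..t, ⟪U s, u s⟫_ℝ)) := by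
      have iB : Integrable (fun s => ‖U s‖ ^ 2 + ‖u s‖ ^ 2) (timeMeasure T) :=
        (integrable_norm_sq hU).add (integrable_norm_sq hu)
      have hsub : uIoc 0 t ⊆ Icc 0 T := uIoc_subset_uIcc.trans (uIcc_subset_Icc h0 ht)
      refine intervalIntegral.tendsto_integral_filter_of_dominated_convergence
        (fun s => ‖U s‖ ^ 2 + ‖u s‖ ^ 2) ?_ ?_
        (intervalIntegrable_of_integrable_timeMeasure iB h0 ht) ?_
      · exact Eventually.of_forall fun n =>
          ((memLp_clm (regOp ι n) hU).1.inner (memLp_clm (regOp ι n) hu).1).mono_measure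
            (Measure.restrict_mono hsub le_rfl)
      · refine Eventually.of_forall fun n => Eventually.of_forall fun s _ => ?_
        have a1 := norm_inner_le_norm (𝕜 := ℝ) (regOp ι n (U s)) (regOp ι n (u s))
        have a2 := norm_regOp_le ι n (U s)
        have a3 := norm_regOp_le ι n (u s)
        have a4 := mul_le_mul a2 a3 (norm_nonneg _) (norm_nonneg _)
        nlinarith [sq_nonneg (‖U s‖ - ‖u s‖), sq_nonneg ‖U s‖, sq_nonneg ‖u s‖]
      · exact Eventually.of_forall fun s _ => (tendsto_regOp hι (U s)).inner (tendsto_regOp hι (u s))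
    refine tendsto_nhds_unique l1 ((l2.add (l3.const_mul 2)).congr fun n => ?_)
    exact (expand (resolv ι n) (gramOp_resolv_comm ι n) t ht).symm

end Abstract

end

section


/-! ### Limits in `L²` -/

section L2Limits

variable {α E : Type*} [MeasurableSpace α] {μ : Measure α} [NormedAddCommGroup E]
  [InnerProductSpace ℝ E]

theorem inner_toLp_toLp {f g : α → E} (hf : MemLp f 2 μ) (hg : MemLp g 2 μ) :
    ⟪hf.toLp f, hg.toLp g⟫_ℝ = ∫ s, ⟪f s, g s⟫_ℝ ∂μ := by
  rw [L2.inner_def]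
  refine integral_congr_ae ?_
  filter_upwards [hf.coeFn_toLp, hg.coeFn_toLp] with s h1 h2
  rw [h1, h2]

theorem norm_toLp_sq {f : α → E} (hf : MemLp f 2 μ) : ‖hf.toLp f‖ ^ 2 = ∫ s, ‖f s‖ ^ 2 ∂μ := by
  rw [← real_inner_self_eq_norm_sq, inner_toLp_toLp]
  simp only [real_inner_self_eq_norm_sq]

theorem norm_toLp_sub_sq {f g : α → E} (hf : MemLp f 2 μ) (hg : MemLp g 2 μ) :
    ‖hf.toLp f - hg.toLp g‖ ^ 2 = ∫ s, ‖f s - g s‖ ^ 2 ∂μ := by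
  rw [← MemLp.toLp_sub, norm_toLp_sq]; rfl

theorem tendsto_toLp {f : ℕ → α → E} {g : α → E} (hf : ∀ n, MemLp (f n) 2 μ) (hg : MemLp g 2 μ)
    (h : Tendsto (fun n => ∫ s, ‖f n s - g s‖ ^ 2 ∂μ) atTop (𝓝 0)) :
    Tendsto (fun n => (hf n).toLp (f n)) atTop (𝓝 (hg.toLp g)) := by
  rw [tendsto_iff_norm_sub_tendsto_zero]
  have : ∀ n, ‖(hf n).toLp (f n) - hg.toLp g‖ = √(∫ s, ‖f n s - g s‖ ^ 2 ∂μ) := fun n => by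
    rw [← norm_toLp_sub_sq (hf n) hg, Real.sqrt_sq (norm_nonneg _)]
  simp only [this]
  simpa using h.sqrt

theorem exists_L2_limit [CompleteSpace E] {f : ℕ → α → E} (hf : ∀ n, MemLp (f n) 2 μ)
    {e : ℕ → ℝ} (he : Tendsto e atTop (𝓝 0))
    (h : ∀ n m, ∫ s, ‖f n s - f m s‖ ^ 2 ∂μ ≤ e n + e m) :
    ∃ g : α → E, MemLp g 2 μ ∧ Tendsto (fun n => ∫ s, ‖f n s - g s‖ ^ 2 ∂μ) atTop (𝓝 0) := by
  have hc : CauchySeq fun n => (hf n).toLp (f n) := by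
    rw [Metric.cauchySeq_iff]
    intro δ hδ
    obtain ⟨N, hN⟩ := Metric.tendsto_atTop.1 he (δ ^ 2 / 2) (by positivity)
    refine ⟨N, fun m hm n hn => ?_⟩
    have h1 := hN m hm
    have h2 := hN n hn
    rw [Real.dist_eq, sub_zero] at h1 h2
    have h3 := h m n
    rw [← norm_toLp_sub_sq (hf m) (hf n)] at h3
    rw [dist_eq_norm]
    refine lt_of_pow_lt_pow_left₀ 2 hδ.le ?_
    linarith [le_abs_self (e m), le_abs_self (e n)]
  obtain ⟨g, hg⟩ := cauchySeq_tendsto_of_complete hc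
  refine ⟨g, Lp.memLp g, ?_⟩
  have := ((tendsto_iff_norm_sub_tendsto_zero.1 hg).pow 2)
  rw [zero_pow two_ne_zero] at this
  refine this.congr fun n => ?_
  have := norm_toLp_sub_sq (hf n) (Lp.memLp g)
  rwa [Lp.toLp_coeFn] at this

theorem tendsto_integral_inner {f g : ℕ → α → E} {f₀ g₀ : α → E} (hf : ∀ n, MemLp (f n) 2 μ)
    (hg : ∀ n, MemLp (g n) 2 μ) (hf₀ : MemLp f₀ 2 μ) (hg₀ : MemLp g₀ 2 μ)
    (h1 : Tendsto (fun n => ∫ s, ‖f n s - f₀ s‖ ^ 2 ∂μ) atTop (𝓝 0))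
    (h2 : Tendsto (fun n => ∫ s, ‖g n s - g₀ s‖ ^ 2 ∂μ) atTop (𝓝 0)) :
    Tendsto (fun n => ∫ s, ⟪f n s, g n s⟫_ℝ ∂μ) atTop (𝓝 (∫ s, ⟪f₀ s, g₀ s⟫_ℝ ∂μ)) := by
  rw [← inner_toLp_toLp hf₀ hg₀]
  exact ((tendsto_toLp hf hf₀ h1).inner (tendsto_toLp hg hg₀ h2)).congr
    fun n => inner_toLp_toLp (hf n) (hg n)

end L2Limits

section TimeL2

variable {E : Type*} [NormedAddCommGroup E] [InnerProductSpace ℝ E] {T : ℝ}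

theorem memLp_two_of_continuousOn {E : Type*} [NormedAddCommGroup E] [NormedSpace ℝ E] {f : ℝ → E}
    (hf : ContinuousOn f (Icc 0 T)) : MemLp f 2 (timeMeasure T) := by
  obtain ⟨C, hC⟩ := isCompact_Icc.exists_bound_of_continuousOn hf
  exact MemLp.of_bound (integrable_of_continuousOn hf).1 C (ae_mem_Icc.mono hC)

theorem tendsto_intervalIntegral_inner {f g : ℕ → ℝ → E} {f₀ g₀ : ℝ → E}
    (hf : ∀ n, MemLp (f n) 2 (timeMeasure T)) (hg : ∀ n, MemLp (g n) 2 (timeMeasure T))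
    (hf₀ : MemLp f₀ 2 (timeMeasure T)) (hg₀ : MemLp g₀ 2 (timeMeasure T))
    (h1 : Tendsto (fun n => ∫ s, ‖f n s - f₀ s‖ ^ 2 ∂timeMeasure T) atTop (𝓝 0))
    (h2 : Tendsto (fun n => ∫ s, ‖g n s - g₀ s‖ ^ 2 ∂timeMeasure T) atTop (𝓝 0))
    {t : ℝ} (ht : t ∈ Icc 0 T) :
    Tendsto (fun n => ∫ s in (0 : ℝ)..t, ⟪f n s, g n s⟫_ℝ) atTop
      (𝓝 (∫ s in (0 : ℝ)..t, ⟪f₀ s, g₀ s⟫_ℝ)) := by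
  have hle : volume.restrict (Ioc 0 t) ≤ timeMeasure T :=
    Measure.restrict_mono (Ioc_subset_Icc_self.trans (Icc_subset_Icc le_rfl ht.2)) le_rfl
  simp only [intervalIntegral.integral_of_le ht.1]
  have aux : ∀ {p : ℕ → ℝ → E} {p₀ : ℝ → E}, (∀ n, MemLp (p n) 2 (timeMeasure T)) →
      MemLp p₀ 2 (timeMeasure T) →
      Tendsto (fun n => ∫ s, ‖p n s - p₀ s‖ ^ 2 ∂timeMeasure T) atTop (𝓝 0) →
      Tendsto (fun n => ∫ s in Ioc 0 t, ‖p n s - p₀ s‖ ^ 2) atTop (𝓝 0) := by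
    intro p p₀ hp hp₀ h
    refine squeeze_zero (fun n => integral_nonneg fun s => by positivity) (fun n => ?_) h
    exact integral_mono_measure hle (Eventually.of_forall fun s => by positivity)
      (integrable_norm_sq ((hp n).sub hp₀))
  exact tendsto_integral_inner (fun n => (hf n).mono_measure hle) (fun n => (hg n).mono_measure hle)
    (hf₀.mono_measure hle) (hg₀.mono_measure hle) (aux hf hf₀ h1) (aux hg hg₀ h2)

theorem tendsto_primitive {f : ℕ → ℝ → E} {f₀ : ℝ → E}
    (hf : ∀ n, MemLp (f n) 2 (timeMeasure T)) (hf₀ : MemLp f₀ 2 (timeMeasure T))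
    (h : Tendsto (fun n => ∫ s, ‖f n s - f₀ s‖ ^ 2 ∂timeMeasure T) atTop (𝓝 0))
    {t : ℝ} (ht : t ∈ Icc 0 T) :
    Tendsto (fun n => ∫ s in (0 : ℝ)..t, f n s) atTop (𝓝 (∫ s in (0 : ℝ)..t, f₀ s)) := by
  have h0 : (0 : ℝ) ∈ Icc 0 T := ⟨le_rfl, ht.1.trans ht.2⟩
  rw [tendsto_iff_norm_sub_tendsto_zero]
  have hb : ∀ n, ‖(∫ s in (0 : ℝ)..t, f n s) - ∫ s in (0 : ℝ)..t, f₀ s‖ ≤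
      √(T * ∫ s, ‖f n s - f₀ s‖ ^ 2 ∂timeMeasure T) := by
    intro n
    have hs := (hf n).sub hf₀
    rw [← intervalIntegral.integral_sub
      (intervalIntegrable_of_integrable_timeMeasure (integrable_of_memLp_two (hf n)) h0 ht)
      (intervalIntegrable_of_integrable_timeMeasure (integrable_of_memLp_two hf₀) h0 ht)]
    refine Real.le_sqrt_of_sq_le ((sq_norm_intervalIntegral_le hs h0 ht ht.1).trans ?_)
    rw [sub_zero]
    have := intervalIntegral_le_of_nonneg (integrable_norm_sq hs)
      (Eventually.of_forall fun s => by positivity) h0 ht ht.1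
    have h3 : 0 ≤ ∫ s in (0 : ℝ)..t, ‖(f n - f₀) s‖ ^ 2 :=
      intervalIntegral.integral_nonneg ht.1 fun s _ => by positivity
    exact mul_le_mul ht.2 this h3 (ht.1.trans ht.2)
  refine squeeze_zero (fun n => norm_nonneg _) hb ?_
  simpa using (h.const_mul T).sqrt

theorem intervalIntegral_inner_le {f g : ℝ → E} (hf : MemLp f 2 (timeMeasure T))
    (hg : MemLp g 2 (timeMeasure T)) {c : ℝ} (hc : 0 < c) {t : ℝ} (ht : t ∈ Icc 0 T) :
    ∫ s in (0 : ℝ)..t, ⟪f s, g s⟫_ℝ ≤ c * (∫ s in (0 : ℝ)..t, ‖f s‖ ^ 2) +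
      (4 * c)⁻¹ * ∫ s in (0 : ℝ)..t, ‖g s‖ ^ 2 := by
  have h0 : (0 : ℝ) ∈ Icc 0 T := ⟨le_rfl, ht.1.trans ht.2⟩
  have k1 := (intervalIntegrable_of_integrable_timeMeasure (integrable_norm_sq hf) h0 ht).const_mul c
  have k2 := (intervalIntegrable_of_integrable_timeMeasure (integrable_norm_sq hg) h0 ht).const_mul
    ((4 * c)⁻¹)
  rw [← intervalIntegral.integral_const_mul, ← intervalIntegral.integral_const_mul,
    ← intervalIntegral.integral_add k1 k2]
  refine intervalIntegral.integral_mono_on ht.1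
    (intervalIntegrable_of_integrable_timeMeasure (integrable_inner hf hg) h0 ht) (k1.add k2)
    fun s _ => ?_
  refine (real_inner_le_norm _ _).trans ?_
  have h1 : c * ‖f s‖ ^ 2 + (4 * c)⁻¹ * ‖g s‖ ^ 2 - ‖f s‖ * ‖g s‖
      = c * (‖f s‖ - (2 * c)⁻¹ * ‖g s‖) ^ 2 := by field_simp; ring
  have h2 := mul_nonneg hc.le (sq_nonneg (‖f s‖ - (2 * c)⁻¹ * ‖g s‖))
  linarith

theorem intervalIntegral_sq_norm_le {f : ℝ → E} (hf : MemLp f 2 (timeMeasure T)) {t : ℝ}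
    (ht : t ∈ Icc 0 T) : ∫ s in (0 : ℝ)..t, ‖f s‖ ^ 2 ≤ ∫ s, ‖f s‖ ^ 2 ∂timeMeasure T :=
  intervalIntegral_le_of_nonneg (integrable_norm_sq hf)
    (Eventually.of_forall fun s => by positivity) ⟨le_rfl, ht.1.trans ht.2⟩ ht ht.1

end TimeL2

/-! ### Strong solutions of the abstract equation, with time derivative in L²(0, T; H) -/

section Abstract

variable {V H : Type*} [NormedAddCommGroup V] [InnerProductSpace ℝ V] [CompleteSpace V]
  [NormedAddCommGroup H] [InnerProductSpace ℝ H] [CompleteSpace H] {ι : V →L[ℝ] H} {T : ℝ}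

theorem integral_sq_norm_sub_le {E : Type*} [NormedAddCommGroup E] {f g h : ℝ → E}
    (hf : MemLp f 2 (timeMeasure T)) (hg : MemLp g 2 (timeMeasure T))
    (hh : MemLp h 2 (timeMeasure T)) :
    ∫ s, ‖f s - g s‖ ^ 2 ∂timeMeasure T ≤
      2 * (∫ s, ‖f s - h s‖ ^ 2 ∂timeMeasure T) + 2 * ∫ s, ‖g s - h s‖ ^ 2 ∂timeMeasure T := by
  have i1 := integrable_norm_sq (hf.sub hg)
  have i2 := (integrable_norm_sq (hf.sub hh)).const_mul 2
  have i3 := (integrable_norm_sq (hg.sub hh)).const_mul 2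
  rw [← integral_const_mul, ← integral_const_mul]
  refine (integral_mono i1 (i2.add i3) fun s => norm_sub_sq_le (f s) (g s) (h s)).trans_eq ?_
  exact integral_add i2 i3

/-- The energy identity for regularizations of the solution of
`ι* ι u = ι* ι x₀ + ∫ (ι* F - (1 - ι* ι) u - ℓ)`. -/
theorem regularized_energy_identity {u : ℝ → V} {F : ℝ → H} {l l' : ℝ → V} {x₀ l₀ : V}
    (hu : MemLp u 2 (timeMeasure T)) (hF : MemLp F 2 (timeMeasure T))
    (hl' : MemLp l' 2 (timeMeasure T)) (hT : 0 ≤ T)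
    (hl : ∀ t ∈ Icc 0 T, l t = l₀ + ∫ s in (0 : ℝ)..t, l' s)
    (h : ∀ᵐ t ∂timeMeasure T, gramOp ι (u t) = gramOp ι x₀ +
      ∫ s in (0 : ℝ)..t, (rieszAdj ι (F s) - (u s - gramOp ι (u s)) - l s))
    (D : V →L[ℝ] V) (hD : ∀ x, gramOp ι (D x) = D (gramOp ι x)) {p P : ℝ → V}
    (hP : P = fun s => D (rieszAdj ι (F s) - (u s - gramOp ι (u s)) - l s))
    (hp : p = fun t => D (gramOp ι x₀) + ∫ s in (0 : ℝ)..t, P s) {t : ℝ} (ht : t ∈ Icc 0 T) :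
    MemLp P 2 (timeMeasure T) ∧ (∀ᵐ s ∂timeMeasure T, p s = D (gramOp ι (u s))) ∧
    ContinuousOn p (Icc 0 T) ∧
    ‖ι (p t)‖ ^ 2 = ‖ι (p 0)‖ ^ 2 + 2 * ∫ s in (0 : ℝ)..t, ⟪ι (P s), ι (p s)⟫_ℝ ∧
    (∫ s in (0 : ℝ)..t, ‖ι (P s)‖ ^ 2) + (‖p t‖ ^ 2 - ‖ι (p t)‖ ^ 2) / 2 =
      (‖p 0‖ ^ 2 - ‖ι (p 0)‖ ^ 2) / 2 +
      (∫ s in (0 : ℝ)..t, ⟪ι (D (rieszAdj ι (F s))), ι (P s)⟫_ℝ)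
      - ⟪D (gramOp ι (l t)), p t⟫_ℝ + ⟪D (gramOp ι l₀), p 0⟫_ℝ
      + ∫ s in (0 : ℝ)..t, ⟪D (gramOp ι (l' s)), p s⟫_ℝ := by
  have h0 : (0 : ℝ) ∈ Icc 0 T := ⟨le_rfl, hT⟩
  have hl'i := integrable_of_memLp_two hl'
  have cl : ContinuousOn l (Icc 0 T) :=
    (continuousOn_const.add (continuousOn_primitive hl'i hT)).congr hl
  have ml : MemLp l 2 (timeMeasure T) := memLp_two_of_continuousOn cl
  have mU : MemLp (fun s => rieszAdj ι (F s) - (u s - gramOp ι (u s)) - l s) 2 (timeMeasure T) :=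
    ((memLp_clm (rieszAdj ι) hF).sub (hu.sub (memLp_clm (gramOp ι) hu))).sub ml
  have mP : MemLp P 2 (timeMeasure T) := by rw [hP]; exact memLp_clm D mU
  have iP := integrable_of_memLp_two mP
  have cp : ContinuousOn p (Icc 0 T) := by
    rw [hp]; exact continuousOn_const.add (continuousOn_primitive iP hT)
  have mp : MemLp p 2 (timeMeasure T) := memLp_two_of_continuousOn cp
  have hp0 : p 0 = D (gramOp ι x₀) := by simp [hp]
  have hpu : ∀ᵐ s ∂timeMeasure T, p s = D (gramOp ι (u s)) := by
    filter_upwards [h, ae_mem_Icc] with s hs hsm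
    rw [hs, map_add, ← D.intervalIntegral_comp_comm
      (intervalIntegrable_of_integrable_timeMeasure (integrable_of_memLp_two mU) h0 hsm), hp, hP]
  have hpp : ∀ r ∈ Icc 0 T, p r = p 0 + ∫ s in (0 : ℝ)..r, P s := fun r _ => by rw [hp0, hp]
  refine ⟨mP, hpu, cp, ?_, ?_⟩
  · have := bilin_primitive_eq (T := T) ((innerSL ℝ).comp (gramOp ι)) iP iP _ _ hpp hpp ht
    simp only [ContinuousLinearMap.comp_apply, innerSL_apply_apply, inner_gramOp,
      real_inner_self_eq_norm_sq] at this
    rw [this, ← intervalIntegral.integral_const_mul]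
    congr 1
    refine intervalIntegral.integral_congr fun s _ => ?_
    rw [real_inner_comm (ι (P s)) (ι (p s)), two_mul]
  -- The operator 1 - ι*ι represents the Dirichlet form; its product rule produces (‖p‖² - ‖ι
  -- p‖²)/2.
  · have e1 := bilin_primitive_eq (T := T)
      ((innerSL ℝ).comp (ContinuousLinearMap.id ℝ V - gramOp ι)) iP iP _ _ hpp hpp ht
    simp only [ContinuousLinearMap.comp_apply, innerSL_apply_apply, sub_apply,
      ContinuousLinearMap.id_apply, inner_sub_left, inner_gramOp,
      real_inner_self_eq_norm_sq] at e1
    have hq : ∀ r ∈ Icc 0 T, D (gramOp ι (l r)) = D (gramOp ι l₀) +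
        ∫ s in (0 : ℝ)..r, (D.comp (gramOp ι)) (l' s) := fun r hr => by
      rw [(D.comp (gramOp ι)).intervalIntegral_comp_comm
        (intervalIntegrable_of_integrable_timeMeasure hl'i h0 hr), hl r hr]
      simp
    have iq : Integrable (fun s => (D.comp (gramOp ι)) (l' s)) (timeMeasure T) :=
      (D.comp (gramOp ι)).integrable_comp hl'i
    -- Integration by parts in time: ℓ is paired in V, where the time derivative P has no uniform
    -- bound, so the derivative is moved onto ℓ.
    have e2 : ⟪D (gramOp ι (l t)), p t⟫_ℝ = ⟪D (gramOp ι l₀), p 0⟫_ℝ +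
        ∫ s in (0 : ℝ)..t, (⟪D (gramOp ι (l' s)), p s⟫_ℝ + ⟪D (gramOp ι (l s)), P s⟫_ℝ) :=
      bilin_primitive_eq (T := T) (innerSL ℝ) iq iP _ _ hq hpp ht
    -- The regularized equation tested with its own time derivative P: apply ι*ι to P and pair with
    -- P.
    have key : ∀ᵐ s ∂timeMeasure T, ‖ι (P s)‖ ^ 2 = ⟪ι (D (rieszAdj ι (F s))), ι (P s)⟫_ℝ
        - (⟪p s, P s⟫_ℝ - ⟪ι (p s), ι (P s)⟫_ℝ) - ⟪D (gramOp ι (l s)), P s⟫_ℝ := by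
      filter_upwards [hpu] with s hs
      have : gramOp ι (P s) = gramOp ι (D (rieszAdj ι (F s))) - (p s - gramOp ι (p s))
          - D (gramOp ι (l s)) := by
        rw [hP, hs]
        simp only [map_sub, hD]
      rw [← real_inner_self_eq_norm_sq, ← inner_gramOp, this]
      simp only [inner_sub_left, inner_gramOp]
    have mp1 := memLp_clm ι mp
    have mP1 := memLp_clm ι mP
    have j1 := integrable_inner (memLp_clm ι (memLp_clm D (memLp_clm (rieszAdj ι) hF))) mP1
    have j2 := integrable_inner mp mP
    have j3 := integrable_inner mp1 mP1
    have j4 := integrable_inner (memLp_clm D (memLp_clm (gramOp ι) ml)) mP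
    have j5 := integrable_inner (memLp_clm D (memLp_clm (gramOp ι) hl')) mp
    have k1 := intervalIntegrable_of_integrable_timeMeasure j1 h0 ht
    have k2 := intervalIntegrable_of_integrable_timeMeasure j2 h0 ht
    have k3 := intervalIntegrable_of_integrable_timeMeasure j3 h0 ht
    have k4 := intervalIntegrable_of_integrable_timeMeasure j4 h0 ht
    have k5 := intervalIntegrable_of_integrable_timeMeasure j5 h0 ht
    have e3 : ∫ s in (0 : ℝ)..t, ‖ι (P s)‖ ^ 2 = _ := intervalIntegral_congr_timeMeasure key h0 ht
    rw [intervalIntegral.integral_sub (k1.sub (k2.sub k3)) k4,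
      intervalIntegral.integral_sub k1 (k2.sub k3), intervalIntegral.integral_sub k2 k3] at e3
    have e4 : ∫ s in (0 : ℝ)..t, (⟪P s, p s⟫_ℝ - ⟪ι (P s), ι (p s)⟫_ℝ +
        (⟪p s, P s⟫_ℝ - ⟪ι (p s), ι (P s)⟫_ℝ)) = 2 * ((∫ s in (0 : ℝ)..t, ⟪p s, P s⟫_ℝ)
          - ∫ s in (0 : ℝ)..t, ⟪ι (p s), ι (P s)⟫_ℝ) := by
      rw [← intervalIntegral.integral_sub k2 k3, ← intervalIntegral.integral_const_mul]
      refine intervalIntegral.integral_congr fun s _ => ?_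
      rw [real_inner_comm (p s) (P s), real_inner_comm (ι (p s)) (ι (P s))]; ring
    rw [e4] at e1
    rw [intervalIntegral.integral_add k5 k4] at e2
    rw [e3]
    linarith


/-- Young's inequality in the regularized identity. No Grönwall argument is needed, since p = D ι*ι
u almost everywhere and u is already known to lie in L²(0, T; V). Leaving D arbitrary allows it to
be a difference of two resolvents, which turns the estimate into a Cauchy bound. -/
theorem regularized_energy_estimate (hι1 : ∀ x, ‖ι x‖ ≤ ‖x‖) {u : ℝ → V} {F : ℝ → H} {l l' : ℝ → V} {x₀ l₀ : V}
    (hu : MemLp u 2 (timeMeasure T)) (hF : MemLp F 2 (timeMeasure T))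
    (hl' : MemLp l' 2 (timeMeasure T)) (hT : 0 ≤ T)
    (hl : ∀ t ∈ Icc 0 T, l t = l₀ + ∫ s in (0 : ℝ)..t, l' s)
    (h : ∀ᵐ t ∂timeMeasure T, gramOp ι (u t) = gramOp ι x₀ +
      ∫ s in (0 : ℝ)..t, (rieszAdj ι (F s) - (u s - gramOp ι (u s)) - l s))
    (D : V →L[ℝ] V) (hD : ∀ x, gramOp ι (D x) = D (gramOp ι x)) {p P : ℝ → V}
    (hP : P = fun s => D (rieszAdj ι (F s) - (u s - gramOp ι (u s)) - l s))
    (hp : p = fun t => D (gramOp ι x₀) + ∫ s in (0 : ℝ)..t, P s) {t : ℝ} (ht : t ∈ Icc 0 T) :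
    (∫ s in (0 : ℝ)..t, ‖ι (P s)‖ ^ 2) + ‖p t‖ ^ 2 ≤ 24 * (1 + T) *
      (‖D (gramOp ι x₀)‖ ^ 2 + ‖D (gramOp ι l₀)‖ ^ 2
      + (∫ s, ‖ι (D (rieszAdj ι (F s)))‖ ^ 2 ∂timeMeasure T)
      + (∫ s, ‖D (gramOp ι (u s))‖ ^ 2 ∂timeMeasure T)
      + ∫ s, ‖D (gramOp ι (l' s))‖ ^ 2 ∂timeMeasure T) := by
  have h0 : (0 : ℝ) ∈ Icc 0 T := ⟨le_rfl, hT⟩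
  obtain ⟨mP, pu, cp, E1, E2⟩ := regularized_energy_identity hu hF hl' hT hl h D hD hP hp ht
  have hp0 : p 0 = D (gramOp ι x₀) := by simp [hp]
  have mp : MemLp p 2 (timeMeasure T) := memLp_two_of_continuousOn cp
  have mG : MemLp (fun s => ι (P s)) 2 (timeMeasure T) := memLp_clm ι mP
  have md' : MemLp (fun s => ι (p s)) 2 (timeMeasure T) := memLp_clm ι mp
  have mQ : MemLp (fun s => ι (D (rieszAdj ι (F s)))) 2 (timeMeasure T) :=
    memLp_clm ι (memLp_clm D (memLp_clm (rieszAdj ι) hF))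
  have ml : MemLp (fun s => D (gramOp ι (l' s))) 2 (timeMeasure T) :=
    memLp_clm D (memLp_clm (gramOp ι) hl')
  have hl't : D (gramOp ι (l t)) = D (gramOp ι l₀) + ∫ s in (0 : ℝ)..t, D (gramOp ι (l' s)) := by
    have := (D.comp (gramOp ι)).intervalIntegral_comp_comm
        (intervalIntegrable_of_integrable_timeMeasure (integrable_of_memLp_two hl') h0 ht)
    simp only [ContinuousLinearMap.comp_apply] at this
    rw [this, hl t ht]
    simp
  have bl := intervalIntegral_sq_norm_le ml ht
  have bF := intervalIntegral_sq_norm_le mQ ht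
  have bU := intervalIntegral_sq_norm_le mp ht
  have eU : ∫ s, ‖p s‖ ^ 2 ∂timeMeasure T = ∫ s, ‖D (gramOp ι (u s))‖ ^ 2 ∂timeMeasure T :=
    integral_congr_ae (pu.mono fun s hs => by simp only [hs])
  rw [eU] at bU
  have c1 := intervalIntegral_inner_le mG md' (c := 1 / 4) (by norm_num) ht
  have c2 := intervalIntegral_inner_le mQ mG (c := 1 / 2) (by norm_num) ht
  have c3 := intervalIntegral_inner_le ml mp (c := 1 / 2) (by norm_num) ht
  have c4 : -⟪D (gramOp ι (l t)), p t⟫_ℝ ≤ ‖D (gramOp ι (l t))‖ ^ 2 + ‖p t‖ ^ 2 / 4 := by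
    have := neg_le_of_abs_le (abs_real_inner_le_norm (D (gramOp ι (l t))) (p t))
    nlinarith [sq_nonneg (‖D (gramOp ι (l t))‖ - ‖p t‖ / 2)]
  have c5 : ⟪D (gramOp ι l₀), p 0⟫_ℝ ≤ ‖D (gramOp ι l₀)‖ ^ 2 / 2 + ‖p 0‖ ^ 2 / 2 := by
    have := real_inner_le_norm (D (gramOp ι l₀)) (p 0)
    nlinarith [sq_nonneg (‖D (gramOp ι l₀)‖ - ‖p 0‖)]
  have c6 : ‖D (gramOp ι (l t))‖ ^ 2 ≤ 2 * ‖D (gramOp ι l₀)‖ ^ 2 +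
      2 * (T * ∫ s, ‖D (gramOp ι (l' s))‖ ^ 2 ∂timeMeasure T) := by
    have h1 := sq_norm_intervalIntegral_le ml h0 ht ht.1
    rw [sub_zero] at h1
    have h2 : t * (∫ s in (0 : ℝ)..t, ‖D (gramOp ι (l' s))‖ ^ 2) ≤
        T * ∫ s, ‖D (gramOp ι (l' s))‖ ^ 2 ∂timeMeasure T :=
      mul_le_mul ht.2 bl (intervalIntegral.integral_nonneg ht.1 fun s _ => by positivity) hT
    have h3 := norm_add_le (D (gramOp ι l₀)) (∫ s in (0 : ℝ)..t, D (gramOp ι (l' s)))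
    rw [← hl't] at h3
    have h4 : ‖D (gramOp ι (l t))‖ ^ 2 ≤
        (‖D (gramOp ι l₀)‖ + ‖∫ s in (0 : ℝ)..t, D (gramOp ι (l' s))‖) ^ 2 := by gcongr
    nlinarith [sq_nonneg (‖D (gramOp ι l₀)‖ - ‖∫ s in (0 : ℝ)..t, D (gramOp ι (l' s))‖)]
  have c7 : ∫ s in (0 : ℝ)..t, ‖ι (p s)‖ ^ 2 ≤ ∫ s in (0 : ℝ)..t, ‖p s‖ ^ 2 :=
    intervalIntegral.integral_mono_on ht.1
      (intervalIntegrable_of_integrable_timeMeasure (integrable_norm_sq md') h0 ht)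
      (intervalIntegrable_of_integrable_timeMeasure (integrable_norm_sq mp) h0 ht)
      fun s _ => pow_le_pow_left₀ (norm_nonneg _) (hι1 _) 2
  have c8 : ‖ι (p 0)‖ ^ 2 ≤ ‖p 0‖ ^ 2 := pow_le_pow_left₀ (norm_nonneg _) (hι1 _) 2
  rw [← hp0]
  have n1 : 0 ≤ ∫ s, ‖D (gramOp ι (l' s))‖ ^ 2 ∂timeMeasure T :=
    integral_nonneg fun s => by positivity
  have n2 : 0 ≤ ∫ s, ‖D (gramOp ι (u s))‖ ^ 2 ∂timeMeasure T :=
    integral_nonneg fun s => by positivity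
  have n3 : 0 ≤ ∫ s, ‖ι (D (rieszAdj ι (F s)))‖ ^ 2 ∂timeMeasure T :=
    integral_nonneg fun s => by positivity
  have n4 := sq_nonneg ‖p 0‖
  have n5 := sq_nonneg ‖D (gramOp ι l₀)‖
  have n6 := sq_nonneg ‖p t‖
  have n7 := mul_nonneg hT n1
  have n8 := mul_nonneg hT n2
  have n9 := mul_nonneg hT n3
  have n10 := mul_nonneg hT n4
  have n11 := mul_nonneg hT n5
  norm_num at c1 c2 c3
  linarith

/-- Solutions of `u' + (1 - ι* ι) u + ℓ = F` with `u(0) = x₀ ∈ V` and `ℓ ∈ W^{1,2}(0, T; V)` are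
strong: `u ∈ C([0, T]; V)`, `u' ∈ L²(0, T; H)`, and the energy identity holds. -/
theorem exists_strong_solution (hι : Function.Injective ι) (hd : DenseRange ι)
    (hι1 : ∀ x, ‖ι x‖ ≤ ‖x‖)
    {u : ℝ → V} {F : ℝ → H} {l l' : ℝ → V} {x₀ l₀ : V}
    (hu : MemLp u 2 (timeMeasure T)) (hF : MemLp F 2 (timeMeasure T))
    (hl' : MemLp l' 2 (timeMeasure T)) (hT : 0 ≤ T)
    (hl : ∀ t ∈ Icc 0 T, l t = l₀ + ∫ s in (0 : ℝ)..t, l' s)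
    (h : ∀ᵐ t ∂timeMeasure T, gramOp ι (u t) = gramOp ι x₀ +
      ∫ s in (0 : ℝ)..t, (rieszAdj ι (F s) - (u s - gramOp ι (u s)) - l s)) :
    ∃ (v : ℝ → V) (u' : ℝ → H), ContinuousOn v (Icc 0 T) ∧ v 0 = x₀ ∧
      (∀ᵐ t ∂timeMeasure T, u t = v t) ∧ MemLp u' 2 (timeMeasure T) ∧
      (∀ t ∈ Icc 0 T, ι (v t) = ι x₀ + ∫ s in (0 : ℝ)..t, u' s) ∧
      ∀ t ∈ Icc 0 T, (∫ s in (0 : ℝ)..t, ‖u' s‖ ^ 2) + (‖v t‖ ^ 2 - ‖ι (v t)‖ ^ 2) / 2 =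
        (‖x₀‖ ^ 2 - ‖ι x₀‖ ^ 2) / 2 + (∫ s in (0 : ℝ)..t, ⟪F s, u' s⟫_ℝ) - ⟪l t, v t⟫_ℝ
        + ⟪l₀, x₀⟫_ℝ + ∫ s in (0 : ℝ)..t, ⟪l' s, v s⟫_ℝ := by
  have h0 : (0 : ℝ) ∈ Icc 0 T := ⟨le_rfl, hT⟩
  have hTm : T ∈ Icc 0 T := ⟨hT, le_rfl⟩
  have hl'i := integrable_of_memLp_two hl'
  set U : ℝ → V := fun s => rieszAdj ι (F s) - (u s - gramOp ι (u s)) - l s with hU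
  let P : ℕ → ℝ → V := fun n s => resolv ι n (U s)
  let p : ℕ → ℝ → V := fun n t => resolv ι n (gramOp ι x₀) + ∫ s in (0 : ℝ)..t, P n s
  have main1 := fun (n : ℕ) (t : ℝ) (ht : t ∈ Icc 0 T) =>
    regularized_energy_identity (ι := ι) hu hF hl' hT hl h (resolv ι n) (gramOp_resolv_comm ι n)
      (p := p n) (P := P n) rfl rfl ht
  have mP : ∀ n, MemLp (P n) 2 (timeMeasure T) := fun n => (main1 n 0 h0).1
  have cp : ∀ n, ContinuousOn (p n) (Icc 0 T) := fun n => (main1 n 0 h0).2.2.1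
  have mp : ∀ n, MemLp (p n) 2 (timeMeasure T) := fun n => memLp_two_of_continuousOn (cp n)
  have pu : ∀ n, ∀ᵐ s ∂timeMeasure T, p n s = regOp ι n (u s) := fun n => (main1 n 0 h0).2.1
  have hp0 : ∀ n, p n 0 = regOp ι n x₀ := fun n => by simp [p, regOp_apply]
  -- The forcing is regularized in H: ι D ι* F with D the resolvent is Q n F.
  let Q : ℕ → H →L[ℝ] H := fun n => ι.comp ((resolv ι n).comp (rieszAdj ι))
  have hQ1 : ∀ n y, ‖Q n y‖ ≤ ‖y‖ := norm_resolv_rieszAdj_le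
  have hQ2 : ∀ y, Tendsto (fun n => Q n y) atTop (𝓝 y) := tendsto_resolv_rieszAdj hι hd
  have tF := tendsto_integral_sq_norm_sub hQ1 hQ2 hF
  have tu := tendsto_integral_sq_norm_sub (norm_regOp_le ι) (tendsto_regOp hι) hu
  have tl' := tendsto_integral_sq_norm_sub (norm_regOp_le ι) (tendsto_regOp hι) hl'
  have tx : Tendsto (fun n => ‖regOp ι n x₀ - x₀‖ ^ 2) atTop (𝓝 0) := by
    simpa using (((tendsto_regOp hι x₀).sub_const x₀).norm.pow 2)
  have tl₀ : Tendsto (fun n => ‖regOp ι n l₀ - l₀‖ ^ 2) atTop (𝓝 0) := by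
    simpa using (((tendsto_regOp hι l₀).sub_const l₀).norm.pow 2)
  let e : ℕ → ℝ := fun n => 48 * (1 + T) * (‖regOp ι n x₀ - x₀‖ ^ 2 + ‖regOp ι n l₀ - l₀‖ ^ 2
    + (∫ s, ‖Q n (F s) - F s‖ ^ 2 ∂timeMeasure T) + (∫ s, ‖regOp ι n (u s) - u s‖ ^ 2 ∂timeMeasure T)
    + ∫ s, ‖regOp ι n (l' s) - l' s‖ ^ 2 ∂timeMeasure T)
  have he : Tendsto e atTop (𝓝 0) := by
    simpa using ((((tx.add tl₀).add tF).add tu).add tl').const_mul (48 * (1 + T))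
  have hcauchy : ∀ n m, ∀ t ∈ Icc 0 T,
      (∫ s in (0 : ℝ)..t, ‖ι (P n s) - ι (P m s)‖ ^ 2) + ‖p n t - p m t‖ ^ 2 ≤ e n + e m := by
    intro n m t ht
    have iPn := fun k => intervalIntegrable_of_integrable_timeMeasure
      (integrable_of_memLp_two (mP k)) h0 ht
    have key : (∫ s in (0 : ℝ)..t, ‖ι ((resolv ι n - resolv ι m) (U s))‖ ^ 2) +
        ‖(resolv ι n - resolv ι m) (gramOp ι x₀) +
        ∫ s in (0 : ℝ)..t, (resolv ι n - resolv ι m) (U s)‖ ^ 2 ≤ _ :=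
      regularized_energy_estimate (ι := ι) hι1 hu hF hl' hT hl h (resolv ι n - resolv ι m)
        (fun x => by simp only [sub_apply, map_sub, gramOp_resolv_comm]) rfl rfl ht
    have e1 : (resolv ι n - resolv ι m) (gramOp ι x₀) +
        ∫ s in (0 : ℝ)..t, (resolv ι n - resolv ι m) (U s) = p n t - p m t := by
      have iPn := fun k => intervalIntegrable_of_integrable_timeMeasure
        (integrable_of_memLp_two (mP k)) h0 ht
      simp only [p, P, sub_apply] at iPn ⊢
      rw [intervalIntegral.integral_sub (iPn n) (iPn m)]; abel
    have sx := norm_sub_sq_le (regOp ι n x₀) (regOp ι m x₀) x₀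
    have sl₀ := norm_sub_sq_le (regOp ι n l₀) (regOp ι m l₀) l₀
    have su := integral_sq_norm_sub_le (memLp_clm (regOp ι n) hu) (memLp_clm (regOp ι m) hu) hu
    have sl' := integral_sq_norm_sub_le (memLp_clm (regOp ι n) hl') (memLp_clm (regOp ι m) hl') hl'
    have sF := integral_sq_norm_sub_le (memLp_clm (Q n) hF) (memLp_clm (Q m) hF) hF
    have e2 : ∀ s, ι ((resolv ι n - resolv ι m) (U s)) = ι (P n s) - ι (P m s) := fun s => by
      simp only [P, sub_apply, map_sub]
    simp only [e1, e2] at key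
    refine key.trans ?_
    simp only [e]
    have hpos : (0 : ℝ) ≤ 24 * (1 + T) := by positivity
    rw [← mul_add, show (48 : ℝ) * (1 + T) = 24 * (1 + T) * 2 by ring, mul_assoc (24 * (1 + T)) 2]
    refine mul_le_mul_of_nonneg_left ?_ hpos
    simp only [regOp_apply, Q, ContinuousLinearMap.comp_apply, sub_apply, map_sub]
      at sx sl₀ su sl' sF ⊢
    linarith
  have cauchy1 : ∀ n m, ∀ t ∈ Icc 0 T, ‖p n t - p m t‖ ^ 2 ≤ e n + e m := fun n m t ht => by
    have := hcauchy n m t ht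
    have h1 : 0 ≤ ∫ s in (0 : ℝ)..t, ‖ι (P n s) - ι (P m s)‖ ^ 2 :=
      intervalIntegral.integral_nonneg ht.1 fun s _ => by positivity
    linarith
  obtain ⟨v, cv, hv⟩ := exists_uniform_limit cp he cauchy1
  have mιP : ∀ n, MemLp (fun s => ι (P n s)) 2 (timeMeasure T) := fun n => memLp_clm ι (mP n)
  -- The time derivatives converge only after ι, so u' is an H-valued limit in L² in time.
  obtain ⟨u', mu', hu'⟩ := exists_L2_limit mιP he fun n m => by
    have := hcauchy n m T hTm
    rw [intervalIntegral_eq_timeMeasure hT] at this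
    linarith [sq_nonneg ‖p n T - p m T‖]
  have mv : MemLp v 2 (timeMeasure T) := memLp_two_of_continuousOn cv
  have huv : ∀ᵐ t ∂timeMeasure T, u t = v t := by
    filter_upwards [ae_all_iff.2 pu, ae_mem_Icc] with t ht htm
    exact tendsto_nhds_unique ((tendsto_regOp hι (u t)).congr fun n => (ht n).symm) (hv t htm)
  have hpv : Tendsto (fun n => ∫ s, ‖p n s - v s‖ ^ 2 ∂timeMeasure T) atTop (𝓝 0) := by
    refine tu.congr fun n => integral_congr_ae ?_
    filter_upwards [pu n, huv] with s h1 h2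
    rw [h1, h2]
  refine ⟨v, u', cv, ?_, huv, mu', fun t ht => ?_, fun t ht => ?_⟩
  · exact tendsto_nhds_unique (hv 0 h0) ((tendsto_regOp hι x₀).congr fun n => (hp0 n).symm)
  · refine tendsto_nhds_unique ((ι.continuous.tendsto _).comp (hv t ht)) ?_
    refine (((ι.continuous.tendsto _).comp (tendsto_regOp hι x₀)).add
      (tendsto_primitive mιP mu' hu' ht)).congr fun n => ?_
    simp only [Function.comp, p, map_add, regOp_apply]
    rw [← ι.intervalIntegral_comp_comm
      (intervalIntegrable_of_integrable_timeMeasure (integrable_of_memLp_two (mP n)) h0 ht)]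
  · have t1 := tendsto_intervalIntegral_inner mιP mιP mu' mu' hu' hu' ht
    simp only [real_inner_self_eq_norm_sq] at t1
    have t2 := tendsto_intervalIntegral_inner (fun n => memLp_clm (Q n) hF) mιP hF mu' tF hu' ht
    have t3 := tendsto_intervalIntegral_inner (fun n => memLp_clm (regOp ι n) hl') mp hl' mv tl'
      hpv ht
    have t4 := (tendsto_regOp hι (l t)).inner (𝕜 := ℝ) (hv t ht)
    have t5 := tendsto_regOp hι x₀
    have t6 := (tendsto_regOp hι l₀).inner (𝕜 := ℝ) t5
    have q1 := (hv t ht).norm.pow 2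
    have q2 := ((ι.continuous.tendsto _).comp (hv t ht)).norm.pow 2
    have q3 := t5.norm.pow 2
    have q4 := ((ι.continuous.tendsto _).comp t5).norm.pow 2
    refine tendsto_nhds_unique (t1.add ((q1.sub q2).div_const 2)) ?_
    refine ((((((q3.sub q4).div_const 2).add t2).sub t4).add t6).add t3).congr fun n => ?_
    have := (main1 n t ht).2.2.2.2
    rw [hp0] at this
    exact this.symm

end Abstract

end

section


/-! ### Abstract estimates -/

section Abstract

variable {V H : Type*} [NormedAddCommGroup V] [InnerProductSpace ℝ V] [CompleteSpace V]
  [NormedAddCommGroup H] [InnerProductSpace ℝ H] [CompleteSpace H] {ι : V →L[ℝ] H} {T : ℝ}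

theorem intervalIntegral_le_mul_of_le {f : ℝ → ℝ} (hf : Integrable f (timeMeasure T)) {c : ℝ}
    (h : ∀ᵐ s ∂timeMeasure T, f s ≤ c) {t : ℝ} (ht : t ∈ Icc 0 T) :
    ∫ s in (0 : ℝ)..t, f s ≤ t * c := by
  have := intervalIntegral_mono_timeMeasure hf (integrable_of_continuousOn (f := fun _ => c)
    continuousOn_const) h (left_mem_Icc.2 (ht.1.trans ht.2)) ht ht.1
  simpa using this

/-- The basic energy estimate. -/
theorem exists_energy_bound (hι : Function.Injective ι) (hd : DenseRange ι) (hT : 0 ≤ T)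
    {A B L M : ℝ} (hA : 0 ≤ A) (hB : 0 ≤ B) : ∃ C : ℝ, 0 ≤ C ∧
    ∀ {u l : ℝ → V} {F : ℝ → H} {u₀ : H}, MemLp u 2 (timeMeasure T) → MemLp F 2 (timeMeasure T) →
      MemLp l 2 (timeMeasure T) →
      (∀ᵐ t ∂timeMeasure T, gramOp ι (u t) = rieszAdj ι u₀ +
        ∫ s in (0 : ℝ)..t, (rieszAdj ι (F s) - (u s - gramOp ι (u s)) - l s)) →
      (∀ᵐ t ∂timeMeasure T, ‖F t‖ ^ 2 ≤ A + B * ∫ s in (0 : ℝ)..t, ‖ι (u s)‖ ^ 2) →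
      (∀ᵐ t ∂timeMeasure T, ‖l t‖ ≤ L) → ‖u₀‖ ≤ M →
      ∃ v : ℝ → H, ContinuousOn v (Icc 0 T) ∧ v 0 = u₀ ∧ (∀ᵐ t ∂timeMeasure T, ι (u t) = v t) ∧
        (∀ t ∈ Icc 0 T, ‖v t‖ ^ 2 ≤ C) ∧ ∫ s, ‖u s‖ ^ 2 ∂timeMeasure T ≤ C := by
  have h0 : (0 : ℝ) ∈ Icc 0 T := ⟨le_rfl, hT⟩
  have hTm : T ∈ Icc 0 T := ⟨hT, le_rfl⟩
  -- Twice the integrand of the energy identity is at most ‖F‖² + ‖v‖² - 2‖u‖² + 2‖v‖² + L² + ‖u‖².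
  -- The three terms ‖v‖² give the 3 in B', and the memory bound on F, integrated over time, gives T
  -- * B.
  set A' := M ^ 2 + T * (A + L ^ 2) with hA'
  set B' := 3 + T * B with hB'
  have nA : 0 ≤ A' := by positivity
  have nB : 0 ≤ B' := by positivity
  set G := A' * Real.exp (B' * T) with hG
  have nG : 0 ≤ G := by positivity
  refine ⟨G + (A' + B' * (T * G)), by positivity, ?_⟩
  intro u l F u₀ hu hF hl h hFb hlb hu₀
  have mU : MemLp (fun s => rieszAdj ι (F s) - (u s - gramOp ι (u s)) - l s) 2 (timeMeasure T) :=
    ((memLp_clm (rieszAdj ι) hF).sub (hu.sub (memLp_clm (gramOp ι) hu))).sub hl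
  obtain ⟨v, cv, v0, huv, hE⟩ := exists_continuous_representative hι hd hu mU u₀ hT h
  have mιu : MemLp (fun s => ι (u s)) 2 (timeMeasure T) := memLp_clm ι hu
  have iv : Integrable (fun s => ‖v s‖ ^ 2) (timeMeasure T) :=
    integrable_of_continuousOn (cv.norm.pow 2)
  have iu := integrable_norm_sq hu
  have iF := integrable_norm_sq hF
  have cI : ContinuousOn (fun t => ∫ s in (0 : ℝ)..t, ‖v s‖ ^ 2) (Icc 0 T) :=
    continuousOn_primitive iv hT
  have vmono : ∀ t ∈ Icc 0 T, ∀ s ∈ Icc 0 t,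
      ∫ r in (0 : ℝ)..s, ‖v r‖ ^ 2 ≤ ∫ r in (0 : ℝ)..t, ‖v r‖ ^ 2 := by
    intro t ht s hs
    have := primitive_sub iv ⟨hs.1, hs.2.trans ht.2⟩ ht
    have h2 : 0 ≤ ∫ r in s..t, ‖v r‖ ^ 2 :=
      intervalIntegral.integral_nonneg hs.2 fun r _ => by positivity
    linarith
  have ineq : ∀ t ∈ Icc 0 T, ‖v t‖ ^ 2 + ∫ s in (0 : ℝ)..t, ‖u s‖ ^ 2 ≤
      A' + B' * ∫ s in (0 : ℝ)..t, ‖v s‖ ^ 2 := by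
    intro t ht
    set I := ∫ s in (0 : ℝ)..t, ‖v s‖ ^ 2 with hI
    have nI : 0 ≤ I := intervalIntegral.integral_nonneg ht.1 fun r _ => by positivity
    have h1 : ∀ᵐ s ∂timeMeasure T, s ∈ Icc 0 t →
        2 * ⟪rieszAdj ι (F s) - (u s - gramOp ι (u s)) - l s, u s⟫_ℝ ≤
        (A + B * I + L ^ 2) + 3 * ‖v s‖ ^ 2 - ‖u s‖ ^ 2 := by
      filter_upwards [hFb, hlb, huv] with s a1 a2 a3 hs
      have e1 : ∫ r in (0 : ℝ)..s, ‖ι (u r)‖ ^ 2 = ∫ r in (0 : ℝ)..s, ‖v r‖ ^ 2 :=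
        intervalIntegral_congr_timeMeasure (huv.mono fun r hr => by simp only [hr]) h0
          ⟨hs.1, hs.2.trans ht.2⟩
      rw [e1] at a1
      have a4 := mul_le_mul_of_nonneg_left (vmono t ht s hs) hB
      have a5 : ⟪F s, v s⟫_ℝ ≤ ‖F s‖ * ‖v s‖ := real_inner_le_norm _ _
      have a6 := neg_le_of_abs_le (abs_real_inner_le_norm (l s) (u s))
      have a7 : ‖l s‖ ^ 2 ≤ L ^ 2 := pow_le_pow_left₀ (norm_nonneg _) a2 2
      simp only [inner_sub_left, inner_rieszAdj, inner_gramOp, real_inner_self_eq_norm_sq, a3]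
      nlinarith [sq_nonneg (‖F s‖ - ‖v s‖), sq_nonneg (‖l s‖ - ‖u s‖)]
    have i1 := ((integrable_of_continuousOn (T := T) (f := fun _ => A + B * I + L ^ 2)
      continuousOn_const).add (iv.const_mul 3)).sub iu
    have h2 : 2 * ∫ s in (0 : ℝ)..t, ⟪rieszAdj ι (F s) - (u s - gramOp ι (u s)) - l s, u s⟫_ℝ ≤
        t * (A + B * I + L ^ 2) + 3 * I - ∫ s in (0 : ℝ)..t, ‖u s‖ ^ 2 := by
      have k1 := intervalIntegrable_of_integrable_timeMeasure (iv.const_mul 3) h0 ht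
      have k2 := intervalIntegrable_of_integrable_timeMeasure iu h0 ht
      have k3 : IntervalIntegrable (fun _ => A + B * I + L ^ 2) volume 0 t := by simp
      have : t * (A + B * I + L ^ 2) + 3 * I - (∫ s in (0 : ℝ)..t, ‖u s‖ ^ 2) =
          ∫ s in (0 : ℝ)..t, ((A + B * I + L ^ 2) + 3 * ‖v s‖ ^ 2 - ‖u s‖ ^ 2) := by
        rw [intervalIntegral.integral_sub (k3.add k1) k2, intervalIntegral.integral_add k3 k1,
          intervalIntegral.integral_const_mul]
        simp only [intervalIntegral.integral_const, smul_eq_mul, sub_zero, hI]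
      rw [this, ← intervalIntegral.integral_const_mul]
      refine intervalIntegral.integral_mono_ae_restrict ht.1
        ((intervalIntegrable_of_integrable_timeMeasure (integrable_inner mU hu) h0 ht).const_mul 2)
        ((k3.add k1).sub k2) ?_
      have : ∀ᵐ s ∂volume.restrict (Icc 0 t), s ∈ Icc 0 t :=
        (ae_restrict_mem measurableSet_Icc)
      filter_upwards [this, ae_restrict_of_ae_restrict_of_subset
        (Icc_subset_Icc le_rfl ht.2 : Icc 0 t ⊆ Icc 0 T) h1] with s hs hs'
      exact hs' hs
    have h3 := hE t ht
    have h4 : ‖u₀‖ ^ 2 ≤ M ^ 2 := pow_le_pow_left₀ (norm_nonneg _) hu₀ 2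
    have h5 : t * (A + B * I + L ^ 2) ≤ T * (A + B * I + L ^ 2) :=
      mul_le_mul_of_nonneg_right ht.2 (by positivity)
    rw [hA', hB']
    linarith
  have hgr : ∀ t ∈ Icc 0 T, ‖v t‖ ^ 2 ≤ G := by
    intro t ht
    have := gronwall_integral (φ := fun t => ‖v t‖ ^ 2) nB (cv.norm.pow 2) (A := A') (fun t ht => by
      have h1 := ineq t ht
      have h2 : 0 ≤ ∫ s in (0 : ℝ)..t, ‖u s‖ ^ 2 :=
        intervalIntegral.integral_nonneg ht.1 fun r _ => by positivity
      linarith) t ht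
    refine this.trans ?_
    rw [hG]
    gcongr
    exact ht.2
  refine ⟨v, cv, v0, huv, fun t ht => (hgr t ht).trans ?_, ?_⟩
  · have : 0 ≤ A' + B' * (T * G) := by positivity
    linarith
  · have h1 := ineq T hTm
    have h2 := intervalIntegral_le_mul_of_le iv (ae_mem_Icc.mono hgr) hTm
    rw [intervalIntegral_eq_timeMeasure hT (fun s => ‖u s‖ ^ 2)] at h1
    have h3 := mul_le_mul_of_nonneg_left h2 nB
    linarith [sq_nonneg ‖v T‖]

/-- The first order estimate, from the energy identity of `exists_strong_solution`. -/
theorem first_order_bound (hT : 0 ≤ T) {v l l' : ℝ → V} {F u' : ℝ → H} {x₀ l₀ : V}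
    {A B C L M : ℝ} (hF : MemLp F 2 (timeMeasure T)) (hl' : MemLp l' 2 (timeMeasure T))
    (cv : ContinuousOn v (Icc 0 T)) (hu' : MemLp u' 2 (timeMeasure T))
    (hE : ∀ t ∈ Icc 0 T, (∫ s in (0 : ℝ)..t, ‖u' s‖ ^ 2) + (‖v t‖ ^ 2 - ‖ι (v t)‖ ^ 2) / 2 =
        (‖x₀‖ ^ 2 - ‖ι x₀‖ ^ 2) / 2 + (∫ s in (0 : ℝ)..t, ⟪F s, u' s⟫_ℝ) - ⟪l t, v t⟫_ℝ
        + ⟪l₀, x₀⟫_ℝ + ∫ s in (0 : ℝ)..t, ⟪l' s, v s⟫_ℝ)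
    (hFb : ∫ s, ‖F s‖ ^ 2 ∂timeMeasure T ≤ A) (hvb : ∫ s, ‖v s‖ ^ 2 ∂timeMeasure T ≤ B)
    (hιv : ∀ t ∈ Icc 0 T, ‖ι (v t)‖ ^ 2 ≤ C) (hl : ∀ t ∈ Icc 0 T, ‖l t‖ ≤ L) (hl₀ : ‖l₀‖ ≤ L)
    (hl'b : ∀ᵐ t ∂timeMeasure T, ‖l' t‖ ≤ L) (hx₀ : ‖x₀‖ ≤ M) :
    ∀ t ∈ Icc 0 T, ‖v t‖ ^ 2 + ∫ s in (0 : ℝ)..t, ‖u' s‖ ^ 2 ≤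
      4 * (M ^ 2 + A + B + C + (2 + T) * L ^ 2) := by
  intro t ht
  have mv : MemLp v 2 (timeMeasure T) := memLp_two_of_continuousOn cv
  have c1 := intervalIntegral_inner_le hF hu' (c := 1 / 2) (by norm_num) ht
  have c2 := intervalIntegral_inner_le hl' mv (c := 1 / 2) (by norm_num) ht
  have c3 := (intervalIntegral_sq_norm_le hF ht).trans hFb
  have c4 := (intervalIntegral_sq_norm_le mv ht).trans hvb
  have c5 : ∫ s in (0 : ℝ)..t, ‖l' s‖ ^ 2 ≤ T * L ^ 2 := by
    refine (intervalIntegral_le_mul_of_le (integrable_norm_sq hl')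
      (hl'b.mono fun s hs => pow_le_pow_left₀ (norm_nonneg _) hs 2) ht).trans ?_
    gcongr
    exact ht.2
  have c6 := neg_le_of_abs_le (abs_real_inner_le_norm (l t) (v t))
  have c7 := real_inner_le_norm l₀ x₀
  have c8 : ‖l t‖ ^ 2 ≤ L ^ 2 := pow_le_pow_left₀ (norm_nonneg _) (hl t ht) 2
  have c9 : ‖l₀‖ ^ 2 ≤ L ^ 2 := pow_le_pow_left₀ (norm_nonneg _) hl₀ 2
  have c10 : ‖x₀‖ ^ 2 ≤ M ^ 2 := pow_le_pow_left₀ (norm_nonneg _) hx₀ 2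
  have c11 := hιv t ht
  have c12 := hE t ht
  have n1 : 0 ≤ ∫ s in (0 : ℝ)..t, ‖u' s‖ ^ 2 :=
    intervalIntegral.integral_nonneg ht.1 fun r _ => by positivity
  norm_num at c1 c2
  have n2 : 0 ≤ A := le_trans (integral_nonneg fun s => by positivity) hFb
  have n3 : 0 ≤ B := le_trans (integral_nonneg fun s => by positivity) hvb
  have n4 : 0 ≤ C := (sq_nonneg _).trans c11
  have n5 := mul_nonneg hT (sq_nonneg L)
  have n6 := sq_nonneg L
  have n7 := sq_nonneg ‖ι x₀‖
  have s1 : ‖l t‖ * ‖v t‖ ≤ ‖l t‖ ^ 2 + ‖v t‖ ^ 2 / 4 := by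
    nlinarith [sq_nonneg (‖l t‖ - ‖v t‖ / 2)]
  have s2 : ‖l₀‖ * ‖x₀‖ ≤ ‖l₀‖ ^ 2 / 2 + ‖x₀‖ ^ 2 / 2 := by
    nlinarith [sq_nonneg (‖l₀‖ - ‖x₀‖)]
  linarith

end Abstract

end

section


/-! ### Moving averages and difference quotients in time -/

section Steklov

variable {E : Type*} [NormedAddCommGroup E] [NormedSpace ℝ E] {T τ : ℝ}

theorem measurePreserving_shift_timeMeasure (hτ : 0 ≤ τ) :
    MeasurePreserving (fun s : ℝ => s + τ) (timeMeasure (T - τ)) (volume.restrict (Icc τ T)) := by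
  have := (measurePreserving_add_right (volume : Measure ℝ) τ).restrict_preimage
    (measurableSet_Icc : MeasurableSet (Icc τ T))
  rwa [preimage_add_const_Icc, sub_self] at this

theorem memLp_shift (hτ : 0 ≤ τ) {g : ℝ → E} (hg : MemLp g 2 (timeMeasure T)) :
    MemLp (fun s => g (s + τ)) 2 (timeMeasure (T - τ)) :=
  (hg.mono_measure (Measure.restrict_mono (Icc_subset_Icc hτ le_rfl) le_rfl)).comp_measurePreserving
    (measurePreserving_shift_timeMeasure hτ)

theorem ae_shift (hτ : 0 ≤ τ) {p : ℝ → Prop} (hp : ∀ᵐ s ∂timeMeasure T, p s) :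
    ∀ᵐ s ∂timeMeasure (T - τ), p (s + τ) :=
  (measurePreserving_shift_timeMeasure hτ).quasiMeasurePreserving.ae
    (ae_restrict_of_ae_restrict_of_subset (Icc_subset_Icc hτ le_rfl) hp)

theorem timeMeasure_sub_le (hτ : 0 ≤ τ) : timeMeasure (T - τ) ≤ timeMeasure T :=
  Measure.restrict_mono (Icc_subset_Icc le_rfl (by linarith)) le_rfl

theorem memLp_of_sub (hτ : 0 ≤ τ) {g : ℝ → E} (hg : MemLp g 2 (timeMeasure T)) :
    MemLp g 2 (timeMeasure (T - τ)) := hg.mono_measure (timeMeasure_sub_le hτ)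

theorem ae_of_sub (hτ : 0 ≤ τ) {p : ℝ → Prop} (hp : ∀ᵐ s ∂timeMeasure T, p s) :
    ∀ᵐ s ∂timeMeasure (T - τ), p s :=
  ae_restrict_of_ae_restrict_of_subset (Icc_subset_Icc le_rfl (by linarith)) hp

/-- The difference quotient `τ⁻¹ (g(s + τ) - g(s))`. -/
def diffQuot (τ : ℝ) (g : ℝ → E) (s : ℝ) : E := τ⁻¹ • (g (s + τ) - g s)

/-- The moving average `τ⁻¹ ∫ₜᵗ⁺ᵗᵃᵘ g`. -/
def movAvg (τ : ℝ) (g : ℝ → E) (t : ℝ) : E := τ⁻¹ • ∫ s in t..(t + τ), g s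

theorem memLp_diffQuot (hτ : 0 ≤ τ) {g : ℝ → E} (hg : MemLp g 2 (timeMeasure T)) :
    MemLp (diffQuot τ g) 2 (timeMeasure (T - τ)) :=
  ((memLp_shift hτ hg).sub (memLp_of_sub hτ hg)).const_smul τ⁻¹

theorem movAvg_eq (hτ : 0 ≤ τ) {g : ℝ → E} (hg : MemLp g 2 (timeMeasure T))
    {t : ℝ} (ht : t ∈ Icc 0 (T - τ)) :
    movAvg τ g t = movAvg τ g 0 + ∫ s in (0 : ℝ)..t, diffQuot τ g s := by
  have hT : 0 ≤ T := by linarith [ht.1, ht.2]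
  have hg' := integrable_of_memLp_two hg
  have I : ∀ {a b : ℝ}, a ∈ Icc 0 T → b ∈ Icc 0 T → IntervalIntegrable g volume a b :=
    fun ha hb => intervalIntegrable_of_integrable_timeMeasure hg' ha hb
  have h0 : (0 : ℝ) ∈ Icc 0 T := ⟨le_rfl, hT⟩
  have htm : t ∈ Icc 0 T := ⟨ht.1, by linarith [ht.2]⟩
  have hτm : τ ∈ Icc 0 T := ⟨hτ, by linarith [ht.1, ht.2]⟩
  have htτ : t + τ ∈ Icc 0 T := ⟨by linarith [ht.1], by linarith [ht.2]⟩
  have i1 : IntervalIntegrable (fun r => g (r + τ)) volume 0 t := by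
    have := (I hτm htτ).comp_add_right τ
    simpa using this
  simp only [movAvg, diffQuot]
  rw [intervalIntegral.integral_smul, ← smul_add, intervalIntegral.integral_sub i1 (I h0 htm),
    intervalIntegral.integral_comp_add_right (fun r => g r) τ, zero_add]
  congr 1
  have A := intervalIntegral.integral_add_adjacent_intervals (I h0 hτm) (I hτm htτ)
  have B := intervalIntegral.integral_add_adjacent_intervals (I h0 htm) (I htm htτ)
  rw [← A] at B
  rw [eq_sub_of_add_eq' B]
  abel

theorem norm_movAvg_le (hτ : 0 < τ) {g : ℝ → E} {C : ℝ} (hC : ∀ᵐ s ∂timeMeasure T, ‖g s‖ ≤ C)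
    {t : ℝ} (ht : t ∈ Icc 0 (T - τ)) : ‖movAvg τ g t‖ ≤ C := by
  have h := norm_intervalIntegral_le_timeMeasure (T := T) (f := g) (g := fun _ => C)
    (integrable_of_continuousOn continuousOn_const) hC
    (a := t) (b := t + τ) ⟨ht.1, by linarith [ht.2]⟩ ⟨by linarith [ht.1], by linarith [ht.2]⟩
    (by linarith)
  simp only [intervalIntegral.integral_const, add_sub_cancel_left, smul_eq_mul] at h
  rw [movAvg, norm_smul, norm_inv, Real.norm_of_nonneg hτ.le, inv_mul_le_iff₀ hτ]
  exact h

end Steklov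

section Abstract

variable {V H : Type*} [NormedAddCommGroup V] [InnerProductSpace ℝ V] [CompleteSpace V]
  [NormedAddCommGroup H] [InnerProductSpace ℝ H] [CompleteSpace H] {ι : V →L[ℝ] H} {T : ℝ}

/-- The initial difference quotients of a strong solution with compatible initial data. -/
theorem norm_sub_initial_le {v l : ℝ → V} {F u' : ℝ → H} {x₀ : V} {z₀ : H} {A B L : ℝ}
    (hA : 0 ≤ A) (hB : 0 ≤ B)
    (cv : ContinuousOn v (Icc 0 T)) (hu' : MemLp u' 2 (timeMeasure T))
    (hv : ∀ t ∈ Icc 0 T, ι (v t) = ι x₀ + ∫ s in (0 : ℝ)..t, u' s)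
    (heq : ∀ᵐ s ∂timeMeasure T, rieszAdj ι (F s - u' s) = v s - gramOp ι (v s) + l s)
    (hz₀ : rieszAdj ι z₀ = x₀ - gramOp ι x₀ + l 0) (hl : ∀ t ∈ Icc 0 T, ‖l t - l 0‖ ≤ L * t)
    (hFA : ∀ᵐ s ∂timeMeasure T, ‖F s‖ ≤ A) (hzA : ‖z₀‖ ≤ A)
    (hB' : ∀ t ∈ Icc 0 T, ‖ι (v t)‖ ≤ B) (hB0 : ‖ι x₀‖ ≤ B) :
    ∀ t ∈ Icc 0 T, ‖ι (v t) - ι x₀‖ ≤ (4 * A + 4 * B + 1 + L ^ 2 * T) * t := by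
  intro t ht
  have hT : 0 ≤ T := ht.1.trans ht.2
  have h0 : (0 : ℝ) ∈ Icc 0 T := ⟨le_rfl, hT⟩
  set Y : ℝ → H := fun s => ι (v s) - ι x₀ with hY
  have cY : ContinuousOn Y (Icc 0 T) := (ι.continuous.comp_continuousOn cv).sub continuousOn_const
  have cYn : ContinuousOn (fun s => ‖Y s‖) (Icc 0 t) :=
    (cY.mono (Icc_subset_Icc le_rfl ht.2)).norm
  -- At a maximum point of ‖Y‖ on [0, t], the factor ‖Y s‖ in the integral is replaced by ‖Y r‖ and
  -- one power cancels, leaving a bound linear in t.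
  obtain ⟨r, hr, hmax⟩ := isCompact_Icc.exists_isMaxOn ⟨t, ht.1, le_rfl⟩ cYn
  have hrT : r ∈ Icc 0 T := ⟨hr.1, hr.2.trans ht.2⟩
  have mY : MemLp Y 2 (timeMeasure T) := memLp_two_of_continuousOn cY
  have hu'i := integrable_of_memLp_two hu'
  have hYp : ∀ s ∈ Icc 0 T, Y s = 0 + ∫ q in (0 : ℝ)..s, u' q := fun s hs => by
    simp [hY, hv s hs]
  have e1 : ⟪Y r, Y r⟫_ℝ = ⟪(0 : H), (0 : H)⟫_ℝ +
      ∫ s in (0 : ℝ)..r, (⟪u' s, Y s⟫_ℝ + ⟪Y s, u' s⟫_ℝ) :=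
    bilin_primitive_eq (T := T) (innerSL ℝ) hu'i hu'i 0 0 hYp hYp hrT
  have b1 : ∀ᵐ s ∂timeMeasure T, ⟪u' s, Y s⟫_ℝ ≤ (2 * A + 2 * B) * ‖Y s‖ + L ^ 2 * s ^ 2 / 4 := by
    filter_upwards [heq, hFA, ae_mem_Icc] with s hs hFs hsm
    -- The compatible stationary equation `hz₀` at time 0 is subtracted from the equation at time s
    -- and the result tested with v s - x₀. The Dirichlet form of v s - x₀ has the good sign, up to
    -- the term ‖Y s‖², which is linearized with the bound B.
    have k1 : ⟪F s - u' s - z₀, Y s⟫_ℝ = (‖v s - x₀‖ ^ 2 - ‖Y s‖ ^ 2) + ⟪l s - l 0, v s - x₀⟫_ℝ := by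
      have : Y s = ι (v s - x₀) := by simp [hY]
      rw [this, ← inner_rieszAdj, map_sub, hs, hz₀]
      have : v s - gramOp ι (v s) + l s - (x₀ - gramOp ι x₀ + l 0) =
          (v s - x₀) - gramOp ι (v s - x₀) + (l s - l 0) := by rw [map_sub]; abel
      rw [this, inner_add_left, inner_sub_left, inner_gramOp, real_inner_self_eq_norm_sq,
        real_inner_self_eq_norm_sq]
    have k2 : ⟪F s - z₀, Y s⟫_ℝ ≤ 2 * A * ‖Y s‖ := by
      refine (real_inner_le_norm _ _).trans ?_
      gcongr
      refine (norm_sub_le _ _).trans ?_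
      linarith
    have k3 := neg_le_of_abs_le (abs_real_inner_le_norm (l s - l 0) (v s - x₀))
    have k4 : ‖l s - l 0‖ ^ 2 ≤ L ^ 2 * s ^ 2 := by
      rw [← mul_pow]; exact pow_le_pow_left₀ (norm_nonneg _) (hl s hsm) 2
    have k5 : ‖Y s‖ ≤ 2 * B := (norm_sub_le _ _).trans (by linarith [hB' s hsm])
    have k6 : ‖Y s‖ ^ 2 ≤ 2 * B * ‖Y s‖ := by
      rw [sq]; exact mul_le_mul_of_nonneg_right k5 (norm_nonneg _)
    simp only [inner_sub_left] at k1 k2 k3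
    nlinarith [sq_nonneg (‖l s - l 0‖ / 2 - ‖v s - x₀‖)]
  have i1 := intervalIntegrable_of_integrable_timeMeasure (integrable_inner hu' mY) h0 hrT
  have i2 := intervalIntegrable_of_integrable_timeMeasure (integrable_inner mY hu') h0 hrT
  have e2 : ‖Y r‖ ^ 2 = 2 * ∫ s in (0 : ℝ)..r, ⟪u' s, Y s⟫_ℝ := by
    rw [← real_inner_self_eq_norm_sq, e1, inner_zero_left, zero_add,
      ← intervalIntegral.integral_const_mul]
    refine intervalIntegral.integral_congr fun s _ => ?_
    simp only [real_inner_comm (u' s) (Y s), two_mul]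
  have b2 : ∫ s in (0 : ℝ)..r, ⟪u' s, Y s⟫_ℝ ≤ r * ((2 * A + 2 * B) * ‖Y r‖ + L ^ 2 * T * t / 4) := by
    have : ∫ s in (0 : ℝ)..r, ⟪u' s, Y s⟫_ℝ ≤
        ∫ s in (0 : ℝ)..r, ((2 * A + 2 * B) * ‖Y r‖ + L ^ 2 * T * t / 4) := by
      refine intervalIntegral.integral_mono_ae_restrict hr.1 i1 (by simp) ?_
      have : ∀ᵐ s ∂volume.restrict (Icc 0 r), s ∈ Icc 0 r := ae_restrict_mem measurableSet_Icc
      filter_upwards [this, ae_restrict_of_ae_restrict_of_subset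
        (Icc_subset_Icc le_rfl hrT.2 : Icc 0 r ⊆ Icc 0 T) b1] with s hs hs'
      refine hs'.trans ?_
      have m1 : ‖Y s‖ ≤ ‖Y r‖ := hmax ⟨hs.1, hs.2.trans hr.2⟩
      have m2 : s ^ 2 ≤ T * t := by
        rw [sq]
        exact mul_le_mul (hs.2.trans hrT.2) (hs.2.trans hr.2) hs.1 hT
      have m3 : L ^ 2 * s ^ 2 ≤ L ^ 2 * (T * t) := by gcongr
      have m4 : (2 * A + 2 * B) * ‖Y s‖ ≤ (2 * A + 2 * B) * ‖Y r‖ := by gcongr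
      linarith
    rwa [intervalIntegral.integral_const, sub_zero, smul_eq_mul] at this
  have b3 : ‖Y r‖ ^ 2 ≤ 2 * (t * ((2 * A + 2 * B) * ‖Y r‖ + L ^ 2 * T * t / 4)) := by
    rw [e2]
    refine mul_le_mul_of_nonneg_left (b2.trans (mul_le_mul_of_nonneg_right hr.2 ?_)) (by norm_num)
    have := ht.1
    positivity
  -- If this failed then t ≤ ‖Y r‖, so the term quadratic in t in `b3` could also be divided by ‖Y
  -- r‖.
  have b4 : ‖Y r‖ ≤ (4 * A + 4 * B + 1 + L ^ 2 * T) * t := by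
    by_contra hlt
    push Not at hlt
    have ht0 := ht.1
    have n1 : 0 ≤ L ^ 2 * T := by positivity
    have n2 : t ≤ ‖Y r‖ := le_trans (by nlinarith) hlt.le
    have n3 : 0 ≤ ‖Y r‖ := norm_nonneg _
    have n4 := mul_le_mul_of_nonneg_left n2 (mul_nonneg n1 ht0)
    rcases n3.eq_or_lt with h | h
    · rw [← h] at hlt
      have : 0 ≤ (4 * A + 4 * B + 1 + L ^ 2 * T) * t := by positivity
      linarith
    · have n5 := mul_lt_mul_of_pos_right hlt h
      nlinarith [mul_nonneg ht0 n3, mul_nonneg (mul_nonneg n1 ht0) ht0]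
  exact (hmax ⟨ht.1, le_rfl⟩ : ‖Y t‖ ≤ ‖Y r‖).trans b4

end Abstract

end

/-! ### The second order estimate for difference quotients -/

section


section Abstract

variable {V H : Type*} [NormedAddCommGroup V] [InnerProductSpace ℝ V] [CompleteSpace V]
  [NormedAddCommGroup H] [InnerProductSpace ℝ H] [CompleteSpace H] {ι : V →L[ℝ] H} {T : ℝ}

/-- Young's inequality. The three products 2 k W, L W and Z N W cost W²/8 each, so at least half of
W² is left over; w₆ has no W-part because `p6` bounds it by lower-order quantities. -/
theorem absorb_aux {A N k L W Z w₁ w₂ w₃ w₄ w₅ w₆ : ℝ} (p1 : -w₁ ≤ k * W) (p2 : w₂ ≤ k * W)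
    (p3 : -w₃ ≤ L * k) (p4 : -w₄ ≤ L * W) (p5 : -w₅ ≤ Z * N + Z * N * W)
    (p6 : w₆ ≤ 3 * (A ^ 2 + k ^ 2 + Z ^ 2)) :
    -(w₁ - w₂ + W ^ 2 - w₆ + w₃ + w₄) - w₅ ≤
      N ^ 2 / 2 + 3 * A ^ 2 + 11 * k ^ 2 + L * k + 2 * L ^ 2
        + 4 * (2 * N ^ 2 + 7 / 2) / 4 * Z ^ 2 - 1 / 2 * W ^ 2 := by
  linarith [sq_nonneg (Z - N), sq_nonneg (4 * (Z * N) - W), sq_nonneg (8 * k - W),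
    sq_nonneg (4 * L - W), sq_nonneg W]

set_option maxHeartbeats 1000000 in
/-- The second order estimate for moving averages and difference quotients. Here
`z = Φ - ι k - u'` plays the role of `-Δ u`. -/
theorem exists_diffQuot_bound (hι1 : ∀ x, ‖ι x‖ ≤ ‖x‖) (hT : 0 < T) {A N k₀ C₀ L : ℝ}
    (hA : 0 ≤ A) (hk₀ : 0 ≤ k₀) (hC₀ : 0 ≤ C₀) (hL : 0 ≤ L) :
    ∃ C : ℝ, 0 ≤ C ∧ ∀ {v k l : ℝ → V} {u' Φ : ℝ → H},
      ContinuousOn v (Icc 0 T) → MemLp u' 2 (timeMeasure T) →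
      (∀ t ∈ Icc 0 T, ι (v t) = ι (v 0) + ∫ s in (0 : ℝ)..t, u' s) →
      ContinuousOn Φ (Icc 0 T) → (∀ t ∈ Icc 0 T, ‖Φ t‖ ≤ A) →
      (∀ s ∈ Icc 0 T, ∀ t ∈ Icc 0 T, s ≤ t → ‖Φ t - Φ s‖ ≤ N * (t - s + ‖v t - v s‖)) →
      MemLp k 2 (timeMeasure T) → (∀ᵐ t ∂timeMeasure T, ‖k t‖ ≤ k₀) →
      ContinuousOn l (Icc 0 T) →
      (∀ s ∈ Icc 0 T, ∀ t ∈ Icc 0 T, s ≤ t → ‖l t - l s‖ ≤ L * (t - s)) →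
      (∀ᵐ s ∂timeMeasure T, rieszAdj ι (Φ s - ι (k s) - u' s) = v s - gramOp ι (v s) + l s) →
      (∀ t ∈ Icc 0 T, ‖ι (v t) - ι (v 0)‖ ≤ C₀ * t) →
      ∀ τ ∈ Ioo 0 T,
        (∀ t ∈ Icc 0 (T - τ), ‖movAvg τ (fun s => Φ s - ι (k s) - u' s) t‖ ^ 2 ≤ C) ∧
        ∫ s, ‖diffQuot τ v s‖ ^ 2 ∂timeMeasure (T - τ) ≤ C := by
  -- Z₀ bounds the initial average of z, with C₀ coming from the initial difference quotient of u.
  -- A₁ and B / 4 are the constants left by `absorb_aux`. The factor 4 appears because absorbing ⟨Z,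
  -- Y⟩ reduces ‖Z‖²/2 to ‖Z‖²/4.
  set Z₀ := A + k₀ + C₀ with hZ₀
  set A₁ := N ^ 2 / 2 + 3 * A ^ 2 + 11 * k₀ ^ 2 + L * k₀ + 2 * L ^ 2 with hA₁
  set B := 4 * (2 * N ^ 2 + 7 / 2) with hB
  set A₂ := 4 * (Z₀ ^ 2 / 2 + A ^ 2 + Z₀ * A + T * A₁) with hA₂
  have nA₁ : 0 ≤ A₁ := by positivity
  have nZ : 0 ≤ Z₀ := by positivity
  have nB : 0 ≤ B := by positivity
  have nA₂ : 0 ≤ A₂ := by positivity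
  set G := A₂ * Real.exp (B * T) with hG
  have nG : 0 ≤ G := by positivity
  refine ⟨G + (A₂ + B * (T * G)), by positivity, ?_⟩
  intro v k l u' Φ cv hu' hv cΦ hΦ hΦL hk hkb cl hlL heq hin τ hτ
  have hτ0 := hτ.1.le
  have nτ : (0 : ℝ) ≤ τ⁻¹ := inv_nonneg.2 hτ0
  set T' := T - τ with hT'
  have hT'0 : 0 < T' := sub_pos.2 hτ.2
  have h0 : (0 : ℝ) ∈ Icc 0 T' := ⟨le_rfl, hT'0.le⟩
  have hsub : ∀ {s}, s ∈ Icc 0 T' → s ∈ Icc 0 T := fun hs => ⟨hs.1, by linarith [hs.2]⟩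
  have hsub' : ∀ {s}, s ∈ Icc 0 T' → s + τ ∈ Icc 0 T := fun hs =>
    ⟨by linarith [hs.1], by linarith [hs.2]⟩
  have mv : MemLp v 2 (timeMeasure T) := memLp_two_of_continuousOn cv
  have mΦ : MemLp Φ 2 (timeMeasure T) := memLp_two_of_continuousOn cΦ
  have ml : MemLp l 2 (timeMeasure T) := memLp_two_of_continuousOn cl
  have mιk : MemLp (fun s => ι (k s)) 2 (timeMeasure T) := memLp_clm ι hk
  set z : ℝ → H := fun s => Φ s - ι (k s) - u' s with hz
  have mz : MemLp z 2 (timeMeasure T) := (mΦ.sub mιk).sub hu'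
  set Z := movAvg τ z with hZdef
  set Y := movAvg τ Φ with hYdef
  set κ := movAvg τ k with hκdef
  set W := diffQuot τ v with hWdef
  have mDz := memLp_diffQuot hτ0 mz
  have mDΦ := memLp_diffQuot hτ0 mΦ
  have mW : MemLp W 2 (timeMeasure T') := memLp_diffQuot hτ0 mv
  have mDl : MemLp (diffQuot τ l) 2 (timeMeasure T') := memLp_diffQuot hτ0 ml
  have hZp : ∀ t ∈ Icc 0 T', Z t = Z 0 + ∫ s in (0 : ℝ)..t, diffQuot τ z s :=
    fun t ht => movAvg_eq hτ0 mz ht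
  have hYp : ∀ t ∈ Icc 0 T', Y t = Y 0 + ∫ s in (0 : ℝ)..t, diffQuot τ Φ s :=
    fun t ht => movAvg_eq hτ0 mΦ ht
  have hκp : ∀ t ∈ Icc 0 T', κ t = κ 0 + ∫ s in (0 : ℝ)..t, diffQuot τ k s :=
    fun t ht => movAvg_eq hτ0 hk ht
  have cZ : ContinuousOn Z (Icc 0 T') := (continuousOn_const.add
    (continuousOn_primitive (integrable_of_memLp_two mDz) hT'0.le)).congr hZp
  have cY : ContinuousOn Y (Icc 0 T') := (continuousOn_const.add
    (continuousOn_primitive (integrable_of_memLp_two mDΦ) hT'0.le)).congr hYp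
  have cκ : ContinuousOn κ (Icc 0 T') := (continuousOn_const.add
    (continuousOn_primitive (integrable_of_memLp_two (memLp_diffQuot hτ0 hk)) hT'0.le)).congr hκp
  have mZ : MemLp Z 2 (timeMeasure T') := memLp_two_of_continuousOn cZ
  have mY : MemLp Y 2 (timeMeasure T') := memLp_two_of_continuousOn cY
  have mκ : MemLp κ 2 (timeMeasure T') := memLp_two_of_continuousOn cκ
  -- pointwise facts
  have hYb : ∀ t ∈ Icc 0 T', ‖Y t‖ ≤ A := fun t ht =>
    norm_movAvg_le hτ.1 (ae_mem_Icc.mono hΦ) ht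
  have hκb : ∀ t ∈ Icc 0 T', ‖κ t‖ ≤ k₀ := fun t ht => norm_movAvg_le hτ.1 hkb ht
  -- The average of u' over a window is the difference quotient of ι v, so the averaged equation
  -- links Z and W without derivatives.
  have hZeq : ∀ t ∈ Icc 0 T', Z t = Y t - ι (κ t) - ι (W t) := by
    intro t ht
    have i1 := fun {E : Type _} [NormedAddCommGroup E] [NormedSpace ℝ E] {f : ℝ → E}
      (hf : MemLp f 2 (timeMeasure T)) => intervalIntegrable_of_integrable_timeMeasure
      (integrable_of_memLp_two hf) (hsub ht) (hsub' ht)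
    have e1 : ∫ s in t..(t + τ), u' s = ι (v (t + τ)) - ι (v t) := by
      rw [hv _ (hsub ht), hv _ (hsub' ht), add_sub_add_left_eq_sub,
        primitive_sub (integrable_of_memLp_two hu') (hsub ht) (hsub' ht)]
    have e2 := ι.intervalIntegral_comp_comm (intervalIntegrable_of_integrable_timeMeasure
      (integrable_of_memLp_two hk) (hsub ht) (hsub' ht))
    simp only [hZdef, hYdef, hκdef, hWdef, movAvg, diffQuot, hz, map_smul, map_sub]
    rw [intervalIntegral.integral_sub ((i1 mΦ).sub (i1 mιk)) (i1 hu'),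
      intervalIntegral.integral_sub (i1 mΦ) (i1 mιk), e1, e2, smul_sub, smul_sub]
  have hDz : ∀ᵐ s ∂timeMeasure T',
      rieszAdj ι (diffQuot τ z s) = W s - gramOp ι (W s) + diffQuot τ l s := by
    filter_upwards [ae_of_sub hτ0 heq, ae_shift hτ0 heq] with s h1 h2
    simp only [diffQuot, hWdef, map_smul, map_sub]
    have h1' : rieszAdj ι (z s) = v s - gramOp ι (v s) + l s := h1
    have h2' : rieszAdj ι (z (s + τ)) = v (s + τ) - gramOp ι (v (s + τ)) + l (s + τ) := h2
    rw [h1', h2', ← smul_sub, ← smul_add]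
    congr 1
    abel
  have hDl : ∀ s ∈ Icc 0 T', ‖diffQuot τ l s‖ ≤ L := by
    intro s hs
    have := hlL s (hsub hs) (s + τ) (hsub' hs) (by linarith)
    rw [diffQuot, norm_smul, norm_inv, Real.norm_of_nonneg hτ0, inv_mul_le_iff₀ hτ.1]
    linarith [mul_comm L τ]
  have hDΦ : ∀ s ∈ Icc 0 T', ‖diffQuot τ Φ s‖ ≤ N * (1 + ‖W s‖) := by
    intro s hs
    have hΦ' := hΦL s (hsub hs) (s + τ) (hsub' hs) (by linarith)
    rw [diffQuot, norm_smul, norm_inv, Real.norm_of_nonneg hτ0, inv_mul_le_iff₀ hτ.1]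
    have e : ‖W s‖ = τ⁻¹ * ‖v (s + τ) - v s‖ := by
      rw [hWdef, diffQuot, norm_smul, norm_inv, Real.norm_of_nonneg hτ0]
    rw [e]
    have : τ * (N * (1 + τ⁻¹ * ‖v (s + τ) - v s‖)) = N * (τ + ‖v (s + τ) - v s‖) := by
      have := hτ.1.ne'
      field_simp
    rw [this]
    rwa [add_sub_cancel_left] at hΦ'
  have hZ0 : ‖Z 0‖ ≤ Z₀ := by
    rw [hZeq 0 h0]
    have h1 : ‖ι (W 0)‖ ≤ C₀ := by
      have := hin τ ⟨hτ0, hτ.2.le⟩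
      simp only [hWdef, diffQuot, zero_add, map_smul, map_sub]
      rw [norm_smul, norm_inv, Real.norm_of_nonneg hτ0, inv_mul_le_iff₀ hτ.1, mul_comm τ]
      exact this
    calc _ ≤ ‖Y 0‖ + ‖ι (κ 0)‖ + ‖ι (W 0)‖ := norm_sub_le_of_le (norm_sub_le _ _) le_rfl
      _ ≤ A + k₀ + C₀ := by
        have := hYb 0 h0
        have := (hι1 (κ 0)).trans (hκb 0 h0)
        linarith
  -- the energy inequality
  have ineq : ∀ t ∈ Icc 0 T', ‖Z t‖ ^ 2 + 2 * ∫ s in (0 : ℝ)..t, ‖W s‖ ^ 2 ≤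
      A₂ + B * ∫ s in (0 : ℝ)..t, ‖Z s‖ ^ 2 := by
    intro t ht
    have iDz := integrable_of_memLp_two mDz
    have iDΦ := integrable_of_memLp_two mDΦ
    have e1 : ⟪Z t, Z t⟫_ℝ = ⟪Z 0, Z 0⟫_ℝ +
        ∫ s in (0 : ℝ)..t, (⟪diffQuot τ z s, Z s⟫_ℝ + ⟪Z s, diffQuot τ z s⟫_ℝ) :=
      bilin_primitive_eq (T := T') (innerSL ℝ) iDz iDz _ _ hZp hZp ht
    have e2 : ⟪Z t, Y t⟫_ℝ = ⟪Z 0, Y 0⟫_ℝ +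
        ∫ s in (0 : ℝ)..t, (⟪diffQuot τ z s, Y s⟫_ℝ + ⟪Z s, diffQuot τ Φ s⟫_ℝ) :=
      bilin_primitive_eq (T := T') (innerSL ℝ) iDz iDΦ _ _ hZp hYp ht
    have j1 := intervalIntegrable_of_integrable_timeMeasure (integrable_inner mDz mZ) h0 ht
    have j2 := intervalIntegrable_of_integrable_timeMeasure (integrable_inner mDz mY) h0 ht
    have j3 := intervalIntegrable_of_integrable_timeMeasure (integrable_inner mZ mDΦ) h0 ht
    have jW := intervalIntegrable_of_integrable_timeMeasure (integrable_norm_sq mW) h0 ht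
    have jZ := intervalIntegrable_of_integrable_timeMeasure (integrable_norm_sq mZ) h0 ht
    have e3 : ‖Z t‖ ^ 2 / 2 = ‖Z 0‖ ^ 2 / 2 + ∫ s in (0 : ℝ)..t, ⟪diffQuot τ z s, Z s⟫_ℝ := by
      have : ∫ s in (0 : ℝ)..t, (⟪diffQuot τ z s, Z s⟫_ℝ + ⟪Z s, diffQuot τ z s⟫_ℝ) =
          2 * ∫ s in (0 : ℝ)..t, ⟪diffQuot τ z s, Z s⟫_ℝ := by
        rw [← intervalIntegral.integral_const_mul]
        refine intervalIntegral.integral_congr fun s _ => ?_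
        simp only [real_inner_comm (diffQuot τ z s) (Z s), two_mul]
      rw [this] at e1
      simp only [real_inner_self_eq_norm_sq] at e1
      linarith
    rw [intervalIntegral.integral_add j2 j3] at e2
    have b1 : ∫ s in (0 : ℝ)..t, (⟪diffQuot τ z s, Z s⟫_ℝ - ⟪diffQuot τ z s, Y s⟫_ℝ
        - ⟪Z s, diffQuot τ Φ s⟫_ℝ) ≤
        ∫ s in (0 : ℝ)..t, (A₁ + B / 4 * ‖Z s‖ ^ 2 - 1 / 2 * ‖W s‖ ^ 2) := by
      refine intervalIntegral.integral_mono_ae_restrict ht.1 ((j1.sub j2).sub j3)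
        (((by simp : IntervalIntegrable (fun _ => A₁) volume 0 t).add (jZ.const_mul (B / 4))).sub
          (jW.const_mul (1 / 2))) ?_
      refine ae_restrict_of_ae_restrict_of_subset
        (Icc_subset_Icc le_rfl ht.2 : Icc 0 t ⊆ Icc 0 T') ?_
      filter_upwards [hDz, (ae_mem_Icc : ∀ᵐ s ∂timeMeasure T', s ∈ Icc 0 T')] with s h1 hs
      -- Here Z - Y = -ι(κ + W) with κ in V, so the increment of the operator equation may be tested
      -- with κ + W. The kernel enters only through its average κ and is never differenced.
      have q0 : ⟪diffQuot τ z s, Z s⟫_ℝ - ⟪diffQuot τ z s, Y s⟫_ℝ =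
          -⟪W s - gramOp ι (W s) + diffQuot τ l s, κ s + W s⟫_ℝ := by
        rw [← h1, inner_rieszAdj, hZeq s hs, map_add, ← inner_sub_right, ← inner_neg_right]
        congr 1
        abel
      have q1 : ⟪W s - gramOp ι (W s) + diffQuot τ l s, κ s + W s⟫_ℝ =
          ⟪W s, κ s⟫_ℝ - ⟪ι (W s), ι (κ s)⟫_ℝ + ‖W s‖ ^ 2 - ‖ι (W s)‖ ^ 2
          + ⟪diffQuot τ l s, κ s⟫_ℝ + ⟪diffQuot τ l s, W s⟫_ℝ := by
        simp only [inner_add_left, inner_sub_left, inner_add_right, inner_gramOp,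
          real_inner_self_eq_norm_sq]
        ring
      have aW := norm_nonneg (W s)
      have aZ := norm_nonneg (Z s)
      have p1 : -⟪W s, κ s⟫_ℝ ≤ k₀ * ‖W s‖ := by
        have h1 := neg_le_of_abs_le (abs_real_inner_le_norm (W s) (κ s))
        have h2 := mul_le_mul_of_nonneg_left (hκb s hs) aW
        linarith
      have p2 : ⟪ι (W s), ι (κ s)⟫_ℝ ≤ k₀ * ‖W s‖ := by
        have h1 := real_inner_le_norm (ι (W s)) (ι (κ s))
        have h2 := mul_le_mul (hι1 (W s)) ((hι1 (κ s)).trans (hκb s hs)) (norm_nonneg _) aW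
        linarith
      have p3 : -⟪diffQuot τ l s, κ s⟫_ℝ ≤ L * k₀ := by
        have h1 := neg_le_of_abs_le (abs_real_inner_le_norm (diffQuot τ l s) (κ s))
        have h2 := mul_le_mul (hDl s hs) (hκb s hs) (norm_nonneg _) hL
        linarith
      have p4 : -⟪diffQuot τ l s, W s⟫_ℝ ≤ L * ‖W s‖ := by
        have h1 := neg_le_of_abs_le (abs_real_inner_le_norm (diffQuot τ l s) (W s))
        have h2 := mul_le_mul_of_nonneg_right (hDl s hs) aW
        linarith
      have p5 : -⟪Z s, diffQuot τ Φ s⟫_ℝ ≤ ‖Z s‖ * N + ‖Z s‖ * N * ‖W s‖ := by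
        have h1 := neg_le_of_abs_le (abs_real_inner_le_norm (Z s) (diffQuot τ Φ s))
        have h2 := mul_le_mul_of_nonneg_left (hDΦ s hs) aZ
        linarith
      -- The Dirichlet form controls only ‖W‖² - ‖ι W‖². The missing part is ι W = Y - ι κ - Z, a
      -- lower-order quantity left to Grönwall.
      have p6 : ‖ι (W s)‖ ^ 2 ≤ 3 * (A ^ 2 + k₀ ^ 2 + ‖Z s‖ ^ 2) := by
        have h1 : ι (W s) = Y s - ι (κ s) - Z s := by rw [hZeq s hs]; abel
        have h2 : ‖ι (W s)‖ ≤ A + k₀ + ‖Z s‖ := by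
          rw [h1]
          refine norm_sub_le_of_le (norm_sub_le_of_le (hYb s hs) ?_) le_rfl
          exact (hι1 (κ s)).trans (hκb s hs)
        have h3 := pow_le_pow_left₀ (norm_nonneg _) h2 2
        nlinarith [sq_nonneg (A - k₀), sq_nonneg (A - ‖Z s‖), sq_nonneg (k₀ - ‖Z s‖)]
      rw [q0, q1, hA₁, hB]
      exact absorb_aux p1 p2 p3 p4 p5 p6
    rw [intervalIntegral.integral_sub (j1.sub j2) j3, intervalIntegral.integral_sub j1 j2,
      intervalIntegral.integral_sub ((by simp : IntervalIntegrable (fun _ => A₁) volume 0 t).add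
        (jZ.const_mul (B / 4))) (jW.const_mul (1 / 2)),
      intervalIntegral.integral_add (by simp) (jZ.const_mul (B / 4)),
      intervalIntegral.integral_const_mul, intervalIntegral.integral_const_mul,
      intervalIntegral.integral_const, smul_eq_mul, sub_zero] at b1
    have f1 : ⟪Z t, Y t⟫_ℝ ≤ ‖Z t‖ ^ 2 / 4 + A ^ 2 := by
      have h1 := real_inner_le_norm (Z t) (Y t)
      have h2 := mul_le_mul_of_nonneg_left (hYb t ht) (norm_nonneg (Z t))
      nlinarith [sq_nonneg (‖Z t‖ / 2 - A)]
    have f2 : -⟪Z 0, Y 0⟫_ℝ ≤ Z₀ * A := by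
      have h1 := neg_le_of_abs_le (abs_real_inner_le_norm (Z 0) (Y 0))
      have h2 := mul_le_mul hZ0 (hYb 0 h0) (norm_nonneg _) nZ
      linarith
    have f3 : ‖Z 0‖ ^ 2 ≤ Z₀ ^ 2 := pow_le_pow_left₀ (norm_nonneg _) hZ0 2
    have f4 : t * A₁ ≤ T * A₁ := mul_le_mul_of_nonneg_right (by linarith [ht.2]) nA₁
    rw [hA₂]
    linarith
  have hgr : ∀ t ∈ Icc 0 T', ‖Z t‖ ^ 2 ≤ G := by
    intro t ht
    have := gronwall_integral (φ := fun t => ‖Z t‖ ^ 2) nB (cZ.norm.pow 2) (A := A₂)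
      (fun t ht => by
        have h1 := ineq t ht
        have h2 : 0 ≤ ∫ s in (0 : ℝ)..t, ‖W s‖ ^ 2 :=
          intervalIntegral.integral_nonneg ht.1 fun r _ => by positivity
        linarith) t ht
    refine this.trans ?_
    rw [hG]
    gcongr
    linarith [ht.2]
  have nBTG : 0 ≤ A₂ + B * (T * G) := by positivity
  refine ⟨fun t ht => (hgr t ht).trans (by linarith), ?_⟩
  have hTm : T' ∈ Icc 0 T' := ⟨hT'0.le, le_rfl⟩
  have h1 := ineq T' hTm
  have h2 := intervalIntegral_le_mul_of_le (integrable_norm_sq mZ) (ae_mem_Icc.mono hgr) hTm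
  rw [intervalIntegral_eq_timeMeasure hT'0.le (fun s => ‖W s‖ ^ 2)] at h1
  have h3 : T' * G ≤ T * G := mul_le_mul_of_nonneg_right (by linarith) nG
  have h4 := mul_le_mul_of_nonneg_left (h2.trans h3) nB
  have h5 : 0 ≤ ∫ s, ‖W s‖ ^ 2 ∂timeMeasure T' := integral_nonneg fun s => by positivity
  linarith [sq_nonneg ‖Z T'‖]

end Abstract

end

/-! ### Weak limits, measurability, and passage to the limit in the difference quotients -/

section


/-- Banach–Alaoglu; the limit along a free ultrafilter replaces the extraction of a subsequence, and
closedness of the ball keeps the norm bound. -/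
theorem exists_weak_limit {E : Type*} [NormedAddCommGroup E] [InnerProductSpace ℝ E]
    [CompleteSpace E] {x : ℕ → E} {R : ℝ} (hx : ∀ n, ‖x n‖ ≤ R) :
    ∃ w : E, ‖w‖ ≤ R ∧ ∀ y, Tendsto (fun n => ⟪x n, y⟫_ℝ) (hyperfilter ℕ) (𝓝 ⟪w, y⟫_ℝ) := by
  let φ : ℕ → WeakDual ℝ E := fun n => StrongDual.toWeakDual (InnerProductSpace.toDual ℝ E (x n))
  have hc := WeakDual.isCompact_closedBall (𝕜 := ℝ) (E := E) 0 R
  have hmem : ∀ n, φ n ∈ WeakDual.toStrongDual ⁻¹' Metric.closedBall (0 : StrongDual ℝ E) R := by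
    intro n
    simp only [mem_preimage, mem_closedBall_zero_iff]
    exact ((InnerProductSpace.toDual ℝ E).norm_map (x n)).trans_le (hx n)
  obtain ⟨ξ, hξ, hlim⟩ := hc.ultrafilter_le_nhds ((hyperfilter ℕ).map φ)
    (le_principal_iff.2 (mem_map.2 (univ_mem' hmem)))
  refine ⟨(InnerProductSpace.toDual ℝ E).symm (WeakDual.toStrongDual ξ), ?_, fun y => ?_⟩
  · rw [LinearIsometryEquiv.norm_map]
    simpa using hξ
  · have h1 : Tendsto φ (hyperfilter ℕ) (𝓝 ξ) := hlim
    have h2 := ((WeakDual.eval_continuous y).tendsto ξ).comp h1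
    rw [InnerProductSpace.toDual_symm_apply]
    exact h2

theorem tendsto_movAvg {E : Type*} [NormedAddCommGroup E] [NormedSpace ℝ E] [CompleteSpace E]
    {q : ℝ → E} {T : ℝ} (hq : ContinuousOn q (Icc 0 T)) {t : ℝ} (ht : t ∈ Ico 0 T) :
    Tendsto (fun τ => movAvg τ q t) (𝓝[>] 0) (𝓝 (q t)) := by
  rw [Metric.tendsto_nhds]
  intro ε hε
  have h1 := Metric.continuousWithinAt_iff.1 (hq t ⟨ht.1, ht.2.le⟩) (ε / 2) (half_pos hε)
  obtain ⟨δ, hδ, h1⟩ := h1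
  have h2 : ∀ᶠ τ in 𝓝[>] (0 : ℝ), τ ∈ Ioo 0 (min δ (T - t)) :=
    Ioo_mem_nhdsGT (lt_min hδ (sub_pos.2 ht.2))
  filter_upwards [h2] with τ hτ
  have hτ1 := hτ.2.trans_le (min_le_left _ _)
  have hτ2 := hτ.2.trans_le (min_le_right _ _)
  have hi : IntervalIntegrable q volume t (t + τ) :=
    intervalIntegrable_of_integrable_timeMeasure (integrable_of_continuousOn hq) ⟨ht.1, ht.2.le⟩
      ⟨by linarith [ht.1, hτ.1], by linarith⟩
  have e : movAvg τ q t - q t = τ⁻¹ • ∫ s in t..(t + τ), (q s - q t) := by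
    rw [intervalIntegral.integral_sub hi (by simp), intervalIntegral.integral_const, movAvg,
      add_sub_cancel_left, smul_sub, smul_smul, inv_mul_cancel₀ hτ.1.ne', one_smul]
  have h3 : ‖∫ s in t..(t + τ), (q s - q t)‖ ≤ ε / 2 * |t + τ - t| := by
    refine intervalIntegral.norm_integral_le_of_norm_le_const fun s hs => ?_
    rw [uIoc_of_le (by linarith [hτ.1])] at hs
    have := h1 (x := s) ⟨by linarith [ht.1, hs.1], by linarith [hs.2]⟩
      (by rw [Real.dist_eq, abs_of_nonneg (by linarith [hs.1])]; linarith [hs.2])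
    rw [dist_eq_norm] at this
    exact this.le
  rw [add_sub_cancel_left, abs_of_pos hτ.1] at h3
  rw [dist_eq_norm, e, norm_smul, norm_inv, Real.norm_of_nonneg hτ.1.le]
  calc τ⁻¹ * ‖∫ s in t..(t + τ), (q s - q t)‖ ≤ τ⁻¹ * (ε / 2 * τ) :=
        mul_le_mul_of_nonneg_left h3 (inv_nonneg.2 hτ.1.le)
    _ = ε / 2 := by field_simp [hτ.1.ne']
    _ < ε := half_lt_self hε

/-- Distinct orthonormal vectors are at distance √2, so the balls of radius 1/2 about them are
disjoint and open. -/
theorem countable_of_orthonormal {H : Type*} [NormedAddCommGroup H] [InnerProductSpace ℝ H]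
    [SecondCountableTopology H] {w : Set H} (hw : Orthonormal ℝ ((↑) : w → H)) : w.Countable := by
  refine Set.PairwiseDisjoint.countable_of_isOpen (s := fun x => Metric.ball x (1 / 2)) ?_
    (fun _ _ => Metric.isOpen_ball) (fun x _ => ⟨x, by simp⟩)
  intro x hx y hy hxy
  refine Metric.ball_disjoint_ball ?_
  have h1 : ⟪x, y⟫_ℝ = 0 := hw.2 (i := ⟨x, hx⟩) (j := ⟨y, hy⟩) (by simpa using hxy)
  have h2 : ‖x‖ = 1 := hw.1 ⟨x, hx⟩
  have h3 : ‖y‖ = 1 := hw.1 ⟨y, hy⟩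
  have h4 := norm_sub_sq_real x y
  rw [h1, h2, h3] at h4
  rw [dist_eq_norm]
  nlinarith [norm_nonneg (x - y)]

/-- Pettis' theorem in a separable Hilbert space, with test vectors in the range of an operator
with dense range. -/
theorem aestronglyMeasurable_of_inner {V H α : Type*} [NormedAddCommGroup V] [NormedSpace ℝ V]
    [NormedAddCommGroup H] [InnerProductSpace ℝ H] [CompleteSpace H] [SecondCountableTopology H]
    [MeasurableSpace α] {μ : Measure α} {ι : V →L[ℝ] H} (hd : DenseRange ι) {F : α → H}
    (h : ∀ x, AEStronglyMeasurable (fun t => ⟪F t, ι x⟫_ℝ) μ) : AEStronglyMeasurable F μ := by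
  have h' : ∀ y, AEStronglyMeasurable (fun t => ⟪F t, y⟫_ℝ) μ := by
    intro y
    obtain ⟨x, hx⟩ := mem_closure_iff_seq_limit.1 (hd y)
    obtain ⟨hx, hlim⟩ := hx
    choose z hz using hx
    refine aestronglyMeasurable_of_tendsto_ae atTop (f := fun n t => ⟪F t, ι (z n)⟫_ℝ)
      (fun n => h (z n)) (Eventually.of_forall fun t => ?_)
    simp only [hz]
    exact tendsto_const_nhds.inner hlim
  -- A Hilbert basis is countable here, so F is a limit of measurable finite expansions along a
  -- countably generated filter.
  obtain ⟨w, b, hb⟩ := exists_hilbertBasis ℝ H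
  have hw : Orthonormal ℝ ((↑) : w → H) := hb ▸ b.orthonormal
  haveI : Countable w := (countable_of_orthonormal hw).to_subtype
  refine aestronglyMeasurable_of_tendsto_ae (u := (atTop : Filter (Finset w)))
    (f := fun s t => ∑ i ∈ s, b.repr (F t) i • b i) (fun s => ?_)
    (Eventually.of_forall fun t => b.hasSum_repr (F t))
  refine Finset.aestronglyMeasurable_fun_sum s fun i _ => ?_
  simp only [HilbertBasis.repr_apply_apply]
  refine AEStronglyMeasurable.smul_const ?_ _
  simpa only [real_inner_comm] using h' (b i)

section Abstract

variable {V H : Type*} [NormedAddCommGroup V] [InnerProductSpace ℝ V] [CompleteSpace V]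
  [NormedAddCommGroup H] [InnerProductSpace ℝ H] [CompleteSpace H] {ι : V →L[ℝ] H} {T : ℝ}

/-- The kernel of ι* is orthogonal to the range of ι. Injectivity makes the element of H
representing a functional on V unique. -/
theorem rieszAdj_injective (hd : DenseRange ι) : Function.Injective (rieszAdj ι) := by
  refine (injective_iff_map_eq_zero _).2 fun y hy => ?_
  have h := hd.equalizer (g := fun x => ⟪y, x⟫_ℝ) (h := fun _ => 0) (by fun_prop) (by fun_prop)
    (funext fun x => by simp [← inner_rieszAdj, hy])
  exact inner_self_eq_zero.1 (congrFun h y)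

/-- A functional on V that is bounded by the H-norm extends from the dense range of ι to H, where
Riesz represents it by z. This recovers -Δu in L² from its action on H¹. -/
theorem exists_rieszAdj_eq (hd : DenseRange ι) {ξ : V} {c : ℝ} (hc : 0 ≤ c)
    (h : ∀ x, ⟪ξ, x⟫_ℝ ≤ c * ‖ι x‖) : ∃ z : H, rieszAdj ι z = ξ ∧ ‖z‖ ≤ c := by
  have h' : ∀ x, ‖(innerSL ℝ ξ).toLinearMap x‖ ≤ c * ‖ι.toLinearMap x‖ := by
    intro x
    rw [Real.norm_eq_abs, abs_le]
    have h1 := h x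
    have h2 := h (-x)
    rw [inner_neg_right, map_neg, norm_neg] at h2
    exact ⟨by simpa using by linarith, by simpa using h1⟩
  have hd' : DenseRange ι.toLinearMap := hd
  set g := (innerSL ℝ ξ).toLinearMap.extendOfNorm ι.toLinearMap with hg
  refine ⟨(InnerProductSpace.toDual ℝ H).symm g, ext_inner_right ℝ fun x => ?_, ?_⟩
  · rw [inner_rieszAdj, InnerProductSpace.toDual_symm_apply]
    exact LinearMap.extendOfNorm_eq hd' ⟨c, h'⟩ x
  · set z := (InnerProductSpace.toDual ℝ H).symm g with hz
    have h1 : ‖g z‖ ≤ c * ‖z‖ := LinearMap.norm_extendOfNorm_apply_le hd' c h' z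
    have h2 : g z = ‖z‖ ^ 2 := by
      rw [← real_inner_self_eq_norm_sq, hz, InnerProductSpace.toDual_symm_apply]
    rw [h2, Real.norm_of_nonneg (by positivity)] at h1
    by_cases h0 : ‖z‖ = 0
    · rwa [h0]
    · have : 0 < ‖z‖ := lt_of_le_of_ne (norm_nonneg _) (Ne.symm h0)
      nlinarith

/-- Bounded difference quotients have a weak limit w in L²(0, T; V). Testing with x on [0, t] and
zero afterwards identifies the primitive of w: the difference quotient integrates to a difference of
moving averages, which converge by continuity of v. -/
theorem exists_weak_derivative (hT : 0 < T) {v : ℝ → V} {C : ℝ} (hC : 0 ≤ C)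
    (cv : ContinuousOn v (Icc 0 T))
    (hb : ∀ τ ∈ Ioo 0 T, ∫ s, ‖diffQuot τ v s‖ ^ 2 ∂timeMeasure (T - τ) ≤ C) :
    ∃ w : ℝ → V, MemLp w 2 (timeMeasure T) ∧ ∫ s, ‖w s‖ ^ 2 ∂timeMeasure T ≤ C ∧
      ∀ t ∈ Icc 0 T, v t = v 0 + ∫ s in (0 : ℝ)..t, w s := by
  have mv : MemLp v 2 (timeMeasure T) := memLp_two_of_continuousOn cv
  -- The shift by 2 keeps the step strictly below T already for n = 0.
  let τ : ℕ → ℝ := fun n => T / (n + 2)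
  have hτ : ∀ n, τ n ∈ Ioo 0 T := fun n => ⟨by positivity, by
    have : (1 : ℝ) < n + 2 := by linarith [(Nat.cast_nonneg n : (0 : ℝ) ≤ n)]
    exact div_lt_self hT this⟩
  have hτlim : Tendsto τ atTop (𝓝[>] 0) := by
    refine tendsto_nhdsWithin_iff.2 ⟨?_, Eventually.of_forall fun n => (hτ n).1⟩
    exact tendsto_const_nhds.div_atTop
      (tendsto_atTop_add_const_right _ _ tendsto_natCast_atTop_atTop)
  let w : ℕ → ℝ → V := fun n => (Icc 0 (T - τ n)).indicator (diffQuot (τ n) v)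
  have hres : ∀ n, (timeMeasure T).restrict (Icc 0 (T - τ n)) = timeMeasure (T - τ n) := fun n => by
    rw [Measure.restrict_restrict measurableSet_Icc,
      inter_eq_left.2 (Icc_subset_Icc le_rfl (by linarith [(hτ n).1]))]
  have mw : ∀ n, MemLp (w n) 2 (timeMeasure T) := fun n => by
    refine (memLp_indicator_iff_restrict measurableSet_Icc).2 ?_
    rw [hres]
    exact memLp_diffQuot (hτ n).1.le mv
  have hwn : ∀ n, ∫ s, ‖w n s‖ ^ 2 ∂timeMeasure T ≤ C := fun n => by
    have : (fun s => ‖w n s‖ ^ 2) =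
        (Icc 0 (T - τ n)).indicator (fun s => ‖diffQuot (τ n) v s‖ ^ 2) := by
      ext s
      by_cases hs : s ∈ Icc 0 (T - τ n) <;> simp [w, hs]
    rw [this, integral_indicator measurableSet_Icc, hres]
    exact hb _ (hτ n)
  have hX : ∀ n, ‖(mw n).toLp‖ ≤ √C := fun n => by
    refine Real.le_sqrt_of_sq_le ?_
    rw [norm_toLp_sq]
    exact hwn n
  obtain ⟨W, hWn, hW⟩ := exists_weak_limit hX
  have mW : MemLp W 2 (timeMeasure T) := Lp.memLp W
  have h0 : (0 : ℝ) ∈ Icc 0 T := ⟨le_rfl, hT.le⟩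
  have key : ∀ {g : ℝ → V} (hg : MemLp g 2 (timeMeasure T)) {t : ℝ} (ht : t ∈ Icc 0 T) (x : V)
      (hx : MemLp ((Icc 0 t).indicator fun _ => x) 2 (timeMeasure T)),
      ⟪hg.toLp, hx.toLp⟫_ℝ = ⟪∫ s in (0 : ℝ)..t, g s, x⟫_ℝ := by
    intro g hg t ht x hx
    rw [inner_toLp_toLp]
    have : (fun s => ⟪g s, (Icc 0 t).indicator (fun _ => x) s⟫_ℝ) =
        (Icc 0 t).indicator (fun s => ⟪g s, x⟫_ℝ) := by
      ext s
      by_cases hs : s ∈ Icc 0 t <;> simp [hs]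
    rw [this, integral_indicator measurableSet_Icc, Measure.restrict_restrict measurableSet_Icc,
      inter_eq_left.2 (Icc_subset_Icc le_rfl ht.2), intervalIntegral.integral_of_le ht.1,
      ← integral_Icc_eq_integral_Ioc]
    have hi : Integrable g (volume.restrict (Icc 0 t)) :=
      (integrable_of_memLp_two hg).mono_measure
        (Measure.restrict_mono (Icc_subset_Icc le_rfl ht.2) le_rfl)
    have := integral_inner (𝕜 := ℝ) hi x
    simp only [real_inner_comm x] at this ⊢
    exact this
  refine ⟨W, mW, ?_, ?_⟩
  · rw [← norm_toLp_sq mW, Lp.toLp_coeFn]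
    calc ‖W‖ ^ 2 ≤ √C ^ 2 := pow_le_pow_left₀ (norm_nonneg _) hWn 2
      _ = C := Real.sq_sqrt hC
  -- The endpoint T is left out because the window [t, t + τ] must stay in [0, T]; continuity adds
  -- it at the end.
  have hlt : ∀ t ∈ Ico 0 T, v t = v 0 + ∫ s in (0 : ℝ)..t, W s := by
    intro t ht
    have ht' : t ∈ Icc 0 T := ⟨ht.1, ht.2.le⟩
    rw [← sub_eq_iff_eq_add']
    refine ext_inner_right ℝ fun x => ?_
    have hx : MemLp ((Icc 0 t).indicator fun _ => x) 2 (timeMeasure T) :=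
      (memLp_const x).indicator measurableSet_Icc
    have h1 := hW hx.toLp
    have e : ⟪W, hx.toLp⟫_ℝ = ⟪∫ s in (0 : ℝ)..t, W s, x⟫_ℝ := by
      rw [← key mW ht' x hx, Lp.toLp_coeFn]
    rw [e] at h1
    refine tendsto_nhds_unique ?_ h1
    have h2 : Tendsto (fun n => movAvg (τ n) v t - movAvg (τ n) v 0) atTop (𝓝 (v t - v 0)) :=
      ((tendsto_movAvg cv ht).comp hτlim).sub ((tendsto_movAvg cv ⟨le_rfl, hT⟩).comp hτlim)
    have h3 := (Tendsto.inner (𝕜 := ℝ) h2 (tendsto_const_nhds (x := x))).mono_left Nat.hyperfilter_le_atTop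
    refine h3.congr' ?_
    have h4 : ∀ᶠ n in atTop, τ n < T - t :=
      (tendsto_nhds_of_tendsto_nhdsWithin hτlim).eventually_lt_const (sub_pos.2 ht.2)
    filter_upwards [h4.filter_mono Nat.hyperfilter_le_atTop] with n hn
    have htn : t ∈ Icc 0 (T - τ n) := ⟨ht.1, by linarith⟩
    rw [key (mw n) ht' x hx, movAvg_eq (hτ n).1.le mv htn, add_sub_cancel_left]
    congr 1
    refine intervalIntegral.integral_congr fun s hs => ?_
    rw [uIcc_of_le ht.1] at hs
    have hs' : s ∈ Icc 0 (T - τ n) := ⟨hs.1, hs.2.trans htn.2⟩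
    simp [w, hs'.1, hs'.2]
  refine eqOn_of_ae_eq hT ?_ cv
    (continuousOn_const.add (continuousOn_primitive (integrable_of_memLp_two mW) hT.le))
  refine ae_timeMeasure_iff.2 ?_
  have : ∀ᵐ t : ℝ, t ≠ T := Measure.ae_ne volume T
  filter_upwards [this] with t h1 h2
  exact hlt t ⟨h2.1, lt_of_le_of_ne h2.2 h1⟩

/-- The second order estimate: `z` plays the role of `-Δ u` and `w` that of `∂ₜ u`. -/
theorem exists_second_order (hd : DenseRange ι)
    (hι1 : ∀ x, ‖ι x‖ ≤ ‖x‖) (hT : 0 < T) {A N k₀ C₀ L : ℝ}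
    (hA : 0 ≤ A) (hk₀ : 0 ≤ k₀) (hC₀ : 0 ≤ C₀) (hL : 0 ≤ L) :
    ∃ C : ℝ, 0 ≤ C ∧ ∀ {v k l : ℝ → V} {u' Φ : ℝ → H},
      ContinuousOn v (Icc 0 T) → MemLp u' 2 (timeMeasure T) →
      (∀ t ∈ Icc 0 T, ι (v t) = ι (v 0) + ∫ s in (0 : ℝ)..t, u' s) →
      ContinuousOn Φ (Icc 0 T) → (∀ t ∈ Icc 0 T, ‖Φ t‖ ≤ A) →
      (∀ s ∈ Icc 0 T, ∀ t ∈ Icc 0 T, s ≤ t → ‖Φ t - Φ s‖ ≤ N * (t - s + ‖v t - v s‖)) →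
      MemLp k 2 (timeMeasure T) → (∀ᵐ t ∂timeMeasure T, ‖k t‖ ≤ k₀) →
      ContinuousOn l (Icc 0 T) →
      (∀ s ∈ Icc 0 T, ∀ t ∈ Icc 0 T, s ≤ t → ‖l t - l s‖ ≤ L * (t - s)) →
      (∀ᵐ s ∂timeMeasure T, rieszAdj ι (Φ s - ι (k s) - u' s) = v s - gramOp ι (v s) + l s) →
      (∀ t ∈ Icc 0 T, ‖ι (v t) - ι (v 0)‖ ≤ C₀ * t) →
      ∃ (z : ℝ → H) (w : ℝ → V),
        (∀ t ∈ Icc 0 T, rieszAdj ι (z t) = v t - gramOp ι (v t) + l t ∧ ‖z t‖ ^ 2 ≤ C) ∧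
        (∀ᵐ t ∂timeMeasure T, z t = Φ t - ι (k t) - u' t) ∧
        MemLp w 2 (timeMeasure T) ∧ ∫ s, ‖w s‖ ^ 2 ∂timeMeasure T ≤ C ∧
        (∀ t ∈ Icc 0 T, v t = v 0 + ∫ s in (0 : ℝ)..t, w s) ∧
        (∀ᵐ t ∂timeMeasure T, ι (w t) = u' t) ∧
        ∀ τ ∈ Ioo 0 T, ∫ s, ‖diffQuot τ v s‖ ^ 2 ∂timeMeasure (T - τ) ≤ C := by
  obtain ⟨C, hC, hbd⟩ := exists_diffQuot_bound (V := V) (H := H) (ι := ι) hι1 hT hA hk₀ hC₀ hL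
  refine ⟨C, hC, ?_⟩
  intro v k l u' Φ cv hu' hv cΦ hΦ hΦL hk hkb cl hlL heq hin
  have main := hbd cv hu' hv cΦ hΦ hΦL hk hkb cl hlL heq hin
  obtain ⟨w, mw, hwC, hw⟩ := exists_weak_derivative hT hC cv fun τ hτ => (main τ hτ).2
  have mz : MemLp (fun s => Φ s - ι (k s) - u' s) 2 (timeMeasure T) :=
    ((memLp_two_of_continuousOn cΦ).sub (memLp_clm ι hk)).sub hu'
  set q : ℝ → V := fun t => v t - gramOp ι (v t) + l t with hq
  have cq : ContinuousOn q (Icc 0 T) :=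
    (cv.sub ((gramOp ι).continuous.comp_continuousOn cv)).add cl
  -- The average of q is ι* of the average of z, whose H-norm is at most √C; letting τ tend to 0
  -- bounds q at every time, although the equation for z holds only almost everywhere.
  have bound : ∀ t ∈ Ico 0 T, ∀ x, ⟪q t, x⟫_ℝ ≤ √C * ‖ι x‖ := by
    intro t ht x
    refine le_of_tendsto ((tendsto_movAvg cq ht).inner tendsto_const_nhds) ?_
    have h2 : ∀ᶠ τ in 𝓝[>] (0 : ℝ), τ ∈ Ioo 0 (T - t) := Ioo_mem_nhdsGT (sub_pos.2 ht.2)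
    filter_upwards [h2] with τ hτ
    have hτ' : τ ∈ Ioo 0 T := ⟨hτ.1, by linarith [hτ.2, ht.1]⟩
    have ht' : t ∈ Icc 0 T := ⟨ht.1, ht.2.le⟩
    have hts : t + τ ∈ Icc 0 T := ⟨by linarith [ht.1, hτ.1], by linarith [hτ.2]⟩
    have e : movAvg τ q t = rieszAdj ι (movAvg τ (fun s => Φ s - ι (k s) - u' s) t) := by
      rw [movAvg, movAvg, map_smul, ← ContinuousLinearMap.intervalIntegral_comp_comm _
        (intervalIntegrable_of_integrable_timeMeasure (integrable_of_memLp_two mz) ht' hts),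
        intervalIntegral_congr_timeMeasure heq ht' hts]
    rw [e, inner_rieszAdj]
    refine (real_inner_le_norm _ _).trans (mul_le_mul_of_nonneg_right ?_ (norm_nonneg _))
    exact Real.le_sqrt_of_sq_le ((main τ hτ').1 t ⟨ht.1, by linarith [hτ.2]⟩)
  have bound' : ∀ t ∈ Icc 0 T, ∀ x, ⟪q t, x⟫_ℝ ≤ √C * ‖ι x‖ := fun t ht x =>
    le_of_ae_le hT (f := fun t => ⟪q t, x⟫_ℝ) (g := fun _ => √C * ‖ι x‖)
      (ae_timeMeasure_iff.2 ((Measure.ae_ne volume T).mono fun s h1 h2 =>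
        bound s ⟨h2.1, lt_of_le_of_ne h2.2 h1⟩ x)) (cq.inner continuousOn_const)
      continuousOn_const t ht
  have ex : ∀ t, ∃ z : H, t ∈ Icc 0 T → rieszAdj ι z = q t ∧ ‖z‖ ≤ √C := by
    intro t
    by_cases ht : t ∈ Icc 0 T
    · obtain ⟨z, hz⟩ := exists_rieszAdj_eq hd (Real.sqrt_nonneg C) (bound' t ht)
      exact ⟨z, fun _ => hz⟩
    · exact ⟨0, fun h => absurd h ht⟩
  choose z hz using ex
  have inj := rieszAdj_injective hd
  refine ⟨z, w, fun t ht => ⟨(hz t ht).1, ?_⟩, ?_, mw, hwC, hw, ?_, fun τ hτ => (main τ hτ).2⟩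
  · calc ‖z t‖ ^ 2 ≤ √C ^ 2 := pow_le_pow_left₀ (norm_nonneg _) (hz t ht).2 2
      _ = C := Real.sq_sqrt hC
  · filter_upwards [heq, ae_mem_Icc] with t h1 h2
    exact inj ((hz t h2).1.trans h1.symm)
  -- Both ι w and u' have the increments of ι v as primitives.
  · refine ae_eq_of_primitive_eq (integrable_of_memLp_two (memLp_clm ι mw))
      (integrable_of_memLp_two hu') fun t ht => ?_
    have h0 : (0 : ℝ) ∈ Icc 0 T := ⟨le_rfl, hT.le⟩
    rw [ι.intervalIntegral_comp_comm (intervalIntegrable_of_integrable_timeMeasure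
      (integrable_of_memLp_two mw) h0 ht), ← add_right_inj (ι (v 0)), ← hv t ht, ← map_add,
      ← hw t ht]

end Abstract

end

/-! ### H¹(Ω) as a Hilbert space densely embedded in L²(Ω) -/

section


variable {N : ℕ} {Ω : Set (Eu N)}

instance secondCountableTopology_L2 : SecondCountableTopology (L2 Ω) := by
  haveI : Fact ((2 : ENNReal) ≠ ⊤) := ⟨by simp⟩
  exact Lp.SecondCountableTopology

/-- The embedding `H¹(Ω) → L²(Ω)`. -/
def fnL (Ω : Set (Eu N)) : H1 Ω →L[ℝ] L2 Ω :=
  (WithLp.fstL 2 ℝ (L2 Ω) (L2vec Ω)).comp (H1 Ω).subtypeL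

/-- The gradient `H¹(Ω) → L²(Ω; ℝᴺ)`. -/
def gradL (Ω : Set (Eu N)) : H1 Ω →L[ℝ] L2vec Ω :=
  (WithLp.sndL 2 ℝ (L2 Ω) (L2vec Ω)).comp (H1 Ω).subtypeL

theorem fnL_apply (v : H1 Ω) : fnL Ω v = fn v := rfl

theorem gradL_apply (v : H1 Ω) : gradL Ω v = grad v := rfl

theorem inner_H1 (v w : H1 Ω) : ⟪v, w⟫_ℝ = ⟪fn v, fn w⟫_ℝ + ⟪grad v, grad w⟫_ℝ := rfl

theorem norm_H1_sq (v : H1 Ω) : ‖v‖ ^ 2 = ‖fn v‖ ^ 2 + ‖grad v‖ ^ 2 := by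
  simp only [← real_inner_self_eq_norm_sq, inner_H1]

theorem norm_fn_le (v : H1 Ω) : ‖fn v‖ ≤ ‖v‖ := by
  refine le_of_sq_le_sq ?_ (norm_nonneg v)
  rw [norm_H1_sq]
  linarith [sq_nonneg ‖grad v‖]

theorem norm_grad_le (v : H1 Ω) : ‖grad v‖ ≤ ‖v‖ := by
  refine le_of_sq_le_sq ?_ (norm_nonneg v)
  rw [norm_H1_sq]
  linarith [sq_nonneg ‖fn v‖]

/-- The element of `H¹(Ω)` with given function and weak gradient. -/
def mkH1 (v : L2 Ω) (w : L2vec Ω) (h : HasWeakGradient Ω v w) : H1 Ω :=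
  ⟨WithLp.toLp 2 (v, w), h⟩

theorem hasWeakGradient_H1 (v : H1 Ω) : HasWeakGradient Ω (fn v) (grad v) := v.2

theorem memLp_restrict {E : Type*} [NormedAddCommGroup E] {φ : Eu N → E}
    (hφ : Continuous φ) (hc : HasCompactSupport φ) : MemLp φ 2 (volume.restrict Ω) :=
  (hφ.memLp_of_hasCompactSupport (p := 2) (μ := volume) hc).restrict Ω

/-- For fixed test function and direction, both sides of the weak gradient identity are inner
products with fixed L² functions, so the condition is closed. -/
theorem isClosed_hasWeakGradient : IsClosed (H1 Ω : Set (WithLp 2 (L2 Ω × L2vec Ω))) := by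
  have : (H1 Ω : Set (WithLp 2 (L2 Ω × L2vec Ω))) = ⋂ (φ : Eu N → ℝ) (hφ : IsTestFunction Ω φ)
      (e : Eu N), {p | ⟪(memLp_restrict (Ω := Ω) ((hφ.contDiff.continuous_fderiv (by simp)).clm_apply
        continuous_const) (hφ.hasCompactSupport.fderiv_apply ℝ e)).toLp _, p.fst⟫_ℝ =
        -⟪(memLp_restrict (Ω := Ω) (hφ.contDiff.continuous.smul continuous_const)
          (hφ.hasCompactSupport.smul_right (f' := fun _ => e))).toLp _, p.snd⟫_ℝ} := by
    ext p
    simp only [SetLike.mem_coe, mem_iInter, mem_ofPred_eq]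
    refine forall_congr' fun φ => forall_congr' fun hφ => forall_congr' fun e => ?_
    rw [L2.inner_def, L2.inner_def]
    refine Eq.congr ?_ (congrArg Neg.neg ?_)
    · refine integral_congr_ae ?_
      filter_upwards [MemLp.coeFn_toLp (memLp_restrict (Ω := Ω) ((hφ.contDiff.continuous_fderiv
        (by simp)).clm_apply continuous_const) (hφ.hasCompactSupport.fderiv_apply ℝ e))] with x hx
      rw [hx]; rfl
    · refine integral_congr_ae ?_
      filter_upwards [MemLp.coeFn_toLp (memLp_restrict (Ω := Ω) (hφ.contDiff.continuous.smul
        continuous_const) (hφ.hasCompactSupport.smul_right (f' := fun _ => e)))] with x hx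
      rw [hx, real_inner_comm]
      change _ = ⟪φ x • e, _⟫_ℝ
      rw [real_inner_smul_left, real_inner_comm, mul_comm]
  rw [this]
  refine isClosed_iInter fun φ => isClosed_iInter fun hφ => isClosed_iInter fun e => ?_
  refine isClosed_eq ?_ ?_
  · exact continuous_const.inner (WithLp.fstL 2 ℝ (L2 Ω) (L2vec Ω)).continuous
  · exact (continuous_const.inner (WithLp.sndL 2 ℝ (L2 Ω) (L2vec Ω)).continuous).neg

instance completeSpace_H1 : CompleteSpace (H1 Ω) :=
  isClosed_hasWeakGradient.completeSpace_coe

theorem ae_eq_zero_of_integral_test (hΩ : IsOpen Ω) {E : Type*} [NormedAddCommGroup E]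
    [NormedSpace ℝ E] [CompleteSpace E] {v : Lp E 2 (volume.restrict Ω)}
    (h : ∀ φ, IsTestFunction Ω φ → ∫ x in Ω, φ x • v x = 0) : v = 0 := by
  have hv : LocallyIntegrableOn v Ω volume := by
    have : LocallyIntegrable v (volume.restrict Ω) := (Lp.memLp v).locallyIntegrable (by norm_num)
    exact locallyIntegrableOn_of_locallyIntegrable_restrict this
  have h' := hΩ.ae_eq_zero_of_integral_contDiff_smul_eq_zero hv fun φ h1 h2 h3 => by
    rw [← h φ ⟨h1, h2, h3⟩]
    refine (setIntegral_eq_integral_of_forall_compl_eq_zero fun x hx => ?_).symm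
    rw [image_eq_zero_of_notMem_tsupport fun h => hx (h3 h), zero_smul]
  rw [Lp.eq_zero_iff_ae_eq_zero]
  exact (ae_restrict_iff' hΩ.measurableSet).2 h'

/-- Weak gradients are unique: if the function vanishes, its gradient is orthogonal to all test
functions. -/
theorem fnL_injective (hΩ : IsOpen Ω) : Function.Injective (fnL Ω) := by
  refine (injective_iff_map_eq_zero _).2 fun v hv => ?_
  have hf : fn v = 0 := hv
  have hg : grad v = 0 := by
    refine ae_eq_zero_of_integral_test hΩ fun φ hφ => ?_
    have hi : Integrable (fun x => φ x • grad v x) (volume.restrict Ω) :=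
      memLp_one_iff_integrable.1 ((Lp.memLp (grad v)).smul (p := 2) (q := 2)
        (memLp_restrict hφ.contDiff.continuous hφ.hasCompactSupport))
    refine ext_inner_right ℝ fun e => ?_
    have h1 := hasWeakGradient_H1 v φ hφ e
    rw [hf] at h1
    have h2 : ∫ x in Ω, ((0 : L2 Ω) : Eu N → ℝ) x * fderiv ℝ φ x e = 0 :=
      integral_eq_zero_of_ae ((Lp.coeFn_zero _ _ _).mono fun x hx => by
        change ((0 : L2 Ω) : Eu N → ℝ) x * _ = 0
        rw [hx]; simp)
    have h3 := integral_inner (𝕜 := ℝ) hi e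
    rw [inner_zero_left, real_inner_comm, ← h3]
    rw [h2] at h1
    rw [← neg_eq_zero, h1]
    congr 1
    refine integral_congr_ae (Eventually.of_forall fun x => ?_)
    simp only [inner_smul_right, real_inner_comm e, mul_comm]
  refine Subtype.ext (WithLp.ofLp_injective 2 (Prod.ext hf hg))

/-- The restriction to `Ω` of a smooth compactly supported function. -/
theorem hasWeakGradient_of_contDiff {φ : Eu N → ℝ} (hφ : ContDiff ℝ ∞ φ)
    (hc : HasCompactSupport φ) (hg : Continuous (gradient φ)) (hgc : HasCompactSupport (gradient φ)) :
    HasWeakGradient Ω ((memLp_restrict hφ.continuous hc).toLp φ)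
      ((memLp_restrict hg hgc).toLp (gradient φ)) := by
  intro ψ hψ e
  have cψ : Continuous fun x => fderiv ℝ ψ x e :=
    (hψ.contDiff.continuous_fderiv (by simp)).clm_apply continuous_const
  have cφ : Continuous fun x => fderiv ℝ φ x e :=
    (hφ.continuous_fderiv (by simp)).clm_apply continuous_const
  have key := integral_mul_fderiv_eq_neg_fderiv_mul_of_integrable (μ := (volume : Measure (Eu N)))
    (f := φ) (g := ψ) (v := e)
    ((cφ.mul hψ.contDiff.continuous).integrable_of_hasCompactSupport
      (hψ.hasCompactSupport.mul_left))
    ((hφ.continuous.mul cψ).integrable_of_hasCompactSupport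
      ((hψ.hasCompactSupport.fderiv_apply ℝ e).mul_left))
    ((hφ.continuous.mul hψ.contDiff.continuous).integrable_of_hasCompactSupport
      (hψ.hasCompactSupport.mul_left))
    (fun x _ => hφ.differentiable (by simp) x) (fun x _ => hψ.contDiff.differentiable (by simp) x)
  have z1 : ∀ x ∉ Ω, ψ x = 0 := fun x hx =>
    image_eq_zero_of_notMem_tsupport fun h => hx (hψ.tsupport_subset h)
  have z2 : ∀ x ∉ Ω, fderiv ℝ ψ x e = 0 := fun x hx => by
    rw [image_eq_zero_of_notMem_tsupport (f := fderiv ℝ ψ) fun h =>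
      hx (hψ.tsupport_subset (tsupport_fderiv_subset ℝ h))]
    rfl
  have e1 : ∫ x in Ω, ((memLp_restrict hφ.continuous hc).toLp φ : L2 Ω) x * fderiv ℝ ψ x e =
      ∫ x, φ x * fderiv ℝ ψ x e := by
    refine Eq.trans (integral_congr_ae ((memLp_restrict hφ.continuous hc).coeFn_toLp.mono fun x hx => ?_))
      (setIntegral_eq_integral_of_forall_compl_eq_zero (s := Ω)
      (fun x hx => by rw [z2 x hx, mul_zero]))
    simp only [hx]
  have e2 : ∫ x in Ω, ⟪((memLp_restrict hg hgc).toLp (gradient φ) : L2vec Ω) x, e⟫_ℝ * ψ x =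
      ∫ x, fderiv ℝ φ x e * ψ x := by
    refine Eq.trans (integral_congr_ae ((memLp_restrict hg hgc).coeFn_toLp.mono fun x hx => ?_))
      (setIntegral_eq_integral_of_forall_compl_eq_zero (s := Ω)
      (fun x hx => by rw [z1 x hx, mul_zero]))
    simp only [hx, gradient, InnerProductSpace.toDual_symm_apply]
  rw [e1, e2, key]

theorem continuous_gradient {φ : Eu N → ℝ} (hφ : ContDiff ℝ ∞ φ) : Continuous (gradient φ) :=
  (InnerProductSpace.toDual ℝ (Eu N)).symm.continuous.comp (hφ.continuous_fderiv (by simp))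

theorem hasCompactSupport_gradient {φ : Eu N → ℝ} (hφ : HasCompactSupport φ) :
    HasCompactSupport (gradient φ) :=
  (hφ.fderiv (𝕜 := ℝ)).comp_left (map_zero (InnerProductSpace.toDual ℝ (Eu N)).symm)

/-- The space `C_c^∞(ℝᴺ)`. -/
def smoothFns (N : ℕ) : Submodule ℝ (Eu N → ℝ) where
  carrier := {φ | ContDiff ℝ ∞ φ ∧ HasCompactSupport φ}
  zero_mem' := ⟨contDiff_const, HasCompactSupport.zero⟩
  add_mem' h1 h2 := ⟨h1.1.add h2.1, h1.2.add h2.2⟩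
  smul_mem' c φ h := ⟨contDiff_const.smul h.1, h.2.smul_left (f := fun _ => c)⟩

theorem memLp_gradient (φ : smoothFns N) : MemLp (gradient φ.1) 2 (volume.restrict Ω) :=
  memLp_restrict (continuous_gradient φ.2.1) (hasCompactSupport_gradient φ.2.2)

/-- The restriction map `C_c^∞(ℝᴺ) → H¹(Ω)`. -/
def resH1 (Ω : Set (Eu N)) : smoothFns N →ₗ[ℝ] H1 Ω where
  toFun φ := mkH1 _ _ (hasWeakGradient_of_contDiff φ.2.1 φ.2.2 (continuous_gradient φ.2.1)
    (hasCompactSupport_gradient φ.2.2))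
  map_add' φ ψ := by
    refine Subtype.ext (WithLp.ofLp_injective 2 (Prod.ext ?_ ?_))
    · exact MemLp.toLp_add (memLp_restrict φ.2.1.continuous φ.2.2)
        (memLp_restrict ψ.2.1.continuous ψ.2.2)
    · refine (MemLp.toLp_congr (memLp_gradient (φ + ψ)) ((memLp_gradient φ).add (memLp_gradient ψ))
        (Eventually.of_forall fun x => ?_)).trans
          (MemLp.toLp_add (memLp_gradient φ) (memLp_gradient ψ))
      change gradient (φ.1 + ψ.1) x = gradient φ.1 x + gradient ψ.1 x
      simp only [gradient]
      rw [fderiv_add (φ.2.1.differentiable (by simp) x) (ψ.2.1.differentiable (by simp) x), map_add]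
  map_smul' c φ := by
    refine Subtype.ext (WithLp.ofLp_injective 2 (Prod.ext ?_ ?_))
    · exact MemLp.toLp_const_smul c (memLp_restrict φ.2.1.continuous φ.2.2)
    · refine (MemLp.toLp_congr (memLp_gradient (c • φ)) ((memLp_gradient φ).const_smul c)
        (Eventually.of_forall fun x => ?_)).trans (MemLp.toLp_const_smul c (memLp_gradient φ))
      change gradient (c • φ.1) x = c • gradient φ.1 x
      simp only [gradient]
      rw [fderiv_const_smul (φ.2.1.differentiable (by simp) x), map_smulₛₗ]
      rfl

theorem fn_resH1 (φ : smoothFns N) : fn (resH1 Ω φ) =ᵐ[volume.restrict Ω] φ.1 :=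
  MemLp.coeFn_toLp (memLp_restrict φ.2.1.continuous φ.2.2)

theorem grad_resH1 (φ : smoothFns N) :
    grad (resH1 Ω φ) =ᵐ[volume.restrict Ω] gradient φ.1 :=
  MemLp.coeFn_toLp (memLp_gradient φ)

/-- Test functions belong to the range, and only 0 is orthogonal to all of them. -/
theorem denseRange_fnL (hΩ : IsOpen Ω) : DenseRange (fnL Ω) := by
  have h : ((fnL Ω).range)ᗮ = ⊥ := by
    rw [Submodule.eq_bot_iff]
    intro y hy
    refine ae_eq_zero_of_integral_test hΩ fun φ hφ => ?_
    have h1 := hy (fnL Ω (resH1 Ω ⟨φ, hφ.contDiff, hφ.hasCompactSupport⟩)) ⟨_, rfl⟩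
    rw [L2.inner_def] at h1
    rw [← h1]
    refine integral_congr_ae ?_
    filter_upwards [fn_resH1 (Ω := Ω) ⟨φ, hφ.contDiff, hφ.hasCompactSupport⟩] with x hx
    rw [fnL_apply, hx]
    simp [mul_comm]
  have h2 := Submodule.topologicalClosure_eq_top_iff.2 h
  exact (Submodule.dense_iff_topologicalClosure_eq_top).2 h2

end

/-! ### Mollification and local approximation in H¹(Ω) -/

section


theorem sq_eLpNorm_two {α E : Type*} [MeasurableSpace α] [NormedAddCommGroup E] (f : α → E)
    (μ : Measure α) : eLpNorm f 2 μ ^ 2 = ∫⁻ x, ‖f x‖ₑ ^ 2 ∂μ := by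
  have := eLpNorm_nnreal_pow_eq_lintegral (f := f) (μ := μ) (p := 2) (by norm_num)
  simpa using this

/-- Continuity of translations in L², as continuity of composition with a continuous family of
measure-preserving maps. -/
theorem tendsto_eLpNorm_translate {N : ℕ} {E : Type*} [NormedAddCommGroup E] {w : Eu N → E}
    (hw : MemLp w 2 volume) :
    Tendsto (fun z => eLpNorm (fun x => w (x - z) - w x) 2 volume) (𝓝 0) (𝓝 0) := by
  let g : Eu N → C(Eu N, Eu N) := ContinuousMap.curry ⟨fun p : Eu N × Eu N => p.2 - p.1, by fun_prop⟩
  have hg : Continuous g := ContinuousMap.continuous _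
  have hgm : ∀ z, MeasurePreserving (g z) volume volume := fun z =>
    measurePreserving_sub_right volume z
  have h := Filter.Tendsto.compMeasurePreservingLp (tendsto_const_nhds (x := hw.toLp) (f := 𝓝 0))
    (hg.tendsto 0) hgm (hgm 0) (by norm_num)
  simp only [Lp.toLp_compMeasurePreserving] at h
  rw [tendsto_iff_edist_tendsto_0] at h
  simp only [Lp.edist_toLp_toLp] at h
  refine h.congr fun z => ?_
  congr 1
  ext x
  simp [g]

/-- Jensen's inequality for the probability measure ν; if the right-hand side is infinite there is
nothing to prove. -/
theorem enorm_integral_sub_sq_le {N : ℕ} {E : Type*} [NormedAddCommGroup E] [NormedSpace ℝ E]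
    [CompleteSpace E] {w : Eu N → E} (hw : StronglyMeasurable w) (ν : Measure (Eu N))
    [IsProbabilityMeasure ν] (x : Eu N) :
    ‖(∫ z, w (x - z) ∂ν) - w x‖ₑ ^ 2 ≤ ∫⁻ z, ‖w (x - z) - w x‖ₑ ^ 2 ∂ν := by
  have hm : StronglyMeasurable fun z => w (x - z) - w x :=
    (hw.comp_measurable (measurable_const.sub measurable_id)).sub stronglyMeasurable_const
  rw [← sq_eLpNorm_two]
  by_cases htop : eLpNorm (fun z => w (x - z) - w x) 2 ν = ⊤
  · simp [htop]
  have hmem : MemLp (fun z => w (x - z) - w x) 2 ν :=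
    ⟨hm.aestronglyMeasurable, lt_top_iff_ne_top.2 htop⟩
  have hi := hmem.integrable (by norm_num)
  have hi' : Integrable (fun z => w (x - z)) ν :=
    (hi.add (integrable_const (w x))).congr (Eventually.of_forall fun z => by simp)
  have e : (∫ z, w (x - z) ∂ν) - w x = ∫ z, (w (x - z) - w x) ∂ν := by
    rw [integral_sub hi' (integrable_const _)]
    simp
  rw [e]
  gcongr
  calc ‖∫ z, (w (x - z) - w x) ∂ν‖ₑ ≤ ∫⁻ z, ‖w (x - z) - w x‖ₑ ∂ν :=
        enorm_integral_le_lintegral_enorm _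
    _ = eLpNorm (fun z => w (x - z) - w x) 1 ν := eLpNorm_one_eq_lintegral_enorm.symm
    _ ≤ _ := eLpNorm_le_eLpNorm_of_exponent_le (by norm_num) hm.aestronglyMeasurable

/-- Averages over small translations converge in `L²`. -/
theorem exists_mollify_bound {N : ℕ} {E : Type*} [NormedAddCommGroup E] [NormedSpace ℝ E]
    [CompleteSpace E] {w : Eu N → E} (hw : StronglyMeasurable w) (hw2 : MemLp w 2 volume)
    {ε : ENNReal} (hε : 0 < ε) :
    ∃ δ > 0, ∀ ν : Measure (Eu N), IsProbabilityMeasure ν → (∀ᵐ z ∂ν, ‖z‖ < δ) →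
      eLpNorm (fun x => (∫ z, w (x - z) ∂ν) - w x) 2 volume ≤ ε := by
  have h1 := (tendsto_eLpNorm_translate hw2).eventually_lt_const hε
  obtain ⟨δ, hδ, h2⟩ := Metric.eventually_nhds_iff.1 h1
  refine ⟨δ, hδ, fun ν _ hν => ?_⟩
  have key : eLpNorm (fun x => (∫ z, w (x - z) ∂ν) - w x) 2 volume ^ 2 ≤ ε ^ 2 := by
    rw [sq_eLpNorm_two]
    have hmeas : Measurable (fun p : Eu N × Eu N => ‖w (p.1 - p.2) - w p.1‖ₑ ^ 2) :=
      (((hw.comp_measurable (measurable_fst.sub measurable_snd)).sub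
        (hw.comp_measurable measurable_fst)).enorm).pow_const 2
    calc ∫⁻ x, ‖(∫ z, w (x - z) ∂ν) - w x‖ₑ ^ 2
        ≤ ∫⁻ x, ∫⁻ z, ‖w (x - z) - w x‖ₑ ^ 2 ∂ν :=
          lintegral_mono fun x => enorm_integral_sub_sq_le hw ν x
      _ = ∫⁻ z, ∫⁻ x, ‖w (x - z) - w x‖ₑ ^ 2 ∂volume ∂ν :=
          lintegral_lintegral_swap hmeas.aemeasurable
      _ ≤ ∫⁻ _, ε ^ 2 ∂ν := by
          refine lintegral_mono_ae (hν.mono fun z hz => ?_)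
          rw [← sq_eLpNorm_two]
          gcongr
          exact (h2 (by simpa using hz)).le
      _ = ε ^ 2 := by simp
  exact (ENNReal.pow_le_pow_left_iff two_ne_zero).1 key

variable {N : ℕ} {Ω : Set (Eu N)}

/-- A mollifier concentrated in the ball of radius `c s` around `-s e`. -/
def offMollifier (e : Eu N) (s r : ℝ) (hr : 0 < r) (z : Eu N) : ℝ :=
  (ContDiffBump.mk (c := (0 : Eu N)) (r / 2) r (half_pos hr) (half_lt_self hr)).normed volume
    (z + s • e)

section

variable {e : Eu N} {s r : ℝ} {hr : 0 < r}

theorem contDiff_offMollifier : ContDiff ℝ ∞ (offMollifier e s r hr) :=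
  (ContDiffBump.contDiff_normed _).comp (contDiff_id.add contDiff_const)

theorem offMollifier_nonneg (z : Eu N) : 0 ≤ offMollifier e s r hr z :=
  ContDiffBump.nonneg_normed _ _

theorem tsupport_offMollifier {z : Eu N} (hz : z ∈ tsupport (offMollifier e s r hr)) :
    ‖z + s • e‖ ≤ r := by
  have h1 : tsupport (offMollifier e s r hr) ⊆ {z | ‖z + s • e‖ ≤ r} := by
    refine closure_minimal (fun z hz => ?_) (isClosed_le (by fun_prop) continuous_const)
    have : z + s • e ∈ Function.support ((ContDiffBump.mk (c := (0 : Eu N)) (r / 2) r (half_pos hr)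
      (half_lt_self hr)).normed volume) := hz
    rw [ContDiffBump.support_normed_eq] at this
    simpa using (mem_ball_zero_iff.1 this).le
  exact h1 hz

theorem hasCompactSupport_offMollifier : HasCompactSupport (offMollifier e s r hr) := by
  refine HasCompactSupport.of_support_subset_isCompact (isCompact_closedBall (-(s • e)) r)
    fun z hz => ?_
  rw [mem_closedBall_iff_norm, sub_neg_eq_add]
  exact tsupport_offMollifier (subset_tsupport _ hz)

theorem integral_offMollifier : ∫ z, offMollifier e s r hr z = 1 := by
  unfold offMollifier
  rw [integral_add_right_eq_self (fun z => ContDiffBump.normed _ volume z)]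
  exact ContDiffBump.integral_normed _

theorem isProbabilityMeasure_offMollifier :
    IsProbabilityMeasure
      (volume.withDensity fun z => ((offMollifier e s r hr z).toNNReal : ENNReal)) := by
  constructor
  rw [withDensity_apply _ MeasurableSet.univ, setLIntegral_univ]
  change ∫⁻ z, ENNReal.ofReal (offMollifier e s r hr z) = 1
  rw [← ofReal_integral_eq_lintegral_ofReal
    (contDiff_offMollifier.continuous.integrable_of_hasCompactSupport
      hasCompactSupport_offMollifier) (Eventually.of_forall offMollifier_nonneg),
    integral_offMollifier, ENNReal.ofReal_one]

theorem ae_offMollifier :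
    ∀ᵐ z ∂(volume.withDensity fun z => ((offMollifier e s r hr z).toNNReal : ENNReal)),
      ‖z + s • e‖ ≤ r := by
  rw [ae_withDensity_iff (by
    exact contDiff_offMollifier.continuous.measurable.real_toNNReal.coe_nnreal_ennreal)]
  refine Eventually.of_forall fun z hz =>
    tsupport_offMollifier (hr := hr) (subset_tsupport (offMollifier e s r hr) ?_)
  rw [Function.mem_support]
  intro h
  simp [h] at hz

theorem integral_offMollifier_measure {E : Type*} [NormedAddCommGroup E] [NormedSpace ℝ E]
    (f : Eu N → E) :
    ∫ z, f z ∂(volume.withDensity fun z => ((offMollifier e s r hr z).toNNReal : ENNReal)) =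
      ∫ z, offMollifier e s r hr z • f z := by
  rw [integral_withDensity_eq_integral_smul
    contDiff_offMollifier.continuous.measurable.real_toNNReal]
  refine integral_congr_ae (Eventually.of_forall fun z => ?_)
  simp only [NNReal.smul_def, Real.coe_toNNReal _ (offMollifier_nonneg z)]

end

/-- Local approximation of `χ v` by smooth functions, where translations by `-s e` move the
part of `Ω` near the support of `χ` into `Ω`. -/
theorem exists_local_approx {χ : Eu N → ℝ} (hΩ : IsOpen Ω) (hχ : ContDiff ℝ ∞ χ)
    (hχc : HasCompactSupport χ) {e : Eu N} {c s₀ : ℝ} (hc : 0 < c) (hs₀ : 0 < s₀)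
    (hgeo : ∀ s ∈ Ioo 0 s₀, ∀ x ∈ Ω, ∀ y ∈ tsupport χ, ‖x - y + s • e‖ ≤ c * s → y ∈ Ω)
    (v : H1 Ω) {ε : ENNReal} (hε : 0 < ε) :
    ∃ φ : smoothFns N,
      eLpNorm (fun x => φ.1 x - χ x * fn v x) 2 (volume.restrict Ω) ≤ ε ∧
      eLpNorm (fun x => gradient φ.1 x - (χ x • grad v x + fn v x • gradient χ x)) 2
        (volume.restrict Ω) ≤ ε := by
  set w : Eu N → ℝ := Ω.indicator fun x => χ x * fn v x with hw
  -- G is the gradient of χ v inside Ω extended by zero. It need not be the distributional gradient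
  -- of w on ℝᴺ, which may have a part on ∂Ω; the shift of the mollifier keeps that part out of
  -- reach from points of Ω.
  set G : Eu N → Eu N := Ω.indicator fun x => χ x • grad v x + fn v x • gradient χ x with hG
  have bdd : ∀ {F : Type} [NormedAddCommGroup F] {f : Eu N → F}, Continuous f →
      HasCompactSupport f → MemLp f ⊤ (volume.restrict Ω) := fun hf hfc =>
    (hf.memLp_of_hasCompactSupport (p := ⊤) (μ := volume) hfc).restrict Ω
  have smw : StronglyMeasurable w :=
    (hχ.continuous.stronglyMeasurable.mul (Lp.stronglyMeasurable (fn v))).indicator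
      hΩ.measurableSet
  have smG : StronglyMeasurable G :=
    ((hχ.continuous.stronglyMeasurable.smul (Lp.stronglyMeasurable (grad v))).add
      ((Lp.stronglyMeasurable (fn v)).smul (continuous_gradient hχ).stronglyMeasurable)).indicator
      hΩ.measurableSet
  have mw : MemLp w 2 volume := by
    rw [hw, memLp_indicator_iff_restrict hΩ.measurableSet]
    exact (Lp.memLp (fn v)).mul (bdd hχ.continuous hχc)
  have mG : MemLp G 2 volume := by
    rw [hG, memLp_indicator_iff_restrict hΩ.measurableSet]
    exact ((Lp.memLp (grad v)).smul (bdd hχ.continuous hχc)).add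
      ((bdd (continuous_gradient hχ) (hasCompactSupport_gradient hχc)).smul (Lp.memLp (fn v)))
  obtain ⟨δ₁, hδ₁, H₁⟩ := exists_mollify_bound smw mw hε
  obtain ⟨δ₂, hδ₂, H₂⟩ := exists_mollify_bound smG mG hε
  -- The mollifier lives where ‖z‖ ≤ s(‖e‖ + c), so a small s puts it below both mollification
  -- thresholds and inside the range of `hgeo`.
  obtain ⟨s, hs0, hs⟩ : ∃ s, 0 < s ∧ s < s₀ ∧ s * (‖e‖ + c) < δ₁ ∧ s * (‖e‖ + c) < δ₂ := by
    have h1 : ∀ᶠ s in 𝓝[>] (0 : ℝ), s < s₀ :=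
      (eventually_lt_nhds hs₀).filter_mono nhdsWithin_le_nhds
    have h2 : Tendsto (fun s : ℝ => s * (‖e‖ + c)) (𝓝[>] 0) (𝓝 0) := by
      have : Tendsto (fun s : ℝ => s * (‖e‖ + c)) (𝓝 0) (𝓝 (0 * (‖e‖ + c))) :=
        (continuous_id.mul continuous_const).tendsto 0
      rw [zero_mul] at this
      exact this.mono_left nhdsWithin_le_nhds
    exact ((eventually_mem_nhdsWithin (s := Ioi (0 : ℝ))).and (h1.and
      ((h2.eventually_lt_const hδ₁).and (h2.eventually_lt_const hδ₂)))).exists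
  have hr : 0 < c * s := mul_pos hc hs0
  set k := offMollifier e s (c * s) hr with hk
  set ν := volume.withDensity fun z => ((k z).toNNReal : ENNReal) with hν
  haveI : IsProbabilityMeasure ν := isProbabilityMeasure_offMollifier
  have hsmall : ∀ᵐ z ∂ν, ‖z‖ ≤ s * (‖e‖ + c) := by
    refine (ae_offMollifier (e := e) (s := s) (hr := hr)).mono fun z hz => ?_
    calc ‖z‖ = ‖z + s • e - s • e‖ := by rw [add_sub_cancel_right]
      _ ≤ ‖z + s • e‖ + ‖s • e‖ := norm_sub_le _ _
      _ ≤ c * s + s * ‖e‖ := by rw [norm_smul, Real.norm_of_nonneg hs0.le]; gcongr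
      _ = _ := by ring
  have B₁ := H₁ ν inferInstance (hsmall.mono fun z hz => hz.trans_lt hs.2.1)
  have B₂ := H₂ ν inferInstance (hsmall.mono fun z hz => hz.trans_lt hs.2.2)
  have wc : HasCompactSupport w := hχc.mono fun x hx => by
    intro h0
    refine hx ?_
    by_cases hxΩ : x ∈ Ω
    · simp [hw, hxΩ, h0]
    · simp [hw, hxΩ]
  set φ : Eu N → ℝ := convolution w k (ContinuousLinearMap.mul ℝ ℝ) volume with hφ
  have wloc : LocallyIntegrable w volume := mw.locallyIntegrable (by norm_num)
  have kc : HasCompactSupport k := hasCompactSupport_offMollifier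
  have ks : ContDiff ℝ ∞ k := contDiff_offMollifier
  have φs : ContDiff ℝ ∞ φ := kc.contDiff_convolution_right _ wloc ks
  have φc : HasCompactSupport φ := wc.convolution _ kc
  have φval : ∀ x, φ x = ∫ z, w (x - z) ∂ν := by
    intro x
    rw [hν, integral_offMollifier_measure, hφ, convolution_eq_swap]
    refine integral_congr_ae (Eventually.of_forall fun z => ?_)
    exact mul_comm _ _
  -- Differentiate the mollifier and integrate by parts with y ↦ χ(y) k(x - y), which is a test
  -- function on Ω precisely because x is in Ω.
  have φgrad : ∀ x ∈ Ω, gradient φ x = ∫ z, G (x - z) ∂ν := by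
    intro x hx
    refine ext_inner_right ℝ fun e' => ?_
    rw [gradient, InnerProductSpace.toDual_symm_apply]
    have hd := kc.hasFDerivAt_convolution_right (ContinuousLinearMap.mul ℝ ℝ) wloc
      (ks.of_le (by simp)) x
    rw [hd.fderiv, convolution_precompR_apply _ wloc (kc.fderiv ℝ)
      (ks.continuous_fderiv (by simp)), convolution_def]
    -- the test function
    set ψ : Eu N → ℝ := fun y => χ y * k (x - y) with hψ
    have hkx : ContDiff ℝ ∞ fun y => k (x - y) := ks.comp (contDiff_const.sub contDiff_id)
    -- On its support y is in the support of χ and x - y is in that of k, so `hgeo` places y in Ω.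
    have tψ : IsTestFunction Ω ψ := by
      refine ⟨hχ.mul hkx, hχc.mul_right, fun y hy => ?_⟩
      have h1 : y ∈ tsupport χ := tsupport_mul_subset_left hy
      have h2 : y ∈ tsupport (fun y => k (x - y)) := tsupport_mul_subset_right hy
      have h3 : x - y ∈ tsupport k :=
        tsupport_comp_subset_preimage (g := k) (f := fun y => x - y) (by fun_prop) h2
      have h4 := tsupport_offMollifier h3
      exact hgeo s ⟨hs0, hs.1⟩ x hx y h1 h4
    have dψ : ∀ y, fderiv ℝ ψ y e' = fderiv ℝ χ y e' * k (x - y) - χ y * fderiv ℝ k (x - y) e' := by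
      intro y
      have d1 : HasFDerivAt χ (fderiv ℝ χ y) y := (hχ.differentiable (by simp) y).hasFDerivAt
      have d2 : HasFDerivAt (fun y => k (x - y)) (-(fderiv ℝ k (x - y))) y := by
        have := (ks.differentiable (by simp) (x - y)).hasFDerivAt.comp y
          ((hasFDerivAt_const x y).sub (hasFDerivAt_id y))
        have h := this.congr_fderiv (g' := -(fderiv ℝ k (x - y))) (by ext; simp)
        exact h
      rw [show ψ = χ * fun y => k (x - y) from rfl, (d1.mul d2).fderiv]
      simp
      ring
    have ibp := hasWeakGradient_H1 v ψ tψ e'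
    have I1 := integrable_mul_fderiv (fn v) tψ e'
    have I2 := integrable_inner_mul (grad v) tψ e'
    have cχ' : Continuous fun y => fderiv ℝ χ y e' * k (x - y) :=
      ((hχ.continuous_fderiv (by simp)).clm_apply continuous_const).mul hkx.continuous
    have I3 : Integrable (fun y => fn v y * (fderiv ℝ χ y e' * k (x - y))) (volume.restrict Ω) :=
      (Lp.memLp (fn v)).integrable_mul
        (memLp_restrict cχ' (hχc.fderiv_apply ℝ e').mul_right)
    have e1 : ∫ y, (ContinuousLinearMap.mul ℝ ℝ) (w y) (fderiv ℝ k (x - y) e') =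
        ∫ y in Ω, (fn v y * (fderiv ℝ χ y e' * k (x - y)) - fn v y * fderiv ℝ ψ y e') := by
      rw [← integral_indicator hΩ.measurableSet]
      refine integral_congr_ae (Eventually.of_forall fun y => ?_)
      by_cases hy : y ∈ Ω
      · simp only [hw, indicator_of_mem hy, dψ, ContinuousLinearMap.mul_apply']
        ring
      · simp [hw, hy]
    have e2 : ⟪∫ z, G (x - z) ∂ν, e'⟫_ℝ =
        ∫ y in Ω, (fn v y * (fderiv ℝ χ y e' * k (x - y)) + ⟪grad v y, e'⟫_ℝ * ψ y) := by
      rw [hν, integral_offMollifier_measure]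
      have sw : ∫ z, k z • G (x - z) = ∫ y, k (x - y) • G y := by
        have := integral_sub_left_eq_self (fun z => k z • G (x - z)) volume x
        rw [← this]
        refine integral_congr_ae (Eventually.of_forall fun z => ?_)
        simp
      have iG : Integrable (fun y => k (x - y) • G y) := by
        have hkm : MemLp (fun y => k (x - y)) 2 volume :=
          hkx.continuous.memLp_of_hasCompactSupport
            (kc.comp_homeomorph (Homeomorph.subLeft x))
        exact memLp_one_iff_integrable.1 (mG.smul (p := 2) (q := 2) hkm)
      rw [sw]
      have := integral_inner (𝕜 := ℝ) iG e'
      rw [real_inner_comm, ← this, ← integral_indicator hΩ.measurableSet]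
      refine integral_congr_ae (Eventually.of_forall fun y => ?_)
      by_cases hy : y ∈ Ω
      · have hgr : ⟪e', gradient χ y⟫_ℝ = fderiv ℝ χ y e' := by
          rw [real_inner_comm, gradient, InnerProductSpace.toDual_symm_apply]
        simp only [hG, hψ, indicator_of_mem hy, inner_smul_right, inner_add_right, hgr,
          real_inner_comm e']
        ring
      · simp [hG, hy]
    rw [e1, e2, integral_sub I3 I1, integral_add I3 I2, ibp, sub_neg_eq_add]
  refine ⟨⟨φ, φs, φc⟩, ?_, ?_⟩
  · refine le_trans (le_of_eq ?_)
      ((eLpNorm_restrict_le (fun x => (∫ z, w (x - z) ∂ν) - w x) 2 volume Ω).trans B₁)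
    refine eLpNorm_congr_ae ((ae_restrict_iff' hΩ.measurableSet).2
      (Eventually.of_forall fun x hx => ?_))
    simp only [φval, hw, indicator_of_mem hx]
  · refine le_trans (le_of_eq ?_)
      ((eLpNorm_restrict_le (fun x => (∫ z, G (x - z) ∂ν) - G x) 2 volume Ω).trans B₂)
    refine eLpNorm_congr_ae ((ae_restrict_iff' hΩ.measurableSet).2
      (Eventually.of_forall fun x hx => ?_))
    simp only [φgrad x hx, hG, indicator_of_mem hx]

end

/-! ### Density of smooth functions in H¹(Ω) -/

section


variable {N : ℕ} {Ω : Set (Eu N)}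

/-- A smooth partition of unity on a compact set, subordinate to a family of balls. -/
theorem exists_partition {K : Set (Eu N)} (hK : IsCompact K) {p : Eu N → Set (Eu N) → Prop}
    (hp : ∀ x ∈ K, ∃ U, IsOpen U ∧ x ∈ U ∧ Bornology.IsBounded U ∧ p x U) :
    ∃ (n : ℕ) (χ : Fin n → smoothFns N), (∀ x ∈ K, ∑ i, (χ i).1 x = 1) ∧ (∀ i x, 0 ≤ (χ i).1 x) ∧
      (∀ i x, (χ i).1 x ≤ 1) ∧
      ∀ i, ∃ x ∈ K, ∃ U, p x U ∧ tsupport (χ i).1 ⊆ U := by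
  choose! U hUo hxU hUb hU using hp
  obtain ⟨t, htK, htU⟩ := hK.elim_nhds_subcover U fun x hx => (hUo x hx).mem_nhds (hxU x hx)
  obtain ⟨f, hf⟩ := SmoothPartitionOfUnity.exists_isSubordinate (modelWithCornersSelf ℝ (Eu N))
    hK.isClosed (fun i : t => U i) (fun i => hUo _ (htK _ i.2)) (by
      rwa [iUnion_subtype])
  let eq := t.equivFin.symm
  have hcs : ∀ i : t, ContDiff ℝ ∞ (f i) ∧ HasCompactSupport (f i) := fun i =>
    ⟨(f i).contMDiff.contDiff, Metric.isCompact_of_isClosed_isBounded (isClosed_tsupport _)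
      ((hUb _ (htK _ i.2)).subset (hf i))⟩
  refine ⟨t.card, fun i => ⟨f (eq i), hcs _⟩, fun x hx => ?_, fun i x => f.nonneg _ x,
    fun i x => f.le_one _ x, fun i =>
      ⟨(eq i : Eu N), htK _ (eq i).2, U (eq i), hU _ (htK _ (eq i).2), hf _⟩⟩
  rw [← f.sum_eq_one hx, finsum_eq_sum_of_fintype]
  exact Equiv.sum_comp eq (fun i => f i x)

theorem memLp_top_restrict {E : Type*} [NormedAddCommGroup E] {f : Eu N → E} (hf : Continuous f)
    (hc : HasCompactSupport f) : MemLp f ⊤ (volume.restrict Ω) :=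
  (hf.memLp_of_hasCompactSupport (p := ⊤) (μ := volume) hc).restrict Ω

theorem memLp_mul_fn (v : H1 Ω) (χ : smoothFns N) :
    MemLp (fun x => χ.1 x * fn v x) 2 (volume.restrict Ω) :=
  (Lp.memLp (fn v)).mul (memLp_top_restrict χ.2.1.continuous χ.2.2)

theorem memLp_grad_mul_fn (v : H1 Ω) (χ : smoothFns N) :
    MemLp (fun x => χ.1 x • grad v x + fn v x • gradient χ.1 x) 2 (volume.restrict Ω) :=
  ((Lp.memLp (grad v)).smul (memLp_top_restrict χ.2.1.continuous χ.2.2)).add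
    ((memLp_top_restrict (continuous_gradient χ.2.1) (hasCompactSupport_gradient χ.2.2)).smul
      (Lp.memLp (fn v)))

/-- The pair `(χ v, ∇(χ v))`, as a function of `χ`. -/
def mulPair (v : H1 Ω) : smoothFns N →+ WithLp 2 (L2 Ω × L2vec Ω) :=
  AddMonoidHom.mk' (fun χ => WithLp.toLp 2 ((memLp_mul_fn v χ).toLp, (memLp_grad_mul_fn v χ).toLp)) (by
    intro χ ξ
    refine WithLp.ofLp_injective 2 (Prod.ext ?_ ?_)
    · refine (MemLp.toLp_congr (memLp_mul_fn v (χ + ξ)) ((memLp_mul_fn v χ).add (memLp_mul_fn v ξ))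
        (Eventually.of_forall fun x => ?_)).trans (MemLp.toLp_add (memLp_mul_fn v χ) (memLp_mul_fn v ξ))
      change (χ.1 x + ξ.1 x) * _ = χ.1 x * _ + ξ.1 x * _
      ring
    · refine (MemLp.toLp_congr (memLp_grad_mul_fn v (χ + ξ)) ((memLp_grad_mul_fn v χ).add (memLp_grad_mul_fn v ξ))
        (Eventually.of_forall fun x => ?_)).trans (MemLp.toLp_add (memLp_grad_mul_fn v χ) (memLp_grad_mul_fn v ξ))
      change (χ.1 x + ξ.1 x) • _ + _ • gradient (χ.1 + ξ.1) x =
        χ.1 x • _ + _ • gradient χ.1 x + (ξ.1 x • _ + _ • gradient ξ.1 x)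
      simp only [gradient]
      rw [fderiv_add (χ.2.1.differentiable (by simp) x) (ξ.2.1.differentiable (by simp) x), map_add,
        add_smul, smul_add]
      abel)

theorem fst_mulPair (v : H1 Ω) (χ : smoothFns N) :
    (mulPair v χ).fst =ᵐ[volume.restrict Ω] fun x => χ.1 x * fn v x :=
  MemLp.coeFn_toLp (memLp_mul_fn v χ)

theorem snd_mulPair (v : H1 Ω) (χ : smoothFns N) :
    (mulPair v χ).snd =ᵐ[volume.restrict Ω]
      fun x => χ.1 x • grad v x + fn v x • gradient χ.1 x :=
  MemLp.coeFn_toLp (memLp_grad_mul_fn v χ)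

theorem norm_le_of_eLpNorm_le {α E : Type*} [MeasurableSpace α] [NormedAddCommGroup E]
    {μ : Measure α} {f : Lp E 2 μ} {g : α → E} (h : f =ᵐ[μ] g) {ε : ℝ} (hε : 0 ≤ ε)
    (hg : eLpNorm g 2 μ ≤ ENNReal.ofReal ε) : ‖f‖ ≤ ε := by
  rw [Lp.norm_def, eLpNorm_congr_ae h]
  exact ENNReal.toReal_le_of_le_ofReal hε hg

/-- The points where translations by `-s e` move the part of `Ω` near `U` into `Ω`. -/
def IsShiftGood (Ω U : Set (Eu N)) : Prop :=
  ∃ (e : Eu N) (c s₀ : ℝ), 0 < c ∧ 0 < s₀ ∧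
    ∀ s ∈ Ioo 0 s₀, ∀ x ∈ Ω, ∀ y ∈ U, ‖x - y + s • e‖ ≤ c * s → y ∈ Ω

/-- The closure is taken in the ambient product space, so χ v does not have to be recognized as an
element of H¹ first, and finite sums over a partition of unity are handled by the submodule
structure. -/
theorem mulPair_mem_closure (hΩ : IsOpen Ω) (v : H1 Ω) {χ : smoothFns N} {U : Set (Eu N)}
    (hU : IsShiftGood Ω U) (hχ : tsupport χ.1 ⊆ U) :
    mulPair v χ ∈ (LinearMap.range ((H1 Ω).subtype ∘ₗ resH1 Ω)).topologicalClosure := by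
  obtain ⟨e, c, s₀, hc, hs₀, hgeo⟩ := hU
  refine Metric.mem_closure_iff.2 fun ε hε => ?_
  obtain ⟨φ, h1, h2⟩ := exists_local_approx hΩ χ.2.1 χ.2.2 hc hs₀
    (fun s hs x hx y hy => hgeo s hs x hx y (hχ hy)) v
    (ε := ENNReal.ofReal (ε / 2)) (by simpa using hε)
  refine ⟨_, ⟨φ, rfl⟩, ?_⟩
  rw [dist_comm, dist_eq_norm]
  refine lt_of_pow_lt_pow_left₀ 2 hε.le ?_
  rw [WithLp.prod_norm_sq_eq_of_L2]
  have n1 : ‖fn (resH1 Ω φ) - (mulPair v χ).fst‖ ≤ ε / 2 := by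
    refine norm_le_of_eLpNorm_le ?_ (by positivity) h1
    filter_upwards [Lp.coeFn_sub (fn (resH1 Ω φ)) (mulPair v χ).fst, fn_resH1 (Ω := Ω) φ,
      fst_mulPair v χ] with x a1 a2 a3
    rw [a1, Pi.sub_apply, a2, a3]
  have n2 : ‖grad (resH1 Ω φ) - (mulPair v χ).snd‖ ≤ ε / 2 := by
    refine norm_le_of_eLpNorm_le ?_ (by positivity) h2
    filter_upwards [Lp.coeFn_sub (grad (resH1 Ω φ)) (mulPair v χ).snd, grad_resH1 (Ω := Ω) φ,
      snd_mulPair v χ] with x a1 a2 a3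
    rw [a1, Pi.sub_apply, a2, a3]
  have m1 := pow_le_pow_left₀ (norm_nonneg _) n1 2
  have m2 := pow_le_pow_left₀ (norm_nonneg _) n2 2
  calc _ ≤ (ε / 2) ^ 2 + (ε / 2) ^ 2 := add_le_add m1 m2
    _ < ε ^ 2 := by nlinarith

/-- The component of `y` orthogonal to `e`. -/
def perp (e y : Eu N) : Eu N := y - ⟪e, y⟫_ℝ • e

theorem perp_add (e y z : Eu N) : perp e (y + z) = perp e y + perp e z := by
  simp only [perp, inner_add_right, add_smul]
  abel

theorem perp_smul_self {e : Eu N} (he : ‖e‖ = 1) (s : ℝ) : perp e (s • e) = 0 := by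
  simp [perp, inner_smul_right, real_inner_self_eq_norm_sq, he]

theorem norm_perp_le {e : Eu N} (he : ‖e‖ = 1) (y : Eu N) : ‖perp e y‖ ≤ ‖y‖ := by
  refine le_of_sq_le_sq ?_ (norm_nonneg y)
  rw [perp, norm_sub_sq_real, inner_smul_right, norm_smul, he, mul_one, Real.norm_eq_abs, sq_abs,
    real_inner_comm y e]
  nlinarith [sq_nonneg ⟪y, e⟫_ℝ]

/-- Moving from x to y adds s e minus a vector b of length at most c s. The height grows by at least
s - c s, while the graph rises by at most L c s; with c(1 + L) = 1/2 the net gain is s/2. The bound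
on s keeps x in the ball of radius r. -/
theorem isShiftGood_of_graph {x₀ e : Eu N} {r : ℝ} (hr : 0 < r) {L : NNReal} {a : Eu N → ℝ}
    (he : ‖e‖ = 1) (ha : LipschitzWith L a)
    (h : ∀ y ∈ Metric.ball x₀ r, (y ∈ Ω ↔ a (perp e y) < ⟪e, y⟫_ℝ)) :
    IsShiftGood Ω (Metric.ball x₀ (r / 2)) := by
  set c : ℝ := 1 / (2 * (1 + L)) with hc
  have hL : (0 : ℝ) ≤ L := L.2
  have c0 : 0 < c := by positivity
  have hcL : c * (1 + L) = 1 / 2 := by rw [hc]; field_simp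
  refine ⟨e, c, r / 2 / (1 + c), c0, by positivity, fun s hs x hx y hy hxy => ?_⟩
  set b := x - y + s • e with hb
  have hxb : x = y + b + (-s) • e := by rw [hb, neg_smul]; abel
  have hs' : (1 + c) * s < r / 2 := by
    have := (lt_div_iff₀ (by positivity)).1 hs.2
    linarith
  have hyb : y ∈ Metric.ball x₀ r := Metric.ball_subset_ball (by linarith) hy
  have hxball : x ∈ Metric.ball x₀ r := by
    rw [Metric.mem_ball] at hy ⊢
    have h1 : dist x y ≤ (1 + c) * s := by
      rw [dist_eq_norm]
      calc ‖x - y‖ = ‖b - s • e‖ := by rw [hb, add_sub_cancel_right]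
        _ ≤ ‖b‖ + ‖s • e‖ := norm_sub_le _ _
        _ ≤ c * s + s := by
          rw [norm_smul, he, Real.norm_of_nonneg hs.1.le, mul_one]
          linarith
        _ = _ := by ring
    linarith [dist_triangle x y x₀]
  have h1 := (h x hxball).1 hx
  refine (h y hyb).2 ?_
  have h2 : perp e x = perp e y + perp e b := by
    rw [hxb, perp_add, perp_smul_self he, perp_add, add_zero]
  have h3 : ⟪e, x⟫_ℝ = ⟪e, y⟫_ℝ + ⟪e, b⟫_ℝ - s := by
    rw [hxb, inner_add_right, inner_add_right, inner_smul_right, real_inner_self_eq_norm_sq, he]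
    ring
  have h4 : ⟪e, b⟫_ℝ ≤ c * s := by
    have := real_inner_le_norm e b
    rw [he, one_mul] at this
    exact this.trans hxy
  have h5 : a (perp e y) ≤ a (perp e x) + L * (c * s) := by
    have := ha.dist_le_mul (perp e y) (perp e x)
    rw [Real.dist_eq, dist_eq_norm, h2, sub_add_cancel_left, norm_neg] at this
    have h6 := (le_abs_self _).trans this
    have h7 := mul_le_mul_of_nonneg_left ((norm_perp_le he b).trans hxy) hL
    rw [h2]
    linarith
  have h8 : c * s + L * (c * s) = s / 2 := by linear_combination s * hcL
  have := hs.1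
  linarith

/-- The restrictions of smooth functions are dense in `H¹(Ω)`. -/
theorem denseRange_resH1 (hΩ : IsBoundedLipschitzDomain Ω) : DenseRange (resH1 Ω) := by
  intro v
  have hK : IsCompact (closure Ω) := hΩ.isBounded.isCompact_closure
  obtain ⟨n, χ, hsum, -, -, hχ⟩ := exists_partition hK (p := fun _ U => IsShiftGood Ω U) (by
    intro x hx
    by_cases hxΩ : x ∈ Ω
    · obtain ⟨r, hr, hrΩ⟩ := Metric.isOpen_iff.1 hΩ.isOpen x hxΩ
      -- Near an interior point no shift is needed, since the whole ball lies in Ω.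
      exact ⟨Metric.ball x r, Metric.isOpen_ball, Metric.mem_ball_self hr, Metric.isBounded_ball,
        0, 1, 1, one_pos, one_pos, fun _ _ _ _ y hy _ => hrΩ hy⟩
    · have hxf : x ∈ frontier Ω := by
        rw [frontier, hΩ.isOpen.interior_eq]
        exact ⟨hx, hxΩ⟩
      obtain ⟨r, e, L, a, hr, he, ha, h⟩ := hΩ.graph x hxf
      exact ⟨Metric.ball x (r / 2), Metric.isOpen_ball, Metric.mem_ball_self (half_pos hr),
        Metric.isBounded_ball, isShiftGood_of_graph hr he ha h⟩)
  -- The functions χ i sum to 1 on the open set Ω, so their sum has zero gradient there and v is the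
  -- sum of the pieces χ i v.
  have hv : (v : WithLp 2 (L2 Ω × L2vec Ω)) = ∑ i, mulPair v (χ i) := by
    rw [← map_sum]
    set ξ := ∑ i, χ i with hξ
    have hξ1 : ∀ x ∈ Ω, ξ.1 x = 1 := fun x hx => by
      rw [← hsum x (subset_closure hx), hξ]
      simp
    have hξ2 : ∀ x ∈ Ω, gradient ξ.1 x = 0 := fun x hx => by
      have : ξ.1 =ᶠ[𝓝 x] fun _ => 1 := by
        filter_upwards [hΩ.isOpen.mem_nhds hx] with y hy using hξ1 y hy
      rw [gradient, this.fderiv_eq]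
      simp
    have hmem : ∀ᵐ x ∂(volume.restrict Ω), x ∈ Ω := ae_restrict_mem hΩ.isOpen.measurableSet
    refine WithLp.ofLp_injective 2 (Prod.ext (Lp.ext ?_) (Lp.ext ?_))
    · filter_upwards [fst_mulPair v ξ, hmem] with x h1 h2
      refine Eq.trans ?_ h1.symm
      rw [hξ1 x h2, one_mul]; rfl
    · filter_upwards [snd_mulPair v ξ, hmem] with x h1 h2
      refine Eq.trans ?_ h1.symm
      rw [hξ1 x h2, hξ2 x h2, one_smul, smul_zero, add_zero]; rfl
  have hmem : (v : WithLp 2 (L2 Ω × L2vec Ω)) ∈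
      (LinearMap.range ((H1 Ω).subtype ∘ₗ resH1 Ω)).topologicalClosure := by
    rw [hv]
    refine Submodule.sum_mem _ fun i _ => ?_
    obtain ⟨x, -, U, hU, hs⟩ := hχ i
    exact mulPair_mem_closure hΩ.isOpen v hU hs
  rw [closure_subtype]
  have h2 : ((fun x : H1 Ω => (x : WithLp 2 (L2 Ω × L2vec Ω))) '' range (resH1 Ω)) =
      (LinearMap.range ((H1 Ω).subtype ∘ₗ resH1 Ω) : Set _) := by
    ext p
    constructor
    · rintro ⟨_, ⟨φ, rfl⟩, rfl⟩
      exact ⟨φ, rfl⟩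
    · rintro ⟨φ, rfl⟩
      exact ⟨_, ⟨φ, rfl⟩, rfl⟩
  rw [h2]
  exact hmem

end

/-! ### The trace inequality and the trace operator -/

section


variable {N : ℕ} {Ω : Set (Eu N)}

/-- Fubini for the orthogonal splitting of ℝᴺ into the line through e and its complement. -/
theorem lintegral_slices {e : Eu N} (he : ‖e‖ = 1) {F : Eu N → ENNReal} (hF : Measurable F) :
    ∫⁻ y, F y = ∫⁻ z : (Submodule.span ℝ {e})ᗮ, ∫⁻ t : ℝ, F (z + t • e) := by
  have h1 := ((Submodule.span ℝ {e}).measurePreserving_measurableEquivProd (0 : Eu N)).symm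
  rw [InnerProductSpace.euclideanHausdorffMeasure_eq_volume] at h1
  rw [← h1.lintegral_comp hF, Measure.volume_eq_prod,
    lintegral_prod_symm' (fun q => F (((Submodule.span ℝ {e}).measurableEquivProd (0 : Eu N)).symm q))
      (hF.comp h1.measurable)]
  refine lintegral_congr fun z => ?_
  have h2 := (LinearIsometryEquiv.toSpanUnitSingleton (𝕜 := ℝ) e he).measurePreserving
  rw [← h2.lintegral_comp_emb
    (LinearIsometryEquiv.toSpanUnitSingleton (𝕜 := ℝ) e he).toHomeomorph.measurableEmbedding]
  refine lintegral_congr fun t => ?_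
  simp [add_comm]

/-- The parametrization of a graph over the hyperplane orthogonal to `e`. -/
def graphMap (e : Eu N) (a : Eu N → ℝ) (z : (Submodule.span ℝ {e})ᗮ) : Eu N := z + a z • e

theorem lipschitzWith_graphMap {e : Eu N} (he : ‖e‖ = 1) {L : NNReal} {a : Eu N → ℝ}
    (ha : LipschitzWith L a) : LipschitzWith (1 + L) (graphMap e a) := by
  refine LipschitzWith.of_dist_le_mul fun z w => ?_
  have h1 := ha.dist_le_mul z w
  rw [Real.dist_eq] at h1
  rw [dist_eq_norm, graphMap, graphMap, add_sub_add_comm, ← sub_smul]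
  calc _ ≤ ‖(z : Eu N) - w‖ + ‖(a z - a w) • e‖ := norm_add_le _ _
    _ ≤ dist z w + L * dist z w := by
      rw [norm_smul, he, mul_one, Real.norm_eq_abs]
      refine add_le_add (le_of_eq ?_) h1
      rw [Subtype.dist_eq, dist_eq_norm]
    _ = _ := by push_cast; ring

theorem perp_mem (e y : Eu N) (he : ‖e‖ = 1) : perp e y ∈ (Submodule.span ℝ {e})ᗮ := by
  rw [Submodule.mem_orthogonal_singleton_iff_inner_right, perp, inner_sub_right, inner_smul_right,
    real_inner_self_eq_norm_sq, he]
  ring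

theorem finrank_orthogonal_span {e : Eu N} (he : ‖e‖ = 1) :
    Module.finrank ℝ (Submodule.span ℝ {e})ᗮ = N - 1 := by
  have h1 : Module.finrank ℝ (Submodule.span ℝ {e}) = 1 :=
    finrank_span_singleton (by rintro rfl; simp at he)
  have h2 := Submodule.finrank_add_finrank_orthogonal (Submodule.span ℝ {e})
  rw [h1, finrank_euclideanSpace_fin] at h2
  omega

/-- S is contained in the image of the hyperplane under a (1 + L)-Lipschitz map, and on the
hyperplane the normalized Hausdorff measure is Lebesgue measure. An inequality suffices for the
trace bound, so no area formula is needed. -/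
theorem euclideanHausdorffMeasure_graph_le {e : Eu N} (he : ‖e‖ = 1) {L : NNReal} {a : Eu N → ℝ}
    (ha : LipschitzWith L a) {S : Set (Eu N)} (hS : ∀ y ∈ S, ⟪e, y⟫_ℝ = a (perp e y)) :
    (Measure.euclideanHausdorffMeasure (N - 1)).restrict S ≤
      ((1 + L) ^ (N - 1) : NNReal) • Measure.map (graphMap e a) volume := by
  have hl := lipschitzWith_graphMap he ha
  refine Measure.le_iff.2 fun A hA => ?_
  rw [Measure.restrict_apply hA, Measure.smul_apply, Measure.map_apply hl.continuous.measurable hA]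
  have hsub : A ∩ S ⊆ graphMap e a '' (graphMap e a ⁻¹' A) := by
    rintro y ⟨hyA, hyS⟩
    have e1 : graphMap e a ⟨perp e y, perp_mem e y he⟩ = y := by
      simp only [graphMap]
      rw [← hS y hyS, perp, sub_add_cancel]
    exact ⟨⟨perp e y, perp_mem e y he⟩, by rw [mem_preimage, e1]; exact hyA, e1⟩
  refine (measure_mono hsub).trans ?_
  rw [← InnerProductSpace.euclideanHausdorffMeasure_eq_volume (V := (Submodule.span ℝ {e})ᗮ),
    finrank_orthogonal_span he, Measure.euclideanHausdorffMeasure_def,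
    Measure.euclideanHausdorffMeasure_def, Measure.smul_apply, Measure.smul_apply, smul_comm]
  simp only [ENNReal.smul_def, smul_eq_mul]
  gcongr
  have := hl.hausdorffMeasure_image_le (d := ((N - 1 : ℕ) : ℝ)) (by positivity)
    (graphMap e a ⁻¹' A)
  simpa using this

/-- The fundamental theorem of calculus along the ray, on which g vanishes far out. -/
theorem le_lintegral_fderiv_ray {g : Eu N → ℝ} (hg : ContDiff ℝ ∞ g) (hgc : HasCompactSupport g)
    {e : Eu N} (he : ‖e‖ = 1) (y : Eu N) (b : ℝ) :
    ENNReal.ofReal (g (y + b • e)) ≤ ∫⁻ t in Ioi b, ‖fderiv ℝ g (y + t • e) e‖ₑ := by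
  have hiso : Isometry fun t : ℝ => y + t • e := by
    refine Isometry.of_dist_eq fun s t => ?_
    rw [dist_add_left, dist_eq_norm, ← sub_smul, norm_smul, he, mul_one, Real.dist_eq,
      Real.norm_eq_abs]
  have hd : ∀ t : ℝ, HasDerivAt (fun t : ℝ => g (y + t • e)) (fderiv ℝ g (y + t • e) e) t := by
    intro t
    have h1 : HasDerivAt (fun t : ℝ => y + t • e) e t := by
      simpa using ((hasDerivAt_id t).smul_const e).const_add y
    exact (hg.differentiable (by simp) _).hasFDerivAt.comp_hasDerivAt t h1
  have hc : HasCompactSupport fun t : ℝ => g (y + t • e) :=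
    hgc.comp_isClosedEmbedding hiso.isClosedEmbedding
  have h := hc.integral_Ioi_deriv_eq
    ((hg.comp (by fun_prop : ContDiff ℝ ∞ fun t : ℝ => y + t • e)).of_le (by simp)) b
  have h2 : ∫ t in Ioi b, fderiv ℝ g (y + t • e) e = -g (y + b • e) := by
    refine Eq.trans ?_ h
    exact integral_congr_ae (Eventually.of_forall fun t => (hd t).deriv.symm)
  calc ENNReal.ofReal (g (y + b • e)) ≤ ‖g (y + b • e)‖ₑ := Real.ofReal_le_enorm _
    _ = ‖∫ t in Ioi b, fderiv ℝ g (y + t • e) e‖ₑ := by rw [h2, enorm_neg]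
    _ ≤ _ := enorm_integral_le_lintegral_enorm _

/-- Both strict inequalities are open conditions: one would put the boundary point inside Ω, the
other would separate it from Ω. -/
theorem frontier_subset_graph {x₀ e : Eu N} {r : ℝ} {a : Eu N → ℝ} (hΩ : IsOpen Ω)
    (ha : Continuous a) (h : ∀ y ∈ Metric.ball x₀ r, (y ∈ Ω ↔ a (perp e y) < ⟪e, y⟫_ℝ)) :
    ∀ y ∈ frontier Ω ∩ Metric.ball x₀ r, ⟪e, y⟫_ℝ = a (perp e y) := by
  rintro y ⟨hyf, hyb⟩
  rw [frontier, hΩ.interior_eq] at hyf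
  have cp : Continuous (perp e) := by unfold perp; fun_prop
  refine le_antisymm (not_lt.1 fun hlt => hyf.2 ((h y hyb).2 hlt)) (not_lt.1 fun hlt => ?_)
  have hev : ∀ᶠ z in 𝓝 y, z ∈ Metric.ball x₀ r ∧ ⟪e, z⟫_ℝ < a (perp e z) :=
    (show ∀ᶠ z in 𝓝 y, z ∈ Metric.ball x₀ r from Metric.isOpen_ball.mem_nhds hyb).and
      ((isOpen_lt (by fun_prop) (ha.comp cp)).mem_nhds hlt)
  obtain ⟨z, hz, hzΩ⟩ := mem_closure_iff_nhds.1 hyf.1 _ hev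
  exact absurd ((h z hz.1).1 hzΩ) (not_lt.2 hz.2.le)

/-- The trace inequality in a chart. -/
theorem lintegral_frontier_le_of_graph {x₀ e : Eu N} {r : ℝ} {L : NNReal} {a : Eu N → ℝ}
    (hΩ : IsOpen Ω) (he : ‖e‖ = 1) (ha : LipschitzWith L a)
    (h : ∀ y ∈ Metric.ball x₀ r, (y ∈ Ω ↔ a (perp e y) < ⟪e, y⟫_ℝ)) {g : Eu N → ℝ}
    (hg : ContDiff ℝ ∞ g) (hgc : HasCompactSupport g) (hgs : tsupport g ⊆ Metric.ball x₀ r) :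
    ∫⁻ y, ENNReal.ofReal (g y) ∂surf Ω ≤
      ((1 + L) ^ (N - 1) : NNReal) * ∫⁻ y in Ω, ‖fderiv ℝ g y e‖ₑ := by
  have cp : Continuous (perp e) := by unfold perp; fun_prop
  have mg : Measurable fun y => ENNReal.ofReal (g y) := by
    have := hg.continuous
    fun_prop
  have md : Measurable fun y => ‖fderiv ℝ g y e‖ₑ :=
    ((hg.continuous_fderiv (by simp)).clm_apply continuous_const).measurable.enorm
  have hl := lipschitzWith_graphMap he ha
  set S := {y | a (perp e y) < ⟪e, y⟫_ℝ} with hS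
  have mS : MeasurableSet S :=
    (isOpen_lt (ha.continuous.comp cp) (by fun_prop)).measurableSet
  calc ∫⁻ y, ENNReal.ofReal (g y) ∂surf Ω
      = ∫⁻ y in frontier Ω ∩ Metric.ball x₀ r, ENNReal.ofReal (g y)
          ∂Measure.euclideanHausdorffMeasure (N - 1) := by
        rw [surf, inter_comm, ← Measure.restrict_restrict Metric.isOpen_ball.measurableSet]
        refine (setLIntegral_eq_of_support_subset ?_).symm
        intro y hy
        refine hgs (subset_tsupport g ?_)
        intro h0
        simp [h0] at hy
    _ ≤ ∫⁻ y, ENNReal.ofReal (g y)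
          ∂(((1 + L) ^ (N - 1) : NNReal) • Measure.map (graphMap e a) volume) :=
        lintegral_mono' (euclideanHausdorffMeasure_graph_le he ha
          (frontier_subset_graph hΩ ha.continuous h)) le_rfl
    _ = ((1 + L) ^ (N - 1) : NNReal) * ∫⁻ z, ENNReal.ofReal (g (graphMap e a z)) := by
        rw [lintegral_smul_measure, lintegral_map mg hl.continuous.measurable]
        rfl
    _ ≤ ((1 + L) ^ (N - 1) : NNReal) * ∫⁻ y in Ω, ‖fderiv ℝ g y e‖ₑ := by
        gcongr
        calc ∫⁻ z, ENNReal.ofReal (g (graphMap e a z))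
            ≤ ∫⁻ z : (Submodule.span ℝ {e})ᗮ, ∫⁻ t : ℝ,
                S.indicator (fun y => ‖fderiv ℝ g y e‖ₑ) (z + t • e) := by
              refine lintegral_mono fun z => ?_
              refine (le_lintegral_fderiv_ray hg hgc he z (a z)).trans (le_of_eq ?_)
              rw [← lintegral_indicator measurableSet_Ioi]
              refine lintegral_congr fun t => ?_
              have hz : ⟪e, (z : Eu N)⟫_ℝ = 0 :=
                Submodule.mem_orthogonal_singleton_iff_inner_right.1 z.2
              have e1 : perp e (z + t • e) = z := by
                rw [perp_add, perp_smul_self he, add_zero, perp, hz, zero_smul, sub_zero]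
              have e2 : ⟪e, (z : Eu N) + t • e⟫_ℝ = t := by
                rw [inner_add_right, hz, inner_smul_right, real_inner_self_eq_norm_sq, he]
                ring
              have e3 : (z : Eu N) + t • e ∈ S ↔ t ∈ Ioi (a z) := by
                rw [hS, mem_ofPred_eq, e1, e2, mem_Ioi]
              by_cases ht : t ∈ Ioi (a z)
              · rw [indicator_of_mem ht, indicator_of_mem (e3.2 ht)]
              · rw [indicator_of_notMem ht, indicator_of_notMem (mt e3.1 ht)]
          _ = ∫⁻ y, S.indicator (fun y => ‖fderiv ℝ g y e‖ₑ) y :=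
              (lintegral_slices he (md.indicator mS)).symm
          -- On the support of g, which lies in the chart, S and Ω agree; off the support the
          -- derivative vanishes.
          _ ≤ ∫⁻ y, Ω.indicator (fun y => ‖fderiv ℝ g y e‖ₑ) y := by
              refine lintegral_mono fun y => ?_
              by_cases hy : y ∈ tsupport g
              · by_cases hyS : y ∈ S
                · rw [indicator_of_mem hyS, indicator_of_mem ((h y (hgs hy)).2 hyS)]
                · rw [indicator_of_notMem hyS]
                  exact zero_le
              · have : fderiv ℝ g y = 0 := image_eq_zero_of_notMem_tsupport
                  fun h => hy (tsupport_fderiv_subset ℝ h)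
                simp [indicator, this]
          _ = ∫⁻ y in Ω, ‖fderiv ℝ g y e‖ₑ := lintegral_indicator hΩ.measurableSet _

/-- The trace inequality. -/
theorem exists_trace_bound (hΩ : IsBoundedLipschitzDomain Ω) :
    ∃ C : NNReal, ∀ φ : smoothFns N, eLpNorm φ.1 2 (surf Ω) ≤ C * ‖resH1 Ω φ‖ₑ := by
  have hK : IsCompact (frontier Ω) :=
    hΩ.isBounded.isCompact_closure.of_isClosed_subset isClosed_frontier frontier_subset_closure
  obtain ⟨n, χ, hsum, hχ0, hχ1, hχ⟩ := exists_partition hK (p := fun _ U => ∃ (C : NNReal)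
      (e : Eu N), ‖e‖ = 1 ∧ ∀ g : Eu N → ℝ, ContDiff ℝ ∞ g → HasCompactSupport g → tsupport g ⊆ U →
        ∫⁻ y, ENNReal.ofReal (g y) ∂surf Ω ≤ C * ∫⁻ y in Ω, ‖fderiv ℝ g y e‖ₑ) (by
    intro x hx
    obtain ⟨r, e, L, a, hr, he, ha, h⟩ := hΩ.graph x hx
    exact ⟨Metric.ball x r, Metric.isOpen_ball, Metric.mem_ball_self hr, Metric.isBounded_ball,
      (1 + L) ^ (N - 1), e, he, fun g h1 h2 h3 =>
        lintegral_frontier_le_of_graph hΩ.isOpen he ha h h1 h2 h3⟩)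
  -- The chart inequality bounds an L¹ trace by a derivative; applied to χ φ² it bounds the L² trace
  -- of φ.
  have hloc : ∀ i, ∃ C : NNReal, ∀ φ : smoothFns N,
      ∫⁻ y, ENNReal.ofReal ((χ i).1 y * φ.1 y ^ 2) ∂surf Ω ≤
        C * ∫⁻ y in Ω, (‖φ.1 y‖ₑ ^ 2 + ‖gradient φ.1 y‖ₑ ^ 2) := by
    intro i
    obtain ⟨x, -, U, ⟨C, e, he, hC⟩, hs⟩ := hχ i
    have cχ' : Continuous fun y => fderiv ℝ (χ i).1 y e :=
      ((χ i).2.1.continuous_fderiv (by simp)).clm_apply continuous_const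
    obtain ⟨K, hK⟩ := cχ'.bounded_above_of_compact_support ((χ i).2.2.fderiv_apply ℝ e)
    have hK0 : 0 ≤ K := (norm_nonneg _).trans (hK 0)
    -- K bounds the derivative of χ along e, and the 1 comes from 2|φ||∇φ| ≤ φ² + |∇φ|² with χ ≤ 1.
    refine ⟨C * (K + 1).toNNReal, fun φ => ?_⟩
    have hg : ContDiff ℝ ∞ fun y => (χ i).1 y * φ.1 y ^ 2 := (χ i).2.1.mul (φ.2.1.pow 2)
    refine (hC (fun y => (χ i).1 y * φ.1 y ^ 2) hg (χ i).2.2.mul_right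
      ((tsupport_mul_subset_left).trans hs)).trans ?_
    rw [ENNReal.coe_mul, mul_assoc,
      ← lintegral_const_mul' ((K + 1).toNNReal : ENNReal) _ ENNReal.coe_ne_top]
    refine mul_le_mul_right (lintegral_mono fun y => ?_) _
    have hd : fderiv ℝ (fun y => (χ i).1 y * φ.1 y ^ 2) y e =
        fderiv ℝ (χ i).1 y e * φ.1 y ^ 2 + (χ i).1 y * (2 * φ.1 y * ⟪gradient φ.1 y, e⟫_ℝ) := by
      have h1 := ((χ i).2.1.differentiable (by simp) y).hasFDerivAt
      have h2 := ((φ.2.1.differentiable (by simp) y).hasFDerivAt.pow 2)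
      have h3 : HasFDerivAt (fun y => (χ i).1 y * φ.1 y ^ 2) _ y := h1.mul h2
      rw [h3.fderiv, gradient, InnerProductSpace.toDual_symm_apply]
      simp
      ring
    have hb : ‖fderiv ℝ (fun y => (χ i).1 y * φ.1 y ^ 2) y e‖ ≤
        (K + 1) * (‖φ.1 y‖ ^ 2 + ‖gradient φ.1 y‖ ^ 2) := by
      rw [hd]
      have b1 : ‖fderiv ℝ (χ i).1 y e * φ.1 y ^ 2‖ ≤ K * ‖φ.1 y‖ ^ 2 := by
        rw [norm_mul, norm_pow]
        exact mul_le_mul_of_nonneg_right (hK y) (by positivity)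
      have b2 : ‖(χ i).1 y * (2 * φ.1 y * ⟪gradient φ.1 y, e⟫_ℝ)‖ ≤
          ‖φ.1 y‖ ^ 2 + ‖gradient φ.1 y‖ ^ 2 := by
        have b3 : ‖⟪gradient φ.1 y, e⟫_ℝ‖ ≤ ‖gradient φ.1 y‖ := by
          simpa [he] using norm_inner_le_norm (𝕜 := ℝ) (gradient φ.1 y) e
        have b4 : ‖(χ i).1 y‖ ≤ 1 := by
          rw [Real.norm_of_nonneg (hχ0 i y)]
          exact hχ1 i y
        rw [norm_mul, norm_mul, norm_mul, Real.norm_of_nonneg (by norm_num : (0 : ℝ) ≤ 2)]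
        calc _ ≤ 1 * (2 * ‖φ.1 y‖ * ‖gradient φ.1 y‖) := by gcongr
          _ ≤ _ := by nlinarith [sq_nonneg (‖φ.1 y‖ - ‖gradient φ.1 y‖)]
      refine (norm_add_le _ _).trans ?_
      nlinarith [mul_nonneg hK0 (sq_nonneg ‖gradient φ.1 y‖)]
    rw [← ofReal_norm, ← ofReal_norm (φ.1 y),
      ← ofReal_norm (gradient φ.1 y), ← ENNReal.ofReal_pow (norm_nonneg _),
      ← ENNReal.ofReal_pow (norm_nonneg _), ← ENNReal.ofReal_add (by positivity) (by positivity)]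
    change _ ≤ ENNReal.ofReal (K + 1) * _
    rw [← ENNReal.ofReal_mul (by positivity)]
    exact ENNReal.ofReal_le_ofReal hb
  choose C hC using hloc
  -- The factor 2 arises from bounding the L² norms of φ and ∇φ each by the full H¹ norm.
  refine ⟨NNReal.sqrt (2 * ∑ i, C i), fun φ => ?_⟩
  have e1 : ∫⁻ y in Ω, (‖φ.1 y‖ₑ ^ 2 + ‖gradient φ.1 y‖ₑ ^ 2) ≤ 2 * ‖resH1 Ω φ‖ₑ ^ 2 := by
    rw [lintegral_add_left (by have := φ.2.1.continuous; fun_prop), ← sq_eLpNorm_two,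
      ← sq_eLpNorm_two, ← eLpNorm_congr_ae (fn_resH1 φ), ← eLpNorm_congr_ae (grad_resH1 φ),
      ← Lp.enorm_def, ← Lp.enorm_def, two_mul]
    refine add_le_add ?_ ?_ <;> gcongr <;> rw [← ofReal_norm, ← ofReal_norm]
    · exact ENNReal.ofReal_le_ofReal (norm_fn_le _)
    · exact ENNReal.ofReal_le_ofReal (norm_grad_le _)
  have e2 : eLpNorm φ.1 2 (surf Ω) ^ 2 ≤
      ((NNReal.sqrt (2 * ∑ i, C i) : ENNReal) * ‖resH1 Ω φ‖ₑ) ^ 2 := by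
    rw [sq_eLpNorm_two, mul_pow, ← ENNReal.coe_pow, NNReal.sq_sqrt]
    have hmem : ∀ᵐ y ∂surf Ω, y ∈ frontier Ω := ae_restrict_mem isClosed_frontier.measurableSet
    calc ∫⁻ y, ‖φ.1 y‖ₑ ^ 2 ∂surf Ω
        = ∫⁻ y, ∑ i, ENNReal.ofReal ((χ i).1 y * φ.1 y ^ 2) ∂surf Ω := by
          refine lintegral_congr_ae (hmem.mono fun y hy => ?_)
          dsimp only
          rw [← ENNReal.ofReal_sum_of_nonneg fun i _ => mul_nonneg (hχ0 i y) (sq_nonneg _),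
            ← Finset.sum_mul, hsum y hy, one_mul, ← ofReal_norm,
            ← ENNReal.ofReal_pow (norm_nonneg _), Real.norm_eq_abs, sq_abs]
      _ = ∑ i, ∫⁻ y, ENNReal.ofReal ((χ i).1 y * φ.1 y ^ 2) ∂surf Ω := by
          refine lintegral_finsetSum _ fun i _ => ?_
          have := φ.2.1.continuous
          have := (χ i).2.1.continuous
          fun_prop
      _ ≤ ∑ i, (C i : ENNReal) * (2 * ‖resH1 Ω φ‖ₑ ^ 2) :=
          Finset.sum_le_sum fun i _ => (hC i φ).trans (by gcongr)
      _ = _ := by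
          rw [← Finset.sum_mul]
          push_cast
          ring
  exact (ENNReal.pow_le_pow_left_iff two_ne_zero).1 e2

theorem memLp_surf (hΩ : IsBoundedLipschitzDomain Ω) (φ : smoothFns N) :
    MemLp φ.1 2 (surf Ω) := by
  obtain ⟨C, hC⟩ := exists_trace_bound hΩ
  exact ⟨φ.2.1.continuous.aestronglyMeasurable,
    (hC φ).trans_lt (ENNReal.mul_lt_top ENNReal.coe_lt_top enorm_lt_top)⟩

/-- The trace operator. -/
theorem exists_trace (hΩ : IsBoundedLipschitzDomain Ω) :
    ∃ tr : H1 Ω →L[ℝ] L2bdry Ω, (∀ v, IsTrace v (tr v)) ∧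
      ∀ φ, tr (resH1 Ω φ) =ᵐ[surf Ω] φ.1 := by
  obtain ⟨C, hC⟩ := exists_trace_bound hΩ
  let tS : smoothFns N →ₗ[ℝ] L2bdry Ω :=
    { toFun := fun φ => (memLp_surf hΩ φ).toLp
      map_add' := fun φ ψ => MemLp.toLp_add (memLp_surf hΩ φ) (memLp_surf hΩ ψ)
      map_smul' := fun c φ => MemLp.toLp_const_smul c (memLp_surf hΩ φ) }
  have hb : ∀ φ, ‖tS φ‖ ≤ C * ‖resH1 Ω φ‖ := fun φ => by
    have h1 := hC φ
    rw [← eLpNorm_congr_ae (memLp_surf hΩ φ).coeFn_toLp, ← Lp.enorm_def] at h1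
    have h2 := ENNReal.toReal_mono (ENNReal.mul_ne_top ENNReal.coe_ne_top enorm_ne_top) h1
    rw [ENNReal.toReal_mul, toReal_enorm, toReal_enorm, ENNReal.coe_toReal] at h2
    exact h2
  have hd := denseRange_resH1 hΩ
  have htr : ∀ φ, tS.extendOfNorm (resH1 Ω) (resH1 Ω φ) = tS φ :=
    LinearMap.extendOfNorm_eq hd ⟨C, hb⟩
  refine ⟨tS.extendOfNorm (resH1 Ω), fun v => ?_, fun φ => ?_⟩
  swap
  · rw [htr]
    exact (memLp_surf hΩ φ).coeFn_toLp
  obtain ⟨w, hw, hlim⟩ := mem_closure_iff_seq_limit.1 (hd v)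
  choose φ hφ using hw
  have hlim' : Tendsto (fun n => resH1 Ω (φ n)) atTop (𝓝 v) := by simpa only [hφ] using hlim
  refine ⟨fun n => (φ n).1, fun n => (φ n).2, ?_, ?_, ?_⟩
  · have h1 := ((fnL Ω).continuous.tendsto v).comp hlim'
    refine ((Lp.tendsto_Lp_iff_tendsto_eLpNorm' _ _).1 h1).congr fun n => eLpNorm_congr_ae ?_
    filter_upwards [fn_resH1 (Ω := Ω) (φ n)] with x hx
    simp only [Function.comp, Pi.sub_apply, fnL_apply, hx]
  · have h1 := ((gradL Ω).continuous.tendsto v).comp hlim'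
    refine ((Lp.tendsto_Lp_iff_tendsto_eLpNorm' _ _).1 h1).congr fun n => eLpNorm_congr_ae ?_
    filter_upwards [grad_resH1 (Ω := Ω) (φ n)] with x hx
    simp only [Function.comp, Pi.sub_apply, gradL_apply, hx]
  · have h1 := ((tS.extendOfNorm (resH1 Ω)).continuous.tendsto v).comp hlim'
    refine ((Lp.tendsto_Lp_iff_tendsto_eLpNorm' _ _).1 h1).congr fun n => eLpNorm_congr_ae ?_
    filter_upwards [(memLp_surf hΩ (φ n)).coeFn_toLp] with x hx
    simp only [Function.comp, Pi.sub_apply, htr]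
    change (tS (φ n) : Eu N → ℝ) x - _ = _
    change (tS (φ n) : Eu N → ℝ) x = _ at hx
    rw [hx]

end

section


/-! ### Functions of time -/

section Time

variable {X : Type*} [NormedAddCommGroup X] [NormedSpace ℝ X] {T M : ℝ} {k : ℕ} {y : ℝ → X}

theorem BoundedCk.continuousOn (h : BoundedCk k T M y) : ContinuousOn y (Icc 0 T) :=
  h.1.continuousOn

theorem BoundedCk.norm_le (h : BoundedCk k T M y) {t : ℝ} (ht : t ∈ Icc 0 T) : ‖y t‖ ≤ M := by
  simpa using h.2 0 (Nat.zero_le k) t ht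

theorem BoundedCk.exists_deriv [CompleteSpace X] (hT : 0 < T) (h : BoundedCk (k + 1) T M y) :
    ∃ y' : ℝ → X, BoundedCk k T M y' ∧
      ∀ t ∈ Icc 0 T, y t = y 0 + ∫ s in (0 : ℝ)..t, y' s := by
  have hu : UniqueDiffOn ℝ (Icc 0 T) := uniqueDiffOn_Icc hT
  have h1 := (contDiffOn_succ_iff_derivWithin hu (n := (k : ℕ∞))).1 (by exact_mod_cast h.1)
  have hc : ContinuousOn (derivWithin y (Icc 0 T)) (Icc 0 T) := h1.2.2.continuousOn
  refine ⟨derivWithin y (Icc 0 T), ⟨by exact_mod_cast h1.2.2, fun j hj t ht => ?_⟩, fun t ht => ?_⟩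
  · rw [← iteratedDerivWithin_succ']
    exact h.2 (j + 1) (by omega) t ht
  · rw [intervalIntegral.integral_eq_sub_of_hasDerivAt_of_le ht.1
      (h.1.continuousOn.mono (Icc_subset_Icc le_rfl ht.2)) (fun x hx => ?_)
      (intervalIntegrable_of_integrable_timeMeasure (integrable_of_continuousOn hc)
        ⟨le_rfl, hT.le⟩ ht)]
    · abel
    · have hx' : x ∈ Ioo 0 T := ⟨hx.1, hx.2.trans_le ht.2⟩
      exact (h1.1 x ⟨hx'.1.le, hx'.2.le⟩).hasDerivWithinAt.hasDerivAt (Icc_mem_nhds hx'.1 hx'.2)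

theorem norm_sub_le_of_primitive [CompleteSpace X] {y' : ℝ → X} {y₀ : X}
    (hy' : Integrable y' (timeMeasure T)) {L : ℝ} (hL : ∀ᵐ s ∂timeMeasure T, ‖y' s‖ ≤ L)
    (hy : ∀ t ∈ Icc 0 T, y t = y₀ + ∫ s in (0 : ℝ)..t, y' s) :
    ∀ s ∈ Icc 0 T, ∀ t ∈ Icc 0 T, s ≤ t → ‖y t - y s‖ ≤ L * (t - s) := by
  intro s hs t ht hst
  rw [hy t ht, hy s hs, add_sub_add_left_eq_sub, primitive_sub hy' hs ht]
  have := norm_intervalIntegral_le_timeMeasure (f := y') (g := fun _ => L)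
    (integrable_of_continuousOn continuousOn_const) hL hs ht hst
  simpa [mul_comm] using this

/-- The exceptional null set depends on x, but strongly measurable functions have essentially
separable range, so countably many x decide equality. -/
theorem ae_eq_of_forall_inner {E α : Type*} [NormedAddCommGroup E] [InnerProductSpace ℝ E]
    [CompleteSpace E] [MeasurableSpace α] {μ : Measure α} {f g : α → E}
    (hf : AEStronglyMeasurable f μ) (hg : AEStronglyMeasurable g μ)
    (h : ∀ x, ∀ᵐ t ∂μ, ⟪f t, x⟫_ℝ = ⟪g t, x⟫_ℝ) : f =ᵐ[μ] g := by
  obtain ⟨S, hS, hfS⟩ := (hf.sub hg).isSeparable_ae_range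
  have := ae_eq_zero_of_forall_dual_of_isSeparable ℝ hS (f := f - g) (fun c => by
    filter_upwards [h ((InnerProductSpace.toDual ℝ E).symm c)] with t ht
    have e : c (f t - g t) = ⟪(InnerProductSpace.toDual ℝ E).symm c, f t - g t⟫_ℝ :=
      (InnerProductSpace.toDual_symm_apply).symm
    simp only [Pi.sub_apply, Pi.zero_apply]
    rw [e, real_inner_comm, inner_sub_left, ht, sub_self]) hfS
  filter_upwards [this] with t ht
  exact sub_eq_zero.1 ht

theorem memLp_reflect {t : ℝ} (ht : t ∈ Icc 0 T) {E : Type*} [NormedAddCommGroup E] {f : ℝ → E}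
    (hf : MemLp f 2 (timeMeasure T)) : MemLp (fun s => f (t - s)) 2 (timeMeasure t) := by
  have h1 : MemLp f 2 (timeMeasure t) :=
    hf.mono_measure (Measure.restrict_mono (Icc_subset_Icc le_rfl ht.2) le_rfl)
  have h2 := (Measure.measurePreserving_sub_left (volume : Measure ℝ) t).restrict_preimage
    (measurableSet_Icc : MeasurableSet (Icc 0 t))
  have h3 : (fun s => t - s) ⁻¹' Icc 0 t = Icc 0 t := by
    rw [preimage_const_sub_Icc, sub_self, sub_zero]
  rw [h3] at h2
  exact h1.comp_measurePreserving h2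

theorem intervalIntegrable_timeConv {K : ℝ → ℝ} (hK : MemLp K 2 (timeMeasure T))
    (hy : MemLp y 2 (timeMeasure T)) {t : ℝ} (ht : t ∈ Icc 0 T) :
    IntervalIntegrable (fun s => K (t - s) • y s) volume 0 t := by
  have h1 : MemLp y 2 (timeMeasure t) :=
    hy.mono_measure (Measure.restrict_mono (Icc_subset_Icc le_rfl ht.2) le_rfl)
  have h2 : Integrable (fun s => K (t - s) • y s) (timeMeasure t) :=
    memLp_one_iff_integrable.1 (h1.smul (p := 2) (q := 2) (memLp_reflect ht hK))
  exact intervalIntegrable_of_integrable_timeMeasure h2 ⟨le_rfl, ht.1⟩ ⟨ht.1, le_rfl⟩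

theorem timeConv_congr {K : ℝ → ℝ} {y z : ℝ → X} (h : y =ᵐ[timeMeasure T] z) {t : ℝ}
    (ht : t ∈ Icc 0 T) : timeConv K y t = timeConv K z t :=
  intervalIntegral_congr_timeMeasure (T := T) (h.mono fun s hs => by simp only [hs])
    ⟨le_rfl, ht.1.trans ht.2⟩ ht

theorem timeConv_eq_swap (K : ℝ → ℝ) (y : ℝ → X) (t : ℝ) :
    timeConv K y t = ∫ r in (0 : ℝ)..t, K r • y (t - r) := by
  have := intervalIntegral.integral_comp_sub_left (a := 0) (b := t)
    (fun r => K r • y (t - r)) t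
  simp only [sub_sub_cancel, sub_self, sub_zero] at this
  exact this

theorem norm_timeConv_le {K : ℝ → ℝ} {B : ℝ}
    (hKB : ∀ᵐ t ∂timeMeasure T, |K t| ≤ B) (hy : Integrable y (timeMeasure T)) {t : ℝ}
    (ht : t ∈ Icc 0 T) : ‖timeConv K y t‖ ≤ B * ∫ s in (0 : ℝ)..t, ‖y s‖ := by
  have h0 : (0 : ℝ) ∈ Icc 0 T := ⟨le_rfl, ht.1.trans ht.2⟩
  have hi := (intervalIntegrable_of_integrable_timeMeasure hy.norm h0 ht).comp_sub_left t
  simp only [sub_zero, sub_self] at hi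
  rw [timeConv_eq_swap]
  have h1 : ‖∫ r in (0 : ℝ)..t, K r • y (t - r)‖ ≤ ∫ r in (0 : ℝ)..t, B * ‖y (t - r)‖ := by
    refine intervalIntegral.norm_integral_le_of_norm_le ht.1 ?_ (hi.symm.const_mul B)
    filter_upwards [ae_timeMeasure_iff.1 hKB] with r hr hrt
    rw [norm_smul]
    exact mul_le_mul_of_nonneg_right (hr ⟨hrt.1.le, hrt.2.trans ht.2⟩) (norm_nonneg _)
  refine h1.trans (le_of_eq ?_)
  rw [intervalIntegral.integral_const_mul]
  congr 1
  have := intervalIntegral.integral_comp_sub_left (a := 0) (b := t) (fun r => ‖y r‖) t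
  simpa using this

/-- By commutativity of the convolution the bound may be put on y instead of K, leaving ∫ |K| on the
right, as Grönwall for the kernel requires. -/
theorem abs_timeConv_le {K y : ℝ → ℝ} (hK : Integrable K (timeMeasure T)) {B : ℝ}
    (hyB : ∀ᵐ t ∂timeMeasure T, |y t| ≤ B) {t : ℝ}
    (ht : t ∈ Icc 0 T) : |timeConv K y t| ≤ B * ∫ s in (0 : ℝ)..t, |K s| := by
  have h := norm_timeConv_le (y := K) hyB hK ht
  have e : timeConv y K t = timeConv K y t := by
    rw [timeConv_eq_swap, timeConv]
    simp only [smul_eq_mul, mul_comm]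
  rwa [e] at h

/-- `K ∗ y` is Lipschitz continuous if `K` is bounded and `y'` is integrable. -/
theorem norm_timeConv_sub_le [CompleteSpace X] {K : ℝ → ℝ} {B : ℝ}
    (hK : Integrable K (timeMeasure T)) (hB : 0 ≤ B)
    (hKB : ∀ᵐ t ∂timeMeasure T, |K t| ≤ B) {y' : ℝ → X} {y₀ : X}
    (hy' : Integrable y' (timeMeasure T)) (hy : ∀ t ∈ Icc 0 T, y t = y₀ + ∫ s in (0 : ℝ)..t, y' s)
    {Y : ℝ} (hY : ∀ t ∈ Icc 0 T, ‖y t‖ ≤ Y) :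
    ∀ s ∈ Icc 0 T, ∀ t ∈ Icc 0 T, s ≤ t →
      ‖timeConv K y t - timeConv K y s‖ ≤ B * (Y + ∫ r, ‖y' r‖ ∂timeMeasure T) * (t - s) := by
  intro s hs t ht hst
  have hT : 0 ≤ T := hs.1.trans hs.2
  have h0 : (0 : ℝ) ∈ Icc 0 T := ⟨le_rfl, hT⟩
  have cy : ContinuousOn y (Icc 0 T) :=
    (continuousOn_const.add (continuousOn_primitive hy' hT)).congr hy
  have cmaps : ∀ q ∈ Icc 0 T, ContinuousOn (fun r => y (q - r)) (uIcc 0 q) := fun q hq => by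
    refine cy.comp (by fun_prop) fun r hr => ?_
    rw [uIcc_of_le hq.1] at hr
    exact ⟨by linarith [hr.2], by linarith [hr.1, hq.2]⟩
  have iK : ∀ {p q : ℝ}, p ∈ Icc 0 T → q ∈ Icc 0 T → IntervalIntegrable K volume p q := fun hp hq =>
    intervalIntegrable_of_integrable_timeMeasure hK hp hq
  have i1 : IntervalIntegrable (fun r => K r • y (t - r)) volume 0 t :=
    (iK h0 ht).smul_continuousOn (cmaps t ht)
  have i1a : IntervalIntegrable (fun r => K r • y (t - r)) volume 0 s :=
    i1.mono_set (by rw [uIcc_of_le hs.1, uIcc_of_le ht.1]; exact Icc_subset_Icc le_rfl hst)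
  have i1b : IntervalIntegrable (fun r => K r • y (t - r)) volume s t :=
    i1.mono_set (by rw [uIcc_of_le hst, uIcc_of_le ht.1]; exact Icc_subset_Icc hs.1 le_rfl)
  have i2 : IntervalIntegrable (fun r => K r • y (s - r)) volume 0 s :=
    (iK h0 hs).smul_continuousOn (cmaps s hs)
  -- The common range [0, s] carries increments of y, the extra range [s, t] carries y itself.
  have e : timeConv K y t - timeConv K y s =
      (∫ r in (0 : ℝ)..s, K r • (y (t - r) - y (s - r))) + ∫ r in s..t, K r • y (t - r) := by
    simp only [smul_sub]
    rw [timeConv_eq_swap, timeConv_eq_swap, intervalIntegral.integral_sub i1a i2,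
      ← intervalIntegral.integral_add_adjacent_intervals i1a i1b]
    abel
  have b2 : ‖∫ r in s..t, K r • y (t - r)‖ ≤ B * Y * (t - s) := by
    have h1 := norm_intervalIntegral_le_timeMeasure (T := t) (f := fun r => K r • y (t - r))
      (g := fun _ => B * Y) (integrable_of_continuousOn continuousOn_const)
      (ae_timeMeasure_iff.2 (by
        filter_upwards [ae_timeMeasure_iff.1 hKB] with r hr hrt
        rw [norm_smul]
        exact mul_le_mul (hr ⟨hrt.1, hrt.2.trans ht.2⟩)
          (hY _ ⟨by linarith [hrt.2], by linarith [hrt.1, ht.2]⟩) (norm_nonneg _) hB))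
      (a := s) (b := t) ⟨hs.1, hst⟩ ⟨ht.1, le_rfl⟩ hst
    simp only [intervalIntegral.integral_const, smul_eq_mul] at h1
    linarith
  have n' := hy'.norm
  set τ := t - s with hτ
  have hτ0 : 0 ≤ τ := sub_nonneg.2 hst
  have cmov : ContinuousOn (fun q => ∫ r in q..(q + τ), ‖y' r‖) (Icc 0 s) := by
    have c := continuousOn_primitive n' hT
    have e1 : ∀ q ∈ Icc 0 s, ∫ r in q..(q + τ), ‖y' r‖ =
        (∫ r in (0 : ℝ)..(q + τ), ‖y' r‖) - ∫ r in (0 : ℝ)..q, ‖y' r‖ := fun q hq =>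
      (primitive_sub n' ⟨hq.1, hq.2.trans hs.2⟩
        ⟨by linarith [hq.1], by linarith [hq.2, ht.2]⟩).symm
    refine ContinuousOn.congr (ContinuousOn.sub ?_ (c.mono (Icc_subset_Icc le_rfl hs.2))) e1
    exact c.comp (f := fun q => q + τ) (by fun_prop)
      fun q hq => ⟨by linarith [hq.1], by linarith [hq.2, ht.2]⟩
  -- The increments of y are moving integrals of y' over windows of length τ; integrating them over
  -- time costs only τ ∫ ‖y'‖, so boundedness of K is enough for a Lipschitz bound.
  have b1 : ‖∫ r in (0 : ℝ)..s, K r • (y (t - r) - y (s - r))‖ ≤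
      B * (τ * ∫ r, ‖y' r‖ ∂timeMeasure T) := by
    have icm : IntervalIntegrable (fun q => ∫ r in q..(q + τ), ‖y' r‖) volume 0 s :=
      (by rw [← uIcc_of_le hs.1] at cmov; exact cmov.intervalIntegrable)
    have hi := icm.comp_sub_left s
    simp only [sub_zero, sub_self] at hi
    have h1 : ‖∫ r in (0 : ℝ)..s, K r • (y (t - r) - y (s - r))‖ ≤
        ∫ r in (0 : ℝ)..s, B * ∫ q in (s - r)..(s - r + τ), ‖y' q‖ := by
      refine intervalIntegral.norm_integral_le_of_norm_le hs.1 ?_ (hi.symm.const_mul B)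
      filter_upwards [ae_timeMeasure_iff.1 hKB] with r hr hrt
      have m1 : s - r ∈ Icc 0 T := ⟨by linarith [hrt.2], by linarith [hrt.1, hs.2]⟩
      have m2 : t - r ∈ Icc 0 T := ⟨by linarith [hrt.2], by linarith [hrt.1, ht.2]⟩
      have e2 : s - r + τ = t - r := by rw [hτ]; ring
      rw [norm_smul, e2]
      refine mul_le_mul (hr ⟨hrt.1.le, hrt.2.trans hs.2⟩) ?_ (norm_nonneg _) hB
      rw [hy _ m1, hy _ m2, add_sub_add_left_eq_sub, primitive_sub hy' m1 m2]
      exact intervalIntegral.norm_integral_le_integral_norm (by linarith)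
    refine h1.trans ?_
    rw [intervalIntegral.integral_const_mul]
    refine mul_le_mul_of_nonneg_left ?_ hB
    have h2 := intervalIntegral.integral_comp_sub_left (a := 0) (b := s)
      (fun q => ∫ r in q..(q + τ), ‖y' r‖) s
    simp only [sub_zero, sub_self] at h2
    rw [h2]
    exact integral_movingIntegral_le n' (Eventually.of_forall fun r => norm_nonneg _) hτ0 hs.1
      (by linarith [ht.2])
  rw [e]
  refine (norm_add_le_of_le b1 b2).trans (le_of_eq ?_)
  ring

theorem continuousOn_of_norm_sub_le {f : ℝ → X} {c : ℝ → ℝ → ℝ}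
    (h : ∀ s ∈ Icc 0 T, ∀ t ∈ Icc 0 T, s ≤ t → ‖f t - f s‖ ≤ c s t)
    (hc : ∀ s ∈ Icc 0 T, Tendsto (fun t => c s t + c t s) (𝓝[Icc 0 T] s) (𝓝 0))
    (hc0 : ∀ s t, 0 ≤ c s t) : ContinuousOn f (Icc 0 T) := by
  intro s hs
  rw [ContinuousWithinAt, tendsto_iff_norm_sub_tendsto_zero]
  refine squeeze_zero' (Eventually.of_forall fun t => norm_nonneg _) ?_ (hc s hs)
  filter_upwards [self_mem_nhdsWithin] with t ht
  rcases le_total s t with hst | hst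
  · linarith [h s hs t ht hst, hc0 t s]
  · rw [norm_sub_rev]
    linarith [h t ht s hs hst, hc0 s t]

end Time

end

/-! ### The nonlinearity in L²(Ω), and the bound on the kernel -/

section


variable {N : ℕ} {Ω : Set (Eu N)} {T w₀ M : ℝ}

/-- The sum of a partition of unity on the compact closure of Ω is smooth, compactly supported and
equal to 1 on Ω. The constant 1 is the test function that isolates the kernel. -/
theorem exists_one (hΩ : IsOpen Ω) (hb : Bornology.IsBounded Ω) :
    ∃ o : H1 Ω, (fn o =ᵐ[volume.restrict Ω] fun _ => (1 : ℝ)) ∧ grad o = 0 := by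
  obtain ⟨n, χ, hsum, -, -, -⟩ := exists_partition hb.isCompact_closure (p := fun _ _ => True)
    (fun x _ => ⟨Metric.ball x 1, Metric.isOpen_ball, Metric.mem_ball_self one_pos,
      Metric.isBounded_ball, trivial⟩)
  set ξ := ∑ i, χ i with hξ
  have hξ1 : ∀ x ∈ Ω, ξ.1 x = 1 := fun x hx => by
    rw [← hsum x (subset_closure hx), hξ]
    simp
  have hmem : ∀ᵐ x ∂(volume.restrict Ω), x ∈ Ω := ae_restrict_mem hΩ.measurableSet
  refine ⟨resH1 Ω ξ, ?_, ?_⟩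
  · filter_upwards [fn_resH1 (Ω := Ω) ξ, hmem] with x h1 h2
    rw [h1, hξ1 x h2]
  · rw [Lp.eq_zero_iff_ae_eq_zero]
    filter_upwards [grad_resH1 (Ω := Ω) ξ, hmem] with x h1 h2
    have : ξ.1 =ᶠ[𝓝 x] fun _ => 1 := by
      filter_upwards [hΩ.mem_nhds h2] with y hy using hξ1 y hy
    rw [h1, gradient, this.fderiv_eq]
    simp

theorem inner_one {o : H1 Ω} (ho : fn o =ᵐ[volume.restrict Ω] fun _ => (1 : ℝ)) (v : L2 Ω) :
    ⟪v, fn o⟫_ℝ = ∫ x in Ω, v x := by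
  rw [L2.inner_def]
  refine integral_congr_ae (ho.mono fun x hx => ?_)
  simp [hx]

theorem norm_le_mul_norm_one {o : H1 Ω} (ho : fn o =ᵐ[volume.restrict Ω] fun _ => (1 : ℝ))
    {v : L2 Ω} {c : ℝ} (hv : ∀ᵐ x ∂(volume.restrict Ω), |v x| ≤ c) : ‖v‖ ≤ c * ‖fn o‖ := by
  refine Lp.norm_le_mul_norm_of_ae_le_mul ?_
  filter_upwards [hv, ho] with x h1 h2
  simpa [h2] using h1

/-- The function `f(·, t, v, ∇v)`. -/
def fval (D : Data Ω) (t : ℝ) (v : H1 Ω) (x : Eu N) : ℝ := D.f x t (fn v x) (grad v x)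

open Classical in
/-- The function `f(·, t, v, ∇v)` as an element of `L²(Ω)`. -/
def nlL2 (D : Data Ω) (t : ℝ) (v : H1 Ω) : L2 Ω :=
  if h : MemLp (fval D t v) 2 (volume.restrict Ω) then h.toLp else 0

section Nonlinearity

variable {D : Data Ω} {o : H1 Ω}

theorem memLp_fval (hD : D.Basic T w₀ M) (hΩ : IsOpen Ω) (hb : Bornology.IsBounded Ω) {t : ℝ}
    (ht : t ∈ Icc 0 T) (v : H1 Ω) : MemLp (fval D t v) 2 (volume.restrict Ω) := by
  haveI : IsFiniteMeasure (volume.restrict Ω) :=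
    ⟨by rw [Measure.restrict_apply_univ]; exact hb.measure_lt_top⟩
  have hm : Measurable (fval D t v) := hD.f_measurable.comp
    (measurable_id.prodMk (measurable_const.prodMk ((Lp.stronglyMeasurable (fn v)).measurable.prodMk
      (Lp.stronglyMeasurable (grad v)).measurable)))
  refine MemLp.of_bound hm.aestronglyMeasurable M ?_
  filter_upwards [ae_restrict_mem hΩ.measurableSet] with x hx
  exact hD.f_bounded x hx t ht _ _

theorem coeFn_nlL2 (hD : D.Basic T w₀ M) (hΩ : IsOpen Ω) (hb : Bornology.IsBounded Ω) {t : ℝ}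
    (ht : t ∈ Icc 0 T) (v : H1 Ω) : nlL2 D t v =ᵐ[volume.restrict Ω] fval D t v := by
  rw [nlL2, dif_pos (memLp_fval hD hΩ hb ht v)]
  exact MemLp.coeFn_toLp _

theorem inner_nlL2 (hD : D.Basic T w₀ M) (hΩ : IsOpen Ω) (hb : Bornology.IsBounded Ω) {t : ℝ}
    (ht : t ∈ Icc 0 T) (v φ : H1 Ω) : ⟪nlL2 D t v, fn φ⟫_ℝ = D.nonlinearity t v φ := by
  rw [L2.inner_def, Data.nonlinearity]
  refine integral_congr_ae ((coeFn_nlL2 hD hΩ hb ht v).mono fun x hx => ?_)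
  simp [hx, fval, mul_comm]

theorem norm_nlL2_le (hD : D.Basic T w₀ M) (hΩ : IsOpen Ω) (hb : Bornology.IsBounded Ω)
    (ho : fn o =ᵐ[volume.restrict Ω] fun _ => (1 : ℝ)) {t : ℝ} (ht : t ∈ Icc 0 T) (v : H1 Ω) :
    ‖nlL2 D t v‖ ≤ M * ‖fn o‖ := by
  refine norm_le_mul_norm_one ho ?_
  filter_upwards [coeFn_nlL2 hD hΩ hb ht v, ae_restrict_mem hΩ.measurableSet] with x h1 h2
  rw [h1]
  exact hD.f_bounded x h2 t ht _ _

/-- The Lipschitz bound of f at the same point x, integrated over Ω; the 2 comes from estimating the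
function and the gradient separately by the H¹ norm. -/
theorem norm_nlL2_sub_le (hD : D.Basic T w₀ M) (hD' : D.SecondOrder T M) (hM : 0 ≤ M)
    (hΩ : IsOpen Ω) (hb : Bornology.IsBounded Ω)
    (ho : fn o =ᵐ[volume.restrict Ω] fun _ => (1 : ℝ)) {s t : ℝ} (hs : s ∈ Icc 0 T)
    (ht : t ∈ Icc 0 T) (v w : H1 Ω) :
    ‖nlL2 D t v - nlL2 D s w‖ ≤ M * (|t - s| * ‖fn o‖ + 2 * ‖v - w‖) := by
  have m1 := (Lp.memLp (fn v - fn w)).norm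
  have m2 := (Lp.memLp (grad v - grad w)).norm
  have n1 : ‖m1.toLp‖ = ‖fn v - fn w‖ := by rw [Lp.norm_toLp, eLpNorm_norm, ← Lp.norm_def]
  have n2 : ‖m2.toLp‖ = ‖grad v - grad w‖ := by rw [Lp.norm_toLp, eLpNorm_norm, ← Lp.norm_def]
  set G : L2 Ω := |t - s| • fn o + m1.toLp + m2.toLp with hG
  have h1 : ‖nlL2 D t v - nlL2 D s w‖ ≤ M * ‖G‖ := by
    refine Lp.norm_le_mul_norm_of_ae_le_mul ?_
    filter_upwards [coeFn_nlL2 hD hΩ hb ht v, coeFn_nlL2 hD hΩ hb hs w, m1.coeFn_toLp,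
      m2.coeFn_toLp, Lp.coeFn_sub (nlL2 D t v) (nlL2 D s w), Lp.coeFn_sub (fn v) (fn w),
      Lp.coeFn_sub (grad v) (grad w), Lp.coeFn_add (|t - s| • fn o + m1.toLp) m2.toLp,
      Lp.coeFn_add (|t - s| • fn o) m1.toLp, Lp.coeFn_smul |t - s| (fn o), ho,
      ae_restrict_mem hΩ.measurableSet] with x a1 a2 a3 a4 a5 a6 a7 a8 a9 a10 a11 a12
    have e1 : G x = |t - s| + |fn v x - fn w x| + ‖grad v x - grad w x‖ := by
      rw [hG, a8, Pi.add_apply, a9, Pi.add_apply, a10, Pi.smul_apply, a11, a3, a4, a6, a7]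
      simp
    have e2 : ‖G x‖ = G x := Real.norm_of_nonneg (by rw [e1]; positivity)
    rw [a5, Pi.sub_apply, a1, a2, e2, e1]
    have := hD'.f_lipschitz x a12 x a12 t ht s hs (fn v x) (fn w x) (grad v x) (grad w x)
    simpa [fval] using this
  have h2 : ‖G‖ ≤ |t - s| * ‖fn o‖ + ‖fn v - fn w‖ + ‖grad v - grad w‖ := by
    refine (norm_add₃_le).trans (le_of_eq ?_)
    rw [n1, n2, norm_smul, Real.norm_eq_abs, abs_abs]
  have h3 : ‖fn v - fn w‖ ≤ ‖v - w‖ := norm_fn_le (v - w)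
  have h4 : ‖grad v - grad w‖ ≤ ‖v - w‖ := norm_grad_le (v - w)
  exact h1.trans (mul_le_mul_of_nonneg_left (by linarith) hM)

end Nonlinearity

theorem inner_timeConv {X : Type*} [NormedAddCommGroup X] [InnerProductSpace ℝ X] [CompleteSpace X]
    {K : ℝ → ℝ} {y : ℝ → X} (hK : MemLp K 2 (timeMeasure T)) (hy : MemLp y 2 (timeMeasure T))
    {t : ℝ} (ht : t ∈ Icc 0 T) (x : X) :
    ⟪timeConv K y t, x⟫_ℝ = timeConv K (fun s => ⟪y s, x⟫_ℝ) t := by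
  have := (innerSL ℝ x).intervalIntegral_comp_comm (intervalIntegrable_timeConv hK hy ht)
  rw [real_inner_comm]
  refine Eq.trans this.symm ?_
  refine intervalIntegral.integral_congr fun s _ => ?_
  simp [inner_smul_right, real_inner_comm]

section Kernel

variable {tr : H1 Ω →L[ℝ] L2bdry Ω} {o : H1 Ω}

/-- Testing the equation with `1` determines the kernel. -/
theorem kernel_formula (hΩ : IsOpen Ω) (hb : Bornology.IsBounded Ω) (hT : 0 < T)
    (htr : ∀ v, IsTrace v (tr v)) (ho : fn o =ᵐ[volume.restrict Ω] fun _ => (1 : ℝ))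
    (hgo : grad o = 0) {D : Data Ω} (hD : D.Basic T w₀ M) {u : ℝ → H1 Ω} {K : ℝ → ℝ}
    (hs : IsWeakSolution D T u K) {m' : ℝ → ℝ} (hm' : Integrable m' (timeMeasure T))
    (hm : ∀ t ∈ Icc 0 T, D.m t = D.m 0 + ∫ s in (0 : ℝ)..t, m' s) :
    ∀ᵐ t ∂timeMeasure T, K t * ⟪D.h t, fn o⟫_ℝ =
      ⟪nlL2 D t (u t), fn o⟫_ℝ - ⟪D.g t, tr o⟫_ℝ - m' t - timeConv K D.m t := by
  obtain ⟨hy', hy⟩ := hs.equation o (tr o) (htr o)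
  set y' := fun t => D.nonlinearity t (u t) o - ⟪grad (u t), grad o⟫_ℝ - ⟪D.g t, tr o⟫_ℝ
        - K t * ⟪D.h t, fn o⟫_ℝ - ⟪timeConv K (fun s => fn (u s)) t, fn o⟫_ℝ with hy'def
  have hmeas : ∀ᵐ t ∂timeMeasure T, ⟪fn (u t), fn o⟫_ℝ = D.m t :=
    hs.measurement.mono fun t ht => by rw [inner_one ho, ht]
  have h0 : (0 : ℝ) ∈ Icc 0 T := ⟨le_rfl, hT.le⟩
  have cm : ContinuousOn D.m (Icc 0 T) := hD.m_C1.continuousOn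
  have h1 : ∀ t ∈ Icc 0 T, D.m t = ⟪D.u₀, fn o⟫_ℝ + ∫ s in (0 : ℝ)..t, y' s := by
    refine eqOn_of_ae_eq hT ?_ cm (continuousOn_const.add (continuousOn_primitive hy' hT.le))
    filter_upwards [hmeas, hy] with t a1 a2
    rw [← a1, a2]
  -- The mass (u, 1) equals m, so the right-hand side of the equation tested with 1 must be m'.
  have h2 : y' =ᵐ[timeMeasure T] m' := by
    refine ae_eq_of_primitive_eq hy' hm' fun t ht => ?_
    have a1 := h1 0 h0
    rw [intervalIntegral.integral_same, add_zero] at a1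
    have a2 := h1 t ht
    have a3 := hm t ht
    linarith
  filter_upwards [h2, ae_mem_Icc] with t ht htm
  have e1 : ⟪timeConv K (fun s => fn (u s)) t, fn o⟫_ℝ = timeConv K D.m t := by
    exact (inner_timeConv hs.K_memLp (memLp_clm (fnL Ω) hs.u_memLp) htm (fn o)).trans
      (timeConv_congr hmeas htm)
  simp only [hy'def, e1, hgo, inner_zero_right, ← inner_nlL2 hD hΩ hb htm] at ht
  linarith

/-- The formula for K is a Volterra inequality |K| ≤ A + b ∫ |K|. It contains u only through the
bounded f, so the constant depends on the data alone. -/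
theorem exists_kernel_bound (hΩ : IsOpen Ω) (hb : Bornology.IsBounded Ω) (hT : 0 < T)
    (hw₀ : 0 < w₀) (hM : 0 ≤ M) (htr : ∀ v, IsTrace v (tr v))
    (ho : fn o =ᵐ[volume.restrict Ω] fun _ => (1 : ℝ)) (hgo : grad o = 0) :
    ∃ B : ℝ, 0 ≤ B ∧ ∀ D : Data Ω, D.Basic T w₀ M → ∀ (u : ℝ → H1 Ω) (K : ℝ → ℝ),
      IsWeakSolution D T u K → ∀ᵐ t ∂timeMeasure T, |K t| ≤ B := by
  set A := w₀⁻¹ * (M * ‖fn o‖ * ‖fn o‖ + M * ‖tr o‖ + M) with hA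
  set b := w₀⁻¹ * M with hbdef
  have nA : 0 ≤ A := by positivity
  have nb : 0 ≤ b := by positivity
  refine ⟨A + b * (T * A * Real.exp (b * T)), by positivity, fun D hD u K hs => ?_⟩
  obtain ⟨m', hm', hm⟩ := hD.m_C1.exists_deriv hT
  have iK : Integrable (fun s => |K s|) (timeMeasure T) := (integrable_of_memLp_two hs.K_memLp).abs
  have main : ∀ᵐ t ∂timeMeasure T, |K t| ≤ A + b * ∫ s in (0 : ℝ)..t, |K s| := by
    filter_upwards [kernel_formula hΩ hb hT htr ho hgo hD hs
      (integrable_of_continuousOn hm'.continuousOn) hm, ae_mem_Icc] with t ht htm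
    have a1 : w₀ ≤ |⟪D.h t, fn o⟫_ℝ| := by
      rw [inner_one ho]
      exact hD.h_mean t htm
    have a2 : |⟪nlL2 D t (u t), fn o⟫_ℝ| ≤ M * ‖fn o‖ * ‖fn o‖ :=
      (abs_real_inner_le_norm _ _).trans (mul_le_mul_of_nonneg_right
        (norm_nlL2_le hD hΩ hb ho htm _) (norm_nonneg _))
    have a3 : |⟪D.g t, tr o⟫_ℝ| ≤ M * ‖tr o‖ :=
      (abs_real_inner_le_norm _ _).trans (mul_le_mul_of_nonneg_right
        (hD.g_continuous.norm_le htm) (norm_nonneg _))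
    have a4 : |m' t| ≤ M := hm'.norm_le htm
    have a5 : |timeConv K D.m t| ≤ M * ∫ s in (0 : ℝ)..t, |K s| :=
      abs_timeConv_le (integrable_of_memLp_two hs.K_memLp)
        (ae_mem_Icc.mono fun s hs => hD.m_C1.norm_le hs) htm
    have a6 : w₀ * |K t| ≤ M * ‖fn o‖ * ‖fn o‖ + M * ‖tr o‖ + M +
        M * ∫ s in (0 : ℝ)..t, |K s| := by
      calc w₀ * |K t| ≤ |⟪D.h t, fn o⟫_ℝ| * |K t| :=
            mul_le_mul_of_nonneg_right a1 (abs_nonneg _)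
        _ = |⟪nlL2 D t (u t), fn o⟫_ℝ - ⟪D.g t, tr o⟫_ℝ - m' t - timeConv K D.m t| := by
            rw [← ht, abs_mul, mul_comm]
        _ ≤ _ := by
            refine (abs_sub _ _).trans (add_le_add ((abs_sub _ _).trans (add_le_add
              ((abs_sub _ _).trans (add_le_add a2 a3)) a4)) a5)
    calc |K t| = w₀⁻¹ * (w₀ * |K t|) := by field_simp
      _ ≤ w₀⁻¹ * (M * ‖fn o‖ * ‖fn o‖ + M * ‖tr o‖ + M + M * ∫ s in (0 : ℝ)..t, |K s|) :=
          mul_le_mul_of_nonneg_left a6 (by positivity)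
      _ = _ := by rw [hA, hbdef]; ring
  clear_value A b
  have cφ := continuousOn_primitive iK hT.le
  have h0 : (0 : ℝ) ∈ Icc 0 T := ⟨le_rfl, hT.le⟩
  -- K is only square integrable, so Grönwall is applied to the continuous primitive of |K|, and the
  -- inequality for K is used once more afterwards.
  have gr := gronwall_integral (A := T * A) nb cφ fun t ht => by
    have ib : Integrable (fun s => b * ∫ r in (0 : ℝ)..s, |K r|) (timeMeasure T) :=
      integrable_of_continuousOn (continuousOn_const.mul cφ)
    have h1 := intervalIntegral_mono_timeMeasure iK ((integrable_of_continuousOn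
      (f := fun _ => A) continuousOn_const).add ib) main h0 ht ht.1
    refine h1.trans ?_
    simp only [Pi.add_apply]
    rw [intervalIntegral.integral_add (by simp)
      (intervalIntegrable_of_integrable_timeMeasure ib h0 ht), intervalIntegral.integral_const_mul]
    simp only [intervalIntegral.integral_const, sub_zero, smul_eq_mul]
    have := mul_le_mul_of_nonneg_right ht.2 nA
    linarith
  filter_upwards [main, ae_mem_Icc] with t ht htm
  refine ht.trans ?_
  have h1 := gr t htm
  have h2 : T * A * Real.exp (b * t) ≤ T * A * Real.exp (b * T) := by
    have := htm.2
    gcongr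
  have := mul_le_mul_of_nonneg_left (h1.trans h2) nb
  linarith

end Kernel

end

/-! ### The weak equation as an identity in H¹(Ω), and the basic estimate -/

section


variable {N : ℕ} {Ω : Set (Eu N)} {T w₀ M : ℝ}

/-- The forcing `f(u, ∇u) - K h - K ∗ u` in `L²(Ω)`. -/
def forcing (D : Data Ω) (u : ℝ → H1 Ω) (K : ℝ → ℝ) (t : ℝ) : L2 Ω :=
  nlL2 D t (u t) - K t • D.h t - timeConv K (fun s => fn (u s)) t

variable {tr : H1 Ω →L[ℝ] L2bdry Ω} {o : H1 Ω}

/-- The element tr* g represents the boundary functional φ ↦ (g, φ)_Γ in H¹(Ω); it plays the role of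
ℓ in the abstract equation. -/
theorem continuousOn_lam {D : Data Ω} (hD : D.Basic T w₀ M) :
    ContinuousOn (fun t => rieszAdj tr (D.g t)) (Icc 0 T) :=
  (rieszAdj tr).continuous.comp_continuousOn hD.g_continuous.continuousOn

theorem norm_lam_le {D : Data Ω} (hD : D.Basic T w₀ M) {t : ℝ} (ht : t ∈ Icc 0 T) :
    ‖rieszAdj tr (D.g t)‖ ≤ ‖rieszAdj tr‖ * M :=
  (rieszAdj tr).le_opNorm_of_le (hD.g_continuous.norm_le ht)

/-- The right-hand side of the equation for `u` in `H¹(Ω)*`. -/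
theorem weak_rhs_eq (hΩ : IsOpen Ω) (hb : Bornology.IsBounded Ω)
    {D : Data Ω} (hD : D.Basic T w₀ M) (u : ℝ → H1 Ω) (K : ℝ → ℝ) {t : ℝ} (ht : t ∈ Icc 0 T)
    (φ : H1 Ω) :
    D.nonlinearity t (u t) φ - ⟪grad (u t), grad φ⟫_ℝ - ⟪D.g t, tr φ⟫_ℝ
        - K t * ⟪D.h t, fn φ⟫_ℝ - ⟪timeConv K (fun s => fn (u s)) t, fn φ⟫_ℝ =
      ⟪rieszAdj (fnL Ω) (forcing D u K t) - (u t - gramOp (fnL Ω) (u t)) - rieszAdj tr (D.g t),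
        φ⟫_ℝ := by
  rw [inner_sub_left, inner_sub_left, inner_sub_left, inner_rieszAdj, inner_rieszAdj, inner_gramOp,
    inner_H1, fnL_apply, fnL_apply, forcing, inner_sub_left, inner_sub_left,
    inner_nlL2 hD hΩ hb ht, inner_smul_left]
  simp
  ring

/-- The scalar equations for the individual φ are collected into one identity in H¹(Ω). The memory
term is estimated by Cauchy–Schwarz in time, which leaves a bound of Grönwall type for the forcing.
-/
theorem weak_formulation (hΩ : IsOpen Ω) (hb : Bornology.IsBounded Ω) (hT : 0 < T)
    (htr : ∀ v, IsTrace v (tr v)) (ho : fn o =ᵐ[volume.restrict Ω] fun _ => (1 : ℝ))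
    {D : Data Ω} (hD : D.Basic T w₀ M) {u : ℝ → H1 Ω} {K : ℝ → ℝ} (hs : IsWeakSolution D T u K)
    {B : ℝ} (hB : 0 ≤ B) (hK : ∀ᵐ t ∂timeMeasure T, |K t| ≤ B) :
    MemLp (forcing D u K) 2 (timeMeasure T) ∧
    (∀ᵐ t ∂timeMeasure T, ‖forcing D u K t‖ ^ 2 ≤ 2 * (M * ‖fn o‖ + B * M) ^ 2 +
      2 * B ^ 2 * T * ∫ s in (0 : ℝ)..t, ‖fnL Ω (u s)‖ ^ 2) ∧
    ∀ᵐ t ∂timeMeasure T, gramOp (fnL Ω) (u t) = rieszAdj (fnL Ω) D.u₀ +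
      ∫ s in (0 : ℝ)..t, (rieszAdj (fnL Ω) (forcing D u K s) - (u s - gramOp (fnL Ω) (u s))
        - rieszAdj tr (D.g s)) := by
  have h0 : (0 : ℝ) ∈ Icc 0 T := ⟨le_rfl, hT.le⟩
  have mfu : MemLp (fun s => fn (u s)) 2 (timeMeasure T) := memLp_clm (fnL Ω) hs.u_memLp
  have mgu : MemLp (fun s => grad (u s)) 2 (timeMeasure T) := memLp_clm (gradL Ω) hs.u_memLp
  -- Pairings of the forcing with φ are measurable because the weak equation asserts that its
  -- right-hand side is integrable in time; Pettis' theorem then gives measurability in L²(Ω).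
  have measF : AEStronglyMeasurable (forcing D u K) (timeMeasure T) := by
    refine aestronglyMeasurable_of_inner (denseRange_fnL hΩ) fun φ => ?_
    obtain ⟨hy', -⟩ := hs.equation φ (tr φ) (htr φ)
    have cg : AEStronglyMeasurable (fun t => ⟪D.g t, tr φ⟫_ℝ) (timeMeasure T) :=
      (integrable_of_continuousOn (hD.g_continuous.continuousOn.inner continuousOn_const)).1
    refine ((hy'.1.add (mgu.1.inner (aestronglyMeasurable_const (b := grad φ)))).add cg).congr ?_
    filter_upwards [ae_mem_Icc] with t ht
    simp only [Pi.add_apply, fnL_apply, forcing, inner_sub_left, inner_nlL2 hD hΩ hb ht,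
      real_inner_smul_left]
    ring
  have bound : ∀ᵐ t ∂timeMeasure T, ‖forcing D u K t‖ ^ 2 ≤ 2 * (M * ‖fn o‖ + B * M) ^ 2 +
      2 * B ^ 2 * T * ∫ s in (0 : ℝ)..t, ‖fnL Ω (u s)‖ ^ 2 := by
    filter_upwards [hK, ae_mem_Icc] with t hKt ht
    have a1 := norm_nlL2_le hD hΩ hb ho ht (u t)
    have a2 : ‖K t • D.h t‖ ≤ B * M := by
      rw [norm_smul]
      exact mul_le_mul hKt (hD.h_continuous.norm_le ht) (norm_nonneg _) hB
    have a3 := norm_timeConv_le hK (integrable_of_memLp_two mfu) ht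
    have a4 := sq_norm_intervalIntegral_le (f := fun s => ‖fn (u s)‖) mfu.norm h0 ht ht.1
    simp only [Real.norm_eq_abs, sq_abs, sub_zero] at a4
    set p := ‖timeConv K (fun s => fn (u s)) t‖ with hp
    set I := ∫ s in (0 : ℝ)..t, ‖fn (u s)‖ with hI
    set J := ∫ s in (0 : ℝ)..t, ‖fn (u s)‖ ^ 2 with hJ
    have nJ : 0 ≤ J := intervalIntegral.integral_nonneg ht.1 fun s _ => by positivity
    have a5 : p ^ 2 ≤ B ^ 2 * T * J := by
      calc p ^ 2 ≤ (B * I) ^ 2 := pow_le_pow_left₀ (norm_nonneg _) a3 2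
        _ = B ^ 2 * I ^ 2 := mul_pow _ _ _
        _ ≤ B ^ 2 * (t * J) := by gcongr
        _ ≤ B ^ 2 * (T * J) := by have := ht.2; gcongr
        _ = _ := by ring
    have a6 : ‖forcing D u K t‖ ≤ (M * ‖fn o‖ + B * M) + p :=
      norm_sub_le_of_le (norm_sub_le_of_le a1 a2) le_rfl
    have a7 := pow_le_pow_left₀ (norm_nonneg _) a6 2
    change _ ≤ _ + 2 * B ^ 2 * T * J
    nlinarith [sq_nonneg ((M * ‖fn o‖ + B * M) - p)]
  have memF : MemLp (forcing D u K) 2 (timeMeasure T) := by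
    set S := ∫ s, ‖fnL Ω (u s)‖ ^ 2 ∂timeMeasure T with hS
    have iu := integrable_norm_sq mfu
    refine MemLp.of_bound measF (√(2 * (M * ‖fn o‖ + B * M) ^ 2 + 2 * B ^ 2 * T * S)) ?_
    filter_upwards [bound, ae_mem_Icc] with t h1 ht
    refine Real.le_sqrt_of_sq_le (h1.trans ?_)
    have := intervalIntegral_le_of_nonneg iu (Eventually.of_forall fun s => sq_nonneg _) h0 ht ht.1
    gcongr
    exact this
  refine ⟨memF, bound, ?_⟩
  set U : ℝ → H1 Ω := fun s => rieszAdj (fnL Ω) (forcing D u K s)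
    - (u s - gramOp (fnL Ω) (u s)) - rieszAdj tr (D.g s) with hU
  have mU : MemLp U 2 (timeMeasure T) :=
    ((memLp_clm (rieszAdj (fnL Ω)) memF).sub
      (hs.u_memLp.sub (memLp_clm (gramOp (fnL Ω)) hs.u_memLp))).sub
      (memLp_two_of_continuousOn (continuousOn_lam hD))
  have iU := integrable_of_memLp_two mU
  refine ae_eq_of_forall_inner (memLp_clm (gramOp (fnL Ω)) hs.u_memLp).1
    (integrable_of_continuousOn (continuousOn_const.add (continuousOn_primitive iU hT.le))).1
    fun φ => ?_
  obtain ⟨-, hy⟩ := hs.equation φ (tr φ) (htr φ)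
  filter_upwards [hy, ae_mem_Icc] with t h1 ht
  rw [inner_gramOp, inner_add_left, inner_rieszAdj]
  refine h1.trans ?_
  congr 1
  have e1 := (innerSL ℝ φ).intervalIntegral_comp_comm
    (intervalIntegrable_of_integrable_timeMeasure iU h0 ht)
  rw [real_inner_comm]
  refine Eq.trans ?_ e1
  refine intervalIntegral.integral_congr fun s hsm => ?_
  rw [uIcc_of_le ht.1] at hsm
  refine (weak_rhs_eq (tr := tr) hΩ hb hD u K ⟨hsm.1, hsm.2.trans ht.2⟩ φ).trans ?_
  rw [innerSL_apply_apply]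
  exact real_inner_comm _ _

theorem norm_sub_gramOp_le (x : H1 Ω) : ‖x - gramOp (fnL Ω) x‖ ≤ 2 * ‖x‖ := by
  have h : ‖gramOp (fnL Ω) x‖ ≤ ‖x‖ := by
    by_contra hc
    push Not at hc
    have h1 : ‖gramOp (fnL Ω) x‖ ^ 2 ≤ ‖x‖ * ‖gramOp (fnL Ω) x‖ := by
      rw [← real_inner_self_eq_norm_sq, inner_gramOp]
      exact (real_inner_le_norm _ _).trans (mul_le_mul (norm_fn_le _) (norm_fn_le _)
        (norm_nonneg _) (norm_nonneg _))
    nlinarith [norm_nonneg x]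
  linarith [norm_sub_le x (gramOp (fnL Ω) x)]

theorem memLp_innerSL {E : Type*} [NormedAddCommGroup E] [InnerProductSpace ℝ E] {U : ℝ → E}
    (hU : MemLp U 2 (timeMeasure T)) :
    MemLp (fun s => (innerSL ℝ (U s) : E →L[ℝ] ℝ)) 2 (timeMeasure T) := by
  refine ⟨(innerSL ℝ).continuous.comp_aestronglyMeasurable hU.1, ?_⟩
  refine lt_of_eq_of_lt ?_ hU.2
  exact eLpNorm_congr_norm_ae (Eventually.of_forall fun s => innerSL_apply_norm ℝ (U s))

theorem norm_rieszAdj_fnL_le (y : L2 Ω) : ‖rieszAdj (fnL Ω) y‖ ≤ ‖y‖ := by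
  have h1 : ‖rieszAdj (fnL Ω) y‖ ^ 2 ≤ ‖y‖ * ‖rieszAdj (fnL Ω) y‖ := by
    rw [← real_inner_self_eq_norm_sq, inner_rieszAdj]
    exact (real_inner_le_norm _ _).trans (mul_le_mul_of_nonneg_left (norm_fn_le _)
      (norm_nonneg _))
  by_contra hc
  push Not at hc
  nlinarith [norm_nonneg y]

/-- The time derivative as an element of `L²(0, T; H¹(Ω)*)`. -/
theorem exists_dual_derivative (hΩ : IsOpen Ω) (hb : Bornology.IsBounded Ω) (hT : 0 < T)
    (htr : ∀ v, IsTrace v (tr v)) {D : Data Ω} (hD : D.Basic T w₀ M) {u : ℝ → H1 Ω} {K : ℝ → ℝ}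
    (hs : IsWeakSolution D T u K) (memF : MemLp (forcing D u K) 2 (timeMeasure T)) {F₀ C : ℝ}
    (hF : ∀ᵐ t ∂timeMeasure T, ‖forcing D u K t‖ ^ 2 ≤ F₀)
    (hC : ∫ s, ‖u s‖ ^ 2 ∂timeMeasure T ≤ C) :
    ∃ u' : ℝ → (H1 Ω →L[ℝ] ℝ), MemLp u' 2 (timeMeasure T) ∧
      (∀ φ : H1 Ω, HasTimeDeriv T (fun t => ⟪fn (u t), fn φ⟫_ℝ) (fun t => u' t φ)
        ⟪D.u₀, fn φ⟫_ℝ) ∧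
      ∫ s in Icc 0 T, ‖u' s‖ ^ 2 ≤ T * (3 * F₀ + 3 * (‖rieszAdj tr‖ * M) ^ 2) + 12 * C := by
  have h0 : (0 : ℝ) ∈ Icc 0 T := ⟨le_rfl, hT.le⟩
  have ml : MemLp (fun t => rieszAdj tr (D.g t)) 2 (timeMeasure T) :=
    memLp_two_of_continuousOn (continuousOn_lam hD)
  have lb : ∀ᵐ t ∂timeMeasure T, ‖rieszAdj tr (D.g t)‖ ≤ ‖rieszAdj tr‖ * M :=
    ae_mem_Icc.mono fun t ht => norm_lam_le hD ht
  generalize ‖rieszAdj tr‖ * M = L at lb ⊢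
  obtain ⟨U, hU⟩ : ∃ U : ℝ → H1 Ω, U = fun s => rieszAdj (fnL Ω) (forcing D u K s)
    - (u s - gramOp (fnL Ω) (u s)) - rieszAdj tr (D.g s) := ⟨_, rfl⟩
  have mU : MemLp U 2 (timeMeasure T) := by
    rw [hU]
    exact ((memLp_clm (rieszAdj (fnL Ω)) memF).sub
      (hs.u_memLp.sub (memLp_clm (gramOp (fnL Ω)) hs.u_memLp))).sub ml
  have UC : ∫ s, ‖U s‖ ^ 2 ∂timeMeasure T ≤ T * (3 * F₀ + 3 * L ^ 2) + 12 * C := by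
    -- The square of a sum of three terms is at most three times the sum of squares, the middle term
    -- being 2 ‖u‖.
    have hp : ∀ᵐ s ∂timeMeasure T, ‖U s‖ ^ 2 ≤ 3 * F₀ + 3 * L ^ 2 + 12 * ‖u s‖ ^ 2 := by
      filter_upwards [hF, lb] with s h1 h2
      have h3 : ‖U s‖ ≤ ‖forcing D u K s‖ + 2 * ‖u s‖ + L := by
        rw [hU]
        exact norm_sub_le_of_le (norm_sub_le_of_le (norm_rieszAdj_fnL_le _)
          (norm_sub_gramOp_le _)) h2
      have h4 := pow_le_pow_left₀ (norm_nonneg _) h3 2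
      have h5 : ‖rieszAdj tr (D.g s)‖ ≤ L := h2
      nlinarith [sq_nonneg (‖forcing D u K s‖ - 2 * ‖u s‖), sq_nonneg (‖forcing D u K s‖ - L),
        sq_nonneg (2 * ‖u s‖ - L)]
    have i12 := (integrable_norm_sq hs.u_memLp).const_mul 12
    have ic := integrable_of_continuousOn (T := T) (f := fun _ => 3 * F₀ + 3 * L ^ 2)
      continuousOn_const
    have h5 := integral_mono_ae (integrable_norm_sq mU) (ic.add i12) hp
    have h6 : ∫ s, ((3 * F₀ + 3 * L ^ 2) + 12 * ‖u s‖ ^ 2) ∂timeMeasure T =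
        T * (3 * F₀ + 3 * L ^ 2) + 12 * ∫ s, ‖u s‖ ^ 2 ∂timeMeasure T := by
      rw [integral_add ic i12, integral_const_mul]
      simp [hT.le]
    have h7 := h5.trans_eq h6
    linarith
  refine ⟨fun s => innerSL ℝ (U s), ?_, fun φ => ?_, ?_⟩
  · exact memLp_innerSL mU
  · obtain ⟨hy', hy⟩ := hs.equation φ (tr φ) (htr φ)
    have e : ∀ t ∈ Icc 0 T, D.nonlinearity t (u t) φ - ⟪grad (u t), grad φ⟫_ℝ - ⟪D.g t, tr φ⟫_ℝ
        - K t * ⟪D.h t, fn φ⟫_ℝ - ⟪timeConv K (fun s => fn (u s)) t, fn φ⟫_ℝ = ⟪U t, φ⟫_ℝ :=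
      fun t ht => by
      rw [hU]
      exact weak_rhs_eq (tr := tr) hΩ hb hD u K ht φ
    refine ⟨hy'.congr (ae_mem_Icc.mono e), ?_⟩
    filter_upwards [hy, ae_mem_Icc] with t h1 ht
    refine h1.trans ?_
    congr 1
    exact intervalIntegral_congr_timeMeasure (ae_mem_Icc.mono e) h0 ht
  · simp only [innerSL_apply_norm]
    exact UC

/-- The basic estimate. -/
theorem exists_basic_estimate (hΩ : IsOpen Ω) (hb : Bornology.IsBounded Ω) (hT : 0 < T)
    (hM : 0 ≤ M) (htr : ∀ v, IsTrace v (tr v))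
    (ho : fn o =ᵐ[volume.restrict Ω] fun _ => (1 : ℝ)) {B : ℝ} (hB : 0 ≤ B) :
    ∃ C : ℝ, 0 ≤ C ∧ ∀ D : Data Ω, D.Basic T w₀ M → ∀ (u : ℝ → H1 Ω) (K : ℝ → ℝ),
      IsWeakSolution D T u K → (∀ᵐ t ∂timeMeasure T, |K t| ≤ B) →
      BasicEstimate D T u K C ∧ (∫ s, ‖u s‖ ^ 2 ∂timeMeasure T ≤ C) ∧
      (∀ᵐ t ∂timeMeasure T, ‖forcing D u K t‖ ^ 2 ≤ C) ∧
      ∀ᵐ t ∂timeMeasure T, ‖fn (u t)‖ ^ 2 ≤ C := by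
  obtain ⟨A, hA⟩ : ∃ A, A = 2 * (M * ‖fn o‖ + B * M) ^ 2 := ⟨_, rfl⟩
  obtain ⟨b, hbd⟩ : ∃ b, b = 2 * B ^ 2 * T := ⟨_, rfl⟩
  obtain ⟨L, hL⟩ : ∃ L, L = ‖rieszAdj tr‖ * M := ⟨_, rfl⟩
  have nA : 0 ≤ A := by rw [hA]; positivity
  have nb : 0 ≤ b := by rw [hbd]; positivity
  have nL : 0 ≤ L := by rw [hL]; positivity
  obtain ⟨C, hC, main⟩ := exists_energy_bound (V := H1 Ω) (H := L2 Ω) (ι := fnL Ω)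
    (fnL_injective hΩ) (denseRange_fnL hΩ) hT.le (L := L) (M := M) nA nb
  -- The forcing bound contains ∫ ‖u‖², at most T * C once the energy estimate is known.
  obtain ⟨F₀, hF₀⟩ : ∃ F₀, F₀ = A + b * (T * C) := ⟨_, rfl⟩
  have nF₀ : 0 ≤ F₀ := by rw [hF₀]; positivity
  obtain ⟨C', hC'⟩ : ∃ C', C' = T * (3 * F₀ + 3 * L ^ 2) + 12 * C := ⟨_, rfl⟩
  have nC' : 0 ≤ C' := by rw [hC']; positivity
  refine ⟨B + 2 * C + F₀ + C', by positivity, fun D hD u K hs hK => ?_⟩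
  obtain ⟨memF, bdF, weq⟩ := weak_formulation hΩ hb hT htr ho hD hs hB hK
  rw [← hA, ← hbd] at bdF
  have ml : MemLp (fun t => rieszAdj tr (D.g t)) 2 (timeMeasure T) :=
    memLp_two_of_continuousOn (continuousOn_lam hD)
  have lb : ∀ᵐ t ∂timeMeasure T, ‖rieszAdj tr (D.g t)‖ ≤ L :=
    ae_mem_Icc.mono fun t ht => hL ▸ norm_lam_le hD ht
  obtain ⟨v, cv, v0, huv, hvC, huC⟩ := main hs.u_memLp memF ml weq bdF lb hD.u₀_bounded
  have mfu : MemLp (fun s => fn (u s)) 2 (timeMeasure T) := memLp_clm (fnL Ω) hs.u_memLp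
  have fuC : ∀ᵐ t ∂timeMeasure T, ‖fn (u t)‖ ^ 2 ≤ C := by
    filter_upwards [huv, ae_mem_Icc] with t h1 ht
    have h1' : fn (u t) = v t := h1
    rw [h1']
    exact hvC t ht
  have bdF' : ∀ᵐ t ∂timeMeasure T, ‖forcing D u K t‖ ^ 2 ≤ F₀ := by
    filter_upwards [bdF, ae_mem_Icc] with t h1 ht
    refine h1.trans ?_
    have h2 := intervalIntegral_le_mul_of_le (integrable_norm_sq mfu) fuC ht
    have h3 : t * C ≤ T * C := mul_le_mul_of_nonneg_right ht.2 hC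
    have h4 := mul_le_mul_of_nonneg_left (h2.trans h3) nb
    rw [hF₀]
    exact add_le_add le_rfl h4
  have mgu : MemLp (fun s => grad (u s)) 2 (timeMeasure T) := memLp_clm (gradL Ω) hs.u_memLp
  have gC : ∫ s, ‖grad (u s)‖ ^ 2 ∂timeMeasure T ≤ C :=
    (integral_mono (integrable_norm_sq mgu) (integrable_norm_sq hs.u_memLp) fun s =>
      pow_le_pow_left₀ (norm_nonneg _) (norm_grad_le _) 2).trans huC
  obtain ⟨u', mu', hu', bu'⟩ := exists_dual_derivative hΩ hb hT htr hD hs memF bdF' huC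
  rw [← hL, ← hC'] at bu'
  refine ⟨⟨hK.mono fun t h => h.trans (by linarith), ⟨v, cv, v0, huv, fun t ht => ?_⟩,
    ⟨u', mu', hu', bu'.trans (by linarith)⟩⟩,
    huC.trans (by linarith), bdF'.mono fun t h => h.trans (by linarith),
    fuC.mono fun t h => h.trans (by linarith)⟩
  linarith [hvC t ht]

end

/-! ### The first order estimate -/

section


section Abstract

variable {V H : Type*} [NormedAddCommGroup V] [InnerProductSpace ℝ V] [CompleteSpace V]
  [NormedAddCommGroup H] [InnerProductSpace ℝ H] [CompleteSpace H] {ι : V →L[ℝ] H} {T : ℝ}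

/-- The equation holds at almost every time. -/
theorem strong_equation (hT : 0 < T) {u v l : ℝ → V} {F u' : ℝ → H} {x₀ : V}
    (hF : MemLp F 2 (timeMeasure T)) (hl : ContinuousOn l (Icc 0 T))
    (h : ∀ᵐ t ∂timeMeasure T, gramOp ι (u t) = gramOp ι x₀ +
      ∫ s in (0 : ℝ)..t, (rieszAdj ι (F s) - (u s - gramOp ι (u s)) - l s))
    (cv : ContinuousOn v (Icc 0 T)) (huv : ∀ᵐ t ∂timeMeasure T, u t = v t)
    (hu' : MemLp u' 2 (timeMeasure T))
    (hv : ∀ t ∈ Icc 0 T, ι (v t) = ι x₀ + ∫ s in (0 : ℝ)..t, u' s) :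
    ∀ᵐ s ∂timeMeasure T, rieszAdj ι (F s - u' s) = v s - gramOp ι (v s) + l s := by
  have h0 : (0 : ℝ) ∈ Icc 0 T := ⟨le_rfl, hT.le⟩
  have mv : MemLp v 2 (timeMeasure T) := memLp_two_of_continuousOn cv
  have i1 : Integrable (fun s => rieszAdj ι (F s) - (v s - gramOp ι (v s)) - l s)
      (timeMeasure T) := integrable_of_memLp_two
    (((memLp_clm (rieszAdj ι) hF).sub (mv.sub (memLp_clm (gramOp ι) mv))).sub
      (memLp_two_of_continuousOn hl))
  have i2 : Integrable (fun s => rieszAdj ι (u' s)) (timeMeasure T) :=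
    integrable_of_memLp_two (memLp_clm (rieszAdj ι) hu')
  have e : ∀ᵐ t ∂timeMeasure T, gramOp ι (v t) = gramOp ι x₀ +
      ∫ s in (0 : ℝ)..t, (rieszAdj ι (F s) - (v s - gramOp ι (v s)) - l s) := by
    filter_upwards [h, huv, ae_mem_Icc] with t h1 h2 ht
    rw [← h2, h1]
    congr 1
    exact intervalIntegral_congr_timeMeasure (huv.mono fun s hs => by simp only [hs]) h0 ht
  have e2 := eqOn_of_ae_eq hT e ((gramOp ι).continuous.comp_continuousOn cv)
    (continuousOn_const.add (continuousOn_primitive i1 hT.le))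
  -- The integrated equation holds at all times by continuity, and also ι*ι v has derivative ι* u';
  -- comparing the two primitives gives the pointwise equation.
  have e3 := ae_eq_of_primitive_eq i1 i2 fun t ht => by
    have h1 := e2 t ht
    have h2 := (rieszAdj ι).intervalIntegral_comp_comm
      (intervalIntegrable_of_integrable_timeMeasure (integrable_of_memLp_two hu') h0 ht)
    rw [h2, ← add_right_inj (gramOp ι x₀), ← h1, gramOp_apply, gramOp_apply, hv t ht, map_add]
  filter_upwards [e3] with s hs
  rw [map_sub, ← hs]
  abel

end Abstract

variable {N : ℕ} {Ω : Set (Eu N)} {T w₀ M : ℝ} {tr : H1 Ω →L[ℝ] L2bdry Ω} {o : H1 Ω}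

theorem exists_deriv_lam {D : Data Ω} (hT : 0 < T) (hg : BoundedCk 1 T M D.g) :
    ∃ l' : ℝ → H1 Ω, MemLp l' 2 (timeMeasure T) ∧ (∀ t ∈ Icc 0 T, ‖l' t‖ ≤ ‖rieszAdj tr‖ * M) ∧
      ∀ t ∈ Icc 0 T, rieszAdj tr (D.g t) = rieszAdj tr (D.g 0) + ∫ s in (0 : ℝ)..t, l' s := by
  obtain ⟨g', hg', hgg⟩ := hg.exists_deriv hT
  have h0 : (0 : ℝ) ∈ Icc 0 T := ⟨le_rfl, hT.le⟩
  have cl : ContinuousOn (fun t => rieszAdj tr (g' t)) (Icc 0 T) :=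
    (rieszAdj tr).continuous.comp_continuousOn hg'.continuousOn
  refine ⟨fun t => rieszAdj tr (g' t), memLp_two_of_continuousOn cl,
    fun t ht => (rieszAdj tr).le_opNorm_of_le (hg'.norm_le ht), fun t ht => ?_⟩
  rw [(rieszAdj tr).intervalIntegral_comp_comm (intervalIntegrable_of_integrable_timeMeasure
    (integrable_of_continuousOn hg'.continuousOn) h0 ht), ← map_add, ← hgg t ht]

/-- The first order estimate. -/
theorem exists_first_order_estimate (hΩ : IsOpen Ω) (hb : Bornology.IsBounded Ω) (hT : 0 < T)
    (hM : 0 ≤ M) (htr : ∀ v, IsTrace v (tr v))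
    (ho : fn o =ᵐ[volume.restrict Ω] fun _ => (1 : ℝ)) {B C : ℝ} (hB : 0 ≤ B) (hC : 0 ≤ C) :
    ∃ C₁ : ℝ, 0 ≤ C₁ ∧ ∀ D : Data Ω, D.Basic T w₀ M → ∀ (u : ℝ → H1 Ω) (K : ℝ → ℝ),
      IsWeakSolution D T u K → (∀ᵐ t ∂timeMeasure T, |K t| ≤ B) →
      (∫ s, ‖u s‖ ^ 2 ∂timeMeasure T ≤ C) → (∀ᵐ t ∂timeMeasure T, ‖forcing D u K t‖ ^ 2 ≤ C) →
      (∀ᵐ t ∂timeMeasure T, ‖fn (u t)‖ ^ 2 ≤ C) → BoundedCk 1 T M D.g →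
      ∀ U : H1 Ω, fn U = D.u₀ → ‖U‖ ≤ M →
      ∃ (v : ℝ → H1 Ω) (u' : ℝ → L2 Ω), ContinuousOn v (Icc 0 T) ∧ v 0 = U ∧
        (∀ᵐ t ∂timeMeasure T, u t = v t) ∧ MemLp u' 2 (timeMeasure T) ∧
        (∀ t ∈ Icc 0 T, fn (v t) = fn U + ∫ s in (0 : ℝ)..t, u' s) ∧
        (∀ t ∈ Icc 0 T, ‖v t‖ ^ 2 + ∫ s, ‖u' s‖ ^ 2 ∂timeMeasure T ≤ C₁) ∧
        ∀ᵐ s ∂timeMeasure T, rieszAdj (fnL Ω) (forcing D u K s - u' s) =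
          v s - gramOp (fnL Ω) (v s) + rieszAdj tr (D.g s) := by
  obtain ⟨L, hL⟩ : ∃ L, L = ‖rieszAdj tr‖ * M := ⟨_, rfl⟩
  have nL : 0 ≤ L := by rw [hL]; positivity
  obtain ⟨C₁, hC₁⟩ : ∃ C₁, C₁ = 4 * (M ^ 2 + T * C + C + C + (2 + T) * L ^ 2) := ⟨_, rfl⟩
  have nC₁ : 0 ≤ C₁ := by rw [hC₁]; positivity
  -- The bound at time t controls v t, and the bound at time T controls the integral over all of [0,
  -- T].
  refine ⟨2 * C₁, by positivity, fun D hD u K hs hK huC hFC hfC hg U hU hUM => ?_⟩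
  have h0 : (0 : ℝ) ∈ Icc 0 T := ⟨le_rfl, hT.le⟩
  have hTm : T ∈ Icc 0 T := ⟨hT.le, le_rfl⟩
  obtain ⟨memF, -, weq⟩ := weak_formulation hΩ hb hT htr ho hD hs hB hK
  obtain ⟨l', ml', l'L, hl⟩ := exists_deriv_lam (tr := tr) hT hg
  have e0 : gramOp (fnL Ω) U = rieszAdj (fnL Ω) D.u₀ := by rw [gramOp_apply, fnL_apply, hU]
  rw [← e0] at weq
  obtain ⟨v, u', cv, v0, huv, mu', hv, hE⟩ := exists_strong_solution (fnL_injective hΩ)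
    (denseRange_fnL hΩ) norm_fn_le hs.u_memLp memF ml' hT.le hl weq
  have hFb : ∫ s, ‖forcing D u K s‖ ^ 2 ∂timeMeasure T ≤ T * C := by
    have := integral_mono_ae (integrable_norm_sq memF)
      (integrable_of_continuousOn (T := T) (f := fun _ => C) continuousOn_const) hFC
    refine this.trans_eq ?_
    simp [hT.le]
  have hvb : ∫ s, ‖v s‖ ^ 2 ∂timeMeasure T ≤ C := by
    have e : ∫ s, ‖u s‖ ^ 2 ∂timeMeasure T = ∫ s, ‖v s‖ ^ 2 ∂timeMeasure T :=
      integral_congr_ae (huv.mono fun s hs => by simp only [hs])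
    exact e ▸ huC
  have hιv : ∀ t ∈ Icc 0 T, ‖fnL Ω (v t)‖ ^ 2 ≤ C := by
    refine le_of_ae_le hT (f := fun t => ‖fnL Ω (v t)‖ ^ 2) (g := fun _ => C) ?_
      (((fnL Ω).continuous.comp_continuousOn cv).norm.pow 2) continuousOn_const
    filter_upwards [hfC, huv] with t h1 h2
    rw [← h2]
    exact h1
  have bd := first_order_bound hT.le memF ml' cv mu' hE hFb hvb hιv
    (fun t ht => hL ▸ norm_lam_le hD ht) (hL ▸ norm_lam_le hD h0)
    (ae_mem_Icc.mono fun t ht => hL ▸ l'L t ht) hUM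
  rw [← hC₁] at bd
  refine ⟨v, u', cv, v0, huv, mu', hv, fun t ht => ?_, ?_⟩
  · have b1 := bd t ht
    have b2 := bd T hTm
    have b3 : 0 ≤ ∫ s in (0 : ℝ)..t, ‖u' s‖ ^ 2 :=
      intervalIntegral.integral_nonneg ht.1 fun s _ => by positivity
    have b4 : ∫ s, ‖u' s‖ ^ 2 ∂timeMeasure T = ∫ s in (0 : ℝ)..T, ‖u' s‖ ^ 2 := by
      rw [intervalIntegral.integral_of_le hT.le, integral_Icc_eq_integral_Ioc]
    rw [b4]
    nlinarith [sq_nonneg ‖v T‖]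
  · exact strong_equation hT memF (continuousOn_lam hD) weq cv huv mu' hv

end

/-! ### Weak Laplacians -/

section


variable {N : ℕ} {Ω : Set (Eu N)} {T w₀ M : ℝ} {tr : H1 Ω →L[ℝ] L2bdry Ω} {o : H1 Ω}

/-- The Laplacian of an `H²` function is bounded. -/
theorem norm_laplacian_le (hΩ : IsOpen Ω) {U : H1 Ω} (hU : BoundedH2 M U) {l : L2 Ω}
    (hl : HasWeakLaplacian U l) : ‖l‖ ≤ N * M := by
  obtain ⟨-, W, hW⟩ := hU
  let b := EuclideanSpace.basisFun (Fin N) ℝ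
  have hp : ∀ i, MemLp (fun x => ⟪grad (W i) x, b i⟫_ℝ) 2 (volume.restrict Ω) := fun i =>
    (Lp.memLp (grad (W i))).inner_const (b i)
  have hpn : ∀ i, ‖(hp i).toLp‖ ≤ M := fun i => by
    refine le_trans (Lp.norm_le_norm_of_ae_le ?_) ((norm_grad_le (W i)).trans (hW i).2)
    filter_upwards [(hp i).coeFn_toLp] with x hx
    rw [hx]
    refine (norm_inner_le_norm _ _).trans ?_
    simp [b]
  -- The Laplacian is the sum of the i-th weak derivatives of the components of the gradient, each
  -- bounded by M in L².
  have key : l - ∑ i, (hp i).toLp = 0 := by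
    refine ae_eq_zero_of_integral_test hΩ fun φ hφ => ?_
    have mφ : MemLp φ 2 (volume.restrict Ω) :=
      memLp_restrict hφ.contDiff.continuous hφ.hasCompactSupport
    have e : ∀ w : L2 Ω, ∫ x in Ω, φ x • w x = ⟪w, mφ.toLp⟫_ℝ := fun w => by
      rw [L2.inner_def]
      refine integral_congr_ae (mφ.coeFn_toLp.mono fun x hx => ?_)
      simp [hx]
    have e1 : ⟪l, mφ.toLp⟫_ℝ = -∫ x in Ω, fderiv ℝ φ x (grad U x) := by
      rw [hl φ hφ, neg_neg, ← e]
      simp only [smul_eq_mul, mul_comm]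
    have e2 : ∀ i, ⟪(hp i).toLp, mφ.toLp⟫_ℝ = -∫ x in Ω, fn (W i) x * fderiv ℝ φ x (b i) :=
      fun i => by
        rw [hasWeakGradient_H1 (W i) φ hφ (b i), neg_neg, ← e]
        refine integral_congr_ae ((hp i).coeFn_toLp.mono fun x hx => ?_)
        simp only [hx, smul_eq_mul, mul_comm]
    have i2 : ∀ i, Integrable (fun x => fn (W i) x * fderiv ℝ φ x (b i)) (volume.restrict Ω) :=
      fun i => integrable_mul_fderiv _ hφ _
    have h1 : ∀ᵐ x ∂volume.restrict Ω, ∀ i, fn (W i) x = grad U x i :=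
      ae_all_iff.2 fun i => (hW i).1
    rw [e, inner_sub_left, sum_inner, e1]
    simp only [e2]
    rw [Finset.sum_neg_distrib, ← integral_finsetSum _ fun i _ => i2 i, sub_neg_eq_add,
      neg_add_eq_zero]
    refine integral_congr_ae (h1.mono fun x hx => ?_)
    simp only [hx]
    conv_lhs => rw [← b.sum_repr (grad U x), map_sum]
    exact Finset.sum_congr rfl fun i _ => by simp [b]
  rw [sub_eq_zero] at key
  rw [key]
  refine (norm_sum_le _ _).trans ((Finset.sum_le_sum fun i _ => hpn i).trans ?_)
  simp

/-- Test functions on the open set Ω vanish on its frontier, so their traces are zero and the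
boundary term disappears. -/
theorem hasWeakLaplacian_of_rieszAdj (hΩ : IsOpen Ω)
    (htr : ∀ φ, tr (resH1 Ω φ) =ᵐ[surf Ω] φ.1) {v : H1 Ω} {z : L2 Ω} {γ : L2bdry Ω}
    (h : rieszAdj (fnL Ω) z = v - gramOp (fnL Ω) v + rieszAdj tr γ) : HasWeakLaplacian v (-z) := by
  intro φ hφ
  let ψ : smoothFns N := ⟨φ, hφ.contDiff, hφ.hasCompactSupport⟩
  have h1 : ⟪z, fn (resH1 Ω ψ)⟫_ℝ = ⟪grad v, grad (resH1 Ω ψ)⟫_ℝ + ⟪γ, tr (resH1 Ω ψ)⟫_ℝ := by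
    have := congrArg (fun x => ⟪x, resH1 Ω ψ⟫_ℝ) h
    simp only [inner_add_left, inner_sub_left, inner_rieszAdj, inner_gramOp, inner_H1,
      fnL_apply] at this
    linarith
  have h2 : tr (resH1 Ω ψ) = 0 := by
    refine (Lp.eq_zero_iff_ae_eq_zero).2 ?_
    have hfr : ∀ᵐ x ∂surf Ω, x ∈ frontier Ω := ae_restrict_mem isClosed_frontier.measurableSet
    filter_upwards [htr ψ, hfr] with x hx1 hx2
    rw [hx1]
    change φ x = 0
    by_contra hne
    have hxΩ : x ∈ Ω := hφ.tsupport_subset (subset_tsupport φ hne)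
    rw [hΩ.frontier_eq] at hx2
    exact hx2.2 hxΩ
  rw [h2, inner_zero_right, add_zero, L2.inner_def, L2.inner_def] at h1
  have e1 : ∫ x in Ω, fderiv ℝ φ x (grad v x) =
      ∫ x in Ω, ⟪grad v x, grad (resH1 Ω ψ) x⟫_ℝ := by
    refine integral_congr_ae ((grad_resH1 (Ω := Ω) ψ).mono fun x hx => ?_)
    simp only [hx]
    rw [real_inner_comm, inner_gradient_left]
  have e2 : ∫ x in Ω, (-z) x * φ x = -∫ x in Ω, ⟪z x, fn (resH1 Ω ψ) x⟫_ℝ := by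
    rw [← integral_neg]
    refine integral_congr_ae ?_
    filter_upwards [fn_resH1 (Ω := Ω) ψ, Lp.coeFn_neg z] with x hx1 hx2
    rw [hx1, hx2]
    simp [ψ, mul_comm]
  rw [e1, e2, neg_neg, h1]

end

/-! ### The second order estimate for the inverse problem -/

section


variable {N : ℕ} {Ω : Set (Eu N)} {T w₀ M : ℝ} {tr : H1 Ω →L[ℝ] L2bdry Ω} {o : H1 Ω}

theorem integral_norm_le {H : Type*} [NormedAddCommGroup H] (hT : 0 ≤ T) {f : ℝ → H}
    (hf : MemLp f 2 (timeMeasure T)) {C : ℝ} (hC : ∫ s, ‖f s‖ ^ 2 ∂timeMeasure T ≤ C) :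
    ∫ s, ‖f s‖ ∂timeMeasure T ≤ T + C := by
  have i1 := integrable_norm_sq hf
  have i0 := integrable_of_continuousOn (T := T) (f := fun _ => (1 : ℝ)) continuousOn_const
  have h1 : ∫ s, ‖f s‖ ∂timeMeasure T ≤ ∫ s, (1 + ‖f s‖ ^ 2) ∂timeMeasure T :=
    integral_mono (integrable_of_memLp_two hf.norm) (i0.add i1) fun s => by
      change ‖f s‖ ≤ 1 + ‖f s‖ ^ 2
      nlinarith [sq_nonneg (‖f s‖ - 1), norm_nonneg (f s)]
  have h2 : ∫ s, (1 + ‖f s‖ ^ 2) ∂timeMeasure T = T + ∫ s, ‖f s‖ ^ 2 ∂timeMeasure T := by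
    rw [integral_add i0 i1]
    simp [hT]
  linarith

/-- The part `f(u, ∇u) - K ∗ u` of the forcing. -/
def smoothForcing (D : Data Ω) (v : ℝ → H1 Ω) (K : ℝ → ℝ) (t : ℝ) : L2 Ω :=
  nlL2 D t (v t) - timeConv K (fun s => fn (v s)) t

theorem forcing_eq_smoothForcing {D : Data Ω} {u v : ℝ → H1 Ω} {K : ℝ → ℝ}
    (huv : ∀ᵐ t ∂timeMeasure T, u t = v t) :
    ∀ᵐ t ∂timeMeasure T, forcing D u K t = smoothForcing D v K t - K t • D.h t := by
  filter_upwards [huv, ae_mem_Icc] with t h1 ht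
  rw [forcing, smoothForcing, h1,
    timeConv_congr (z := fun s => fn (v s)) (huv.mono fun s hs => by simp only [hs]) ht]
  abel

section SmoothForcing

variable {D : Data Ω} {v : ℝ → H1 Ω} {u' : ℝ → L2 Ω} {y₀ : L2 Ω} {K : ℝ → ℝ} {B Y : ℝ}

theorem norm_smoothForcing_le (hΩ : IsOpen Ω) (hb : Bornology.IsBounded Ω)
    (ho : fn o =ᵐ[volume.restrict Ω] fun _ => (1 : ℝ)) (hD : D.Basic T w₀ M)
    (hB : 0 ≤ B) (hK : ∀ᵐ t ∂timeMeasure T, |K t| ≤ B) (cv : ContinuousOn v (Icc 0 T))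
    (hY : ∀ t ∈ Icc 0 T, ‖fn (v t)‖ ≤ Y) {t : ℝ} (ht : t ∈ Icc 0 T) :
    ‖smoothForcing D v K t‖ ≤ M * ‖fn o‖ + B * (T * Y) := by
  have hT : 0 ≤ T := ht.1.trans ht.2
  have nY : 0 ≤ Y := (norm_nonneg _).trans (hY t ht)
  have cfv : ContinuousOn (fun s => fn (v s)) (Icc 0 T) := (fnL Ω).continuous.comp_continuousOn cv
  refine norm_sub_le_of_le (norm_nlL2_le hD hΩ hb ho ht _) ?_
  refine (norm_timeConv_le hK (integrable_of_continuousOn cfv) ht).trans ?_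
  refine mul_le_mul_of_nonneg_left ?_ hB
  refine (intervalIntegral_le_mul_of_le (integrable_of_continuousOn cfv.norm)
    (ae_mem_Icc.mono fun s hs => hY s hs) ht).trans ?_
  exact mul_le_mul_of_nonneg_right ht.2 nY

/-- This part of the forcing is Lipschitz in time up to increments of v: f by assumption, and K ∗ u
because K is bounded and ∂ₜu is integrable. The term K h is excluded, since K has no time regularity
at this stage. -/
theorem norm_smoothForcing_sub_le (hΩ : IsOpen Ω) (hb : Bornology.IsBounded Ω) (hM : 0 ≤ M)
    (ho : fn o =ᵐ[volume.restrict Ω] fun _ => (1 : ℝ)) (hD : D.Basic T w₀ M)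
    (hD' : D.SecondOrder T M) (hKi : Integrable K (timeMeasure T))
    (hB : 0 ≤ B) (hK : ∀ᵐ t ∂timeMeasure T, |K t| ≤ B)
    (hu' : Integrable u' (timeMeasure T))
    (hv : ∀ t ∈ Icc 0 T, fn (v t) = y₀ + ∫ s in (0 : ℝ)..t, u' s)
    (hY : ∀ t ∈ Icc 0 T, ‖fn (v t)‖ ≤ Y) :
    ∀ s ∈ Icc 0 T, ∀ t ∈ Icc 0 T, s ≤ t → ‖smoothForcing D v K t - smoothForcing D v K s‖ ≤
      (M * ‖fn o‖ + 2 * M + B * (Y + ∫ r, ‖u' r‖ ∂timeMeasure T)) * (t - s + ‖v t - v s‖) := by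
  intro s hs t ht hst
  have nY : 0 ≤ Y := (norm_nonneg _).trans (hY t ht)
  have h1 := norm_nlL2_sub_le hD hD' hM hΩ hb ho hs ht (v t) (v s)
  rw [abs_of_nonneg (sub_nonneg.2 hst)] at h1
  have h2 := norm_timeConv_sub_le hKi hB hK hu' hv hY s hs t ht hst
  have e : smoothForcing D v K t - smoothForcing D v K s = (nlL2 D t (v t) - nlL2 D s (v s)) -
      (timeConv K (fun s => fn (v s)) t - timeConv K (fun s => fn (v s)) s) := by
    rw [smoothForcing, smoothForcing]
    abel
  rw [e]
  refine (norm_sub_le_of_le h1 h2).trans ?_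
  have nI : 0 ≤ ∫ r, ‖u' r‖ ∂timeMeasure T := integral_nonneg fun _ => norm_nonneg _
  generalize ∫ r, ‖u' r‖ ∂timeMeasure T = I at nI ⊢
  have n1 : 0 ≤ t - s := sub_nonneg.2 hst
  have n2 := norm_nonneg (v t - v s)
  have n3 : 0 ≤ M * ‖fn o‖ := by positivity
  have n4 : 0 ≤ B * (Y + I) := by positivity
  nlinarith [mul_nonneg n3 n2, mul_nonneg n4 n2, mul_nonneg hM n1]

end SmoothForcing

theorem continuousOn_of_norm_sub_le_mul {X V : Type*} [NormedAddCommGroup X]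
    [NormedSpace ℝ X] [NormedAddCommGroup V] {f : ℝ → X} {v : ℝ → V} {c : ℝ} (hc : 0 ≤ c)
    (cv : ContinuousOn v (Icc 0 T))
    (h : ∀ s ∈ Icc 0 T, ∀ t ∈ Icc 0 T, s ≤ t → ‖f t - f s‖ ≤ c * (t - s + ‖v t - v s‖)) :
    ContinuousOn f (Icc 0 T) := by
  refine continuousOn_of_norm_sub_le (c := fun s t => c * (|t - s| + ‖v t - v s‖))
    (fun s hs t ht hst => ?_) (fun s hs => ?_) (fun s t => by positivity)
  · rw [abs_of_nonneg (sub_nonneg.2 hst)]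
    exact h s hs t ht hst
  · have h1 : Tendsto v (𝓝[Icc 0 T] s) (𝓝 (v s)) := cv s hs
    have h2 : Tendsto (fun t : ℝ => t) (𝓝[Icc 0 T] s) (𝓝 s) := tendsto_id.mono_left inf_le_left
    have h3 : Tendsto (fun t => c * (|t - s| + ‖v t - v s‖) + c * (|s - t| + ‖v s - v t‖))
        (𝓝[Icc 0 T] s) (𝓝 (c * (|s - s| + ‖v s - v s‖) + c * (|s - s| + ‖v s - v s‖))) :=
      ((((h2.sub_const s).abs).add (h1.sub_const _).norm).const_mul c).add
        ((((h2.const_sub s).abs).add (h1.const_sub _).norm).const_mul c)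
    simpa using h3

/-- Green's formula with the Neumann condition is the operator equation at time 0 with z = -Δu₀;
this is how compatibility of the data enters. -/
theorem rieszAdj_laplacian (htr : ∀ v, IsTrace v (tr v)) {U : H1 Ω} {γ : L2bdry Ω} {l : L2 Ω}
    (h : ∀ (φ : H1 Ω) (ψ : L2bdry Ω), IsTrace φ ψ →
      ⟪grad U, grad φ⟫_ℝ + ⟪l, fn φ⟫_ℝ = -⟪γ, ψ⟫_ℝ) :
    rieszAdj (fnL Ω) (-l) = U - gramOp (fnL Ω) U + rieszAdj tr γ := by
  refine ext_inner_right ℝ fun φ => ?_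
  have := h φ (tr φ) (htr φ)
  rw [inner_add_left, inner_sub_left, inner_rieszAdj, inner_rieszAdj, inner_gramOp, inner_H1,
    fnL_apply, fnL_apply, inner_neg_left]
  linarith

/-- The solution leaves a compatible initial datum at bounded speed. -/
theorem norm_sub_initial_datum_le (hΩ : IsOpen Ω) (htr : ∀ v, IsTrace v (tr v))
    {U : H1 Ω} {g : ℝ → L2bdry Ω} (hU : BoundedH2 M U) (hNeu : NeumannCondition U (g 0))
    {v : ℝ → H1 Ω} {F u' : ℝ → L2 Ω} {A Y L : ℝ} (nA : 0 ≤ A) (nY : 0 ≤ Y) (hA : N * M ≤ A)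
    (hl : ∀ s ∈ Icc 0 T, ∀ t ∈ Icc 0 T, s ≤ t →
      ‖rieszAdj tr (g t) - rieszAdj tr (g s)‖ ≤ L * (t - s))
    (cv : ContinuousOn v (Icc 0 T)) (v0 : v 0 = U) (mu' : MemLp u' 2 (timeMeasure T))
    (hv : ∀ t ∈ Icc 0 T, fn (v t) = fn U + ∫ s in (0 : ℝ)..t, u' s)
    (hF : ∀ᵐ s ∂timeMeasure T, ‖F s‖ ≤ A)
    (heq : ∀ᵐ s ∂timeMeasure T, rieszAdj (fnL Ω) (F s - u' s) =
      v s - gramOp (fnL Ω) (v s) + rieszAdj tr (g s))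
    (hY : ∀ t ∈ Icc 0 T, ‖fn (v t)‖ ≤ Y) :
    ∀ t ∈ Icc 0 T, ‖fnL Ω (v t) - fnL Ω (v 0)‖ ≤ (4 * A + 4 * Y + 1 + L ^ 2 * T) * t := by
  intro t ht
  have h0 : (0 : ℝ) ∈ Icc 0 T := ⟨le_rfl, ht.1.trans ht.2⟩
  obtain ⟨lap, hlap, hgreen⟩ := hNeu
  have hz : rieszAdj (fnL Ω) (-lap) = U - gramOp (fnL Ω) U + rieszAdj tr (g 0) :=
    rieszAdj_laplacian htr hgreen
  have hzA : ‖-lap‖ ≤ A := by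
    rw [norm_neg]
    exact (norm_laplacian_le hΩ hU hlap).trans hA
  have hl0 : ∀ t ∈ Icc 0 T, ‖rieszAdj tr (g t) - rieszAdj tr (g 0)‖ ≤ L * t := fun t ht => by
    simpa using hl 0 h0 t ht ht.1
  have hU0 : ‖fnL Ω U‖ ≤ Y := v0 ▸ hY 0 h0
  have := norm_sub_initial_le (l := fun t => rieszAdj tr (g t)) nA nY cv mu' hv heq hz hl0 hF hzA
    hY hU0 t ht
  rwa [v0]

set_option maxHeartbeats 1000000 in
/-- The second order estimate, with a bound on the difference quotients. -/
theorem exists_second_order_estimate (hΩ : IsOpen Ω) (hb : Bornology.IsBounded Ω) (hT : 0 < T)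
    (hM : 0 ≤ M) (htr : ∀ v, IsTrace v (tr v)) (htr' : ∀ φ, tr (resH1 Ω φ) =ᵐ[surf Ω] φ.1)
    (ho : fn o =ᵐ[volume.restrict Ω] fun _ => (1 : ℝ)) {B C C₁ : ℝ} (hB : 0 ≤ B) (hC : 0 ≤ C)
    (hC₁ : 0 ≤ C₁) :
    ∃ C₂ : ℝ, 0 ≤ C₂ ∧ ∀ D : Data Ω, D.Basic T w₀ M → D.SecondOrder T M →
      ∀ (u : ℝ → H1 Ω) (K : ℝ → ℝ), IsWeakSolution D T u K → (∀ᵐ t ∂timeMeasure T, |K t| ≤ B) →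
      (∀ᵐ t ∂timeMeasure T, ‖forcing D u K t‖ ^ 2 ≤ C) →
      ∀ U : H1 Ω, fn U = D.u₀ → BoundedH2 M U → NeumannCondition U (D.g 0) →
      ∀ (v : ℝ → H1 Ω) (u' : ℝ → L2 Ω), ContinuousOn v (Icc 0 T) → v 0 = U →
        (∀ᵐ t ∂timeMeasure T, u t = v t) → MemLp u' 2 (timeMeasure T) →
        (∀ t ∈ Icc 0 T, fn (v t) = fn U + ∫ s in (0 : ℝ)..t, u' s) →
        (∀ t ∈ Icc 0 T, ‖v t‖ ^ 2 + ∫ s, ‖u' s‖ ^ 2 ∂timeMeasure T ≤ C₁) →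
        (∀ᵐ s ∂timeMeasure T, rieszAdj (fnL Ω) (forcing D u K s - u' s) =
          v s - gramOp (fnL Ω) (v s) + rieszAdj tr (D.g s)) →
      SecondOrderEstimate D T u C₂ ∧
        ∀ τ ∈ Ioo 0 T, ∫ s, ‖diffQuot τ v s‖ ^ 2 ∂timeMeasure (T - τ) ≤ C₂ := by
  obtain ⟨L, hL⟩ : ∃ L, L = ‖rieszAdj tr‖ * M := ⟨_, rfl⟩
  -- Here s ≤ 1 + s² turns bounds on squares into bounds on norms; likewise T + C₁ in E bounds ∫
  -- ‖∂ₜu‖, and 1 + C in A' bounds the forcing, with N * M for Δu₀.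
  obtain ⟨Y, hYd⟩ : ∃ Y, Y = 1 + C₁ := ⟨_, rfl⟩
  obtain ⟨A, hA⟩ : ∃ A, A = M * ‖fn o‖ + B * (T * Y) := ⟨_, rfl⟩
  obtain ⟨E, hE⟩ : ∃ E, E = M * ‖fn o‖ + 2 * M + B * (Y + (T + C₁)) := ⟨_, rfl⟩
  obtain ⟨A', hA'⟩ : ∃ A', A' = 1 + C + N * M := ⟨_, rfl⟩
  obtain ⟨C₀, hC₀⟩ : ∃ C₀, C₀ = 4 * A' + 4 * Y + 1 + L ^ 2 * T := ⟨_, rfl⟩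
  obtain ⟨k₀, hk₀⟩ : ∃ k₀, k₀ = B * M := ⟨_, rfl⟩
  have nL : 0 ≤ L := by rw [hL]; positivity
  have nY : 0 ≤ Y := by rw [hYd]; positivity
  have nA : 0 ≤ A := by rw [hA]; positivity
  have nE : 0 ≤ E := by rw [hE]; positivity
  have nA' : 0 ≤ A' := by rw [hA']; positivity
  have nC₀ : 0 ≤ C₀ := by rw [hC₀]; positivity
  have nk₀ : 0 ≤ k₀ := by rw [hk₀]; positivity
  obtain ⟨C₃, nC₃, main⟩ := exists_second_order (V := H1 Ω) (H := L2 Ω) (ι := fnL Ω)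
    (denseRange_fnL hΩ) norm_fn_le hT nA nk₀ nC₀ nL
  refine ⟨2 * C₃ + (A + k₀ + √C₃), by positivity, ?_⟩
  intro D hD hD' u K hs hK hFC U hU hU2 hNeu v u' cv v0 huv mu' hv hvC heq
  have h0 : (0 : ℝ) ∈ Icc 0 T := ⟨le_rfl, hT.le⟩
  -- The H¹-valued version of h makes K h an element of V, the k of the abstract estimate.
  obtain ⟨Hh, hHh, bHh⟩ := hD'.h_H1
  have iu' := integrable_of_memLp_two mu'
  have vY : ∀ t ∈ Icc 0 T, ‖fn (v t)‖ ≤ Y := fun t ht => by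
    have h1 : 0 ≤ ∫ s, ‖u' s‖ ^ 2 ∂timeMeasure T := integral_nonneg fun _ => sq_nonneg _
    have h2 := norm_fn_le (v t)
    rw [hYd]
    nlinarith [hvC t ht, sq_nonneg (‖v t‖ - 1), norm_nonneg (v t)]
  have u'C : ∫ s, ‖u' s‖ ^ 2 ∂timeMeasure T ≤ C₁ := by
    linarith [hvC 0 h0, sq_nonneg ‖v 0‖]
  have hΦ : ∀ t ∈ Icc 0 T, ‖smoothForcing D v K t‖ ≤ A := fun t ht =>
    hA ▸ norm_smoothForcing_le hΩ hb ho hD hB hK cv vY ht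
  have hΦL : ∀ s ∈ Icc 0 T, ∀ t ∈ Icc 0 T, s ≤ t →
      ‖smoothForcing D v K t - smoothForcing D v K s‖ ≤ E * (t - s + ‖v t - v s‖) := by
    intro s hs' t ht hst
    refine (norm_smoothForcing_sub_le hΩ hb hM ho hD hD' (integrable_of_memLp_two hs.K_memLp) hB
      hK iu' hv vY s hs' t ht hst).trans ?_
    have := integral_norm_le hT.le mu' u'C
    have n1 : 0 ≤ t - s := sub_nonneg.2 hst
    rw [hE]
    gcongr
  have cΦ : ContinuousOn (smoothForcing D v K) (Icc 0 T) :=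
    continuousOn_of_norm_sub_le_mul nE cv hΦL
  have kb : ∀ᵐ t ∂timeMeasure T, ‖K t • Hh t‖ ≤ k₀ := by
    filter_upwards [hK, ae_mem_Icc] with t h1 ht
    rw [norm_smul, hk₀]
    exact mul_le_mul h1 (bHh.norm_le ht) (norm_nonneg _) hB
  have mk : MemLp (fun t => K t • Hh t) 2 (timeMeasure T) :=
    MemLp.of_bound (hs.K_memLp.1.smul
      (integrable_of_continuousOn bHh.continuousOn).1) k₀ kb
  have cl := continuousOn_lam (tr := tr) hD
  obtain ⟨l', ml', l'L, hl⟩ := exists_deriv_lam (tr := tr) hT hD'.g_C1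
  have lL : ∀ s ∈ Icc 0 T, ∀ t ∈ Icc 0 T, s ≤ t →
      ‖rieszAdj tr (D.g t) - rieszAdj tr (D.g s)‖ ≤ L * (t - s) :=
    norm_sub_le_of_primitive (y := fun t => rieszAdj tr (D.g t)) (integrable_of_memLp_two ml')
      (ae_mem_Icc.mono fun t ht => hL ▸ l'L t ht) hl
  have hFeq := forcing_eq_smoothForcing (D := D) (K := K) huv
  have heq' : ∀ᵐ s ∂timeMeasure T, rieszAdj (fnL Ω)
      (smoothForcing D v K s - fnL Ω (K s • Hh s) - u' s) =
      v s - gramOp (fnL Ω) (v s) + rieszAdj tr (D.g s) := by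
    filter_upwards [heq, hFeq, ae_mem_Icc] with s h1 h2 hs'
    rw [map_smul, fnL_apply, hHh s hs', ← h2]
    exact h1
  have hin : ∀ t ∈ Icc 0 T, ‖fnL Ω (v t) - fnL Ω (v 0)‖ ≤ C₀ * t := fun t ht => by
    rw [hC₀]
    refine norm_sub_initial_datum_le hΩ htr hU2 hNeu nA' nY (by rw [hA']; linarith) lL cv v0 mu'
      hv ?_ heq vY t ht
    filter_upwards [hFC] with s h1
    rw [hA']
    have : (0 : ℝ) ≤ N * M := by positivity
    nlinarith [sq_nonneg (‖forcing D u K s‖ - 1), norm_nonneg (forcing D u K s)]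
  have hv' : ∀ t ∈ Icc 0 T, fnL Ω (v t) = fnL Ω (v 0) + ∫ s in (0 : ℝ)..t, u' s := by
    rw [v0]
    exact hv
  obtain ⟨z, w, hz, hzΦ, mw, wC, hvw, hwu', hdq⟩ := main cv mu' hv' cΦ hΦ hΦL mk kb cl lL heq' hin
  have nzb : ∀ t ∈ Icc 0 T, ‖z t‖ ≤ √C₃ := fun t ht => Real.le_sqrt_of_sq_le (hz t ht).2
  refine ⟨⟨v, fun t => -z t, w, cv, huv, ?_, mw, ⟨?_, ?_⟩, fun t ht => ⟨?_, ?_⟩, ?_⟩,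
    fun τ hτ => (hdq τ hτ).trans (by linarith [Real.sqrt_nonneg C₃])⟩
  · refine memLp_top_of_bound ?_ (√C₃) (ae_mem_Icc.mono fun t ht => by
      rw [norm_neg]
      exact nzb t ht)
    have h1 : AEStronglyMeasurable
        (fun t => smoothForcing D v K t - fnL Ω (K t • Hh t) - u' t) (timeMeasure T) :=
      (((memLp_two_of_continuousOn cΦ).sub (memLp_clm (fnL Ω) mk)).sub mu').1
    exact (h1.congr (hzΦ.mono fun t ht => ht.symm)).neg
  · exact integrable_of_memLp_two (memLp_clm (fnL Ω) mw)
  · filter_upwards [huv, ae_mem_Icc] with t h1 ht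
    rw [h1, hv t ht, hU]
    congr 1
    exact intervalIntegral_congr_timeMeasure (hwu'.mono fun s hs => hs.symm) h0 ht
  · exact hasWeakLaplacian_of_rieszAdj hΩ htr' (hz t ht).1
  · have h1 : ∫ s, ‖grad (w s)‖ ^ 2 ∂timeMeasure T ≤ C₃ :=
      (integral_mono (integrable_norm_sq (memLp_clm (gradL Ω) mw)) (integrable_norm_sq mw)
        fun s => pow_le_pow_left₀ (norm_nonneg _) (norm_grad_le _) 2).trans wC
    rw [norm_neg]
    linarith [(hz t ht).2, Real.sqrt_nonneg C₃]
  · filter_upwards [hwu', hzΦ, kb, ae_mem_Icc] with t h1 h2 h3 ht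
    have e : fn (w t) = smoothForcing D v K t - fnL Ω (K t • Hh t) - z t := by
      have h1' : fn (w t) = u' t := h1
      rw [h1', h2]
      abel
    rw [e]
    refine (norm_sub_le_of_le (norm_sub_le_of_le (hΦ t ht) ((norm_fn_le _).trans h3))
      (nzb t ht)).trans ?_
    linarith

end

/-! ### The derivative of the kernel -/

section


variable {N : ℕ} {Ω : Set (Eu N)} {T w₀ M : ℝ} {tr : H1 Ω →L[ℝ] L2bdry Ω} {o : H1 Ω}

theorem BoundedCk.norm_sub_le {X : Type*} [NormedAddCommGroup X] [NormedSpace ℝ X]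
    [CompleteSpace X] {y : ℝ → X} (hT : 0 < T) (h : BoundedCk 1 T M y) :
    ∀ s ∈ Icc 0 T, ∀ t ∈ Icc 0 T, s ≤ t → ‖y t - y s‖ ≤ M * (t - s) := by
  obtain ⟨y', hy', hy⟩ := h.exists_deriv hT
  exact norm_sub_le_of_primitive (integrable_of_continuousOn hy'.continuousOn)
    (ae_mem_Icc.mono fun t ht => hy'.norm_le ht) hy

theorem abs_div_sub_div_le {q₁ q₂ p₁ p₂ w Q a b : ℝ} (hw : 0 < w) (h₁ : w ≤ |p₁|) (h₂ : w ≤ |p₂|)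
    (hQ : |q₂| ≤ Q) (ha : |q₁ - q₂| ≤ a) (hb : |p₁ - p₂| ≤ b) :
    |q₁ / p₁ - q₂ / p₂| ≤ w⁻¹ * a + Q * (w⁻¹ * w⁻¹) * b := by
  have n₁ : p₁ ≠ 0 := abs_pos.1 (hw.trans_le h₁)
  have n₂ : p₂ ≠ 0 := abs_pos.1 (hw.trans_le h₂)
  have i₁ : |p₁|⁻¹ ≤ w⁻¹ := inv_anti₀ hw h₁
  have i₂ : |p₂|⁻¹ ≤ w⁻¹ := inv_anti₀ hw h₂
  have e : q₁ / p₁ - q₂ / p₂ = p₁⁻¹ * (q₁ - q₂) - q₂ * (p₁⁻¹ * p₂⁻¹) * (p₁ - p₂) := by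
    field_simp
    ring
  have nw : 0 ≤ w⁻¹ := by positivity
  have nQ : 0 ≤ Q := (abs_nonneg _).trans hQ
  rw [e]
  refine (abs_sub _ _).trans (add_le_add ?_ ?_)
  · rw [abs_mul, abs_inv]
    exact mul_le_mul i₁ ha (abs_nonneg _) nw
  · rw [abs_mul, abs_mul, abs_mul, abs_inv, abs_inv]
    gcongr

/-- A function of time that is Lipschitz up to the increments of `v` inherits a weak derivative
from a bound on the difference quotients of `v`. -/
theorem exists_weak_derivative_of_norm_sub_le {V : Type*} [NormedAddCommGroup V]
    [InnerProductSpace ℝ V] {v : ℝ → V} {κ : ℝ → ℝ} {G C : ℝ} (hT : 0 < T)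
    (hG : 0 ≤ G) (hC : 0 ≤ C) (cv : ContinuousOn v (Icc 0 T))
    (hκ : ∀ s ∈ Icc 0 T, ∀ t ∈ Icc 0 T, s ≤ t → ‖κ t - κ s‖ ≤ G * (t - s + ‖v t - v s‖))
    (hv : ∀ τ ∈ Ioo 0 T, ∫ s, ‖diffQuot τ v s‖ ^ 2 ∂timeMeasure (T - τ) ≤ C) :
    ∃ κ' : ℝ → ℝ, MemLp κ' 2 (timeMeasure T) ∧
      ∫ s, ‖κ' s‖ ^ 2 ∂timeMeasure T ≤ 2 * G ^ 2 * (T + C) ∧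
      ∀ t ∈ Icc 0 T, κ t = κ 0 + ∫ s in (0 : ℝ)..t, κ' s := by
  have cκ : ContinuousOn κ (Icc 0 T) := continuousOn_of_norm_sub_le_mul hG cv hκ
  refine exists_weak_derivative hT (by positivity) cκ fun τ hτ => ?_
  have hp : ∀ᵐ s ∂timeMeasure (T - τ),
      ‖diffQuot τ κ s‖ ^ 2 ≤ 2 * G ^ 2 * (1 + ‖diffQuot τ v s‖ ^ 2) := by
    filter_upwards [ae_mem_Icc] with s hs
    have hs1 : s ∈ Icc 0 T := ⟨hs.1, by linarith [hs.2, hτ.1]⟩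
    have hs2 : s + τ ∈ Icc 0 T := ⟨by linarith [hs.1, hτ.1], by linarith [hs.2]⟩
    have h1 := hκ s hs1 (s + τ) hs2 (by linarith [hτ.1])
    have h2 : ‖diffQuot τ κ s‖ ≤ G * (1 + ‖diffQuot τ v s‖) := by
      have nτ : 0 < τ⁻¹ := inv_pos.2 hτ.1
      rw [diffQuot, diffQuot, norm_smul, norm_smul, Real.norm_of_nonneg nτ.le]
      calc τ⁻¹ * ‖κ (s + τ) - κ s‖ ≤ τ⁻¹ * (G * (s + τ - s + ‖v (s + τ) - v s‖)) := by gcongr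
        _ = G * (τ⁻¹ * τ + τ⁻¹ * ‖v (s + τ) - v s‖) := by ring
        _ = _ := by rw [inv_mul_cancel₀ hτ.1.ne']
    have h3 := pow_le_pow_left₀ (norm_nonneg _) h2 2
    -- This is (1 + d)² ≤ 2(1 + d²), the origin of the constant 2 G².
    nlinarith [sq_nonneg (G * (1 - ‖diffQuot τ v s‖))]
  have mv := integrable_norm_sq (memLp_diffQuot hτ.1.le (memLp_two_of_continuousOn cv))
  have mκ := integrable_norm_sq (memLp_diffQuot hτ.1.le (memLp_two_of_continuousOn cκ))
  have i0 := integrable_of_continuousOn (T := T - τ) (f := fun _ => (1 : ℝ)) continuousOn_const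
  refine (integral_mono_ae mκ ((i0.add mv).const_mul (2 * G ^ 2)) hp).trans ?_
  rw [integral_const_mul]
  have e : ∫ s, (1 + ‖diffQuot τ v s‖ ^ 2) ∂timeMeasure (T - τ) =
      T - τ + ∫ s, ‖diffQuot τ v s‖ ^ 2 ∂timeMeasure (T - τ) := by
    rw [integral_add i0 mv]
    simp [hτ.2.le]
  refine mul_le_mul_of_nonneg_left (e.trans_le ?_) (by positivity)
  linarith [hv τ hτ, hτ.1]

/-- The numerator in the formula for the kernel. -/
def kernelNum (D : Data Ω) (tr : H1 Ω →L[ℝ] L2bdry Ω) (o : H1 Ω) (m' : ℝ → ℝ) (v : ℝ → H1 Ω)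
    (K : ℝ → ℝ) (t : ℝ) : ℝ :=
  ⟪nlL2 D t (v t), fn o⟫_ℝ - ⟪D.g t, tr o⟫_ℝ - m' t - timeConv K D.m t

section KernelNum

variable {D : Data Ω} {v : ℝ → H1 Ω} {K m' : ℝ → ℝ} {B : ℝ}

theorem abs_kernelNum_le (hΩ : IsOpen Ω) (hb : Bornology.IsBounded Ω) (hM : 0 ≤ M)
    (ho : fn o =ᵐ[volume.restrict Ω] fun _ => (1 : ℝ)) (hD : D.Basic T w₀ M)
    (hB : 0 ≤ B) (hK : ∀ᵐ t ∂timeMeasure T, |K t| ≤ B) (hm' : BoundedCk 0 T M m')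
    {t : ℝ} (ht : t ∈ Icc 0 T) :
    |kernelNum D tr o m' v K t| ≤
      M * ‖fn o‖ * ‖fn o‖ + M * ‖tr o‖ + M + B * (T * M) := by
  have cm := hD.m_C1.continuousOn
  have h1 : |⟪nlL2 D t (v t), fn o⟫_ℝ| ≤ M * ‖fn o‖ * ‖fn o‖ :=
    (abs_real_inner_le_norm _ _).trans
      (mul_le_mul_of_nonneg_right (norm_nlL2_le hD hΩ hb ho ht _) (norm_nonneg _))
  have h2 : |⟪D.g t, tr o⟫_ℝ| ≤ M * ‖tr o‖ :=
    (abs_real_inner_le_norm _ _).trans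
      (mul_le_mul_of_nonneg_right (hD.g_continuous.norm_le ht) (norm_nonneg _))
  have h3 : |m' t| ≤ M := hm'.norm_le ht
  have h4 : |timeConv K D.m t| ≤ B * (T * M) := by
    refine (norm_timeConv_le hK (integrable_of_continuousOn cm) ht).trans ?_
    refine mul_le_mul_of_nonneg_left ?_ hB
    refine (intervalIntegral_le_mul_of_le (integrable_of_continuousOn cm.norm)
      (ae_mem_Icc.mono fun s hs => hD.m_C1.norm_le hs) ht).trans ?_
    exact mul_le_mul_of_nonneg_right ht.2 hM
  rw [kernelNum]
  exact (abs_sub _ _).trans (add_le_add ((abs_sub _ _).trans (add_le_add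
    ((abs_sub _ _).trans (add_le_add h1 h2)) h3)) h4)

/-- Each term is Lipschitz in time, the one with f up to increments of v. For K ∗ m only boundedness
of K and integrability of m' are used, so the unknown K' does not appear. -/
theorem norm_kernelNum_sub_le (hΩ : IsOpen Ω) (hb : Bornology.IsBounded Ω) (hT : 0 < T)
    (hM : 0 ≤ M) (ho : fn o =ᵐ[volume.restrict Ω] fun _ => (1 : ℝ)) (hD : D.Basic T w₀ M)
    (hD' : D.SecondOrder T M) (hKi : Integrable K (timeMeasure T))
    (hB : 0 ≤ B) (hK : ∀ᵐ t ∂timeMeasure T, |K t| ≤ B) (hm' : BoundedCk 1 T M m')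
    (hm : ∀ t ∈ Icc 0 T, D.m t = D.m 0 + ∫ s in (0 : ℝ)..t, m' s) :
    ∀ s ∈ Icc 0 T, ∀ t ∈ Icc 0 T, s ≤ t →
      ‖kernelNum D tr o m' v K t - kernelNum D tr o m' v K s‖ ≤
      ((M * ‖fn o‖ + 2 * M) * ‖fn o‖ + M * ‖tr o‖ + M + B * (M + T * M)) *
        (t - s + ‖v t - v s‖) := by
  intro s hs t ht hst
  have n1 : 0 ≤ t - s := sub_nonneg.2 hst
  have cm' := hm'.continuousOn
  have h1 : |⟪nlL2 D t (v t), fn o⟫_ℝ - ⟪nlL2 D s (v s), fn o⟫_ℝ| ≤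
      M * ((t - s) * ‖fn o‖ + 2 * ‖v t - v s‖) * ‖fn o‖ := by
    rw [← inner_sub_left]
    refine (abs_real_inner_le_norm _ _).trans (mul_le_mul_of_nonneg_right ?_ (norm_nonneg _))
    have := norm_nlL2_sub_le hD hD' hM hΩ hb ho hs ht (v t) (v s)
    rwa [abs_of_nonneg n1] at this
  have h2 : |⟪D.g t, tr o⟫_ℝ - ⟪D.g s, tr o⟫_ℝ| ≤ M * (t - s) * ‖tr o‖ := by
    rw [← inner_sub_left]
    exact (abs_real_inner_le_norm _ _).trans (mul_le_mul_of_nonneg_right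
      (hD'.g_C1.norm_sub_le hT s hs t ht hst) (norm_nonneg _))
  have h3 : |m' t - m' s| ≤ M * (t - s) := hm'.norm_sub_le hT s hs t ht hst
  have h4 : |timeConv K D.m t - timeConv K D.m s| ≤ B * (M + T * M) * (t - s) := by
    refine (norm_timeConv_sub_le hKi hB hK (integrable_of_continuousOn cm') hm
      (fun t ht => hD.m_C1.norm_le ht) s hs t ht hst).trans ?_
    have h5 : ∫ r, ‖m' r‖ ∂timeMeasure T ≤ T * M := by
      rw [← intervalIntegral_eq_timeMeasure hT.le]
      exact intervalIntegral_le_mul_of_le (integrable_of_continuousOn cm'.norm)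
        (ae_mem_Icc.mono fun s hs => hm'.norm_le hs) ⟨hT.le, le_rfl⟩
    gcongr
  have e : kernelNum D tr o m' v K t - kernelNum D tr o m' v K s =
      (⟪nlL2 D t (v t), fn o⟫_ℝ - ⟪nlL2 D s (v s), fn o⟫_ℝ) -
      (⟪D.g t, tr o⟫_ℝ - ⟪D.g s, tr o⟫_ℝ) - (m' t - m' s) -
      (timeConv K D.m t - timeConv K D.m s) := by
    rw [kernelNum, kernelNum]
    ring
  rw [e, Real.norm_eq_abs]
  refine ((abs_sub _ _).trans (add_le_add ((abs_sub _ _).trans (add_le_add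
    ((abs_sub _ _).trans (add_le_add h1 h2)) h3)) h4)).trans ?_
  have n2 := norm_nonneg (v t - v s)
  generalize ‖v t - v s‖ = d at n2 ⊢
  generalize t - s = r at n1 ⊢
  have k1 : 0 ≤ M * ‖fn o‖ * ‖fn o‖ * d := by positivity
  have k2 : 0 ≤ M * ‖fn o‖ * r := by positivity
  have k3 : 0 ≤ (M * ‖tr o‖ + M + B * (M + T * M)) * d := by positivity
  nlinarith

end KernelNum

/-- The estimate of the derivative of the kernel. -/
theorem exists_kernel_estimate (hΩ : IsOpen Ω) (hb : Bornology.IsBounded Ω) (hT : 0 < T)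
    (hw₀ : 0 < w₀) (hM : 0 ≤ M) (htr : ∀ v, IsTrace v (tr v))
    (ho : fn o =ᵐ[volume.restrict Ω] fun _ => (1 : ℝ)) (hgo : grad o = 0) {B C : ℝ}
    (hB : 0 ≤ B) (hC : 0 ≤ C) :
    ∃ C₃ : ℝ, 0 ≤ C₃ ∧ ∀ D : Data Ω, D.Basic T w₀ M → D.SecondOrder T M →
      BoundedCk 1 T M D.h → BoundedCk 2 T M D.m →
      ∀ (u : ℝ → H1 Ω) (K : ℝ → ℝ), IsWeakSolution D T u K → (∀ᵐ t ∂timeMeasure T, |K t| ≤ B) →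
      ∀ v : ℝ → H1 Ω, ContinuousOn v (Icc 0 T) → (∀ᵐ t ∂timeMeasure T, u t = v t) →
        (∀ τ ∈ Ioo 0 T, ∫ s, ‖diffQuot τ v s‖ ^ 2 ∂timeMeasure (T - τ) ≤ C) →
        KernelEstimate T K C₃ := by
  obtain ⟨Q, hQ⟩ : ∃ Q, Q = M * ‖fn o‖ * ‖fn o‖ + M * ‖tr o‖ + M + B * (T * M) := ⟨_, rfl⟩
  obtain ⟨E, hE⟩ : ∃ E, E = (M * ‖fn o‖ + 2 * M) * ‖fn o‖ + M * ‖tr o‖ + M + B * (M + T * M) :=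
    ⟨_, rfl⟩
  obtain ⟨G, hG⟩ : ∃ G, G = w₀⁻¹ * E + Q * (w₀⁻¹ * w₀⁻¹) * (M * ‖fn o‖) := ⟨_, rfl⟩
  have nQ : 0 ≤ Q := by rw [hQ]; positivity
  have nE : 0 ≤ E := by rw [hE]; positivity
  have nG : 0 ≤ G := by rw [hG]; positivity
  refine ⟨2 * G ^ 2 * (T + C), by positivity, ?_⟩
  intro D hD hD' hh hm2 u K hs hK v cv huv hdq
  obtain ⟨m', hm', hm⟩ := hm2.exists_deriv hT
  have hp : ∀ t ∈ Icc 0 T, w₀ ≤ |⟪D.h t, fn o⟫_ℝ| := fun t ht => by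
    rw [inner_one ho]
    exact hD.h_mean t ht
  have hpL : ∀ s ∈ Icc 0 T, ∀ t ∈ Icc 0 T, s ≤ t →
      |⟪D.h t, fn o⟫_ℝ - ⟪D.h s, fn o⟫_ℝ| ≤ M * (t - s) * ‖fn o‖ := fun s hs t ht hst => by
    rw [← inner_sub_left]
    exact (abs_real_inner_le_norm _ _).trans (mul_le_mul_of_nonneg_right
      (hh.norm_sub_le hT s hs t ht hst) (norm_nonneg _))
  have hm'0 : BoundedCk 0 T M m' := ⟨hm'.1.of_le (by simp), fun j hj => hm'.2 j (by omega)⟩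
  -- The quotient is formed with the continuous representative v, so it is defined at all times; by
  -- the kernel formula it agrees with K almost everywhere.
  have hκ : ∀ s ∈ Icc 0 T, ∀ t ∈ Icc 0 T, s ≤ t →
      ‖kernelNum D tr o m' v K t / ⟪D.h t, fn o⟫_ℝ -
        kernelNum D tr o m' v K s / ⟪D.h s, fn o⟫_ℝ‖ ≤ G * (t - s + ‖v t - v s‖) := by
    intro s hs' t ht hst
    have h1 := norm_kernelNum_sub_le (tr := tr) (v := v) hΩ hb hT hM ho hD hD'
      (integrable_of_memLp_two hs.K_memLp) hB hK hm' hm s hs' t ht hst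
    rw [← hE] at h1
    have h2 := abs_kernelNum_le (tr := tr) (v := v) hΩ hb hM ho hD hB hK hm'0 hs'
    rw [← hQ] at h2
    refine (abs_div_sub_div_le hw₀ (hp t ht) (hp s hs') h2 h1 (hpL s hs' t ht hst)).trans ?_
    have n3 : 0 ≤ Q * (w₀⁻¹ * w₀⁻¹) * (M * ‖fn o‖) := by positivity
    rw [hG]
    nlinarith [mul_nonneg n3 (norm_nonneg (v t - v s))]
  obtain ⟨κ', mκ', bκ', hκ'⟩ := exists_weak_derivative_of_norm_sub_le hT nG hC cv hκ hdq
  refine ⟨κ', kernelNum D tr o m' v K 0 / ⟪D.h 0, fn o⟫_ℝ, mκ', ⟨integrable_of_memLp_two mκ', ?_⟩, bκ'⟩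
  filter_upwards [kernel_formula hΩ hb hT htr ho hgo hD hs
    (integrable_of_continuousOn hm'.continuousOn) hm, huv, ae_mem_Icc] with t h1 h2 ht
  rw [← hκ' t ht, eq_div_iff (abs_pos.1 (hw₀.trans_le (hp t ht))), h1, h2, kernelNum]

end

/-! ### Monotonicity of the estimates in the constant, and the theorem -/

section


variable {N : ℕ} {Ω : Set (Eu N)} {T : ℝ} {D : Data Ω} {u : ℝ → H1 Ω} {K : ℝ → ℝ} {C C' : ℝ}

theorem BasicEstimate.mono (h : BasicEstimate D T u K C) (hC : C ≤ C') :
    BasicEstimate D T u K C' := by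
  obtain ⟨h1, ⟨v, cv, v0, huv, hv⟩, ⟨u', mu', hu', bu'⟩⟩ := h
  exact ⟨h1.mono fun t ht => ht.trans hC, ⟨v, cv, v0, huv, fun t ht => (hv t ht).trans hC⟩,
    ⟨u', mu', hu', bu'.trans hC⟩⟩

theorem SecondOrderEstimate.mono (h : SecondOrderEstimate D T u C) (hC : C ≤ C') :
    SecondOrderEstimate D T u C' := by
  obtain ⟨v, l, u', cv, huv, ml, mu', hu', hl, bu'⟩ := h
  exact ⟨v, l, u', cv, huv, ml, mu', hu', fun t ht => ⟨(hl t ht).1, (hl t ht).2.trans hC⟩,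
    bu'.mono fun t ht => ht.trans hC⟩

theorem KernelEstimate.mono (h : KernelEstimate T K C) (hC : C ≤ C') : KernelEstimate T K C' := by
  obtain ⟨K', k₀, mK', hK', bK'⟩ := h
  exact ⟨K', k₀, mK', hK', bK'.trans hC⟩

theorem firstOrderEstimate_of_strong {U : H1 Ω} (hU : fn U = D.u₀) {v : ℝ → H1 Ω}
    {u' : ℝ → L2 Ω} (cv : ContinuousOn v (Icc 0 T)) (huv : ∀ᵐ t ∂timeMeasure T, u t = v t)
    (mu' : MemLp u' 2 (timeMeasure T))
    (hv : ∀ t ∈ Icc 0 T, fn (v t) = fn U + ∫ s in (0 : ℝ)..t, u' s)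
    (hC : ∀ t ∈ Icc 0 T, ‖v t‖ ^ 2 + ∫ s, ‖u' s‖ ^ 2 ∂timeMeasure T ≤ C) :
    FirstOrderEstimate D T u C := by
  refine ⟨v, u', cv, huv, mu', ⟨integrable_of_memLp_two mu', ?_⟩, fun t ht => ?_⟩
  · filter_upwards [huv, ae_mem_Icc] with t h1 ht
    rw [h1, hv t ht, hU]
  · have h1 := pow_le_pow_left₀ (norm_nonneg _) (norm_grad_le (v t)) 2
    linarith [hC t ht]

end

end

end KernelRecovery

theorem lemma2p4 (N : ℕ) (hN : 1 ≤ N) (Ω : Set (KernelRecovery.Eu N))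
    (hΩ : KernelRecovery.IsBoundedLipschitzDomain Ω)
    (T : ℝ) (hT : 0 < T) (w₀ : ℝ) (hw₀ : 0 < w₀) (M : ℝ) :
    ∃ C : ℝ, 0 < C ∧
      ∀ (D : KernelRecovery.Data Ω), D.Basic T w₀ M →
      ∀ (u : ℝ → KernelRecovery.H1 Ω) (K : ℝ → ℝ), KernelRecovery.IsWeakSolution D T u K →
        KernelRecovery.BasicEstimate D T u K C ∧
        (D.FirstOrder T M → KernelRecovery.FirstOrderEstimate D T u C) ∧
        (D.SecondOrder T M → KernelRecovery.SecondOrderEstimate D T u C) ∧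
        (D.SecondOrder T M →
          KernelRecovery.BoundedCk 1 T M D.h → KernelRecovery.BoundedCk 2 T M D.m →
          KernelRecovery.KernelEstimate T K C) := by
  -- For negative M no data satisfy the bound on ‖u₀‖, so the claim is vacuous.
  rcases lt_or_ge M 0 with hM | hM
  · exact ⟨1, one_pos, fun D hD => absurd (hD.u₀_bounded.trans_lt hM) (norm_nonneg _).not_gt⟩
  obtain ⟨tr, htr, htr'⟩ := KernelRecovery.exists_trace hΩ
  obtain ⟨o, ho, hgo⟩ := KernelRecovery.exists_one hΩ.isOpen hΩ.isBounded
  obtain ⟨B, hB, hKB⟩ := KernelRecovery.exists_kernel_bound (w₀ := w₀) (M := M) hΩ.isOpen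
    hΩ.isBounded hT hw₀ hM htr ho hgo
  obtain ⟨C₀, hC₀, h₀⟩ := KernelRecovery.exists_basic_estimate (w₀ := w₀) (M := M) hΩ.isOpen
    hΩ.isBounded hT hM htr ho hB
  obtain ⟨C₁, hC₁, h₁⟩ := KernelRecovery.exists_first_order_estimate (w₀ := w₀) (M := M) hΩ.isOpen
    hΩ.isBounded hT hM htr ho hB hC₀
  obtain ⟨C₂, hC₂, h₂⟩ := KernelRecovery.exists_second_order_estimate (w₀ := w₀) (M := M) hΩ.isOpen
    hΩ.isBounded hT hM htr htr' ho hB hC₀ hC₁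
  obtain ⟨C₃, hC₃, h₃⟩ := KernelRecovery.exists_kernel_estimate (w₀ := w₀) (M := M) hΩ.isOpen
    hΩ.isBounded hT hw₀ hM htr ho hgo hB hC₂
  refine ⟨1 + C₀ + C₁ + C₂ + C₃, by positivity, fun D hD u K hs => ?_⟩
  have hK := hKB D hD u K hs
  obtain ⟨b₀, huC, hFC, hfC⟩ := h₀ D hD u K hs hK
  refine ⟨b₀.mono (by linarith), fun hF => ?_, fun hS => ?_, fun hS hh hm => ?_⟩
  · obtain ⟨U, hU, hUM⟩ := hF.u₀_H1
    obtain ⟨v, u', cv, -, huv, mu', hv, hvC, -⟩ :=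
      h₁ D hD u K hs hK huC hFC hfC hF.g_C1 U hU hUM
    exact KernelRecovery.firstOrderEstimate_of_strong hU cv huv mu' hv fun t ht =>
      (hvC t ht).trans (by linarith)
  · obtain ⟨U, hU, hU2, hNeu⟩ := hS.u₀_H2
    obtain ⟨v, u', cv, v0, huv, mu', hv, hvC, heq⟩ :=
      h₁ D hD u K hs hK huC hFC hfC hS.g_C1 U hU hU2.1
    exact (h₂ D hD hS u K hs hK hFC U hU hU2 hNeu v u' cv v0 huv mu' hv hvC heq).1.mono
      (by linarith)
  · obtain ⟨U, hU, hU2, hNeu⟩ := hS.u₀_H2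
    obtain ⟨v, u', cv, v0, huv, mu', hv, hvC, heq⟩ :=
      h₁ D hD u K hs hK huC hFC hfC hS.g_C1 U hU hU2.1
    exact (h₃ D hD hS hh hm u K hs hK v cv huv
      (h₂ D hD hS u K hs hK hFC U hU hU2 hNeu v u' cv v0 huv mu' hv hvC heq).2).mono (by linarith)
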